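/- **Setting.** Let $d,d_x,d_y,p\ge 1$ be integers, $\Theta\subset\mathbb R^d$ bounded and open, $\tilde\Theta\subseteq\mathbb R^d$ open with $\mathrm{cl}\,\Theta\subset\tilde\Theta$, and $\mathcal X\subset\mathbb R^{d_x}$, $\mathcal Y\subset\mathbb R^{d_y}$ compact with non-empty interiors. For $\theta\in\tilde\Theta$, $x\in\mathbb R^{d_x}$ let $A_\theta(x)\in\mathbb R^{d_x}$, $B_\theta(x)\in\mathbb R^{d_x\times d_x}$, $C_\theta(x)\in\mathbb R^{d_y}$, $D_\theta(x)\in\mathbb R^{d_y\times d_y}$, with $B_\theta(x)$, $D_\theta(x)$ invertible, and let $r$, $s$ be strictly positive probability densities on $\mathbb R^{d_x}$, $\mathbb R^{d_y}$. Assume that $r,s$ are $p$-times differentiable with continuous partial derivatives of all orders $\le p$, and that $A_\theta(x),B_\theta(x),C_\theta(x),D_\theta(x)$ are $p$-times differentiable in $\theta\in\tilde\Theta$ with $\partial_\theta^{\alpha}$-derivatives continuous in $(\theta,x)\in\tilde\Theta\times\mathbb R^{d_x}$ for all multi-indices $|\alpha|\le p$. The truncated model is, for $x,x'\in\mathcal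 X$, $y\in\mathcal Y$, $$p_\theta(x'|x)=\frac{r(B_\theta^{-1}(x)(x'-A_\theta(x)))}{\int_{\mathcal X}r(B_\theta^{-1}(x)(x''-A_\theta(x)))dx''},\quad q_\theta(y|x)=\frac{s(D_\theta^{-1}(x)(y-C_\theta(x)))}{\int_{\mathcal Y}s(D_\theta^{-1}(x)(y'-C_\theta(x)))dy'},\quad r_\theta(y,x'|x)=q_\theta(y|x')p_\theta(x'|x),$$ and $\mu$ is Lebesgue measure on $\mathcal X$. **Filter.** For a sequence $\boldsymbol y=\{y_n\}_{n\ge1}$ in $\mathcal Y$ put $r^{m:m+1}_{\theta,\boldsymbol y}(x'|x)=r_\theta(y_{m+1},x'|x)$, $r^{m:n+1}_{\theta,\boldsymbol y}(x'|x)=\int r_\theta(y_{n+1},x'|x'')r^{m:n}_{\theta,\boldsymbol y}(x''|x)\mu(dx'')$, and for a probability measure $\lambda$ on $\mathcal X$ and $n>m\ge 0$ $$p^{m:n}_{\theta,\boldsymbol y}(x|\lambda)=\frac{\int r^{m:n}_{\theta,\boldsymbol y}(x|x')\lambda(dx')}{\iint r^{m:n}_{\theta,\boldsymbol y}(x''|x')\mu(dx'')\lambda(dx')},\qquad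 P^{m:n}_{\theta,\boldsymbol y}(B|\lambda)=\int_B p^{m:n}_{\theta,\boldsymbol y}(x|\lambda)\mu(dx).$$ **Derivative recursion.** $\mathcal L$ is the set of families $\Lambda=\{\lambda_\alpha:\alpha\in\mathbb N_0^d,|\alpha|\le p\}$ of finite signed measures on $\mathcal X$, with $\|\Lambda\|=\max_\alpha\|\lambda_\alpha\|$ (total variation norms), and $\mathcal L_0\subset\mathcal L$ consists of those with $\lambda_{\boldsymbol 0}$ a probability measure. For $\Lambda\in\mathcal L_0$ let $r^\alpha_{\theta,y}(x|\lambda)=\int\partial_\theta^\alpha r_\theta(y,x|x')\lambda(dx')$, $$s^\alpha_{\theta,y}(x|\Lambda)=\sum_{\beta\le\alpha}\binom\alpha\beta\frac{r^{\alpha-\beta}_{\theta,y}(x|\lambda_\beta)}{\int r^{\boldsymbol 0}_{\theta,y}(x'|\lambda_{\boldsymbol 0})\mu(dx')},\qquad f^\alpha_{\theta,y}(x|\Lambda)=s^\alpha_{\theta,y}(x|\Lambda)-\sum_{\beta\le\alpha,\beta\ne\alpha}\binom\alpha\beta f^\beta_{\theta,y}(x|\Lambda)\int s^{\alpha-\beta}_{\theta,y}(x'|\Lambda)\mu(dx').$$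 $F_{\theta,y}(\Lambda)$ is the element of $\mathcal L_0$ with components $F^\alpha_{\theta,y}(B|\Lambda)=\int_Bf^\alpha_{\theta,y}(x|\Lambda)\mu(dx)$; $F^{m:m}_{\theta,\boldsymbol y}(\Lambda)=\Lambda$, $F^{m:n+1}_{\theta,\boldsymbol y}(\Lambda)=F_{\theta,y_{n+1}}(F^{m:n}_{\theta,\boldsymbol y}(\Lambda))$, with components $F^{\alpha,m:n}_{\theta,\boldsymbol y}(\cdot|\Lambda)$; and $f^{\alpha,m:n}_{\theta,\boldsymbol y}(x|\Lambda)=f^\alpha_{\theta,y_n}(x|F^{m:n-1}_{\theta,\boldsymbol y}(\Lambda))$ for $n>m$. $\mathcal E_\lambda\in\mathcal L_0$ has component $\boldsymbol 0$ equal to $\lambda$ and all others zero. **Two conditions.** $\mathrm{(M}_\varepsilon)$, for $\varepsilon\in(0,1)$: for all $\theta\in\Theta,y\in\mathcal Y$ there is a measure $\mu_\theta(dx|y)$ on $\mathcal X$ with $0<\mu_\theta(\mathcal X|y)<\infty$ and $\varepsilon\mu_\theta(B|y)\le\int_Br_\theta(y,x'|x)\mu(dx')\le\varepsilon^{-1}\mu_\theta(B|y)$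 for all $x\in\mathcal X$ and Borel $B\subseteq\mathcal X$. $\mathrm{(S}_\psi)$, for $\psi:\mathcal Y\to[1,\infty)$: $|\partial_\theta^\alpha r_\theta(y,x'|x)|\le\psi(y)^{|\alpha|}r_\theta(y,x'|x)$ for all $\theta\in\Theta$, $x,x'\in\mathcal X$, $y\in\mathcal Y$, $1\le|\alpha|\le p$. **True model (for (ii), (iii)).** $P(x,dx')$ is a transition kernel on $\mathcal X$, $Q(x,dy)$ a conditional probability on $\mathcal Y$ given $x\in\mathcal X$, and there are a probability measure $\pi$, $\delta\in(0,1)$ and $K_0\ge1$ such that $|P^n(x,B)-\pi(B)|\le K_0\delta^n$ for all $x\in\mathcal X$, $n\ge0$, Borel $B\subseteq\mathcal X$. **Claim.** (i) For every probability measure $\lambda$ on $\mathcal X$, every $\boldsymbol y$ and $n>m\ge0$, the functions $p^{m:n}_{\theta,\boldsymbol y}(x|\lambda)$ ($x\in\mathcal X$) and $P^{m:n}_{\theta,\boldsymbol y}(B|\lambda)$ ($B\subseteq\mathcal X$ Borel) are $p$-times differentiable in $\theta\in\Theta$, and for $|\alpha|\le p$ $$\partial^\alpha_\theta p^{m:n}_{\theta,\boldsymbol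 y}(x|\lambda)=f^{\alpha,m:n}_{\theta,\boldsymbol y}(x|\mathcal E_\lambda),\qquad\partial^\alpha_\theta P^{m:n}_{\theta,\boldsymbol y}(B|\lambda)=F^{\alpha,m:n}_{\theta,\boldsymbol y}(B|\mathcal E_\lambda).$$ Moreover $\mathrm{(M}_\varepsilon)$ and $\mathrm{(S}_\psi)$ hold for some $\varepsilon$ and some constant function $\psi$; and for all $\varepsilon$, $\psi$ for which they hold there are $\tau\in(0,1)$, $K\in[1,\infty)$, depending only on $p,\varepsilon$, such that for all $\theta\in\Theta$, $\Lambda,\Lambda'\in\mathcal L_0$, $n\ge m\ge0$ and all $\boldsymbol y$ $$\|F^{m:n}_{\theta,\boldsymbol y}(\Lambda)\|\le K\|\Lambda\|^p\Big(\sum_{k=m+1}^n\psi(y_k)\Big)^p,$$ $$\|F^{m:n}_{\theta,\boldsymbol y}(\Lambda)-F^{m:n}_{\theta,\boldsymbol y}(\Lambda')\|\le K\tau^{n-m}\|\Lambda-\Lambda'\|(\|\Lambda\|+\|\Lambda'\|)^p\Big(\sum_{k=m+1}^n\psi(y_k)\Big)^p,$$ where for $n=m$ the sum is read as $1$. (ii)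 Let $\mathcal Z=\mathcal X\times\mathcal Y\times\mathcal L_0$ with its Borel $\sigma$-algebra ($\mathcal L_0$ metrized by $\|\Lambda-\Lambda'\|$), let $\Phi_\theta:\mathcal Z\to\mathbb R$ ($\theta\in\Theta$) be measurable, and let $q\ge0$ and a measurable $\varphi:\mathcal X\times\mathcal Y\to[1,\infty)$ be such that $$|\Phi_\theta(x,y,\Lambda)|\le\varphi(x,y)\|\Lambda\|^q,\quad|\Phi_\theta(x,y,\Lambda)-\Phi_\theta(x,y,\Lambda')|\le\varphi(x,y)\|\Lambda-\Lambda'\|(\|\Lambda\|+\|\Lambda'\|)^q$$ for all $\theta\in\Theta$, $x\in\mathcal X$, $y\in\mathcal Y$, $\Lambda,\Lambda'\in\mathcal L_0$, and $\sup_{x\in\mathcal X}\int\varphi(x,y)Q(x,dy)<\infty$. Let $\Pi_\theta$, $\tilde\Pi_\theta$ be the kernels on $\mathcal Z$ given for $z=(x,y,\Lambda)$ by $$\Pi_\theta(z,B)=\iint I_B(x',y',F_{\theta,y'}(\Lambda))Q(x',dy')P(x,dx'),\quad\tilde\Pi_\theta(z,B)=\iint I_B(x',y',F_{\theta,y}(\Lambda))Q(x',dy')P(x,dx'),$$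 and $(\Pi^n\Phi)_\theta(z)=\int\Phi_\theta(z')\Pi^n_\theta(z,dz')$, $(\tilde\Pi^n\Phi)_\theta(z)=\int\Phi_\theta(z')\tilde\Pi^n_\theta(z,dz')$. Then these integrals exist for $n\ge1$, and there are $\phi_\theta,\tilde\phi_\theta\in\mathbb R$ with $\phi_\theta=\lim_n(\Pi^n\Phi)_\theta(z)$ and $\tilde\phi_\theta=\lim_n(\tilde\Pi^n\Phi)_\theta(z)$ for all $\theta\in\Theta$, $z\in\mathcal Z$. Put $r=p(p+q+1)$, $s=p(q+1)$. There are $\varepsilon$, a constant function $\psi$ and $L_0\ge1$ such that $\mathrm{(M}_\varepsilon)$, $\mathrm{(S}_\psi)$ and $$\int\varphi(x,y)\psi^r(y)Q(x,dy)\le L_0\quad\text{for all }x\in\mathcal X$$ hold; and for all $\varepsilon$, measurable $\psi$ and $L_0\ge1$ for which these three hold there are $\rho\in(0,1)$, $L\in[1,\infty)$, depending only on $\varepsilon,\delta,p,q,K_0,L_0$, such that $$|(\Pi^n\Phi)_\theta(z)-\phi_\theta|\le L\rho^n\|\Lambda\|^s,\qquad|(\tilde\Pi^n\Phi)_\theta(z)-\tilde\phi_\theta|\le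 L\rho^n\psi^r(y)\|\Lambda\|^s$$ for all $\theta\in\Theta$, $z=(x,y,\Lambda)\in\mathcal Z$, $n\ge1$. (iii) Let $\{(X_n,Y_n)\}_{n\ge0}$ be an $\mathcal X\times\mathcal Y$-valued process on a probability space with $P((X_{n+1},Y_{n+1})\in B\,|\,X_{0:n},Y_{0:n})=\iint I_B(x,y)Q(x,dy)P(X_n,dx)$ a.s. for all Borel $B$ and $n\ge0$, and let $$q^n_\theta(y_{1:n}|\lambda)=\int\!\cdots\!\int\prod_{k=1}^nr_\theta(y_k,x_k|x_{k-1})\,\mu(dx_n)\cdots\mu(dx_1)\lambda(dx_0),\qquad l_n(\theta,\lambda)=E\Big(\tfrac1n\log q^n_\theta(Y_{1:n}|\lambda)\Big).$$ Then these expectations exist for $n\ge1$, and there is a function $l:\Theta\to\mathbb R$ that is $p$-times differentiable on $\Theta$ with $l(\theta)=\lim_{n\to\infty}l_n(\theta,\lambda)$ for all $\theta\in\Theta$ and all probability measures $\lambda$ on $\mathcal X$. -/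

import Mathlib

open MeasureTheory ProbabilityTheory Filter Topology
open scoped ENNReal

noncomputable section

namespace OptFilter

/-- Euclidean space of dimension `n`. -/
abbrev E (n : ℕ) := EuclideanSpace ℝ (Fin n)

/-! ### Multi-indices and higher-order partial derivatives -/

/-- Multi-indices in `ℕ₀^d`, with the componentwise order. -/
abbrev MultiIndex (d : ℕ) := Fin d → ℕ

/-- The order `|α| = α₁ + ⋯ + α_d`. -/
def deg {d : ℕ} (α : MultiIndex d) : ℕ := ∑ i, α i

/-- The coefficient `(α choose β) = ∏ᵢ (αᵢ choose βᵢ)`. -/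
def mchoose {d : ℕ} (α β : MultiIndex d) : ℕ := ∏ i, (α i).choose (β i)

theorem deg_lt_deg {d : ℕ} {α β : MultiIndex d} (h : β < α) : deg β < deg α := by
  obtain ⟨h1, i, hi⟩ := Pi.lt_def.1 h
  exact Finset.sum_lt_sum (fun j _ => h1 j) ⟨i, Finset.mem_univ i, hi⟩

/-- The first-order partial derivative `∂f/∂θᵢ`. -/
def partialDeriv {d : ℕ} {F : Type*} [NormedAddCommGroup F] [NormedSpace ℝ F]
    (i : Fin d) (f : E d → F) : E d → F :=
  fun θ => lineDeriv ℝ f θ (EuclideanSpace.single i 1)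

/-- The partial derivative `∂^α f = ∂^{|α|} f / (∂θ₁^{α₁} ⋯ ∂θ_d^{α_d})`. -/
def mderiv {d : ℕ} {F : Type*} [NormedAddCommGroup F] [NormedSpace ℝ F]
    (α : MultiIndex d) (f : E d → F) : E d → F :=
  (List.finRange d).foldr (fun i g => (partialDeriv i)^[α i] g) f

/-- `f` is `p`-times differentiable (in the Fréchet sense) at every point of the open set `U`:
for each `k < p` the `k`-th derivative of `f` is differentiable on `U`. -/
def DiffTimes {d : ℕ} {F : Type*} [NormedAddCommGroup F] [NormedSpace ℝ F]
    (p : ℕ) (f : E d → F) (U : Set (E d)) : Prop :=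
  ∀ k < p, ∀ θ ∈ U, DifferentiableAt ℝ (iteratedFDeriv ℝ k f) θ

/-! ### Finite signed vector measures indexed by multi-indices of order at most `p` -/

/-- The total variation norm of a finite signed measure. -/
def tvNorm {X : Type*} [MeasurableSpace X] (l : SignedMeasure X) : ℝ :=
  l.totalVariation.real Set.univ

/-- The space `𝓛(X)` of vector measures `Λ = {λ_α : |α| ≤ p}` whose components are
finite signed measures. -/
def LVec (d p : ℕ) (X : Type*) [MeasurableSpace X] :=
  {α : MultiIndex d // deg α ≤ p} → SignedMeasure X

section LVec

variable {d p : ℕ} {X : Type*} [MeasurableSpace X]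

instance : AddCommGroup (LVec d p X) :=
  inferInstanceAs (AddCommGroup ({α : MultiIndex d // deg α ≤ p} → SignedMeasure X))

/-- The component `λ_α` of `Λ` (only used for `|α| ≤ p`). -/
def LVec.comp (Λ : LVec d p X) (α : MultiIndex d) : SignedMeasure X :=
  if h : deg α ≤ p then Λ ⟨α, h⟩ else 0

/-- `‖Λ‖ = max {‖λ_α‖ : |α| ≤ p}`; the index set is finite. -/
def LVec.norm (Λ : LVec d p X) : ℝ :=
  ⨆ α : {α : MultiIndex d // deg α ≤ p}, tvNorm (Λ.comp α.1)

/-- The topology of the metric `‖Λ - Λ'‖`. -/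
instance : TopologicalSpace (LVec d p X) where
  IsOpen U := ∀ Λ ∈ U, ∃ ε > 0, ∀ Λ' : LVec d p X, (Λ' - Λ).norm < ε → Λ' ∈ U
  isOpen_univ := fun _ _ => ⟨1, one_pos, fun _ _ => trivial⟩
  isOpen_inter := fun s t hs ht Λ hΛ => by
    obtain ⟨a, ha, h1⟩ := hs Λ hΛ.1
    obtain ⟨b, hb, h2⟩ := ht Λ hΛ.2
    exact ⟨min a b, lt_min ha hb, fun Λ' h =>
      ⟨h1 Λ' (h.trans_le (min_le_left _ _)), h2 Λ' (h.trans_le (min_le_right _ _))⟩⟩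
  isOpen_sUnion := fun S hS Λ hΛ => by
    obtain ⟨s, hs, hm⟩ := hΛ
    obtain ⟨a, ha, h1⟩ := hS s hs Λ hm
    exact ⟨a, ha, fun Λ' h => ⟨s, hs, h1 Λ' h⟩⟩

/-- The Borel σ-algebra of the total variation metric. -/
instance : MeasurableSpace (LVec d p X) := borel _

/-- Membership in `𝓛₀(X)`: the component `0` is a probability measure. -/
def LVec.IsL0 (Λ : LVec d p X) : Prop :=
  ∃ (l : Measure X) (_ : IsProbabilityMeasure l), Λ.comp 0 = l.toSignedMeasure

/-- The vector measure `𝓔_λ`, with component `0` equal to `λ` and all other components zero. -/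
def initVec (d p : ℕ) (l : Measure X) [IsFiniteMeasure l] : LVec d p X :=
  fun α => if α.1 = 0 then l.toSignedMeasure else 0

end LVec

/-! ### The filter and the recursion for its derivatives

Here `R θ y x' x` is the function `r_θ(y, x' | x) = q_θ(y | x') p_θ(x' | x)`, and `μ` is the
reference measure on the state space. A sequence of observations is a function `y : ℕ → Y`, of which
only the values `y 1, y 2, …` are used. -/

section Filter

variable {d p : ℕ} {X Y : Type*} [MeasurableSpace X]

/-- `r_{θ,y}^{m:n}(x' | x)` for `n > m`. -/
def rIter (μ : Measure X) (R : E d → Y → X → X → ℝ) (θ : E d) (y : ℕ → Y) (m : ℕ) :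
    ℕ → X → X → ℝ
  | 0 => fun _ _ => 0
  | n + 1 => fun x' x =>
      if n = m then R θ (y (m + 1)) x' x
      else ∫ x'', R θ (y (n + 1)) x' x'' * rIter μ R θ y m n x'' x ∂μ

/-- The filtering density `p_{θ,y}^{m:n}(x | λ)`. -/
def filterDens (μ : Measure X) (R : E d → Y → X → X → ℝ) (θ : E d) (y : ℕ → Y) (m n : ℕ)
    (l : Measure X) (x : X) : ℝ :=
  (∫ x', rIter μ R θ y m n x x' ∂l) / ∫ x', ∫ x'', rIter μ R θ y m n x'' x' ∂μ ∂l

/-- The filtering distribution `P_{θ,y}^{m:n}(B | λ)`. -/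
def filterProb (μ : Measure X) (R : E d → Y → X → X → ℝ) (θ : E d) (y : ℕ → Y) (m n : ℕ)
    (l : Measure X) (B : Set X) : ℝ :=
  ∫ x in B, filterDens μ R θ y m n l x ∂μ

/-- `r_{θ,y}^α(x | λ) = ∫ ∂_θ^α r_θ(y, x | x') λ(dx')` for a finite signed measure `λ`. -/
def rDeriv (R : E d → Y → X → X → ℝ) (α : MultiIndex d) (θ : E d) (y : Y) (l : SignedMeasure X)
    (x : X) : ℝ :=
  ∫ᵛ x', mderiv α (fun ϑ => R ϑ y x x') θ ∂•l

/-- `s_{θ,y}^α(x | Λ)`. -/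
def sDens (μ : Measure X) (R : E d → Y → X → X → ℝ) (θ : E d) (y : Y) (Λ : LVec d p X)
    (α : MultiIndex d) (x : X) : ℝ :=
  ∑ β ∈ Finset.Iic α, (mchoose α β : ℝ) *
    (rDeriv R (α - β) θ y (Λ.comp β) x / ∫ x', rDeriv R 0 θ y (Λ.comp 0) x' ∂μ)

/-- `f_{θ,y}^α(x | Λ)`, by recursion on `|α|`; for `α = 0` the sum is empty. -/
def fDens (μ : Measure X) (R : E d → Y → X → X → ℝ) (θ : E d) (y : Y) (Λ : LVec d p X)
    (α : MultiIndex d) (x : X) : ℝ :=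
  sDens μ R θ y Λ α x -
    ∑ β ∈ (Finset.Iio α).attach, (mchoose α β.1 : ℝ) *
      (fDens μ R θ y Λ β.1 x * ∫ x', sDens μ R θ y Λ (α - β.1) x' ∂μ)
termination_by deg α
decreasing_by exact deg_lt_deg (Finset.mem_Iio.1 β.2)

/-- `F_{θ,y}(Λ)`, whose component `α` is the signed measure with density `f_{θ,y}^α(· | Λ)`
with respect to `μ`. -/
def FStep (μ : Measure X) (R : E d → Y → X → X → ℝ) (θ : E d) (y : Y) (Λ : LVec d p X) :
    LVec d p X :=
  fun α => μ.withDensityᵥ (fDens μ R θ y Λ α.1)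

/-- `F_{θ,y}^{m:n}(Λ)` for `n ≥ m`. -/
def FIter (μ : Measure X) (R : E d → Y → X → X → ℝ) (θ : E d) (y : ℕ → Y) (Λ : LVec d p X)
    (m : ℕ) : ℕ → LVec d p X
  | 0 => Λ
  | n + 1 => if m ≤ n then FStep μ R θ (y (n + 1)) (FIter μ R θ y Λ m n) else Λ

/-- `f_{θ,y}^{α,m:n}(x | Λ)` for `n > m`. -/
def fIter (μ : Measure X) (R : E d → Y → X → X → ℝ) (θ : E d) (y : ℕ → Y) (Λ : LVec d p X)
    (m n : ℕ) (α : MultiIndex d) (x : X) : ℝ :=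
  fDens μ R θ (y n) (FIter μ R θ y Λ m (n - 1)) α x

/-- `q_θ^n(y_{1:n} | λ)`, the integral of `∏ₖ r_θ(y_k, x_k | x_{k-1})` over
`x_0 ∼ λ` and `(x_1, …, x_n) ∼ μ^n`. -/
def likelihood (μ : Measure X) (R : E d → Y → X → X → ℝ) (θ : E d) (n : ℕ) (y : ℕ → Y)
    (l : Measure X) : ℝ :=
  ∫ x₀, ∫ x : Fin n → X,
    ∏ k : Fin n, R θ (y (k + 1)) (x k) ((Fin.cons x₀ x : Fin (n + 1) → X) k.castSucc)
      ∂(Measure.pi fun _ => μ) ∂l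

/-! ### Mixing and score conditions -/

/-- Strong mixing with constant `ε`: there are measures `μ_θ(dx | y)` with
`0 < μ_θ(X | y) < ∞` and `ε μ_θ(B | y) ≤ ∫_B r_θ(y, x' | x) μ(dx') ≤ μ_θ(B | y) / ε`. -/
def StrongMixing (μ : Measure X) (R : E d → Y → X → X → ℝ) (Θ : Set (E d)) (ε : ℝ) : Prop :=
  0 < ε ∧ ε < 1 ∧ ∃ m : E d → Y → Measure X, ∀ θ ∈ Θ, ∀ y,
    0 < m θ y Set.univ ∧ m θ y Set.univ < ∞ ∧
    ∀ x, ∀ B, MeasurableSet B →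
      ENNReal.ofReal ε * m θ y B ≤ ∫⁻ x' in B, ENNReal.ofReal (R θ y x' x) ∂μ ∧
      ∫⁻ x' in B, ENNReal.ofReal (R θ y x' x) ∂μ ≤ m θ y B / ENNReal.ofReal ε

/-- `ψ ≥ 1` and `|∂_θ^α r_θ(y, x' | x)| ≤ ψ(y)^{|α|} r_θ(y, x' | x)` for `1 ≤ |α| ≤ p`. -/
def ScoreBound (p : ℕ) (R : E d → Y → X → X → ℝ) (Θ : Set (E d)) (ψ : Y → ℝ) : Prop :=
  (∀ y, 1 ≤ ψ y) ∧ ∀ θ ∈ Θ, ∀ x x' y, ∀ α : MultiIndex d, α ≠ 0 → deg α ≤ p →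
    |mderiv α (fun ϑ => R ϑ y x' x) θ| ≤ ψ y ^ deg α * R θ y x' x

/-- `∑_{k=m+1}^n ψ(y_k)` if `n > m`, and `1` if `n = m`. -/
def psiSum (ψ : Y → ℝ) (y : ℕ → Y) (m n : ℕ) : ℝ :=
  if n = m then 1 else ∑ k ∈ Finset.Icc (m + 1) n, ψ (y k)

end Filter

/-! ### The Markov chains `(X_n, Y_n, F^{0:n})` and `(X_{n+1}, Y_{n+1}, F^{0:n})` -/

section Chains

variable {d p : ℕ} {X Y : Type*} [MeasurableSpace X] [MeasurableSpace Y]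

/-- `Π_θ(z, B) = ∬ 1_B(x', y', F_{θ,y'}(Λ)) Q(x', dy') P(x, dx')` for `z = (x, y, Λ)`. -/
def chainKer (μ : Measure X) (R : E d → Y → X → X → ℝ) (P : Kernel X X) (Q : Kernel X Y)
    (θ : E d) (z : X × Y × LVec d p X) : Measure (X × Y × LVec d p X) :=
  (P z.1 ⊗ₘ Q).map fun w => (w.1, w.2, FStep μ R θ w.2 z.2.2)

/-- `Π̃_θ(z, B) = ∬ 1_B(x', y', F_{θ,y}(Λ)) Q(x', dy') P(x, dx')` for `z = (x, y, Λ)`. -/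
def chainKer' (μ : Measure X) (R : E d → Y → X → X → ℝ) (P : Kernel X X) (Q : Kernel X Y)
    (θ : E d) (z : X × Y × LVec d p X) : Measure (X × Y × LVec d p X) :=
  (P z.1 ⊗ₘ Q).map fun w => (w.1, w.2, FStep μ R θ z.2.1 z.2.2)

/-- The `n`-step transition probabilities `κⁿ(z, B) = ∫ κ(z', B) κⁿ⁻¹(z, dz')`. -/
def kerIter {Z : Type*} [MeasurableSpace Z] (κ : Z → Measure Z) : ℕ → Z → Measure Z
  | 0 => fun z => Measure.dirac z
  | n + 1 => fun z => (kerIter κ n z).bind κ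

/-- `(κⁿΦ)(z) = ∫ Φ(z') κⁿ(z, dz')`. -/
def kerInt {Z : Type*} [MeasurableSpace Z] (κ : Z → Measure Z) (n : ℕ) (Φ : Z → ℝ) (z : Z) : ℝ :=
  ∫ z', Φ z' ∂(kerIter κ n z)

/-- `|Pⁿ(x, B) - π(B)| ≤ K₀ δⁿ` for all `x`, `B`, `n`, where `δ ∈ (0, 1)` and `K₀ ≥ 1`. -/
def GeomErgodic (P : Kernel X X) (π : Measure X) (δ K₀ : ℝ) : Prop :=
  0 < δ ∧ δ < 1 ∧ 1 ≤ K₀ ∧ ∀ (n : ℕ) (x : X) (B : Set X), MeasurableSet B →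
    |((P ^ n) x).real B - π.real B| ≤ K₀ * δ ^ n

/-- The growth and local Lipschitz conditions on `Φ_θ(x, y, Λ)`, with `φ ≥ 1`, `q ≥ 0`, for
`Λ, Λ'` in `𝓛₀(X)`. -/
def GrowthCondition (Θ : Set (E d)) (Φ : E d → X × Y × LVec d p X → ℝ) (φ : X × Y → ℝ) (q : ℝ) :
    Prop :=
  0 ≤ q ∧ (∀ w, 1 ≤ φ w) ∧ ∀ θ ∈ Θ, ∀ x y, ∀ Λ Λ' : LVec d p X, Λ.IsL0 → Λ'.IsL0 →
    |Φ θ (x, y, Λ)| ≤ φ (x, y) * Λ.norm ^ q ∧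
    |Φ θ (x, y, Λ) - Φ θ (x, y, Λ')| ≤ φ (x, y) * (Λ - Λ').norm * (Λ.norm + Λ'.norm) ^ q

/-- `(X_n, Y_n)` is a state-space model with state transition kernel `P` and observation
kernel `Q`: the conditional law of `(X_{n+1}, Y_{n+1})` given `X_{0:n}, Y_{0:n}` is
`P(X_n, dx) Q(x, dy)`. The law of `(X_0, Y_0)` is arbitrary. -/
def IsStateSpaceModel {Ω : Type*} [MeasurableSpace Ω] (Pr : Measure Ω) (P : Kernel X X)
    (Q : Kernel X Y) (Xs : ℕ → Ω → X) (Ys : ℕ → Ω → Y) : Prop :=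
  (∀ n, Measurable (Xs n)) ∧ (∀ n, Measurable (Ys n)) ∧
  ∀ (n : ℕ) (B : Set (X × Y)), MeasurableSet B →
    Pr[((fun ω => (Xs (n + 1) ω, Ys (n + 1) ω)) ⁻¹' B).indicator (fun _ => (1 : ℝ)) |
        MeasurableSpace.comap (fun ω (k : Fin (n + 1)) => (Xs k ω, Ys k ω)) inferInstance]
      =ᵐ[Pr] fun ω => (P (Xs n ω) ⊗ₘ Q).real B

end Chains

/-! ### The truncated nonlinear state-space model -/

/-- The data of the model `X_{n+1} = A_θ(X_n) + B_θ(X_n) U_n`, `Y_n = C_θ(X_n) + D_θ(X_n) V_n`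
with noise densities `r`, `s`, parameter sets `Θ ⊆ Θ'` and truncation sets `𝒳`, `𝒴`. -/
structure TruncatedModel (d dx dy : ℕ) where
  Θ : Set (E d)
  Θ' : Set (E d)
  A : E d → E dx → E dx
  B : E d → E dx → Matrix (Fin dx) (Fin dx) ℝ
  C : E d → E dx → E dy
  D : E d → E dx → Matrix (Fin dy) (Fin dy) ℝ
  r : E dx → ℝ
  s : E dy → ℝ
  𝒳 : Set (E dx)
  𝒴 : Set (E dy)

namespace TruncatedModel

variable {d dx dy : ℕ} (M : TruncatedModel d dx dy)

/-- The standing assumptions of the model and its regularity assumptions of order `p`. -/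
structure Regular (p : ℕ) : Prop where
  isOpen_Θ : IsOpen M.Θ
  isBounded_Θ : Bornology.IsBounded M.Θ
  isOpen_Θ' : IsOpen M.Θ'
  closure_subset : closure M.Θ ⊆ M.Θ'
  -- `r` and `s` are strictly positive probability densities
  r_pos : ∀ u, 0 < M.r u
  s_pos : ∀ v, 0 < M.s v
  integral_r : ∫ u, M.r u = 1
  integral_s : ∫ v, M.s v = 1
  isUnit_B : ∀ θ ∈ M.Θ', ∀ x, IsUnit (M.B θ x)
  isUnit_D : ∀ θ ∈ M.Θ', ∀ x, IsUnit (M.D θ x)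
  -- `p`-fold differentiability
  diff_r : DiffTimes p M.r Set.univ
  diff_s : DiffTimes p M.s Set.univ
  diff_A : ∀ x, DiffTimes p (fun θ => M.A θ x) M.Θ'
  diff_B : ∀ x i j, DiffTimes p (fun θ => M.B θ x i j) M.Θ'
  diff_C : ∀ x, DiffTimes p (fun θ => M.C θ x) M.Θ'
  diff_D : ∀ x i j, DiffTimes p (fun θ => M.D θ x i j) M.Θ'
  -- continuity of the derivatives
  cont_r : ∀ α : MultiIndex dx, deg α ≤ p → Continuous (mderiv α M.r)
  cont_s : ∀ α : MultiIndex dy, deg α ≤ p → Continuous (mderiv α M.s)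
  cont_A : ∀ α : MultiIndex d, deg α ≤ p →
    ContinuousOn (fun z : E d × E dx => mderiv α (fun θ => M.A θ z.2) z.1) (M.Θ' ×ˢ Set.univ)
  cont_B : ∀ α : MultiIndex d, deg α ≤ p → ∀ i j,
    ContinuousOn (fun z : E d × E dx => mderiv α (fun θ => M.B θ z.2 i j) z.1) (M.Θ' ×ˢ Set.univ)
  cont_C : ∀ α : MultiIndex d, deg α ≤ p →
    ContinuousOn (fun z : E d × E dx => mderiv α (fun θ => M.C θ z.2) z.1) (M.Θ' ×ˢ Set.univ)
  cont_D : ∀ α : MultiIndex d, deg α ≤ p → ∀ i j,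
    ContinuousOn (fun z : E d × E dx => mderiv α (fun θ => M.D θ z.2 i j) z.1) (M.Θ' ×ˢ Set.univ)
  -- truncation to compact sets with non-empty interiors
  isCompact_𝒳 : IsCompact M.𝒳
  interior_𝒳 : (interior M.𝒳).Nonempty
  isCompact_𝒴 : IsCompact M.𝒴
  interior_𝒴 : (interior M.𝒴).Nonempty

/-- Lebesgue measure on `𝒳`. -/
def mu : Measure M.𝒳 := (volume : Measure (E dx)).comap Subtype.val

/-- The truncated transition density `p_θ(x' | x)` for `x, x' ∈ 𝒳`. -/
def p (θ : E d) (x' x : M.𝒳) : ℝ :=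
  M.r (Matrix.toEuclideanLin (M.B θ x)⁻¹ (x' - M.A θ x)) /
    ∫ x'' in M.𝒳, M.r (Matrix.toEuclideanLin (M.B θ x)⁻¹ (x'' - M.A θ x))

/-- The truncated observation density `q_θ(y | x)` for `x ∈ 𝒳`, `y ∈ 𝒴`. -/
def q (θ : E d) (y : M.𝒴) (x : M.𝒳) : ℝ :=
  M.s (Matrix.toEuclideanLin (M.D θ x)⁻¹ (y - M.C θ x)) /
    ∫ y' in M.𝒴, M.s (Matrix.toEuclideanLin (M.D θ x)⁻¹ (y' - M.C θ x))

/-- `r_θ(y, x' | x) = q_θ(y | x') p_θ(x' | x)`. -/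
def R (θ : E d) (y : M.𝒴) (x' x : M.𝒳) : ℝ := M.q θ y x' * M.p θ x' x

end TruncatedModel

end OptFilter

end

noncomputable section

universe u

namespace OptFilter

set_option linter.unusedSectionVars false

/-! ### Multi-indices and Pascal's rule -/

section MultiIndex

variable {d : ℕ}

/-! The filter is a normalized product of positive kernels. Write `m` for total mass and `A_γ` for
the operator on signed measures whose kernel is the derivative of order `γ` of `r_θ(y, ·|·)`. One
step of the derivative recursion (`IsStep`) is a triangular system in the order of the multi-index.
For `α ≠ 0` the old component `λ_α` enters only through `A_0 λ_α`, once directly and once through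
the term `β = 0`, and these two occurrences form the linearization `tanMap` of the normalized filter
at the current filter (`IsStep.eq_tanMap_add`). Hence every component solves a linear recursion with
one common linear part, forced by components of lower order.

The linear part contracts. Each tangent map annihilates its own base point, so a product of tangent
maps is the tangent map of the unnormalized product (`compFrom_tanMap`). By duality, that map tested
on a set `A` pairs the direction with `f - P'(A) u`, where `f` and `u` are the backward functions of
the indicator of `A` and of `1`. Mixing with constant `κ = ε ^ 2` shrinks the oscillation of `f / u`
by the factor `1 - κ ^ 2` per step (`exists_ratio_bounds`, `norm_tanMap_compFrom_le`). Duhamel's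
formula and induction on the order then bound component `α` by a constant times `w ^ |α|`, where `w`
dominates the scores and the initial value (`IsTrajectory.exists_norm_le`). The same induction
applied to the difference of two trajectories gives exponential forgetting, with a slightly worse
rate at each order (`IsTrajectory.exists_norm_sub_le`). No constant depends on the space or on the
dimension.

For the derivative formulas, parametrized families are treated as `C^p` maps of `θ` into Banach
spaces of continuous functions on compact spaces. Integration, evaluation and prediction are then
continuous linear or bilinear maps and commute with derivatives up to the Leibniz rule. If `h` is
the unnormalized density and `c` its integral, the Leibniz rule for `(h / c) c = h` is exactly the
recursion for `f^α` (`exists_normalize`). Compactness of the closure of `Θ` gives the mixing and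
score constants.

For ergodicity, restart the filter after one step from a fixed reference value. The forgetting bound
makes the expectation after `n + 1` steps close to a function `g n` of the initial state alone, and
`g (n + 1)` close to `P (g n)`, with errors of order `n ^ r τ ^ n` times moments of `φ ψ ^ r`.
Geometric ergodicity of `P` then turns `g n` into a sequence converging to a constant
(`exists_geometric_limit`, `exists_limit_pathK`).

For the likelihood, `log q^n` is the sum of the logarithms of the one-step normalizing constants.
Each derivative of such a logarithm is a fixed function, of polynomial growth and locally Lipschitz,
of the next observation and of the derivative filter (`exists_isTame_logDeriv`). Ergodicity makes
the expectations of all these derivatives converge uniformly in `θ`, so the limit is `C^p`, and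
Cesàro averaging identifies it with the log-likelihood rate (`exists_likelihood_rate`). -/

@[simp] theorem deg_zero : deg (0 : MultiIndex d) = 0 := by simp [deg]

theorem deg_add (α β : MultiIndex d) : deg (α + β) = deg α + deg β := by
  simp [deg, Finset.sum_add_distrib]

@[simp] theorem deg_single (i : Fin d) : deg (Pi.single i 1 : MultiIndex d) = 1 := by
  simp [deg]

theorem deg_mono {α β : MultiIndex d} (h : α ≤ β) : deg α ≤ deg β :=
  Finset.sum_le_sum fun i _ => h i

theorem deg_sub_add {α β : MultiIndex d} (h : β ≤ α) : deg (α - β) + deg β = deg α := by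
  rw [← deg_add, tsub_add_cancel_of_le h]

theorem deg_eq_zero {α : MultiIndex d} : deg α = 0 ↔ α = 0 := by
  simp [deg, funext_iff]

theorem single_le_iff {α : MultiIndex d} {i : Fin d} :
    (Pi.single i 1 : MultiIndex d) ≤ α ↔ α i ≠ 0 := by
  constructor
  · intro h
    have := h i
    simp at this
    omega
  · intro h j
    by_cases hj : j = i
    · subst hj; simp; omega
    · simp [hj]

theorem multiIndex_induction {P : MultiIndex d → Prop} (zero : P 0)
    (add_single : ∀ α i, P α → P (α + Pi.single i 1)) (α : MultiIndex d) : P α := by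
  induction h : deg α generalizing α with
  | zero => rw [deg_eq_zero.1 h]; exact zero
  | succ n ih =>
    have hα : α ≠ 0 := fun h0 => by simp [h0] at h
    obtain ⟨i, hi⟩ := Function.ne_iff.1 hα
    have hle : (Pi.single i 1 : MultiIndex d) ≤ α := single_le_iff.2 hi
    have h1 := deg_sub_add hle
    rw [← tsub_add_cancel_of_le hle]
    exact add_single _ _ (ih _ (by simp at h1; omega))

theorem mchoose_self (α : MultiIndex d) : mchoose α α = 1 := by simp [mchoose]

theorem mchoose_zero_right (α : MultiIndex d) : mchoose α 0 = 1 := by simp [mchoose]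

theorem mchoose_eq_zero {α β : MultiIndex d} (h : ¬ β ≤ α) : mchoose α β = 0 := by
  obtain ⟨i, hi⟩ := not_forall.1 h
  exact Finset.prod_eq_zero (Finset.mem_univ i) (Nat.choose_eq_zero_of_lt (not_le.1 hi))

theorem mchoose_split (α β : MultiIndex d) (i : Fin d) :
    mchoose α β = (α i).choose (β i) * ∏ j ∈ Finset.univ.erase i, (α j).choose (β j) :=
  (Finset.mul_prod_erase _ _ (Finset.mem_univ i)).symm

theorem mchoose_add_single_add_single (α β : MultiIndex d) (i : Fin d) :
    mchoose (α + Pi.single i 1) (β + Pi.single i 1) =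
      mchoose α β + mchoose α (β + Pi.single i 1) := by
  rw [mchoose_split _ _ i, mchoose_split α _ i, mchoose_split α _ i]
  have h1 : ∀ γ δ : MultiIndex d, ∀ (a b : ℕ),
      ∏ j ∈ Finset.univ.erase i, ((γ + Pi.single i a : MultiIndex d) j).choose ((δ + Pi.single i b : MultiIndex d) j) =
      ∏ j ∈ Finset.univ.erase i, (γ j).choose (δ j) := fun γ δ a b =>
    Finset.prod_congr rfl fun j hj => by simp [Finset.ne_of_mem_erase hj]
  have h2 := h1 α β 0 1
  simp only [Pi.single_zero, add_zero] at h2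
  rw [h1, h2, ← add_mul]
  simp [Nat.choose_succ_succ]

theorem mchoose_add_single_of_eq_zero (α β : MultiIndex d) (i : Fin d) (h : β i = 0) :
    mchoose (α + Pi.single i 1) β = mchoose α β := by
  rw [mchoose_split _ _ i, mchoose_split α _ i, h]
  simp only [Nat.choose_zero_right]
  congr 1
  exact Finset.prod_congr rfl fun j hj => by simp [Finset.ne_of_mem_erase hj]

/-- Pascal's rule for sums over multi-indices below `α + eᵢ`. -/
theorem sum_mchoose_add_single {V : Type*} [AddCommGroup V] [Module ℝ V] (α : MultiIndex d)
    (i : Fin d) (a : MultiIndex d → MultiIndex d → V) :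
    ∑ γ ∈ Finset.Iic (α + Pi.single i 1),
        (mchoose (α + Pi.single i 1) γ : ℝ) • a γ (α + Pi.single i 1 - γ) =
      ∑ β ∈ Finset.Iic α, (mchoose α β : ℝ) •
        (a (β + Pi.single i 1) (α - β) + a β (α - β + Pi.single i 1)) := by
  classical
  set e : MultiIndex d := Pi.single i 1 with he
  have hinj : Set.InjOn (fun β : MultiIndex d => β + e) (Finset.Iic α) :=
    fun _ _ _ _ h => add_right_cancel h
  have himg : (Finset.Iic α).image (fun β => β + e) =
      (Finset.Iic (α + e)).filter (fun γ => e ≤ γ) := by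
    ext γ
    simp only [Finset.mem_image, Finset.mem_Iic, Finset.mem_filter]
    constructor
    · rintro ⟨β, hβ, rfl⟩
      exact ⟨add_le_add_left hβ e, le_add_self⟩
    · rintro ⟨h1, h2⟩
      exact ⟨γ - e, tsub_le_iff_right.2 h1, tsub_add_cancel_of_le h2⟩
  have hsub : Finset.Iic α ⊆ Finset.Iic (α + e) := Finset.Iic_subset_Iic.2 le_self_add
  -- The second Pascal term needs the case distinction because `γ - e` is a truncated subtraction
  -- and is meaningful only for `e ≤ γ`.
  have key : ∀ γ, (mchoose (α + e) γ : ℝ) =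
      mchoose α γ + if e ≤ γ then (mchoose α (γ - e) : ℝ) else 0 := by
    intro γ
    split_ifs with h
    · obtain ⟨β, rfl⟩ : ∃ β, γ = β + e := ⟨γ - e, (tsub_add_cancel_of_le h).symm⟩
      rw [he, mchoose_add_single_add_single, ← he, add_tsub_cancel_right]
      push_cast; ring
    · rw [he, single_le_iff, not_not] at h
      rw [he, mchoose_add_single_of_eq_zero _ _ _ h, add_zero]
  simp only [key, add_smul, smul_add, Finset.sum_add_distrib]
  rw [add_comm]
  congr 1
  · simp only [ite_smul, zero_smul]
    rw [← Finset.sum_filter, ← himg, Finset.sum_image hinj]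
    refine Finset.sum_congr rfl fun β _ => ?_
    rw [add_tsub_cancel_right, add_tsub_add_eq_tsub_right]
  · rw [← Finset.sum_subset hsub]
    · refine Finset.sum_congr rfl fun β hβ => ?_
      rw [tsub_add_eq_add_tsub (Finset.mem_Iic.1 hβ)]
    · intro γ _ h
      rw [mchoose_eq_zero (by simpa using h)]; simp

/-- Pascal's rule with constant summands doubles the sum at each unit step. This is the source of
the factors `2 ^ deg α` in the estimates of the recursion. -/
theorem sum_mchoose_eq (α : MultiIndex d) :
    ∑ β ∈ Finset.Iic α, (mchoose α β : ℝ) = 2 ^ deg α := by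
  induction α using multiIndex_induction with
  | zero => simp [show Finset.Iic (0 : MultiIndex d) = {0} by ext; simp, mchoose]
  | add_single α i ih =>
    have h := sum_mchoose_add_single α i (fun _ _ => (1 : ℝ))
    simp only [smul_eq_mul, mul_one] at h
    rw [h, deg_add, deg_single, pow_succ, ← ih, Finset.sum_mul]
    norm_num

end MultiIndex

/-! ### Partial derivatives of vector-valued maps and the Leibniz rule -/

section Calculus

variable {d : ℕ} {F G H : Type*} [NormedAddCommGroup F] [NormedSpace ℝ F]
  [NormedAddCommGroup G] [NormedSpace ℝ G] [NormedAddCommGroup H] [NormedSpace ℝ H]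

/-- `f` has iterated partial derivatives of order `n` on `U`, and those of order `< n` are
Fréchet differentiable. -/
def PartialDiff : ℕ → (E d → F) → Set (E d) → Prop
  | 0, _, _ => True
  | n + 1, f, U => DifferentiableOn ℝ f U ∧ ∀ i, PartialDiff n (partialDeriv i f) U

theorem partialDeriv_congr {U : Set (E d)} (hU : IsOpen U) {f g : E d → F} (h : Set.EqOn f g U)
    (i : Fin d) : Set.EqOn (partialDeriv i f) (partialDeriv i g) U := fun _ hθ =>
  (h.eventuallyEq_of_mem (hU.mem_nhds hθ)).lineDeriv_eq

theorem iterate_partialDeriv_congr {U : Set (E d)} (hU : IsOpen U) {f g : E d → F}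
    (h : Set.EqOn f g U) (i : Fin d) (n : ℕ) :
    Set.EqOn ((partialDeriv i)^[n] f) ((partialDeriv i)^[n] g) U := by
  induction n generalizing f g with
  | zero => exact h
  | succ n ih => exact ih (partialDeriv_congr hU h i)

theorem mderiv_congr {U : Set (E d)} (hU : IsOpen U) {f g : E d → F} (h : Set.EqOn f g U)
    (α : MultiIndex d) : Set.EqOn (mderiv α f) (mderiv α g) U := by
  unfold mderiv
  induction List.finRange d with
  | nil => exact h
  | cons j l ih => exact iterate_partialDeriv_congr hU ih j _

theorem PartialDiff.congr {U : Set (E d)} (hU : IsOpen U) {n : ℕ} {f g : E d → F}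
    (hf : PartialDiff n f U) (h : Set.EqOn f g U) : PartialDiff n g U := by
  induction n generalizing f g with
  | zero => trivial
  | succ n ih => exact ⟨hf.1.congr h.symm, fun i => ih (hf.2 i) (partialDeriv_congr hU h i)⟩

theorem PartialDiff.of_succ {U : Set (E d)} {n : ℕ} {f : E d → F}
    (hf : PartialDiff (n + 1) f U) : PartialDiff n f U := by
  induction n generalizing f with
  | zero => trivial
  | succ n ih => exact ⟨hf.1, fun i => ih (hf.2 i)⟩

theorem PartialDiff.mono {U : Set (E d)} {m n : ℕ} (hmn : m ≤ n) {f : E d → F}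
    (hf : PartialDiff n f U) : PartialDiff m f U := by
  induction hmn with
  | refl => exact hf
  | step _ ih => exact ih hf.of_succ

theorem partialDeriv_eq_fderiv {f : E d → F} {θ : E d} (h : DifferentiableAt ℝ f θ) (i : Fin d) :
    partialDeriv i f θ = fderiv ℝ f θ (EuclideanSpace.single i 1) :=
  h.lineDeriv_eq_fderiv

/-- The linear map with prescribed values on the standard basis. -/
def ofPartials (v : Fin d → F) : E d →L[ℝ] F :=
  ∑ i, (EuclideanSpace.proj i : E d →L[ℝ] ℝ).smulRight (v i)

theorem ofPartials_apply (v : Fin d → F) (x : E d) : ofPartials v x = ∑ i, x i • v i := by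
  simp [ofPartials]

theorem ofPartials_single (v : Fin d → F) (i : Fin d) :
    ofPartials v (EuclideanSpace.single i 1) = v i := by
  rw [ofPartials_apply, Finset.sum_eq_single i] <;> simp +contextual

theorem eq_ofPartials (L : E d →L[ℝ] F) :
    L = ofPartials fun i => L (EuclideanSpace.single i 1) := by
  ext x
  rw [ofPartials_apply]
  conv_lhs => rw [← (EuclideanSpace.basisFun (Fin d) ℝ).sum_repr x]
  simp

theorem fderiv_eq_ofPartials {f : E d → F} {θ : E d} (h : DifferentiableAt ℝ f θ) :
    fderiv ℝ f θ = ofPartials fun i => partialDeriv i f θ := by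
  simp_rw [partialDeriv_eq_fderiv h]
  exact eq_ofPartials _

theorem norm_ofPartials_le (v : Fin d → F) : ‖ofPartials v‖ ≤ ∑ i, ‖v i‖ := by
  refine ContinuousLinearMap.opNorm_le_bound _ (by positivity) fun x => ?_
  rw [ofPartials_apply, Finset.sum_mul]
  refine norm_sum_le_of_le _ fun i _ => ?_
  rw [norm_smul, mul_comm]
  gcongr
  exact PiLp.norm_apply_le x i

theorem ofPartials_sub (v w : Fin d → F) :
    ofPartials v - ofPartials w = ofPartials fun i => v i - w i := by
  ext x; simp [ofPartials_apply, smul_sub]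

/-- `ofPartials` as a continuous linear map of the `i`-th coordinate. -/
def ofPartialsCLM (i : Fin d) : F →L[ℝ] E d →L[ℝ] F :=
  ContinuousLinearMap.smulRightL ℝ (E d) F (EuclideanSpace.proj i : E d →L[ℝ] ℝ)

theorem ofPartials_eq_sum (v : Fin d → F) : ofPartials v = ∑ i, ofPartialsCLM i (v i) := by
  ext x; simp [ofPartials, ofPartialsCLM]

/-- Symmetry of the second derivative only needs `fderiv ℝ f` to be differentiable at the point. It
is, being a finite combination of the first partial derivatives; no continuity of second derivatives
enters. -/
theorem partialDeriv_comm {U : Set (E d)} (hU : IsOpen U) {f : E d → F} (hf : PartialDiff 2 f U)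
    (i j : Fin d) :
    Set.EqOn (partialDeriv i (partialDeriv j f)) (partialDeriv j (partialDeriv i f)) U := by
  intro θ hθ
  have h1 : ∀ ϑ ∈ U, DifferentiableAt ℝ f ϑ := fun ϑ h => (hf.1 ϑ h).differentiableAt (hU.mem_nhds h)
  have hp : ∀ i, ∀ ϑ ∈ U, DifferentiableAt ℝ (partialDeriv i f) ϑ := fun i ϑ h =>
    ((hf.2 i).1 ϑ h).differentiableAt (hU.mem_nhds h)
  have hd : DifferentiableAt ℝ (fderiv ℝ f) θ := by
    have : DifferentiableAt ℝ (fun ϑ => ∑ i, ofPartialsCLM i (partialDeriv i f ϑ)) θ :=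
      DifferentiableAt.fun_sum fun i _ => (ofPartialsCLM (F := F) i).differentiableAt.comp θ (hp i θ hθ)
    refine this.congr_of_eventuallyEq ?_
    filter_upwards [hU.mem_nhds hθ] with ϑ h
    rw [fderiv_eq_ofPartials (h1 ϑ h), ofPartials_eq_sum]
  have hsymm := second_derivative_symmetric_of_eventually_of_real
    (f := f) (f' := fderiv ℝ f) (f'' := fderiv ℝ (fderiv ℝ f) θ) (x := θ)
    (by filter_upwards [hU.mem_nhds hθ] with ϑ h using (h1 ϑ h).hasFDerivAt) hd.hasFDerivAt
  have key : ∀ i j : Fin d, partialDeriv i (partialDeriv j f) θ =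
      fderiv ℝ (fderiv ℝ f) θ (EuclideanSpace.single i 1) (EuclideanSpace.single j 1) := by
    intro i j
    rw [partialDeriv_eq_fderiv (hp j θ hθ)]
    have : HasFDerivAt (fun ϑ => fderiv ℝ f ϑ (EuclideanSpace.single j 1))
        ((ContinuousLinearMap.apply ℝ F (EuclideanSpace.single j (1 : ℝ))).comp
          (fderiv ℝ (fderiv ℝ f) θ)) θ :=
      (ContinuousLinearMap.apply ℝ F
        (EuclideanSpace.single j (1 : ℝ) : E d)).hasFDerivAt.comp θ hd.hasFDerivAt
    rw [(this.congr_of_eventuallyEq ?_).fderiv]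
    · rfl
    · filter_upwards [hU.mem_nhds hθ] with ϑ h
      exact partialDeriv_eq_fderiv (h1 ϑ h) j
  rw [key, key, hsymm]

theorem PartialDiff.iterate {U : Set (E d)} {k n : ℕ} {f : E d → F} (i : Fin d)
    (hf : PartialDiff (k + n) f U) : PartialDiff k ((partialDeriv i)^[n] f) U := by
  induction n generalizing f with
  | zero => exact hf
  | succ n ih => exact ih (hf.2 i)

theorem iterate_partialDeriv_comm {U : Set (E d)} (hU : IsOpen U) {n : ℕ} {f : E d → F}
    (hf : PartialDiff (n + 1) f U) (i j : Fin d) :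
    Set.EqOn ((partialDeriv j)^[n] (partialDeriv i f)) (partialDeriv i ((partialDeriv j)^[n] f))
      U := by
  induction n generalizing f with
  | zero => exact fun _ _ => rfl
  | succ n ih =>
    exact (iterate_partialDeriv_congr hU
      (partialDeriv_comm hU (hf.mono (by omega)) j i) j n).trans (ih (hf.2 j))

/-- The iterated derivative along the coordinates of a list. -/
def listDeriv (l : List (Fin d)) (α : MultiIndex d) (f : E d → F) : E d → F :=
  l.foldr (fun i g => (partialDeriv i)^[α i] g) f

theorem PartialDiff.listDeriv {U : Set (E d)} (l : List (Fin d)) (α : MultiIndex d) {k : ℕ}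
    {f : E d → F} (hf : PartialDiff (k + (l.map α).sum) f U) :
    PartialDiff k (listDeriv l α f) U := by
  induction l generalizing k with
  | nil => simpa [OptFilter.listDeriv] using hf
  | cons j l ih =>
    have : PartialDiff (k + α j) (OptFilter.listDeriv l α f) U :=
      ih (by simpa [add_assoc] using hf)
    exact this.iterate j

theorem listDeriv_partialDeriv {U : Set (E d)} (hU : IsOpen U) (l : List (Fin d))
    (α : MultiIndex d) {f : E d → F} (hf : PartialDiff ((l.map α).sum + 1) f U) (i : Fin d) :
    Set.EqOn (listDeriv l α (partialDeriv i f)) (partialDeriv i (listDeriv l α f)) U := by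
  induction l with
  | nil => exact fun _ _ => rfl
  | cons j l ih =>
    simp only [List.map_cons, List.sum_cons] at hf
    have h1 := ih (hf.mono (by omega))
    have h2 : PartialDiff (α j + 1) (listDeriv l α f) U :=
      PartialDiff.listDeriv l α (hf.mono (by omega))
    exact (iterate_partialDeriv_congr hU h1 j _).trans (iterate_partialDeriv_comm hU h2 i j)

/-- Raising the exponent of `i` changes a single factor of the product, since the list has no
repetitions. The additional derivative is then moved past the later factors until it acts on `f`
directly. -/
theorem listDeriv_add_single {U : Set (E d)} (hU : IsOpen U) (l : List (Fin d)) (hl : l.Nodup)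
    (α : MultiIndex d) {f : E d → F} (hf : PartialDiff ((l.map α).sum + 1) f U) (i : Fin d) :
    (i ∈ l → Set.EqOn (listDeriv l (α + Pi.single i 1) f) (listDeriv l α (partialDeriv i f)) U) ∧
    (i ∉ l → listDeriv l (α + Pi.single i 1) f = listDeriv l α f) := by
  induction l with
  | nil => exact ⟨fun h => by simp at h, fun _ => rfl⟩
  | cons j l ih =>
    simp only [List.map_cons, List.sum_cons] at hf
    obtain ⟨hj, hl⟩ := List.nodup_cons.1 hl
    obtain ⟨ih1, ih2⟩ := ih hl (hf.mono (by omega))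
    constructor
    · intro hi
      by_cases hij : i = j
      · subst hij
        change Set.EqOn ((partialDeriv i)^[(α + Pi.single i 1 : MultiIndex d) i] (listDeriv l _ f))
          ((partialDeriv i)^[α i] (listDeriv l α (partialDeriv i f))) U
        rw [ih2 hj]
        have : (α + Pi.single i 1 : MultiIndex d) i = α i + 1 := by simp
        rw [this, Function.iterate_succ_apply]
        exact iterate_partialDeriv_congr hU
          (listDeriv_partialDeriv hU l α (hf.mono (by omega)) i).symm i _
      · have hi' : i ∈ l := by simpa [hij] using hi
        change Set.EqOn ((partialDeriv j)^[(α + Pi.single i 1 : MultiIndex d) j] (listDeriv l _ f)) _ U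
        have : (α + Pi.single i 1 : MultiIndex d) j = α j := by simp [Ne.symm hij]
        rw [this]
        exact iterate_partialDeriv_congr hU (ih1 hi') j _
    · intro hi
      have hij : j ≠ i := fun h => hi (by simp [h])
      have : (α + Pi.single i 1 : MultiIndex d) j = α j := by simp [hij]
      simp only [listDeriv, List.foldr_cons, this]
      congr 1
      exact ih2 fun h => hi (List.mem_cons_of_mem _ h)

theorem sum_finRange (α : MultiIndex d) : ((List.finRange d).map α).sum = deg α := by
  rw [deg, ← List.ofFn_eq_map, List.sum_ofFn]

@[simp] theorem mderiv_zero (f : E d → F) : mderiv 0 f = f := by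
  unfold mderiv
  induction List.finRange d with
  | nil => rfl
  | cons j l ih => exact ih

/-- `mderiv` applies the coordinates in a fixed order, so commutation is needed to let the new
derivative act first. In this form a statement about `f` at order `α + eᵢ` becomes one about
`partialDeriv i f` at order `α`, which drives the inductions along unit vectors below. -/
theorem mderiv_add_single {U : Set (E d)} (hU : IsOpen U) {α : MultiIndex d} {f : E d → F}
    (hf : PartialDiff (deg α + 1) f U) (i : Fin d) :
    Set.EqOn (mderiv (α + Pi.single i 1) f) (mderiv α (partialDeriv i f)) U :=
  (listDeriv_add_single hU _ (List.nodup_finRange d) α (by rwa [sum_finRange]) i).1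
    (List.mem_finRange i)

theorem partialDeriv_clm_comp {U : Set (E d)} (hU : IsOpen U) (L : F →L[ℝ] G) {f : E d → F}
    (hf : DifferentiableOn ℝ f U) (i : Fin d) :
    Set.EqOn (partialDeriv i fun θ => L (f θ)) (fun θ => L (partialDeriv i f θ)) U := by
  intro θ hθ
  have h := (hf θ hθ).differentiableAt (hU.mem_nhds hθ)
  have h2 : HasFDerivAt (fun θ => L (f θ)) (L.comp (fderiv ℝ f θ)) θ :=
    L.hasFDerivAt.comp θ h.hasFDerivAt
  rw [partialDeriv_eq_fderiv h2.differentiableAt, h2.fderiv]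
  simp [partialDeriv_eq_fderiv h]

theorem PartialDiff.clm_comp {U : Set (E d)} (hU : IsOpen U) (L : F →L[ℝ] G) {n : ℕ}
    {f : E d → F} (hf : PartialDiff n f U) : PartialDiff n (fun θ => L (f θ)) U := by
  induction n generalizing f with
  | zero => trivial
  | succ n ih =>
    exact ⟨L.differentiable.comp_differentiableOn hf.1, fun i =>
      (ih (hf.2 i)).congr hU (partialDeriv_clm_comp hU L hf.1 i).symm⟩

theorem mderiv_clm_comp {U : Set (E d)} (hU : IsOpen U) (L : F →L[ℝ] G) {α : MultiIndex d}
    {f : E d → F} (hf : PartialDiff (deg α) f U) :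
    Set.EqOn (mderiv α fun θ => L (f θ)) (fun θ => L (mderiv α f θ)) U := by
  induction α using multiIndex_induction generalizing f with
  | zero => simp [Set.EqOn]
  | add_single α i ih =>
    rw [deg_add, deg_single] at hf
    intro θ hθ
    rw [mderiv_add_single hU (hf.clm_comp hU L) i hθ,
      mderiv_congr hU (partialDeriv_clm_comp hU L hf.1 i) α hθ, ih (hf.2 i) hθ]
    simp only
    rw [mderiv_add_single hU hf i hθ]

/-- The Fréchet derivative and the tuple of partial derivatives determine each other through
continuous linear maps, so smoothness can be proved one coordinate and one order at a time. -/
theorem contDiffOn_succ_iff_partialDeriv {U : Set (E d)} (hU : IsOpen U) {n : ℕ} {f : E d → F} :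
    ContDiffOn ℝ (n + 1 : ℕ) f U ↔
      DifferentiableOn ℝ f U ∧ ∀ i, ContDiffOn ℝ n (partialDeriv i f) U := by
  push_cast
  rw [contDiffOn_succ_iff_fderiv_of_isOpen hU]
  constructor
  · rintro ⟨h1, -, h2⟩
    refine ⟨h1, fun i => ?_⟩
    refine ContDiffOn.congr (f := fun θ => fderiv ℝ f θ (EuclideanSpace.single i 1))
      (h2.clm_apply contDiffOn_const) fun θ hθ => ?_
    exact partialDeriv_eq_fderiv ((h1 θ hθ).differentiableAt (hU.mem_nhds hθ)) i
  · rintro ⟨h1, h2⟩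
    refine ⟨h1, fun h => by simp at h, ?_⟩
    refine ContDiffOn.congr (f := fun θ => ∑ i, ofPartialsCLM i (partialDeriv i f θ))
      (ContDiffOn.sum fun i _ => (ofPartialsCLM (F := F) i).contDiff.comp_contDiffOn (h2 i)) fun θ hθ => ?_
    rw [fderiv_eq_ofPartials ((h1 θ hθ).differentiableAt (hU.mem_nhds hθ)), ofPartials_eq_sum]

theorem partialDiff_of_contDiffOn {U : Set (E d)} (hU : IsOpen U) {n : ℕ} {f : E d → F}
    (hf : ContDiffOn ℝ n f U) : PartialDiff n f U := by
  induction n generalizing f with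
  | zero => trivial
  | succ n ih =>
    obtain ⟨h1, h2⟩ := (contDiffOn_succ_iff_partialDeriv hU).1 hf
    exact ⟨h1, fun i => ih (h2 i)⟩

theorem contDiffOn_mderiv {U : Set (E d)} (hU : IsOpen U) {k : ℕ} {α : MultiIndex d} {f : E d → F}
    (hf : ContDiffOn ℝ (k + deg α : ℕ) f U) : ContDiffOn ℝ k (mderiv α f) U := by
  induction α using multiIndex_induction generalizing f with
  | zero => simpa using hf
  | add_single α i ih =>
    rw [deg_add, deg_single, ← add_assoc] at hf
    refine (ih (((contDiffOn_succ_iff_partialDeriv hU).1 hf).2 i)).congr ?_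
    exact mderiv_add_single hU ((partialDiff_of_contDiffOn hU hf).mono (by omega)) i

theorem diffTimes_of_contDiffOn {U : Set (E d)} (hU : IsOpen U) {n : ℕ} {f : E d → F}
    (hf : ContDiffOn ℝ n f U) : DiffTimes n f U := fun k hk _ hθ =>
  (hf.contDiffAt (hU.mem_nhds hθ)).differentiableAt_iteratedFDeriv (by exact_mod_cast hk)

theorem partialDiff_of_diffTimes {U : Set (E d)} (hU : IsOpen U) {n : ℕ} {f : E d → F}
    (hf : DiffTimes n f U) : PartialDiff n f U := by
  -- The induction passes from `f` to `fderiv ℝ f`, so the target space has to vary; the two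
  -- iterated derivatives differ by a currying isometry.
  induction n generalizing F with
  | zero => trivial
  | succ n ih =>
    have h0 : ∀ θ ∈ U, DifferentiableAt ℝ f θ := fun θ hθ => by
      have h := hf 0 (by omega) θ hθ
      rw [iteratedFDeriv_zero_eq_comp] at h
      exact (LinearIsometryEquiv.comp_differentiableAt_iff _).1 h
    have h1 : DiffTimes n (fderiv ℝ f) U := fun k hk θ hθ => by
      have h := hf (k + 1) (by omega) θ hθ
      have he : iteratedFDeriv ℝ (k + 1) f =
          ⇑(continuousMultilinearCurryRightEquiv' ℝ k (E d) F).symm ∘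
            iteratedFDeriv ℝ k (fderiv ℝ f) := by
        ext1 x; exact iteratedFDeriv_succ_eq_comp_right
      rw [he] at h
      exact (LinearIsometryEquiv.comp_differentiableAt_iff _).1 h
    refine ⟨fun θ hθ => (h0 θ hθ).differentiableWithinAt, fun i => ?_⟩
    refine ((ih h1).clm_comp hU (ContinuousLinearMap.apply ℝ F
      (EuclideanSpace.single i (1 : ℝ) : E d))).congr hU fun θ hθ => ?_
    exact (partialDeriv_eq_fderiv (h0 θ hθ) i).symm

theorem partialDeriv_bilin {U : Set (E d)} (hU : IsOpen U) (B : F →L[ℝ] G →L[ℝ] H)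
    {f : E d → F} {g : E d → G} (hf : DifferentiableOn ℝ f U) (hg : DifferentiableOn ℝ g U)
    (i : Fin d) :
    Set.EqOn (partialDeriv i fun θ => B (f θ) (g θ))
      (fun θ => B (partialDeriv i f θ) (g θ) + B (f θ) (partialDeriv i g θ)) U := by
  intro θ hθ
  have h1 := (hf θ hθ).differentiableAt (hU.mem_nhds hθ)
  have h2 := (hg θ hθ).differentiableAt (hU.mem_nhds hθ)
  have h := B.hasFDerivAt_of_bilinear h1.hasFDerivAt h2.hasFDerivAt
  rw [partialDeriv_eq_fderiv h.differentiableAt, h.fderiv]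
  simp [partialDeriv_eq_fderiv h1, partialDeriv_eq_fderiv h2, add_comm]

theorem mderiv_add {U : Set (E d)} (hU : IsOpen U) {α : MultiIndex d} {f g : E d → F}
    (hf : PartialDiff (deg α) f U) (hg : PartialDiff (deg α) g U) :
    PartialDiff (deg α) (fun θ => f θ + g θ) U ∧
    Set.EqOn (mderiv α fun θ => f θ + g θ) (fun θ => mderiv α f θ + mderiv α g θ) U := by
  have hd : ∀ {f g : E d → F}, DifferentiableOn ℝ f U → DifferentiableOn ℝ g U → ∀ i,
      Set.EqOn (partialDeriv i fun θ => f θ + g θ)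
        (fun θ => partialDeriv i f θ + partialDeriv i g θ) U := by
    intro f g hf hg i θ hθ
    have h1 := (hf θ hθ).differentiableAt (hU.mem_nhds hθ)
    have h2 := (hg θ hθ).differentiableAt (hU.mem_nhds hθ)
    rw [partialDeriv_eq_fderiv (h1.fun_add h2), fderiv_fun_add h1 h2]
    simp [partialDeriv_eq_fderiv h1, partialDeriv_eq_fderiv h2]
  have hP : ∀ (n : ℕ) {f g : E d → F}, PartialDiff n f U → PartialDiff n g U →
      PartialDiff n (fun θ => f θ + g θ) U := by
    intro n
    induction n with
    | zero => intros; trivial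
    | succ n ih =>
      intro f g hf hg
      exact ⟨hf.1.add hg.1, fun i => (ih (hf.2 i) (hg.2 i)).congr hU (hd hf.1 hg.1 i).symm⟩
  refine ⟨hP _ hf hg, ?_⟩
  induction α using multiIndex_induction generalizing f g with
  | zero => simp [Set.EqOn]
  | add_single α i ih =>
    rw [deg_add, deg_single] at hf hg
    intro θ hθ
    rw [mderiv_add_single hU (hP _ hf hg) i hθ, mderiv_congr hU (hd hf.1 hg.1 i) α hθ,
      ih (hf.2 i) (hg.2 i) hθ]
    simp only
    rw [mderiv_add_single hU hf i hθ, mderiv_add_single hU hg i hθ]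

theorem contDiffOn_bilin {U : Set (E d)} (B : F →L[ℝ] G →L[ℝ] H) {n : WithTop ℕ∞}
    {f : E d → F} {g : E d → G} (hf : ContDiffOn ℝ n f U) (hg : ContDiffOn ℝ n g U) :
    ContDiffOn ℝ n (fun θ => B (f θ) (g θ)) U :=
  (B.contDiff.comp_contDiffOn hf).clm_apply hg

/-- The Leibniz rule for a continuous bilinear map. -/
theorem mderiv_bilin {U : Set (E d)} (hU : IsOpen U) (B : F →L[ℝ] G →L[ℝ] H) {α : MultiIndex d}
    {f : E d → F} {g : E d → G} (hf : ContDiffOn ℝ (deg α) f U) (hg : ContDiffOn ℝ (deg α) g U) :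
    Set.EqOn (mderiv α fun θ => B (f θ) (g θ))
      (fun θ => ∑ β ∈ Finset.Iic α, (mchoose α β : ℝ) • B (mderiv β f θ) (mderiv (α - β) g θ))
      U := by
  induction α using multiIndex_induction generalizing f g with
  | zero => simp [Set.EqOn, show Finset.Iic (0 : MultiIndex d) = {0} by ext; simp, mchoose]
  | add_single α i ih =>
    rw [deg_add, deg_single] at hf hg
    intro θ hθ
    obtain ⟨hf1, hf2⟩ := (contDiffOn_succ_iff_partialDeriv hU).1 hf
    obtain ⟨hg1, hg2⟩ := (contDiffOn_succ_iff_partialDeriv hU).1 hg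
    have hf0 : ContDiffOn ℝ (deg α) f U := hf.of_le (by norm_cast; omega)
    have hg0 : ContDiffOn ℝ (deg α) g U := hg.of_le (by norm_cast; omega)
    rw [mderiv_add_single hU (partialDiff_of_contDiffOn hU (contDiffOn_bilin B hf hg)) i hθ,
      mderiv_congr hU (partialDeriv_bilin hU B hf1 hg1 i) α hθ,
      (mderiv_add hU (partialDiff_of_contDiffOn hU (contDiffOn_bilin B (hf2 i) hg0))
        (partialDiff_of_contDiffOn hU (contDiffOn_bilin B hf0 (hg2 i)))).2 hθ]
    simp only
    rw [ih (hf2 i) hg0 hθ, ih hf0 (hg2 i) hθ,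
      sum_mchoose_add_single α i fun β γ => B (mderiv β f θ) (mderiv γ g θ),
      ← Finset.sum_add_distrib]
    refine Finset.sum_congr rfl fun β hβ => ?_
    have hβ' := deg_mono (Finset.mem_Iic.1 hβ)
    have hs := deg_sub_add (Finset.mem_Iic.1 hβ)
    rw [mderiv_add_single hU ((partialDiff_of_contDiffOn hU hf).mono (by omega)) i hθ,
      mderiv_add_single hU ((partialDiff_of_contDiffOn hU hg).mono (by omega)) i hθ, smul_add]

end Calculus

/-! ### Smooth maps into spaces of continuous functions on compact spaces -/

section FunctionSpace

variable {d : ℕ} {T S : Type*} [TopologicalSpace T] [CompactSpace T] [TopologicalSpace S]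
  [CompactSpace S] {F G H : Type*} [NormedAddCommGroup F] [NormedSpace ℝ F]
  [NormedAddCommGroup G] [NormedSpace ℝ G] [NormedAddCommGroup H] [NormedSpace ℝ H]

/-- Evaluation at a point as a continuous linear map. -/
def evalL (t : T) : C(T, F) →L[ℝ] F :=
  LinearMap.mkContinuous
    { toFun := fun f => f t, map_add' := fun _ _ => rfl, map_smul' := fun _ _ => rfl } 1
    fun f => by simpa using f.norm_coe_le_norm t

@[simp] theorem evalL_apply (t : T) (f : C(T, F)) : evalL t f = f t := rfl

/-- Composition with a continuous map on the right as a continuous linear map. -/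
def pullL (φ : C(S, T)) : C(T, F) →L[ℝ] C(S, F) :=
  LinearMap.mkContinuous
    { toFun := fun f => f.comp φ, map_add' := fun _ _ => rfl, map_smul' := fun _ _ => rfl } 1
    fun f => by
      rw [one_mul, ContinuousMap.norm_le _ (norm_nonneg _)]
      exact fun s => f.norm_coe_le_norm _

@[simp] theorem pullL_apply (φ : C(S, T)) (f : C(T, F)) (s : S) : pullL φ f s = f (φ s) := rfl

/-- Pointwise application of a continuous bilinear map, as a continuous bilinear map. -/
def bilinL (B : F →L[ℝ] G →L[ℝ] H) : C(T, F) →L[ℝ] C(T, G) →L[ℝ] C(T, H) :=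
  LinearMap.mkContinuous₂
    (LinearMap.mk₂ ℝ (fun f g => (⟨fun t => B (f t) (g t), by fun_prop⟩ : C(T, H)))
      (fun _ _ _ => by ext; simp) (fun _ _ _ => by ext; simp) (fun _ _ _ => by ext; simp)
      (fun _ _ _ => by ext; simp)) ‖B‖ fun f g => by
      rw [ContinuousMap.norm_le _ (by positivity)]
      intro t
      refine (B.le_opNorm₂ _ _).trans ?_
      gcongr
      · exact f.norm_coe_le_norm t
      · exact g.norm_coe_le_norm t

@[simp] theorem bilinL_apply (B : F →L[ℝ] G →L[ℝ] H) (f : C(T, F)) (g : C(T, G)) (t : T) :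
    bilinL B f g t = B (f t) (g t) := rfl

/-- Composition with a continuous linear map on the left. -/
def postL (L : F →L[ℝ] G) : C(T, F) →L[ℝ] C(T, G) := L.compLeftContinuous ℝ T

@[simp] theorem postL_apply (L : F →L[ℝ] G) (f : C(T, F)) (t : T) : postL L f t = L (f t) := rfl

theorem isOpen_inter_ball {U : Set (E d)} (hU : IsOpen U) {θ : E d} (hθ : θ ∈ U)
    {P : E d → Prop} (hP : ∀ᶠ ϑ in 𝓝[U] θ, P ϑ) : ∃ r > 0, ∀ ϑ ∈ Metric.ball θ r, ϑ ∈ U ∧ P ϑ := by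
  rw [hU.nhdsWithin_eq hθ] at hP
  obtain ⟨r, hr, h⟩ := Metric.eventually_nhds_iff_ball.1 (hP.and (hU.mem_nhds hθ))
  exact ⟨r, hr, fun ϑ h' => (h ϑ h').symm⟩

/-- Differentiability of a map into a space of continuous functions on a compact space, from
pointwise differentiability and continuity of the partial derivatives. -/
theorem hasFDerivAt_continuousMap {U : Set (E d)} (hU : IsOpen U) {g : E d → C(T, F)}
    {g' : Fin d → E d → C(T, F)} (hc : ∀ i, ContinuousOn (g' i) U)
    (hg : ∀ θ ∈ U, ∀ t, HasFDerivAt (fun ϑ => g ϑ t) (ofPartials fun i => g' i θ t) θ)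
    {θ : E d} (hθ : θ ∈ U) : HasFDerivAt g (ofPartials fun i => g' i θ) θ := by
  rw [hasFDerivAt_iff_isLittleO, Asymptotics.isLittleO_iff]
  intro ε hε
  -- The radius serves all `t` at once because the `g' i` are continuous for the sup norm. The
  -- denominator `d + 1` distributes `ε` over `d` partial derivatives and stays positive for `d =
  -- 0`.
  obtain ⟨r, hr, h⟩ := isOpen_inter_ball hU hθ
    (P := fun ϑ => ∀ i, ‖g' i ϑ - g' i θ‖ < ε / (d + 1)) (by
      rw [eventually_all]
      intro i
      have := Metric.continuousWithinAt_iff'.1 (hc i θ hθ) (ε / (d + 1)) (by positivity)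
      simpa [dist_eq_norm] using this)
  filter_upwards [Metric.ball_mem_nhds θ hr] with ϑ hϑ
  rw [ContinuousMap.norm_le _ (by positivity)]
  intro t
  -- The mean value inequality on the ball at fixed `t`; its constant `ε` does not depend on `t`, so
  -- the estimate passes to the sup norm.
  have key := Convex.norm_image_sub_le_of_norm_hasFDerivWithin_le' (𝕜 := ℝ)
    (f := fun ϑ => g ϑ t) (f' := fun ϑ => ofPartials fun i => g' i ϑ t)
    (φ := ofPartials fun i => g' i θ t) (C := ε) (s := Metric.ball θ r) (x := θ) (y := ϑ)
    (fun x hx => (hg x (h x hx).1 t).hasFDerivWithinAt) (fun x hx => by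
      rw [ofPartials_sub]
      refine (norm_ofPartials_le _).trans ?_
      calc ∑ i, ‖g' i x t - g' i θ t‖ ≤ ∑ _i : Fin d, ε / (d + 1) :=
            Finset.sum_le_sum fun i _ =>
              ((g' i x - g' i θ).norm_coe_le_norm t).trans ((h x hx).2 i).le
        _ = d * (ε / (d + 1)) := by simp
        _ ≤ ε := by
            rw [mul_div_assoc', div_le_iff₀ (by positivity)]
            nlinarith) (convex_ball θ r) (Metric.mem_ball_self hr) hϑ
  simpa [ofPartials_apply] using key

theorem partialDeriv_of_hasFDerivAt {f : E d → F} {v : Fin d → F} {θ : E d}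
    (h : HasFDerivAt f (ofPartials v) θ) (i : Fin d) : partialDeriv i f θ = v i := by
  rw [partialDeriv_eq_fderiv h.differentiableAt, h.fderiv, ofPartials_single]

theorem contDiffOn_continuousMap_succ {U : Set (E d)} (hU : IsOpen U) {n : ℕ} {g : E d → C(T, F)}
    {g' : Fin d → E d → C(T, F)} (hc : ∀ i, ContDiffOn ℝ n (g' i) U)
    (hg : ∀ θ ∈ U, ∀ t, HasFDerivAt (fun ϑ => g ϑ t) (ofPartials fun i => g' i θ t) θ) :
    ContDiffOn ℝ (n + 1 : ℕ) g U := by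
  have h := fun θ (hθ : θ ∈ U) => hasFDerivAt_continuousMap hU (fun i => (hc i).continuousOn) hg hθ
  refine (contDiffOn_succ_iff_partialDeriv hU).2
    ⟨fun θ hθ => (h θ hθ).differentiableAt.differentiableWithinAt, fun i => ?_⟩
  exact (hc i).congr fun θ hθ => partialDeriv_of_hasFDerivAt (h θ hθ) i

theorem continuousOn_continuousMap {U : Set (E d)} {g : E d → C(T, F)}
    (h : ContinuousOn (fun z : E d × T => g z.1 z.2) (U ×ˢ Set.univ)) : ContinuousOn g U := by
  rw [continuousOn_iff_continuous_domRestrict]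
  refine ContinuousMap.continuous_of_continuous_uncurry _ ?_
  have : Continuous fun z : U × T => ((z.1 : E d), z.2) := by fun_prop
  exact h.comp_continuous this fun z => ⟨z.1.2, trivial⟩

theorem continuousOn_uncurry {U : Set (E d)} {g : E d → C(T, F)} (h : ContinuousOn g U) :
    ContinuousOn (fun z : E d × T => g z.1 z.2) (U ×ˢ Set.univ) := by
  have h1 : ContinuousOn (fun z : E d × T => g z.1) (U ×ˢ Set.univ) :=
    h.comp continuousOn_fst fun z hz => hz.1
  exact fun z hz => (ContinuousEval.continuous_eval.tendsto (g z.1, z.2)).comp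
    ((h1 z hz).prodMk_nhds continuousWithinAt_snd)

/-- A family of functions with jointly continuous partial derivatives of order up to `n` is an
`n` times continuously differentiable map into the space of continuous functions. -/
theorem contDiffOn_continuousMap_of_mderiv {U : Set (E d)} (hU : IsOpen U) {n : ℕ}
    {f : E d → T → F} (hf : ∀ t, PartialDiff n (fun θ => f θ t) U)
    (hc : ∀ α : MultiIndex d, deg α ≤ n →
      ContinuousOn (fun z : E d × T => mderiv α (fun θ => f θ z.2) z.1) (U ×ˢ Set.univ)) :
    ∃ g : E d → C(T, F), (∀ θ ∈ U, ∀ t, g θ t = f θ t) ∧ ContDiffOn ℝ n g U := by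
  classical
  have hex : ∀ f : E d → T → F, ContinuousOn (fun z : E d × T => f z.1 z.2) (U ×ˢ Set.univ) →
      ∃ g : E d → C(T, F), ∀ θ ∈ U, ∀ t, g θ t = f θ t := by
    intro f hf
    refine ⟨fun θ => if h : θ ∈ U then ⟨f θ, ?_⟩ else 0, fun θ hθ t => by simp [hθ]⟩
    exact hf.comp_continuous (f := fun t => (θ, t)) (by fun_prop) fun t => ⟨h, trivial⟩
  have hcont : ∀ (f : E d → T → F) (g : E d → C(T, F)),
      ContinuousOn (fun z : E d × T => f z.1 z.2) (U ×ˢ Set.univ) →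
      (∀ θ ∈ U, ∀ t, g θ t = f θ t) → ContinuousOn g U := fun f g hf hg =>
    continuousOn_continuousMap (hf.congr fun z hz => hg z.1 hz.1 z.2)
  induction n generalizing f with
  | zero =>
    have h0 : ContinuousOn (fun z : E d × T => f z.1 z.2) (U ×ˢ Set.univ) := by
      simpa using hc 0 (by simp)
    obtain ⟨g, hg⟩ := hex f h0
    exact ⟨g, hg, by simpa using hcont f g h0 hg⟩
  | succ n ih =>
    have h0 : ContinuousOn (fun z : E d × T => f z.1 z.2) (U ×ˢ Set.univ) := by
      simpa using hc 0 (by simp)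
    obtain ⟨g, hg⟩ := hex f h0
    have h1 : ∀ i : Fin d, ∃ g : E d → C(T, F),
        (∀ θ ∈ U, ∀ t, g θ t = partialDeriv i (fun θ => f θ t) θ) ∧ ContDiffOn ℝ n g U := by
      intro i
      refine ih (f := fun θ t => partialDeriv i (fun θ => f θ t) θ) (fun t => (hf t).2 i) ?_
      intro α hα
      refine (hc (α + Pi.single i 1) (by rw [deg_add, deg_single]; omega)).congr fun z hz => ?_
      exact (mderiv_add_single hU ((hf z.2).mono (by omega)) i hz.1).symm
    choose g' hg' hd' using h1
    refine ⟨g, hg, contDiffOn_continuousMap_succ hU hd' fun θ hθ t => ?_⟩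
    have hd : DifferentiableAt ℝ (fun θ => f θ t) θ :=
      ((hf t).1 θ hθ).differentiableAt (hU.mem_nhds hθ)
    have h2 := hd.hasFDerivAt
    rw [fderiv_eq_ofPartials hd] at h2
    simp_rw [hg' _ θ hθ]
    refine h2.congr_of_eventuallyEq ?_
    filter_upwards [hU.mem_nhds hθ] with ϑ hϑ using hg ϑ hϑ t

/-- Composition with a fixed `C^n` function preserves `C^n` maps into spaces of continuous
functions. -/
theorem contDiffOn_comp_left {F G : Type u} [NormedAddCommGroup F] [NormedSpace ℝ F]
    [NormedAddCommGroup G] [NormedSpace ℝ G] {U : Set (E d)} (hU : IsOpen U) {O : Set F} (hO : IsOpen O) {n : ℕ}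
    {h : F → G} (hh : ContDiffOn ℝ n h O) {g : E d → C(T, F)} (hg : ContDiffOn ℝ n g U)
    (hgO : ∀ θ ∈ U, ∀ t, g θ t ∈ O) {k : E d → C(T, G)}
    (hk : ∀ θ ∈ U, ∀ t, k θ t = h (g θ t)) : ContDiffOn ℝ n k U := by
  classical
  -- The derivative of `h` takes values in `F →L[ℝ] G`, so the target has to vary in the induction.
  -- This is why `F` and `G` share a universe.
  induction n generalizing G with
  | zero =>
    simp only [Nat.cast_zero, contDiffOn_zero] at *
    refine continuousOn_continuousMap ?_
    refine ContinuousOn.congr (f := fun z : E d × T => h (g z.1 z.2)) ?_ fun z hz => hk _ hz.1 _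
    exact hh.comp (continuousOn_uncurry hg) fun z hz => hgO _ hz.1 _
  | succ n ih =>
    obtain ⟨hg1, hg2⟩ := (contDiffOn_succ_iff_partialDeriv hU).1 hg
    have hh' : ContDiffOn ℝ n (fderiv ℝ h) O := hh.fderiv_of_isOpen hO (by norm_cast)
    have hcont : ∀ θ ∈ U, Continuous fun t => fderiv ℝ h (g θ t) := fun θ hθ =>
      hh'.continuousOn.comp_continuous (g θ).continuous fun t => hgO θ hθ t
    let K : E d → C(T, F →L[ℝ] G) := fun θ =>
      if hθ : θ ∈ U then ⟨fun t => fderiv ℝ h (g θ t), hcont θ hθ⟩ else 0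
    have hK : ∀ θ ∈ U, ∀ t, K θ t = fderiv ℝ h (g θ t) := fun θ hθ t => by simp [K, hθ]
    have hKd : ContDiffOn ℝ n K U := ih hh' (hg.of_le (by norm_cast; omega)) hK
    refine contDiffOn_continuousMap_succ hU (g' := fun i θ =>
      bilinL (ContinuousLinearMap.id ℝ (F →L[ℝ] G)) (K θ) (partialDeriv i g θ))
      (fun i => contDiffOn_bilin _ hKd (hg2 i)) fun θ hθ t => ?_
    have hgd := (hg1 θ hθ).differentiableAt (hU.mem_nhds hθ)
    have h1 : HasFDerivAt (fun ϑ => g ϑ t) ((evalL t).comp (fderiv ℝ g θ)) θ :=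
      (evalL (F := F) t).hasFDerivAt.comp θ hgd.hasFDerivAt
    have h2 : HasFDerivAt h (fderiv ℝ h (g θ t)) (g θ t) :=
      ((hh.differentiableOn (by norm_cast) _ (hgO θ hθ t)).differentiableAt
        (hO.mem_nhds (hgO θ hθ t))).hasFDerivAt
    have h3 := (h2.comp θ h1).congr_of_eventuallyEq (f₁ := fun ϑ => k ϑ t)
      (by filter_upwards [hU.mem_nhds hθ] with ϑ hϑ using hk ϑ hϑ t)
    rw [eq_ofPartials ((fderiv ℝ h (g θ t)).comp _)] at h3
    have he : ∀ i, ((fderiv ℝ h (g θ t)).comp ((evalL t).comp (fderiv ℝ g θ)))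
        (EuclideanSpace.single i 1) = bilinL (ContinuousLinearMap.id ℝ (F →L[ℝ] G)) (K θ)
          (partialDeriv i g θ) t := fun i => by
      simp [hK θ hθ t, partialDeriv_eq_fderiv hgd]
    simp_rw [he] at h3
    exact h3

variable {X : Type*} [TopologicalSpace X] [CompactSpace X] [MeasurableSpace X] [BorelSpace X]

/-- The integral as a continuous linear functional. -/
def intL (μ : Measure X) [IsFiniteMeasure μ] : C(X, ℝ) →L[ℝ] ℝ :=
  LinearMap.mkContinuous
    { toFun := fun f => ∫ x, f x ∂μ
      map_add' := fun f g =>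
        integral_add (f.continuous.integrable_of_hasCompactSupport
          (HasCompactSupport.of_compactSpace _)) (g.continuous.integrable_of_hasCompactSupport
          (HasCompactSupport.of_compactSpace _))
      map_smul' := fun c f => integral_const_mul c _ } (μ.real Set.univ) fun f => by
      rw [mul_comm]
      exact norm_integral_le_of_norm_le_const (Eventually.of_forall fun x => f.norm_coe_le_norm _)

@[simp] theorem intL_apply (μ : Measure X) [IsFiniteMeasure μ] (f : C(X, ℝ)) :
    intL μ f = ∫ x, f x ∂μ := rfl

theorem continuous_integral_of_compact (μ : Measure X) [IsFiniteMeasure μ] (f : C(T × X, ℝ)) :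
    Continuous fun t => ∫ x, f (t, x) ∂μ :=
  (intL μ).continuous.comp f.curry.continuous

/-- Integration over the second variable. -/
def integralL (T : Type*) [TopologicalSpace T] [CompactSpace T] (μ : Measure X)
    [IsFiniteMeasure μ] : C(T × X, ℝ) →L[ℝ] C(T, ℝ) := by
  have hi : ∀ (f : C(T × X, ℝ)) (t : T), Integrable (fun x => f (t, x)) μ := fun f t =>
    (Continuous.comp (g := f) (by fun_prop) (by fun_prop)).integrable_of_hasCompactSupport
      (HasCompactSupport.of_compactSpace _)
  exact LinearMap.mkContinuous
    { toFun := fun f => ⟨fun t => ∫ x, f (t, x) ∂μ, continuous_integral_of_compact μ f⟩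
      map_add' := fun f g => by
        ext t; exact integral_add (hi f t) (hi g t)
      map_smul' := fun c f => by ext t; exact integral_const_mul c _ } (μ.real Set.univ) fun f => by
      rw [ContinuousMap.norm_le _ (by positivity)]
      intro t
      rw [mul_comm]
      exact norm_integral_le_of_norm_le_const (Eventually.of_forall fun x => f.norm_coe_le_norm _)

@[simp] theorem integralL_apply (μ : Measure X) [IsFiniteMeasure μ] (f : C(T × X, ℝ)) (t : T) :
    integralL T μ f t = ∫ x, f (t, x) ∂μ := rfl

end FunctionSpace

/-! ### Differentiability of uniform limits -/

section UniformLimit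

variable {d : ℕ} {F : Type*} [NormedAddCommGroup F] [NormedSpace ℝ F] [CompleteSpace F]

/-- A limit of `C^n` functions whose partial derivatives of order up to `n` are uniformly Cauchy
is `C^n`. -/
theorem contDiffOn_of_uniformCauchy_mderiv {U : Set (E d)} (hU : IsOpen U) {n : ℕ}
    {f : ℕ → E d → F} (hf : ∀ k, ContDiffOn ℝ n (f k) U)
    (hu : ∀ α : MultiIndex d, deg α ≤ n → UniformCauchySeqOn (fun k => mderiv α (f k)) atTop U)
    {g : E d → F} (hg : ∀ θ ∈ U, Tendsto (fun k => f k θ) atTop (𝓝 (g θ))) :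
    ContDiffOn ℝ n g U := by
  induction n generalizing f g with
  | zero =>
    simp only [Nat.cast_zero, contDiffOn_zero] at *
    refine TendstoUniformlyOn.continuousOn (F := f) (p := atTop) ?_ (Eventually.of_forall hf).frequently
    have := hu 0 (by simp)
    simp only [mderiv_zero] at this
    exact this.tendstoUniformlyOn_of_tendsto hg
  | succ n ih =>
    have hfd := fun k => (contDiffOn_succ_iff_partialDeriv hU).1 (hf k)
    have hu' : ∀ (i : Fin d) (α : MultiIndex d), deg α ≤ n →
        UniformCauchySeqOn (fun k => mderiv α (partialDeriv i (f k))) atTop U := by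
      intro i α hα
      have := hu (α + Pi.single i 1) (by rw [deg_add, deg_single]; omega)
      intro u hu
      filter_upwards [this u hu] with m hm x hx
      have key := fun k => mderiv_add_single (α := α) hU
        ((partialDiff_of_contDiffOn hU (hf k)).mono (by omega)) i hx
      simpa only [key] using hm x hx
    have hlim : ∀ i : Fin d, ∃ g' : E d → F, ∀ θ ∈ U,
        Tendsto (fun k => partialDeriv i (f k) θ) atTop (𝓝 (g' θ)) := by
      intro i
      have h : ∀ θ, ∃ v : F, θ ∈ U → Tendsto (fun k => partialDeriv i (f k) θ) atTop (𝓝 v) := by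
        intro θ
        by_cases hθ : θ ∈ U
        · have := (hu' i 0 (by simp)).cauchySeq hθ
          simp only [mderiv_zero] at this
          obtain ⟨v, hv⟩ := cauchySeq_tendsto_of_complete this
          exact ⟨v, fun _ => hv⟩
        · exact ⟨0, fun h => absurd h hθ⟩
      choose g' hg' using h
      exact ⟨g', hg'⟩
    choose g' hg' using hlim
    have hder : ∀ θ ∈ U, HasFDerivAt g (ofPartials fun i => g' i θ) θ := by
      intro θ hθ
      refine hasFDerivAt_of_tendstoUniformlyOn (l := atTop) (f := f)
        (f' := fun k θ => ofPartials fun i => partialDeriv i (f k) θ)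
        (g' := fun θ => ofPartials fun i => g' i θ) hU ?_ ?_ hg hθ
      · have hun : ∀ i, TendstoUniformlyOn (fun k => partialDeriv i (f k)) (g' i) atTop U := by
          intro i
          have := hu' i 0 (by simp)
          simp only [mderiv_zero] at this
          exact this.tendstoUniformlyOn_of_tendsto (hg' i)
        rw [Metric.tendstoUniformlyOn_iff]
        intro ε hε
        have : ∀ᶠ k in atTop, ∀ i : Fin d, ∀ x ∈ U,
            dist (g' i x) (partialDeriv i (f k) x) < ε / (d + 1) := by
          rw [eventually_all]
          exact fun i => Metric.tendstoUniformlyOn_iff.1 (hun i) _ (by positivity)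
        filter_upwards [this] with k hk x hx
        rw [dist_eq_norm, ofPartials_sub]
        refine (norm_ofPartials_le _).trans_lt ?_
        calc ∑ i, ‖g' i x - partialDeriv i (f k) x‖ ≤ ∑ _i : Fin d, ε / (d + 1) :=
              Finset.sum_le_sum fun i _ => by
                rw [← dist_eq_norm]; exact (hk i x hx).le
          _ = d * (ε / (d + 1)) := by simp
          _ < ε := by
              rw [mul_div_assoc', div_lt_iff₀ (by positivity)]
              nlinarith
      · intro k x hx
        have := ((hfd k).1 x hx).differentiableAt (hU.mem_nhds hx)
        rw [← fderiv_eq_ofPartials this]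
        exact this.hasFDerivAt
    refine (contDiffOn_succ_iff_partialDeriv hU).2
      ⟨fun θ hθ => (hder θ hθ).differentiableAt.differentiableWithinAt, fun i => ?_⟩
    refine (ih (fun k => (hfd k).2 i) (hu' i) (hg' i)).congr fun θ hθ => ?_
    exact partialDeriv_of_hasFDerivAt (hder θ hθ) i

end UniformLimit

/-! ### Signed measures as a normed space, and integration against them -/

section SignedMeasure

variable {X : Type*} [MeasurableSpace X]

theorem tvNorm_eq (l : SignedMeasure X) : tvNorm l = l.variation.real Set.univ := by
  rw [tvNorm, SignedMeasure.totalVariation_eq_variation]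

instance isFiniteMeasure_variation (l : SignedMeasure X) : IsFiniteMeasure l.variation := by
  rw [← SignedMeasure.totalVariation_eq_variation]; infer_instance

instance : Norm (SignedMeasure X) := ⟨tvNorm⟩

theorem norm_signedMeasure_def (l : SignedMeasure X) : ‖l‖ = tvNorm l := rfl

theorem abs_apply_le_norm (l : SignedMeasure X) (A : Set X) : |l A| ≤ ‖l‖ :=
  (l.norm_le_totalVariation A).trans (measureReal_mono (Set.subset_univ _))

theorem norm_eq_apply_sub_apply (l : SignedMeasure X) :
    ∃ A, MeasurableSet A ∧ ‖l‖ = l A - l Aᶜ := by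
  obtain ⟨s, hs, hp, hn, h1, h2⟩ := l.toJordanDecomposition_spec
  refine ⟨s, hs, ?_⟩
  rw [norm_signedMeasure_def, tvNorm, SignedMeasure.totalVariation, measureReal_add_apply, h1, h2,
    SignedMeasure.toMeasureOfZeroLE_real_apply _ _ _ MeasurableSet.univ,
    SignedMeasure.toMeasureOfLEZero_real_apply _ _ _ MeasurableSet.univ, Set.inter_univ,
    Set.inter_univ, sub_eq_add_neg]

/-- A Hahn set `A` gives the norm as `l A - l Aᶜ`, hence the factor 2. It reduces norm estimates for
operators to tests on indicator functions, where duality is available. -/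
theorem norm_le_of_forall_abs_apply_le {l : SignedMeasure X} {C : ℝ}
    (h : ∀ A, MeasurableSet A → |l A| ≤ C) : ‖l‖ ≤ 2 * C := by
  obtain ⟨A, hA, he⟩ := norm_eq_apply_sub_apply l
  rw [he]
  linarith [(abs_le.1 (h A hA)).2, (abs_le.1 (h _ hA.compl)).1]

theorem signedMeasure_normedSpaceCore : NormedSpace.Core ℝ (SignedMeasure X) where
  norm_nonneg l := by rw [norm_signedMeasure_def, tvNorm]; positivity
  norm_smul c l := by
    rw [norm_signedMeasure_def, norm_signedMeasure_def, tvNorm_eq, tvNorm_eq,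
      VectorMeasure.variation_smul]
    simp
  norm_triangle l m := by
    simp only [norm_signedMeasure_def, tvNorm_eq]
    rw [← measureReal_add_apply]
    refine ENNReal.toReal_mono (measure_ne_top _ _) ?_
    exact VectorMeasure.variation_add_le Set.univ
  norm_eq_zero_iff l := by
    refine ⟨fun h => ?_, fun h => ?_⟩
    · ext A hA
      have := abs_apply_le_norm l A
      rw [h] at this
      simpa using this
    · rw [h, norm_signedMeasure_def, tvNorm, SignedMeasure.totalVariation_zero]; simp

instance : NormedAddCommGroup (SignedMeasure X) :=
  NormedAddCommGroup.ofCore signedMeasure_normedSpaceCore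

instance : NormedSpace ℝ (SignedMeasure X) := NormedSpace.ofCore signedMeasure_normedSpaceCore

/-- The integral of a real function against a signed measure. -/
abbrev sInt (l : SignedMeasure X) (f : X → ℝ) : ℝ := ∫ᵛ x, f x ∂•l

theorem lsmul_flip_real :
    (ContinuousLinearMap.lsmul ℝ ℝ : ℝ →L[ℝ] ℝ →L[ℝ] ℝ).flip = ContinuousLinearMap.lsmul ℝ ℝ := by
  ext; simp

theorem sInt_toSignedMeasure (l : Measure X) [IsFiniteMeasure l] (f : X → ℝ) :
    sInt l.toSignedMeasure f = ∫ x, f x ∂l := by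
  rw [sInt, ← lsmul_flip_real, VectorMeasure.integral_toSignedMeasure]

theorem norm_toSignedMeasure (l : Measure X) [IsFiniteMeasure l] :
    ‖l.toSignedMeasure‖ = l.real Set.univ := by
  rw [norm_signedMeasure_def, tvNorm_eq, Measure.variation_toSignedMeasure]

theorem integrable_of_abs_le (l : Measure X) [IsFiniteMeasure l] {f : X → ℝ} (hf : Measurable f)
    {C : ℝ} (h : ∀ x, |f x| ≤ C) : Integrable f l :=
  Integrable.of_bound hf.aestronglyMeasurable C (Eventually.of_forall h)

theorem sInt_sub_toSignedMeasure (a b : Measure X) [IsFiniteMeasure a] [IsFiniteMeasure b]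
    {f : X → ℝ} (hf : Measurable f) {C : ℝ} (h : ∀ x, |f x| ≤ C) :
    sInt (a.toSignedMeasure - b.toSignedMeasure) f = ∫ x, f x ∂a - ∫ x, f x ∂b := by
  rw [sInt, VectorMeasure.integral_sub_vectorMeasure (integrable_of_abs_le _ hf h)
    (integrable_of_abs_le _ hf h)]
  exact congrArg₂ _ (sInt_toSignedMeasure a f) (sInt_toSignedMeasure b f)

theorem exists_eq_sub_toSignedMeasure (l : SignedMeasure X) :
    ∃ (a b : Measure X) (_ : IsFiniteMeasure a) (_ : IsFiniteMeasure b),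
      l = a.toSignedMeasure - b.toSignedMeasure :=
  ⟨_, _, inferInstance, inferInstance, l.toSignedMeasure_toJordanDecomposition.symm⟩

theorem sInt_add (l m : SignedMeasure X) {f : X → ℝ} (hf : Measurable f) {C : ℝ}
    (h : ∀ x, |f x| ≤ C) : sInt (l + m) f = sInt l f + sInt m f :=
  VectorMeasure.integral_add_vectorMeasure (integrable_of_abs_le _ hf h)
    (integrable_of_abs_le _ hf h)

theorem sInt_smul (c : ℝ) (l : SignedMeasure X) (f : X → ℝ) : sInt (c • l) f = c * sInt l f := by
  rw [sInt, VectorMeasure.integral_smul_vectorMeasure]; rfl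

theorem sInt_fun_sub (l : SignedMeasure X) {f g : X → ℝ} (hf : Measurable f) (hg : Measurable g)
    {C D : ℝ} (h : ∀ x, |f x| ≤ C) (h' : ∀ x, |g x| ≤ D) :
    sInt l (fun x => f x - g x) = sInt l f - sInt l g :=
  VectorMeasure.integral_fun_sub (integrable_of_abs_le _ hf h) (integrable_of_abs_le _ hg h')

theorem sInt_const_mul (l : SignedMeasure X) (c : ℝ) (f : X → ℝ) :
    sInt l (fun x => c * f x) = c * sInt l f :=
  VectorMeasure.integral_fun_smul (μ := l) (B := ContinuousLinearMap.lsmul ℝ ℝ) c f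

theorem abs_sInt_le (l : SignedMeasure X) {f : X → ℝ} {C : ℝ} (h : ∀ x, |f x| ≤ C) :
    |sInt l f| ≤ C * ‖l‖ := by
  have := VectorMeasure.norm_integral_le_of_norm_le_const (μ := l)
    (B := ContinuousLinearMap.lsmul ℝ ℝ) (f := f) (C := C) (Eventually.of_forall h)
  rw [norm_signedMeasure_def, tvNorm_eq]
  simpa using this

theorem sInt_indicator (l : SignedMeasure X) {A : Set X} (hA : MeasurableSet A) :
    sInt l (A.indicator fun _ => 1) = l A := by
  obtain ⟨a, b, _, _, rfl⟩ := exists_eq_sub_toSignedMeasure l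
  rw [sInt_sub_toSignedMeasure (C := 1) a b (measurable_const.indicator hA),
    integral_indicator_const _ hA, integral_indicator_const _ hA]
  · simp [Measure.toSignedMeasure_apply_measurable hA]
  · intro x
    by_cases hx : x ∈ A <;> simp [hx]

theorem sInt_one (l : SignedMeasure X) : sInt l (fun _ => 1) = l Set.univ := by
  simpa only [Set.indicator_univ] using sInt_indicator l MeasurableSet.univ

theorem sInt_withDensityᵥ (μ : Measure X) [IsFiniteMeasure μ] {g : X → ℝ} (hg : Integrable g μ)
    {f : X → ℝ} (hf : Measurable f) {C : ℝ} (h : ∀ x, |f x| ≤ C) :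
    sInt (μ.withDensityᵥ g) f = ∫ x, f x * g x ∂μ := by
  have : IsFiniteMeasure (μ.withDensity fun x => ENNReal.ofReal (g x)) :=
    isFiniteMeasure_withDensity_ofReal hg.2
  have : IsFiniteMeasure (μ.withDensity fun x => ENNReal.ofReal (-g x)) :=
    isFiniteMeasure_withDensity_ofReal hg.neg.2
  rw [withDensityᵥ_eq_withDensity_pos_part_sub_withDensity_neg_part hg,
    sInt_sub_toSignedMeasure _ _ hf h,
    integral_withDensity_eq_integral_toReal_smul₀ hg.1.aemeasurable.ennreal_ofReal
      (Eventually.of_forall fun _ => ENNReal.ofReal_lt_top),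
    integral_withDensity_eq_integral_toReal_smul₀ (f := fun x => ENNReal.ofReal (-g x))
      hg.1.aemeasurable.neg.ennreal_ofReal
      (Eventually.of_forall fun _ => ENNReal.ofReal_lt_top), ← integral_sub]
  · refine integral_congr_ae (Eventually.of_forall fun x => ?_)
    simp only [smul_eq_mul, ENNReal.toReal_ofReal']
    rcases le_total 0 (g x) with hx | hx <;> simp [hx, mul_comm]
  · have := hg.pos_part.mul_bdd (c := C) hf.aestronglyMeasurable (Eventually.of_forall h)
    simpa [ENNReal.toReal_ofReal'] using this
  · have := hg.neg_part.mul_bdd (c := C) hf.aestronglyMeasurable (Eventually.of_forall h)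
    simpa [ENNReal.toReal_ofReal'] using this

end SignedMeasure

/-! ### Integral operators on signed measures and their duals -/

section Kernel

variable {X : Type*} [MeasurableSpace X] [MetricSpace X] [CompactSpace X] [BorelSpace X]

theorem continuous_sInt {T : Type*} [TopologicalSpace T] [CompactSpace T] (ρ : C(T × X, ℝ))
    (l : SignedMeasure X) : Continuous fun t => sInt l fun x => ρ (t, x) := by
  obtain ⟨a, b, _, _, rfl⟩ := exists_eq_sub_toSignedMeasure l
  have : ∀ t, sInt (a.toSignedMeasure - b.toSignedMeasure) (fun x => ρ (t, x)) =
      ∫ x, ρ (t, x) ∂a - ∫ x, ρ (t, x) ∂b := fun t =>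
    sInt_sub_toSignedMeasure _ _ (ρ.continuous.comp (by fun_prop)).measurable
      fun x => ρ.norm_coe_le_norm _
  simp_rw [this]
  exact (continuous_integral_of_compact a ρ).sub (continuous_integral_of_compact b ρ)

theorem integrable_of_continuous (μ : Measure X) [IsFiniteMeasure μ] {f : X → ℝ}
    (hf : Continuous f) : Integrable f μ :=
  hf.integrable_of_hasCompactSupport (HasCompactSupport.of_compactSpace _)

/-- The operator on signed measures with kernel `ρ(x, x') μ(dx)`. -/
def kerOp (μ : Measure X) [IsFiniteMeasure μ] (ρ : C(X × X, ℝ)) :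
    SignedMeasure X →ₗ[ℝ] SignedMeasure X where
  toFun l := μ.withDensityᵥ fun x => sInt l fun x' => ρ (x, x')
  map_add' l m := by
    rw [← withDensityᵥ_add' (integrable_of_continuous μ (continuous_sInt ρ l))
      (integrable_of_continuous μ (continuous_sInt ρ m))]
    congr 1
    ext x
    exact sInt_add l m (by fun_prop) fun x' => ρ.norm_coe_le_norm _
  map_smul' c l := by
    rw [RingHom.id_apply, ← withDensityᵥ_smul']
    congr 1
    ext x
    exact sInt_smul c l _

theorem kerOp_apply (μ : Measure X) [IsFiniteMeasure μ] (ρ : C(X × X, ℝ)) (l : SignedMeasure X) :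
    kerOp μ ρ l = μ.withDensityᵥ fun x => sInt l fun x' => ρ (x, x') := rfl

/-- The function `x' ↦ ∫ f(x) ρ(x, x') μ(dx)`. -/
def dualOp (μ : Measure X) (ρ : C(X × X, ℝ)) (f : X → ℝ) (x' : X) : ℝ := ∫ x, f x * ρ (x, x') ∂μ

theorem measurable_dualOp (μ : Measure X) [IsFiniteMeasure μ] (ρ : C(X × X, ℝ)) {f : X → ℝ}
    (hf : Measurable f) : Measurable (dualOp μ ρ f) := by
  refine StronglyMeasurable.measurable ?_
  refine StronglyMeasurable.integral_prod_right (f := fun x' x => f x * ρ (x, x')) ?_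
  exact Measurable.stronglyMeasurable (by
    unfold Function.uncurry
    have : Measurable fun a : X × X => ρ (a.2, a.1) := by fun_prop
    fun_prop)

theorem abs_dualOp_le (μ : Measure X) [IsFiniteMeasure μ] (ρ : C(X × X, ℝ)) {f : X → ℝ} {C : ℝ}
    (h : ∀ x, |f x| ≤ C) (x' : X) : |dualOp μ ρ f x'| ≤ C * ‖ρ‖ * μ.real Set.univ := by
  rw [← Real.norm_eq_abs]
  unfold dualOp
  refine norm_integral_le_of_norm_le_const (Eventually.of_forall fun x => ?_)
  rw [norm_mul]
  exact mul_le_mul (h x) (ρ.norm_coe_le_norm _) (norm_nonneg _) ((abs_nonneg _).trans (h x))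

/-- Fubini's theorem for the operator with kernel `ρ`. -/
theorem sInt_kerOp (μ : Measure X) [IsFiniteMeasure μ] (ρ : C(X × X, ℝ)) (l : SignedMeasure X)
    {f : X → ℝ} (hf : Measurable f) {C : ℝ} (h : ∀ x, |f x| ≤ C) :
    sInt (kerOp μ ρ l) f = sInt l (dualOp μ ρ f) := by
  rw [kerOp_apply, sInt_withDensityᵥ μ (integrable_of_continuous μ (continuous_sInt ρ l)) hf h]
  obtain ⟨a, b, _, _, rfl⟩ := exists_eq_sub_toSignedMeasure l
  rw [sInt_sub_toSignedMeasure a b (measurable_dualOp μ ρ hf) (abs_dualOp_le μ ρ h)]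
  have h1 : ∀ x, sInt (a.toSignedMeasure - b.toSignedMeasure) (fun x' => ρ (x, x')) =
      ∫ x', ρ (x, x') ∂a - ∫ x', ρ (x, x') ∂b := fun x =>
    sInt_sub_toSignedMeasure _ _ (by fun_prop) fun x' => ρ.norm_coe_le_norm _
  simp_rw [h1, mul_sub]
  have h2 : ∀ (c : Measure X) [IsFiniteMeasure c],
      Integrable (fun x => f x * ∫ x', ρ (x, x') ∂c) μ := fun c _ =>
    (integrable_of_continuous μ (continuous_integral_of_compact c ρ)).bdd_mul (c := C)
      hf.aestronglyMeasurable (Eventually.of_forall h)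
  rw [integral_sub (h2 a) (h2 b)]
  have h3 : ∀ (c : Measure X) [IsFiniteMeasure c],
      ∫ x, f x * ∫ x', ρ (x, x') ∂c ∂μ = ∫ x', dualOp μ ρ f x' ∂c := fun c _ => by
    unfold dualOp
    rw [← integral_integral_swap]
    · simp_rw [integral_const_mul]
    · have : Measurable (Function.uncurry fun x x' : X => f x * ρ (x, x')) := by
        unfold Function.uncurry
        have : Measurable fun a : X × X => ρ (a.1, a.2) := by fun_prop
        fun_prop
      refine integrable_of_abs_le _ this (C := C * ‖ρ‖) fun z => ?_
      rw [Function.uncurry_def, abs_mul]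
      exact mul_le_mul (h _) (ρ.norm_coe_le_norm _) (abs_nonneg _)
        ((abs_nonneg _).trans (h z.1))
  rw [h3 a, h3 b]

theorem kerOp_univ (μ : Measure X) [IsFiniteMeasure μ] (ρ : C(X × X, ℝ)) (l : SignedMeasure X) :
    kerOp μ ρ l Set.univ = sInt l (dualOp μ ρ fun _ => 1) := by
  rw [← sInt_one, sInt_kerOp μ ρ l measurable_const (C := 1) (by simp)]

/-- The total mass as a linear functional. -/
def mass : SignedMeasure X →ₗ[ℝ] ℝ where
  toFun l := l Set.univ
  map_add' _ _ := rfl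
  map_smul' _ _ := rfl

theorem mass_apply (l : SignedMeasure X) : mass l = l Set.univ := rfl

theorem abs_mass_le (l : SignedMeasure X) : |mass l| ≤ ‖l‖ := abs_apply_le_norm l _

/-- By duality the mass of a set is the integral against `l` of the dual applied to an indicator,
and that function is bounded by the column integrals of `|ρ|`. -/
theorem norm_kerOp_le (μ : Measure X) [IsFiniteMeasure μ] (ρ : C(X × X, ℝ)) (l : SignedMeasure X)
    {b : ℝ} (h : ∀ x', ∫ x, |ρ (x, x')| ∂μ ≤ b) : ‖kerOp μ ρ l‖ ≤ 2 * (b * ‖l‖) := by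
  refine norm_le_of_forall_abs_apply_le fun A hA => ?_
  rw [← sInt_indicator _ hA, sInt_kerOp μ ρ l (measurable_const.indicator hA) (C := 1)]
  · refine abs_sInt_le _ fun x' => (h x').trans' ?_
    refine (abs_integral_le_integral_abs).trans ?_
    have hi : Integrable (fun x => |ρ (x, x')|) μ := integrable_of_continuous μ (by fun_prop)
    refine integral_mono_of_nonneg (Eventually.of_forall fun x => abs_nonneg _) hi
      (Eventually.of_forall fun x => ?_)
    by_cases hx : x ∈ A <;> simp [hx]
  · intro x
    by_cases hx : x ∈ A <;> simp [hx]

end Kernel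

/-! ### Forced linear recursions with a contracting linear part -/

section LinearRecursion

variable {V : Type*} [NormedAddCommGroup V] [NormedSpace ℝ V]

/-- The composition `T_{k+j-1} ∘ ⋯ ∘ T_k`. -/
def compFrom (T : ℕ → V →ₗ[ℝ] V) (k : ℕ) : ℕ → V →ₗ[ℝ] V
  | 0 => LinearMap.id
  | j + 1 => T (k + j) ∘ₗ compFrom T k j

/-- Variation of constants: the error made at step `k` is carried to time `n` by the maps with
indices `k + 1, …, n - 1`, which are `n - 1 - k` in number. -/
theorem duhamel (T : ℕ → V →ₗ[ℝ] V) {v e : ℕ → V} {n : ℕ}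
    (h : ∀ k < n, v (k + 1) = T k (v k) + e k) :
    v n = compFrom T 0 n (v 0) + ∑ k ∈ Finset.range n, compFrom T (k + 1) (n - 1 - k) (e k) := by
  induction n with
  | zero => simp [compFrom]
  | succ n ih =>
    rw [h n (Nat.lt_succ_self n), ih fun k hk => h k (by omega), Finset.sum_range_succ, map_add,
      map_sum, add_assoc]
    congr 1
    · simp [compFrom]
    · congr 1
      · refine Finset.sum_congr rfl fun k hk => ?_
        have hk' := Finset.mem_range.1 hk
        obtain ⟨i, rfl⟩ : ∃ i, n = k + 1 + i := ⟨n - (k + 1), by omega⟩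
        rw [show k + 1 + i + 1 - 1 - k = i + 1 by omega, show k + 1 + i - 1 - k = i by omega]
        rfl
      · simp [compFrom]

variable {T : ℕ → V →ₗ[ℝ] V} {v e : ℕ → V} {N : ℕ} {C τ : ℝ}

theorem norm_le_of_recursion
    (hT : ∀ k j, k + j ≤ N → ∀ u, ‖compFrom T k j u‖ ≤ C * τ ^ j * ‖u‖)
    (h : ∀ k < N, v (k + 1) = T k (v k) + e k) {n : ℕ} (hn : n ≤ N) :
    ‖v n‖ ≤ C * τ ^ n * ‖v 0‖ + ∑ k ∈ Finset.range n, C * τ ^ (n - 1 - k) * ‖e k‖ := by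
  rw [duhamel T fun k hk => h k (hk.trans_le hn)]
  refine (norm_add_le _ _).trans (add_le_add (hT 0 n (by omega) _) ?_)
  refine norm_sum_le_of_le _ fun k hk => hT _ _ ?_ _
  have := Finset.mem_range.1 hk
  omega

/-- Bounded errors, each damped geometrically until time `n`, add up to at most a geometric series.
-/
theorem norm_le_of_recursion_bounded (hC : 0 ≤ C) (hτ : 0 ≤ τ) (hτ1 : τ < 1)
    (hT : ∀ k j, k + j ≤ N → ∀ u, ‖compFrom T k j u‖ ≤ C * τ ^ j * ‖u‖)
    (h : ∀ k < N, v (k + 1) = T k (v k) + e k) {M : ℝ} (hM : 0 ≤ M) (he : ∀ k < N, ‖e k‖ ≤ M)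
    {n : ℕ} (hn : n ≤ N) : ‖v n‖ ≤ C * (‖v 0‖ + M / (1 - τ)) := by
  refine (norm_le_of_recursion hT h hn).trans ?_
  rw [mul_add]
  gcongr ?_ + ?_
  · rw [mul_assoc]
    gcongr
    exact mul_le_of_le_one_left (norm_nonneg _) (pow_le_one₀ hτ hτ1.le)
  · calc ∑ k ∈ Finset.range n, C * τ ^ (n - 1 - k) * ‖e k‖
        ≤ ∑ k ∈ Finset.range n, C * τ ^ (n - 1 - k) * M := Finset.sum_le_sum fun k hk => by
          gcongr
          exact he k ((Finset.mem_range.1 hk).trans_le hn)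
      _ = C * M * ∑ k ∈ Finset.range n, τ ^ (n - 1 - k) := by
          rw [Finset.mul_sum]; exact Finset.sum_congr rfl fun _ _ => by ring
      _ = C * M * ∑ k ∈ Finset.range n, τ ^ k := by rw [Finset.sum_range_reflect (τ ^ ·) n]
      _ ≤ C * M * (1 - τ)⁻¹ := by
          gcongr
          rw [← tsum_geometric_of_lt_one hτ hτ1]
          exact (summable_geometric_of_lt_one hτ hτ1).sum_le_tsum _ fun _ _ => by positivity
      _ = C * (M / (1 - τ)) := by ring

/-- Bernoulli's inequality for `σ' / σ`: an arbitrarily small loss in the rate absorbs the linear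
factor. -/
theorem nat_mul_pow_le {σ σ' : ℝ} (hσ : 0 < σ) (h : σ < σ') (n : ℕ) :
    n * σ ^ (n - 1) ≤ σ' ^ n / (σ' - σ) := by
  rw [le_div_iff₀ (sub_pos.2 h)]
  rcases n with _ | n
  · simp
  have hb := one_add_mul_le_pow (a := (σ' - σ) / σ)
    (by have := div_pos (sub_pos.2 h) hσ; linarith) (n + 1)
  have h1 : 1 + (σ' - σ) / σ = σ' / σ := by field_simp; ring
  rw [h1, div_pow, le_div_iff₀ (by positivity)] at hb
  refine le_trans ?_ hb
  have : ((n + 1 : ℕ) : ℝ) * ((σ' - σ) / σ) * σ ^ (n + 1) =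
      (n + 1 : ℕ) * σ ^ (n + 1 - 1) * (σ' - σ) := by
    rw [Nat.add_sub_cancel, pow_succ]; field_simp
  rw [add_mul, this]
  have : 0 < σ ^ (n + 1) := by positivity
  linarith

/-- Errors of size `σ ^ k` damped by `τ ^ (n - 1 - k)` with `τ ≤ σ` sum to at most `n σ ^ (n - 1)`.
The factor `n` is the reason for passing from `σ` to the larger rate `σ'`. -/
theorem norm_le_of_recursion_decay (hC : 0 ≤ C) (hτ : 0 < τ)
    (hT : ∀ k j, k + j ≤ N → ∀ u, ‖compFrom T k j u‖ ≤ C * τ ^ j * ‖u‖)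
    (h : ∀ k < N, v (k + 1) = T k (v k) + e k) {M σ σ' : ℝ} (hM : 0 ≤ M) (hτσ : τ ≤ σ)
    (hσ : σ < σ') (he : ∀ k < N, ‖e k‖ ≤ M * σ ^ k)
    {n : ℕ} (hn : n ≤ N) : ‖v n‖ ≤ C * (1 + 1 / (σ' - σ)) * (‖v 0‖ + M) * σ' ^ n := by
  have hσ0 : 0 < σ := hτ.trans_le hτσ
  have hσ' : 0 < σ' := hσ0.trans hσ
  refine (norm_le_of_recursion hT h hn).trans ?_
  have h1 : ∑ k ∈ Finset.range n, C * τ ^ (n - 1 - k) * ‖e k‖ ≤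
      C * M * (σ' ^ n / (σ' - σ)) :=
    calc ∑ k ∈ Finset.range n, C * τ ^ (n - 1 - k) * ‖e k‖
        ≤ ∑ k ∈ Finset.range n, C * M * σ ^ (n - 1) := Finset.sum_le_sum fun k hk => by
          have hk' := Finset.mem_range.1 hk
          calc C * τ ^ (n - 1 - k) * ‖e k‖ ≤ C * σ ^ (n - 1 - k) * (M * σ ^ k) := by
                gcongr
                exact he k (hk'.trans_le hn)
            _ = C * M * σ ^ (n - 1) := by
                rw [show n - 1 = (n - 1 - k) + k by omega, pow_add]
                simp only [Nat.add_sub_cancel]; ring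
      _ = C * M * (n * σ ^ (n - 1)) := by simp; ring
      _ ≤ _ := by gcongr; exact nat_mul_pow_le hσ0 hσ n
  have h2 : C * τ ^ n * ‖v 0‖ ≤ C * σ' ^ n * ‖v 0‖ := by gcongr; exact hτσ.trans hσ.le
  have h3 : 0 ≤ 1 / (σ' - σ) := by have := sub_pos.2 hσ; positivity
  have h4 : 0 ≤ C * σ' ^ n := by positivity
  calc _ ≤ C * σ' ^ n * ‖v 0‖ + C * M * (σ' ^ n / (σ' - σ)) := add_le_add h2 h1
    _ ≤ C * σ' ^ n * ‖v 0‖ + C * M * (σ' ^ n / (σ' - σ)) +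
        C * σ' ^ n * (M + 1 / (σ' - σ) * ‖v 0‖) := by
          have : 0 ≤ C * σ' ^ n * (M + 1 / (σ' - σ) * ‖v 0‖) := by positivity
          linarith
    _ = _ := by ring

end LinearRecursion

/-! ### The abstract derivative recursion and bounds for its trajectories -/

section Recursion

variable {V : Type*} [NormedAddCommGroup V] [NormedSpace ℝ V] {d : ℕ}

/-- The abstract form of the measures with densities `s^α`. -/
def sVec (m : V →ₗ[ℝ] ℝ) (A : MultiIndex d → V →ₗ[ℝ] V) (l : MultiIndex d → V)
    (α : MultiIndex d) : V :=
  ∑ β ∈ Finset.Iic α, (mchoose α β : ℝ) • ((m (A 0 (l 0)))⁻¹ • A (α - β) (l β))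

/-- One step of the abstract form of the derivative recursion. -/
def IsStep (m : V →ₗ[ℝ] ℝ) (p : ℕ) (A : MultiIndex d → V →ₗ[ℝ] V) (l l' : MultiIndex d → V) :
    Prop :=
  ∀ α, deg α ≤ p → l' α = sVec m A l α -
    ∑ β ∈ Finset.Iio α, (mchoose α β : ℝ) • (m (sVec m A l (α - β)) • l' β)

/-- The part of `sVec` that only involves components of lower order. -/
def sVecLow (m : V →ₗ[ℝ] ℝ) (A : MultiIndex d → V →ₗ[ℝ] V) (l : MultiIndex d → V)
    (α : MultiIndex d) : V :=
  ∑ β ∈ Finset.Iio α, (mchoose α β : ℝ) • ((m (A 0 (l 0)))⁻¹ • A (α - β) (l β))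

theorem sVec_eq (m : V →ₗ[ℝ] ℝ) (A : MultiIndex d → V →ₗ[ℝ] V) (l : MultiIndex d → V)
    (α : MultiIndex d) :
    sVec m A l α = (m (A 0 (l 0)))⁻¹ • A 0 (l α) + sVecLow m A l α := by
  rw [sVec, sVecLow, ← Finset.Iio_insert, Finset.sum_insert (by simp)]
  simp [mchoose_self]

/-- The linearization of the filter step in the direction of the top component. -/
def tanMap (m : V →ₗ[ℝ] ℝ) (A : V →ₗ[ℝ] V) (l l' : V) : V →ₗ[ℝ] V :=
  (m (A l))⁻¹ • (A - (m ∘ₗ A).smulRight l')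

theorem tanMap_apply (m : V →ₗ[ℝ] ℝ) (A : V →ₗ[ℝ] V) (l l' v : V) :
    tanMap m A l l' v = (m (A l))⁻¹ • A v - m ((m (A l))⁻¹ • A v) • l' := by
  simp [tanMap, smul_sub, smul_smul]

/-- The inhomogeneous term of the recursion for the component `α`. -/
def restVec (m : V →ₗ[ℝ] ℝ) (A : MultiIndex d → V →ₗ[ℝ] V) (l l' : MultiIndex d → V)
    (α : MultiIndex d) : V :=
  sVecLow m A l α - m (sVecLow m A l α) • l' 0 -
    ∑ β ∈ (Finset.Iio α).filter (· ≠ 0), (mchoose α β : ℝ) • (m (sVec m A l (α - β)) • l' β)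

/-- The component `l α` occurs only in `sVec m A l α`, which enters once directly and once through
the term `β = 0`, multiplied by `l' 0`. These two contributions make up the tangent map; every other
term involves components of lower order only. -/
theorem IsStep.eq_tanMap_add {m : V →ₗ[ℝ] ℝ} {p : ℕ} {A : MultiIndex d → V →ₗ[ℝ] V}
    {l l' : MultiIndex d → V} (h : IsStep m p A l l') {α : MultiIndex d} (hα : α ≠ 0)
    (hp : deg α ≤ p) :
    l' α = tanMap m (A 0) (l 0) (l' 0) (l α) + restVec m A l l' α := by
  have h0 : (0 : MultiIndex d) ∈ Finset.Iio α := by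
    rw [Finset.mem_Iio]; exact lt_of_le_of_ne zero_le hα.symm
  have hf : (Finset.Iio α).filter (· ≠ 0) = (Finset.Iio α).erase 0 := by
    ext; simp [and_comm]
  rw [h α hp, restVec, hf, ← Finset.add_sum_erase _ _ h0, tanMap_apply, mchoose_zero_right,
    tsub_zero, sVec_eq m A l α, map_add]
  simp only [Nat.cast_one, one_smul, add_smul]
  abel

theorem norm_sum_mchoose_le {α : MultiIndex d} {s : Finset (MultiIndex d)} (hs : s ⊆ Finset.Iic α)
    {f : MultiIndex d → V} {M : ℝ} (hM : 0 ≤ M) (h : ∀ β ∈ s, ‖f β‖ ≤ M) :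
    ‖∑ β ∈ s, (mchoose α β : ℝ) • f β‖ ≤ 2 ^ deg α * M := by
  calc ‖∑ β ∈ s, (mchoose α β : ℝ) • f β‖ ≤ ∑ β ∈ s, (mchoose α β : ℝ) * M :=
        norm_sum_le_of_le _ fun β hβ => by
          rw [norm_smul, Real.norm_natCast]; gcongr; exact h β hβ
    _ ≤ ∑ β ∈ Finset.Iic α, (mchoose α β : ℝ) * M :=
        Finset.sum_le_sum_of_subset_of_nonneg hs fun _ _ _ => by positivity
    _ = 2 ^ deg α * M := by rw [← Finset.sum_mul, sum_mchoose_eq]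

/-- A trajectory of length `N` of the abstract derivative recursion, with uniform bounds on the
operators, contraction of the linearized filter, and scale parameter `w`. -/
structure IsTrajectory (m : V →ₗ[ℝ] ℝ) (p : ℕ) (C τ : ℝ) (N : ℕ) (w : ℝ)
    (A : ℕ → MultiIndex d → V →ₗ[ℝ] V) (L : ℕ → MultiIndex d → V) : Prop where
  abs_mass_le : ∀ v, |m v| ≤ ‖v‖
  one_le_w : 1 ≤ w
  step : ∀ n < N, IsStep m p (A n) (L n) (L (n + 1))
  mass_pos : ∀ n < N, 0 < m (A n 0 (L n 0))
  norm_op_le : ∀ n < N, ∀ γ, deg γ ≤ p → ∀ v,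
    ‖A n γ v‖ ≤ C * w ^ deg γ * m (A n 0 (L n 0)) * ‖v‖
  norm_zero_le : ∀ n ≤ N, ‖L n 0‖ ≤ 1
  norm_init_le : ∀ α, deg α ≤ p → ‖L 0 α‖ ≤ w ^ deg α
  contraction : ∀ k j, k + j ≤ N → ∀ v,
    ‖compFrom (fun n => tanMap m (A n 0) (L n 0) (L (n + 1) 0)) k j v‖ ≤ C * τ ^ j * ‖v‖

variable {m : V →ₗ[ℝ] ℝ} {p : ℕ} {C τ : ℝ} {N : ℕ} {w : ℝ} {A : ℕ → MultiIndex d → V →ₗ[ℝ] V}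
  {L L' : ℕ → MultiIndex d → V}

namespace IsTrajectory

theorem norm_normalized_le (h : IsTrajectory m p C τ N w A L) {n : ℕ} (hn : n < N)
    {γ : MultiIndex d} (hγ : deg γ ≤ p) (v : V) :
    ‖(m (A n 0 (L n 0)))⁻¹ • A n γ v‖ ≤ C * w ^ deg γ * ‖v‖ := by
  have hc := h.mass_pos n hn
  rw [norm_smul, norm_inv, Real.norm_of_nonneg hc.le, inv_mul_le_iff₀ hc]
  refine (h.norm_op_le n hn γ hγ v).trans (le_of_eq (by ring))

theorem norm_sum_normalized_le (h : IsTrajectory m p C τ N w A L) (hC : 1 ≤ C) {n : ℕ}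
    (hn : n < N) {B : ℝ} (hB : 0 ≤ B) {α : MultiIndex d} (hα : deg α ≤ p)
    {s : Finset (MultiIndex d)} (hs : s ⊆ Finset.Iic α)
    (hL : ∀ β ∈ s, ‖L n β‖ ≤ B * w ^ deg β) :
    ‖∑ β ∈ s, (mchoose α β : ℝ) • ((m (A n 0 (L n 0)))⁻¹ • A n (α - β) (L n β))‖ ≤
      2 ^ deg α * (C * B) * w ^ deg α := by
  have hw : 0 ≤ w := zero_le_one.trans h.one_le_w
  rw [mul_assoc]
  refine norm_sum_mchoose_le hs (by positivity) fun β hβ => ?_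
  have hd := deg_sub_add (Finset.mem_Iic.1 (hs hβ))
  refine (h.norm_normalized_le hn (by omega) _).trans ?_
  calc C * w ^ deg (α - β) * ‖L n β‖ ≤ C * w ^ deg (α - β) * (B * w ^ deg β) := by
        gcongr; exact hL β hβ
    _ = C * B * w ^ deg α := by rw [← hd, pow_add]; ring

/-- The components of a trajectory are bounded in terms of the scale `w`, with a constant that
only depends on the order and on the constants of the linearized filter. -/
theorem exists_norm_le (hC : 1 ≤ C) (hτ0 : 0 < τ) (hτ1 : τ < 1) (j : ℕ) :
    ∃ B : ℝ, 1 ≤ B ∧ ∀ (V : Type) [NormedAddCommGroup V] [NormedSpace ℝ V] (d : ℕ)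
      (m : V →ₗ[ℝ] ℝ) (p N : ℕ) (w : ℝ)
      (A : ℕ → MultiIndex d → V →ₗ[ℝ] V) (L : ℕ → MultiIndex d → V), j ≤ p →
      IsTrajectory m p C τ N w A L →
      ∀ n ≤ N, ∀ α, deg α ≤ j → ‖L n α‖ ≤ B * w ^ deg α := by
  induction j with
  | zero =>
    refine ⟨1, le_rfl, fun V _ _ d m p N w A L _ h n hn α hα => ?_⟩
    have : α = 0 := deg_eq_zero.1 (by omega)
    subst this
    simpa using h.norm_zero_le n hn
  | succ j ih =>
    obtain ⟨B, hB1, hB⟩ := ih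
    have hB0 : 0 ≤ B := zero_le_one.trans hB1
    have hC0 : 0 ≤ C := zero_le_one.trans hC
    -- The first summand covers `sVecLow` and its multiple of `l' 0`. The second covers the
    -- remaining sum: total binomial weight `2 ^ (j + 1)`, mass of `s^(α-β)` at most `2 ^ j * (C *
    -- B)`, and `l' β` at most `B`, all in units of powers of `w`.
    set M : ℝ := 2 * (2 ^ (j + 1) * (C * B)) + 2 ^ (j + 1) * (2 ^ j * (C * B) * B) with hM
    have hM0 : 0 ≤ M := by positivity
    refine ⟨max B (C * (1 + M / (1 - τ))), hB1.trans (le_max_left _ _),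
      fun V _ _ d m p N w A L hjp h n hn α hα => ?_⟩
    have hw : 0 ≤ w := zero_le_one.trans h.one_le_w
    have hlow := hB V d m p N w A L (by omega) h
    rcases Nat.lt_or_ge (deg α) (j + 1) with hlt | hge
    · refine (hlow n hn α (by omega)).trans ?_
      gcongr
      exact le_max_left _ _
    have hdeg : deg α = j + 1 := le_antisymm hα hge
    have hα0 : α ≠ 0 := fun h0 => by simp [h0] at hdeg
    have hlt : ∀ β ∈ Finset.Iio α, deg β ≤ j := fun β hβ => by
      have := deg_lt_deg (Finset.mem_Iio.1 hβ); omega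
    have hrest : ∀ k < N, ‖restVec m (A k) (L k) (L (k + 1)) α‖ ≤ M * w ^ deg α := by
      intro k hk
      have h1 : ‖sVecLow m (A k) (L k) α‖ ≤ 2 ^ (j + 1) * (C * B) * w ^ deg α := by
        rw [← hdeg]
        exact h.norm_sum_normalized_le hC hk hB0 (by omega)
          (fun β hβ => Finset.mem_Iic.2 (Finset.mem_Iio.1 hβ).le)
          fun β hβ => hlow k hk.le β (hlt β hβ)
      have h2 : ‖m (sVecLow m (A k) (L k) α) • L (k + 1) 0‖ ≤
          2 ^ (j + 1) * (C * B) * w ^ deg α := by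
        rw [norm_smul, Real.norm_eq_abs]
        refine (mul_le_of_le_one_right (abs_nonneg _) (h.norm_zero_le _ (by omega))).trans ?_
        exact (h.abs_mass_le _).trans h1
      have h3 : ‖∑ β ∈ (Finset.Iio α).filter (· ≠ 0),
          (mchoose α β : ℝ) • (m (sVec m (A k) (L k) (α - β)) • L (k + 1) β)‖ ≤
          2 ^ deg α * ((2 ^ j * (C * B) * B) * w ^ deg α) := by
        refine norm_sum_mchoose_le (fun β hβ => Finset.mem_Iic.2
          (Finset.mem_Iio.1 (Finset.mem_filter.1 hβ).1).le) (by positivity) fun β hβ => ?_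
        obtain ⟨hβ1, hβ2⟩ := Finset.mem_filter.1 hβ
        have hle := (Finset.mem_Iio.1 hβ1).le
        have hd := deg_sub_add hle
        -- Leaving out `β = 0` forces `α - β` to have order at most `j`, so the induction hypothesis
        -- covers everything inside `s^(α-β)`.
        have hβ3 : deg β ≠ 0 := fun h0 => hβ2 (deg_eq_zero.1 h0)
        have h4 : ‖sVec m (A k) (L k) (α - β)‖ ≤ 2 ^ j * (C * B) * w ^ deg (α - β) := by
          refine (h.norm_sum_normalized_le hC hk hB0 (by omega) subset_rfl
            fun γ hγ => hlow k hk.le γ ?_).trans ?_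
          · have := deg_mono (Finset.mem_Iic.1 hγ); omega
          · gcongr
            · norm_num
            · omega
        rw [norm_smul, Real.norm_eq_abs]
        calc _ ≤ (2 ^ j * (C * B) * w ^ deg (α - β)) * (B * w ^ deg β) := by
              gcongr
              · exact (h.abs_mass_le _).trans h4
              · exact hlow _ (by omega) β (hlt β hβ1)
          _ = _ := by rw [← hd, pow_add]; ring
      calc _ ≤ _ := norm_sub_le_of_le (norm_sub_le_of_le h1 h2) h3
        _ = _ := by rw [hM, hdeg]; ring
    have := norm_le_of_recursion_bounded (v := fun n => L n α) hC0 hτ0.le hτ1 h.contraction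
      (fun k hk => (h.step k hk).eq_tanMap_add hα0 (by omega)) (by positivity) hrest hn
    refine this.trans ?_
    calc C * (‖L 0 α‖ + M * w ^ deg α / (1 - τ))
        ≤ C * (w ^ deg α + M * w ^ deg α / (1 - τ)) := by
          gcongr
          exact h.norm_init_le α (by omega)
      _ = C * (1 + M / (1 - τ)) * w ^ deg α := by ring
      _ ≤ _ := by gcongr; exact le_max_right _ _

end IsTrajectory

end Recursion

/-! ### Forgetting of the initial value by the derivative recursion -/

section Difference

variable {V : Type*} [NormedAddCommGroup V] [NormedSpace ℝ V] {d : ℕ}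
  {m : V →ₗ[ℝ] ℝ} {p : ℕ} {C τ : ℝ} {N : ℕ} {w : ℝ} {A : ℕ → MultiIndex d → V →ₗ[ℝ] V}
  {L L' : ℕ → MultiIndex d → V}

namespace IsTrajectory

/-- Change the argument first and the normalizer second. The mass difference is at most `C c' ‖L n 0
- L' n 0‖` while the operator bound carries the factor `c`, so both normalizers cancel and no lower
bound on them is needed. -/
theorem norm_normalized_sub_le (h : IsTrajectory m p C τ N w A L)
    (h' : IsTrajectory m p C τ N w A L') (hC : 1 ≤ C) {n : ℕ} (hn : n < N)
    {γ : MultiIndex d} (hγ : deg γ ≤ p) (v v' : V) :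
    ‖(m (A n 0 (L n 0)))⁻¹ • A n γ v - (m (A n 0 (L' n 0)))⁻¹ • A n γ v'‖ ≤
      C * w ^ deg γ * ‖v - v'‖ + C * C * ‖L n 0 - L' n 0‖ * w ^ deg γ * ‖v'‖ := by
  have hw : 0 ≤ w := zero_le_one.trans h.one_le_w
  set c := m (A n 0 (L n 0)) with hc
  set c' := m (A n 0 (L' n 0)) with hc'
  have hcp : 0 < c := h.mass_pos n hn
  have hcp' : 0 < c' := h'.mass_pos n hn
  have h1 : c⁻¹ • A n γ v - c'⁻¹ • A n γ v' =
      c⁻¹ • A n γ (v - v') + (c⁻¹ - c'⁻¹) • A n γ v' := by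
    rw [map_sub, smul_sub, sub_smul]; abel
  rw [h1]
  refine norm_add_le_of_le (h.norm_normalized_le hn hγ _) ?_
  have h2 : |c' - c| ≤ C * c' * ‖L n 0 - L' n 0‖ := by
    rw [hc, hc', ← map_sub, ← map_sub]
    refine (h.abs_mass_le _).trans ?_
    have := h'.norm_op_le n hn 0 (by simp) (L' n 0 - L n 0)
    simpa [norm_sub_rev] using this
  have h3 : c⁻¹ - c'⁻¹ = (c' - c) / (c * c') := by field_simp
  rw [norm_smul, h3, Real.norm_eq_abs, abs_div, abs_of_pos (mul_pos hcp hcp'),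
    div_mul_eq_mul_div, div_le_iff₀ (mul_pos hcp hcp')]
  calc |c' - c| * ‖A n γ v'‖
      ≤ (C * c' * ‖L n 0 - L' n 0‖) * (C * w ^ deg γ * c * ‖v'‖) := by
        gcongr
        exact h.norm_op_le n hn γ hγ v'
    _ = _ := by ring

theorem norm_sum_normalized_sub_le (h : IsTrajectory m p C τ N w A L)
    (h' : IsTrajectory m p C τ N w A L') (hC : 1 ≤ C) {n : ℕ}
    (hn : n < N) {B K : ℝ} (hB : 1 ≤ B) (hK : 0 ≤ K) {α : MultiIndex d} (hα : deg α ≤ p)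
    {s : Finset (MultiIndex d)} (hs : s ⊆ Finset.Iic α)
    (hL' : ∀ β ∈ s, ‖L' n β‖ ≤ B * w ^ deg β)
    (h0 : ‖L n 0 - L' n 0‖ ≤ K) (hd : ∀ β ∈ s, ‖L n β - L' n β‖ ≤ K * w ^ deg β) :
    ‖∑ β ∈ s, (mchoose α β : ℝ) • ((m (A n 0 (L n 0)))⁻¹ • A n (α - β) (L n β)) -
      ∑ β ∈ s, (mchoose α β : ℝ) • ((m (A n 0 (L' n 0)))⁻¹ • A n (α - β) (L' n β))‖ ≤
      2 ^ deg α * (2 * (C * C * B)) * K * w ^ deg α := by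
  have hw : 0 ≤ w := zero_le_one.trans h.one_le_w
  rw [← Finset.sum_sub_distrib]
  simp_rw [← smul_sub]
  rw [mul_assoc, mul_assoc]
  refine norm_sum_mchoose_le hs (by positivity) fun β hβ => ?_
  have hdg := deg_sub_add (Finset.mem_Iic.1 (hs hβ))
  refine (h.norm_normalized_sub_le h' hC hn (by omega) _ _).trans ?_
  calc _ ≤ C * w ^ deg (α - β) * (K * w ^ deg β) +
        C * C * K * w ^ deg (α - β) * (B * w ^ deg β) := by
        gcongr
        · exact hd β hβ
        · exact hL' β hβ
    _ = (C * 1 * 1 + C * C * B) * (K * w ^ deg α) := by rw [← hdg, pow_add]; ring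
    _ ≤ (C * C * B + C * C * B) * (K * w ^ deg α) := by gcongr
    _ = _ := by ring

/-- Two trajectories of the same derivative recursion approach each other geometrically, with
constants that only depend on the order and on the constants of the linearized filter. -/
theorem exists_norm_sub_le (hC : 1 ≤ C) (hτ0 : 0 < τ) (hτ1 : τ < 1) (j : ℕ) :
    ∃ K σ : ℝ, 1 ≤ K ∧ τ ≤ σ ∧ σ < 1 ∧ ∀ (V : Type) [NormedAddCommGroup V] [NormedSpace ℝ V]
      (d : ℕ) (m : V →ₗ[ℝ] ℝ) (p N : ℕ) (w : ℝ)
      (A : ℕ → MultiIndex d → V →ₗ[ℝ] V) (L L' : ℕ → MultiIndex d → V), j ≤ p →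
      IsTrajectory m p C τ N w A L → IsTrajectory m p C τ N w A L' →
      (∀ n ≤ N, ‖L n 0 - L' n 0‖ ≤ C * τ ^ n * ‖L 0 0 - L' 0 0‖) →
      ∀ D : ℝ, (∀ α, deg α ≤ p → ‖L 0 α - L' 0 α‖ ≤ D * w ^ deg α) →
      ∀ n ≤ N, ∀ α, deg α ≤ j → ‖L n α - L' n α‖ ≤ K * σ ^ n * D * w ^ deg α := by
  induction j with
  | zero =>
    refine ⟨C, τ, hC, le_rfl, hτ1, fun V _ _ d m p N w A L L' _ h h' hf D hD n hn α hα => ?_⟩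
    have : α = 0 := deg_eq_zero.1 (by omega)
    subst this
    have h0 := hD 0 (by simp)
    simp only [deg_zero, pow_zero, mul_one] at h0 ⊢
    refine (hf n hn).trans ?_
    gcongr
  | succ j ih =>
    obtain ⟨K, σ, hK1, hτσ, hσ1, hK⟩ := ih
    obtain ⟨B, hB1, hB⟩ := exists_norm_le hC hτ0 hτ1 (j + 1)
    have hB0 : 0 ≤ B := zero_le_one.trans hB1
    have hC0 : 0 ≤ C := zero_le_one.trans hC
    have hK0 : 0 ≤ K := zero_le_one.trans hK1
    have hσ0 : 0 < σ := hτ0.trans_le hτσ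
    -- Every order loses part of the rate, since the forcing already decays like `σ ^ k`. The
    -- midpoint between `σ` and `1` keeps the new rate below `1`.
    set σ' : ℝ := (1 + σ) / 2 with hσ'
    have hσσ' : σ < σ' := by rw [hσ']; linarith
    have hσ'0 : 0 < σ' := hσ0.trans hσσ'
    set S : ℝ := 2 ^ (j + 1) * (2 * (C * C * B)) with hS
    set S0 : ℝ := 2 ^ (j + 1) * (C * B) with hS0
    have hS1 : 0 ≤ S := by positivity
    have hS2 : 0 ≤ S0 := by positivity
    -- In order: the mismatch of the tangent maps, of `sVecLow`, of its multiple of `l' 0`, and of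
    -- the sum over intermediate multi-indices.
    set M : ℝ := 3 * (C * C * B) * K + (S * K + (S * K + S0 * K) +
      2 ^ (j + 1) * (S * K * B + S0 * K)) with hM
    have hM0 : 0 ≤ M := by positivity
    set K' : ℝ := C * (1 + 1 / (σ' - σ)) * (1 + M) with hK'
    have hK'0 : 0 ≤ K' := by have := sub_pos.2 hσσ'; positivity
    refine ⟨max K K', σ', hK1.trans (le_max_left _ _), hτσ.trans hσσ'.le, by rw [hσ']; linarith,
      fun V _ _ d m p N w A L L' hjp h h' hf D hD n hn α hα => ?_⟩
    have hw : 0 ≤ w := zero_le_one.trans h.one_le_w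
    have hD0 : 0 ≤ D := by
      have h0 := hD 0 (by simp)
      simp only [deg_zero, pow_zero, mul_one] at h0
      exact (norm_nonneg _).trans h0
    have hbd := hB V d m p N w A L hjp h
    have hbd' := hB V d m p N w A L' hjp h'
    have hdiff := hK V d m p N w A L L' (by omega) h h' hf D hD
    rcases Nat.lt_or_ge (deg α) (j + 1) with hlt | hge
    · refine (hdiff n hn α (by omega)).trans ?_
      gcongr
      exact le_max_left _ _
    have hdeg : deg α = j + 1 := le_antisymm hα hge
    have hα0 : α ≠ 0 := fun h0 => by simp [h0] at hdeg
    have hlt : ∀ β ∈ Finset.Iio α, deg β ≤ j := fun β hβ => by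
      have := deg_lt_deg (Finset.mem_Iio.1 hβ); omega
    -- The difference of the trajectories follows the linear recursion of the first one. The forcing
    -- consists of the two tangent maps compared on the second trajectory, and of the difference of
    -- the inhomogeneous terms.
    have herr : ∀ k < N,
        ‖(tanMap m (A k 0) (L k 0) (L (k + 1) 0) (L' k α) -
          tanMap m (A k 0) (L' k 0) (L' (k + 1) 0) (L' k α)) +
          (restVec m (A k) (L k) (L (k + 1)) α - restVec m (A k) (L' k) (L' (k + 1)) α)‖ ≤
        M * D * w ^ deg α * σ ^ k := by
      intro k hk
      set Q : ℝ := σ ^ k * D with hQ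
      have hQ0 : 0 ≤ Q := by positivity
      have hdk : ∀ β, deg β ≤ j → ‖L k β - L' k β‖ ≤ (K * Q) * w ^ deg β := fun β hβ =>
        (hdiff k hk.le β hβ).trans (le_of_eq (by rw [hQ]; ring))
      have hdk' : ∀ β, deg β ≤ j → ‖L (k + 1) β - L' (k + 1) β‖ ≤ (K * Q) * w ^ deg β := by
        intro β hβ
        refine (hdiff (k + 1) (by omega) β hβ).trans ?_
        rw [hQ, ← mul_assoc]
        gcongr _ * ?_ * _ * _
        exact pow_le_pow_of_le_one hσ0.le hσ1.le (by omega)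
      have hp0 : ‖L k 0 - L' k 0‖ ≤ K * Q := by simpa using hdk 0 (by simp)
      have hp1 : ‖L (k + 1) 0 - L' (k + 1) 0‖ ≤ K * Q := by simpa using hdk' 0 (by simp)
      have hKQ : 0 ≤ K * Q := by positivity
      -- Product rule for `m v • l' 0`, using that the filter component has norm at most `1` and the
      -- mass functional is a contraction.
      have hprod : ∀ v v' : V, ‖m v • L (k + 1) 0 - m v' • L' (k + 1) 0‖ ≤
          ‖v - v'‖ + ‖v'‖ * (K * Q) := by
        intro v v'
        have : m v • L (k + 1) 0 - m v' • L' (k + 1) 0 =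
            m (v - v') • L (k + 1) 0 + m v' • (L (k + 1) 0 - L' (k + 1) 0) := by
          rw [map_sub, sub_smul, smul_sub]; abel
        rw [this]
        refine norm_add_le_of_le ?_ ?_
        · rw [norm_smul, Real.norm_eq_abs]
          exact (mul_le_of_le_one_right (abs_nonneg _) (h.norm_zero_le _ (by omega))).trans
            (h.abs_mass_le _)
        · rw [norm_smul, Real.norm_eq_abs]
          gcongr
          exact h.abs_mass_le _
      have e1 : ‖tanMap m (A k 0) (L k 0) (L (k + 1) 0) (L' k α) -
          tanMap m (A k 0) (L' k 0) (L' (k + 1) 0) (L' k α)‖ ≤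
          3 * (C * C * B) * K * Q * w ^ deg α := by
        rw [tanMap_apply, tanMap_apply, sub_sub_sub_comm]
        have h1 := h.norm_normalized_sub_le h' hC hk (γ := 0) (by simp) (L' k α) (L' k α)
        have h2 := h'.norm_normalized_le hk (γ := 0) (by simp) (L' k α)
        simp only [deg_zero, pow_zero, sub_self, norm_zero, mul_zero, zero_add, mul_one] at h1 h2
        have h3 := hbd' k hk.le α hα
        have h4 : C * C * ‖L k 0 - L' k 0‖ * ‖L' k α‖ ≤ C * C * B * K * Q * w ^ deg α :=
          calc _ ≤ C * C * (K * Q) * (B * w ^ deg α) := by gcongr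
            _ = _ := by ring
        have h5 : C * ‖L' k α‖ * (K * Q) ≤ C * C * B * K * Q * w ^ deg α :=
          calc _ ≤ C * (B * w ^ deg α) * (K * Q) := by gcongr
            _ = 1 * C * B * K * Q * w ^ deg α := by ring
            _ ≤ C * C * B * K * Q * w ^ deg α := by gcongr
        refine (norm_sub_le_of_le (h1.trans h4) ((hprod _ _).trans (add_le_add (h1.trans h4)
          ((mul_le_mul_of_nonneg_right h2 hKQ).trans h5)))).trans (le_of_eq (by ring))
      have e2 : ‖sVecLow m (A k) (L k) α - sVecLow m (A k) (L' k) α‖ ≤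
          S * (K * Q) * w ^ deg α := by
        rw [hS, ← hdeg]
        exact h.norm_sum_normalized_sub_le h' hC hk hB1 hKQ (by omega)
          (fun β hβ => Finset.mem_Iic.2 (Finset.mem_Iio.1 hβ).le)
          (fun β hβ => hbd' k hk.le β (by have := hlt β hβ; omega)) hp0
          fun β hβ => hdk β (hlt β hβ)
      have e3 : ‖sVecLow m (A k) (L' k) α‖ ≤ S0 * w ^ deg α := by
        rw [hS0, ← hdeg]
        exact h'.norm_sum_normalized_le hC hk hB0 (by omega)
          (fun β hβ => Finset.mem_Iic.2 (Finset.mem_Iio.1 hβ).le)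
          fun β hβ => hbd' k hk.le β (by have := hlt β hβ; omega)
      have e4 : ‖m (sVecLow m (A k) (L k) α) • L (k + 1) 0 -
          m (sVecLow m (A k) (L' k) α) • L' (k + 1) 0‖ ≤
          S * (K * Q) * w ^ deg α + S0 * w ^ deg α * (K * Q) :=
        (hprod _ _).trans (add_le_add e2 (mul_le_mul_of_nonneg_right e3 hKQ))
      have e5 : ‖∑ β ∈ (Finset.Iio α).filter (· ≠ 0),
            (mchoose α β : ℝ) • (m (sVec m (A k) (L k) (α - β)) • L (k + 1) β) -
          ∑ β ∈ (Finset.Iio α).filter (· ≠ 0),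
            (mchoose α β : ℝ) • (m (sVec m (A k) (L' k) (α - β)) • L' (k + 1) β)‖ ≤
          2 ^ deg α * ((S * K * B + S0 * K) * Q * w ^ deg α) := by
        rw [← Finset.sum_sub_distrib]
        simp_rw [← smul_sub]
        refine norm_sum_mchoose_le (fun β hβ => Finset.mem_Iic.2
          (Finset.mem_Iio.1 (Finset.mem_filter.1 hβ).1).le) (by positivity) fun β hβ => ?_
        obtain ⟨hβ1, hβ2⟩ := Finset.mem_filter.1 hβ
        have hd := deg_sub_add (Finset.mem_Iio.1 hβ1).le
        have hβ3 : deg β ≠ 0 := fun h0 => hβ2 (deg_eq_zero.1 h0)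
        have hle : ∀ γ ∈ Finset.Iic (α - β), deg γ ≤ j := fun γ hγ => by
          have := deg_mono (Finset.mem_Iic.1 hγ); omega
        have f1 : ‖sVec m (A k) (L' k) (α - β)‖ ≤ S0 * w ^ deg (α - β) := by
          refine (h'.norm_sum_normalized_le hC hk hB0 (by omega) subset_rfl
            fun γ hγ => hbd' k hk.le γ (by have := hle γ hγ; omega)).trans ?_
          rw [hS0]
          gcongr
          · norm_num
          · omega
        have f2 : ‖sVec m (A k) (L k) (α - β) - sVec m (A k) (L' k) (α - β)‖ ≤
            S * (K * Q) * w ^ deg (α - β) := by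
          refine (h.norm_sum_normalized_sub_le h' hC hk hB1 hKQ (by omega) subset_rfl
            (fun γ hγ => hbd' k hk.le γ (by have := hle γ hγ; omega)) hp0
            fun γ hγ => hdk γ (hle γ hγ)).trans ?_
          rw [hS]
          gcongr
          · norm_num
          · omega
        have : m (sVec m (A k) (L k) (α - β)) • L (k + 1) β -
            m (sVec m (A k) (L' k) (α - β)) • L' (k + 1) β =
            m (sVec m (A k) (L k) (α - β) - sVec m (A k) (L' k) (α - β)) • L (k + 1) β +
            m (sVec m (A k) (L' k) (α - β)) • (L (k + 1) β - L' (k + 1) β) := by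
          rw [map_sub, sub_smul, smul_sub]; abel
        rw [this]
        calc _ ≤ (S * (K * Q) * w ^ deg (α - β)) * (B * w ^ deg β) +
              (S0 * w ^ deg (α - β)) * (K * Q * w ^ deg β) := by
              refine norm_add_le_of_le ?_ ?_
              · rw [norm_smul, Real.norm_eq_abs]
                gcongr
                · exact (h.abs_mass_le _).trans f2
                · exact hbd _ (by omega) β (by have := hlt β hβ1; omega)
              · rw [norm_smul, Real.norm_eq_abs]
                gcongr
                · exact (h.abs_mass_le _).trans f1
                · exact hdk' β (hlt β hβ1)
          _ = _ := by rw [← hd, pow_add]; ring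
      refine (norm_add_le_of_le e1 ?_).trans (b := 3 * (C * C * B) * K * Q * w ^ deg α +
        ((S * (K * Q) * w ^ deg α) + (S * (K * Q) * w ^ deg α + S0 * w ^ deg α * (K * Q)) +
        2 ^ deg α * ((S * K * B + S0 * K) * Q * w ^ deg α))) ?_
      · rw [restVec, restVec, sub_sub_sub_comm, sub_sub_sub_comm (sVecLow m (A k) (L k) α)]
        exact norm_sub_le_of_le (norm_sub_le_of_le e2 e4) e5
      · rw [hM, hdeg, hQ]
        exact le_of_eq (by ring)
    have hrec : ∀ k < N, L (k + 1) α - L' (k + 1) α =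
        tanMap m (A k 0) (L k 0) (L (k + 1) 0) (L k α - L' k α) +
        ((tanMap m (A k 0) (L k 0) (L (k + 1) 0) (L' k α) -
          tanMap m (A k 0) (L' k 0) (L' (k + 1) 0) (L' k α)) +
          (restVec m (A k) (L k) (L (k + 1)) α - restVec m (A k) (L' k) (L' (k + 1)) α)) := by
      intro k hk
      rw [(h.step k hk).eq_tanMap_add hα0 (by omega), (h'.step k hk).eq_tanMap_add hα0 (by omega),
        map_sub]
      abel
    refine (norm_le_of_recursion_decay (v := fun n => L n α - L' n α) hC0 hτ0 h.contraction hrec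
      (by positivity) hτσ hσσ' herr hn).trans ?_
    have hsub := sub_pos.2 hσσ'
    calc _ ≤ C * (1 + 1 / (σ' - σ)) * (D * w ^ deg α + M * D * w ^ deg α) * σ' ^ n := by
          gcongr
          exact hD α (by omega)
      _ = K' * σ' ^ n * D * w ^ deg α := by rw [hK']; ring
      _ ≤ _ := by gcongr; exact le_max_right _ _

end IsTrajectory

end Difference

/-! ### Products of tangent maps -/

section TangentComposition

variable {V : Type*} [NormedAddCommGroup V] [NormedSpace ℝ V]

theorem compFrom_succ' (T : ℕ → V →ₗ[ℝ] V) (k j : ℕ) :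
    compFrom T k (j + 1) = compFrom T (k + 1) j ∘ₗ T k := by
  induction j with
  | zero => rfl
  | succ j ih =>
    rw [compFrom, ih, ← LinearMap.comp_assoc, show k + (j + 1) = k + 1 + j by omega]
    rfl

variable {m : V →ₗ[ℝ] ℝ} {R : ℕ → V →ₗ[ℝ] V} {P : ℕ → V} {N : ℕ}

/-- The unnormalized flow keeps `P k` on the ray through `P (k + j)`, and normalization to mass one
fixes the scalar. -/
theorem compFrom_apply_eq (hP : ∀ n < N, R n (P n) = m (R n (P n)) • P (n + 1))
    (hm : ∀ n ≤ N, m (P n) = 1) {k j : ℕ} (hj : k + j ≤ N) :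
    compFrom R k j (P k) = m (compFrom R k j (P k)) • P (k + j) := by
  have key : ∀ i, k + i ≤ N → ∃ c : ℝ, compFrom R k i (P k) = c • P (k + i) := by
    intro i
    induction i with
    | zero => exact fun _ => ⟨1, by simp [compFrom]⟩
    | succ i ih =>
      intro hi
      obtain ⟨c, hc⟩ := ih (by omega)
      refine ⟨c * m (R (k + i) (P (k + i))), ?_⟩
      rw [compFrom, LinearMap.comp_apply, hc, map_smul, hP _ (by omega), smul_smul,
        ← hP _ (by omega)]
      rfl
  obtain ⟨c, hc⟩ := key j hj
  rw [hc, map_smul, hm _ hj, smul_eq_mul, mul_one]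

/-- The chain rule for the normalized flow. Each tangent map annihilates its own base point, so the
corrections made at intermediate times disappear and a single correction at the end remains.
Contraction can therefore be read off the unnormalized product. -/
theorem compFrom_tanMap (hP : ∀ n < N, R n (P n) = m (R n (P n)) • P (n + 1))
    (hm : ∀ n ≤ N, m (P n) = 1) (hpos : ∀ n < N, m (R n (P n)) ≠ 0) {k j : ℕ}
    (hj : k + (j + 1) ≤ N) (v : V) :
    compFrom (fun n => tanMap m (R n) (P n) (P (n + 1))) k (j + 1) v =
      tanMap m (compFrom R k (j + 1)) (P k) (P (k + (j + 1))) v := by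
  induction j with
  | zero => rfl
  | succ j ih =>
    rw [compFrom, LinearMap.comp_apply, ih (by omega)]
    set a := compFrom R k (j + 1) with ha
    set n := k + (j + 1) with hn
    have hPn : tanMap m (R n) (P n) (P (n + 1)) (P n) = 0 := by
      have h1 := hP n (by omega)
      have h2 : m ((m (R n (P n)))⁻¹ • R n (P n)) = 1 := by
        rw [map_smul, smul_eq_mul, inv_mul_cancel₀ (hpos n (by omega))]
      rw [tanMap_apply, h2]
      nth_rw 2 [h1]
      rw [smul_smul, inv_mul_cancel₀ (hpos n (by omega)), sub_self]
    have hc : m (compFrom R k (j + 1 + 1) (P k)) = m (a (P k)) * m (R n (P n)) := by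
      have h1 := compFrom_apply_eq hP hm (k := k) (j := j + 1) (by omega)
      rw [← ha, ← hn] at h1
      rw [compFrom, LinearMap.comp_apply, ← ha, h1, map_smul, map_smul, smul_eq_mul, map_smul,
        hm n (by omega), smul_eq_mul, mul_one]
    rw [tanMap_apply (A := a), map_sub, map_smul _ _ (P n), hPn, smul_zero, sub_zero, tanMap_apply,
      tanMap_apply, hc, mul_inv]
    simp only [map_smul, smul_smul, smul_eq_mul]
    rw [mul_comm (m (a (P k)))⁻¹]
    rfl

end TangentComposition

/-! ### Contraction by mixing kernels -/

section Mixing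

variable {X : Type*} [MeasurableSpace X] [MetricSpace X] [CompactSpace X] [BorelSpace X]

/-- `l` is a probability measure, seen as a signed measure. -/
def IsProb (l : SignedMeasure X) : Prop :=
  ∃ (a : Measure X) (_ : IsProbabilityMeasure a), l = a.toSignedMeasure

theorem isProb_of_nonneg {l : SignedMeasure X} (h0 : ∀ A, MeasurableSet A → 0 ≤ l A)
    (h1 : l Set.univ = 1) : IsProb l := by
  have h : 0 ≤[Set.univ] l :=
    (VectorMeasure.le_restrict_univ_iff_le _ _).2 (VectorMeasure.le_iff.2 fun A hA => by simpa using h0 A hA)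
  have he := SignedMeasure.toMeasureOfZeroLE_toSignedMeasure l h
  refine ⟨l.toMeasureOfZeroLE Set.univ MeasurableSet.univ h, ⟨?_⟩, he.symm⟩
  have h2 := congrArg (fun s : SignedMeasure X => s Set.univ) he
  simp only [Measure.toSignedMeasure_apply_measurable MeasurableSet.univ, h1] at h2
  rw [measureReal_def, ENNReal.toReal_eq_one_iff] at h2
  exact h2

theorem IsProb.mass_eq {l : SignedMeasure X} (h : IsProb l) : mass l = 1 := by
  obtain ⟨a, _, rfl⟩ := h
  rw [mass_apply, Measure.toSignedMeasure_apply_measurable MeasurableSet.univ, probReal_univ]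

theorem IsProb.norm_eq {l : SignedMeasure X} (h : IsProb l) : ‖l‖ = 1 := by
  obtain ⟨a, _, rfl⟩ := h
  rw [norm_toSignedMeasure, probReal_univ]

theorem IsProb.sInt_mono {l : SignedMeasure X} (h : IsProb l) {f g : X → ℝ} (hf : Measurable f)
    (hg : Measurable g) {C D : ℝ} (hC : ∀ x, |f x| ≤ C) (hD : ∀ x, |g x| ≤ D)
    (hfg : ∀ x, f x ≤ g x) : sInt l f ≤ sInt l g := by
  obtain ⟨a, _, rfl⟩ := h
  rw [sInt_toSignedMeasure, sInt_toSignedMeasure]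
  exact integral_mono (integrable_of_abs_le a hf hC) (integrable_of_abs_le a hg hD) hfg

theorem IsProb.sInt_const {l : SignedMeasure X} (h : IsProb l) (c : ℝ) :
    sInt l (fun _ => c) = c := by
  obtain ⟨a, _, rfl⟩ := h
  rw [sInt_toSignedMeasure]; simp

/-- The kernel `ρ(x, x') μ(dx)` satisfies the mixing condition with constant `κ`. -/
def IsMixing (μ : Measure X) (ρ : C(X × X, ℝ)) (κ : ℝ) : Prop :=
  ∀ f : X → ℝ, Measurable f → (∀ x, 0 ≤ f x) → (∃ C, ∀ x, |f x| ≤ C) → ∀ x x₀,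
    κ * dualOp μ ρ f x₀ ≤ dualOp μ ρ f x

variable {μ : Measure X} [IsFiniteMeasure μ]

theorem dualOp_nonneg {ρ : C(X × X, ℝ)} (hρ : ∀ z, 0 ≤ ρ z) {f : X → ℝ} (hf : ∀ x, 0 ≤ f x)
    (x : X) : 0 ≤ dualOp μ ρ f x :=
  integral_nonneg fun _ => mul_nonneg (hf _) (hρ _)

theorem integrable_dualOp (ρ : C(X × X, ℝ)) {f : X → ℝ} (hf : Measurable f) {C : ℝ}
    (hC : ∀ x, |f x| ≤ C) (x' : X) : Integrable (fun x => f x * ρ (x, x')) μ :=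
  (integrable_of_continuous μ (f := fun x => ρ (x, x')) (by fun_prop)).bdd_mul (c := C)
    hf.aestronglyMeasurable (Eventually.of_forall hC)

theorem dualOp_pos [NeZero μ] {ρ : C(X × X, ℝ)} (hρ : ∀ z, 0 < ρ z) {f : X → ℝ}
    (hfm : Measurable f) {C : ℝ} (hC : ∀ x, |f x| ≤ C) (hf : ∀ x, 0 < f x) (x : X) :
    0 < dualOp μ ρ f x := by
  refine (integral_pos_iff_support_of_nonneg (fun y => (mul_pos (hf y) (hρ _)).le)
    (integrable_dualOp ρ hfm hC x)).2 ?_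
  have : Function.support (fun y => f y * ρ (y, x)) = Set.univ :=
    Set.eq_univ_of_forall fun y => (mul_pos (hf y) (hρ _)).ne'
  rw [this]
  exact Measure.measure_univ_pos.2 (NeZero.ne μ)

theorem dualOp_sub_mul (ρ : C(X × X, ℝ)) {f g : X → ℝ} (hf : Measurable f) (hg : Measurable g)
    {C D : ℝ} (hC : ∀ x, |f x| ≤ C) (hD : ∀ x, |g x| ≤ D) (a b : ℝ) (x' : X) :
    dualOp μ ρ (fun x => a * f x - b * g x) x' = a * dualOp μ ρ f x' - b * dualOp μ ρ g x' := by
  unfold dualOp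
  rw [← integral_const_mul, ← integral_const_mul, ← integral_sub]
  · exact integral_congr_ae (Eventually.of_forall fun x => by ring)
  · exact (integrable_dualOp ρ hf hC x').const_mul a
  · exact (integrable_dualOp ρ hg hD x').const_mul b

/-- The dual of the composition of the operators with kernels `ρ k, …, ρ (k + j - 1)`. -/
def dualFrom (μ : Measure X) (ρ : ℕ → C(X × X, ℝ)) (f : X → ℝ) : ℕ → ℕ → X → ℝ
  | _, 0 => f
  | k, j + 1 => dualOp μ (ρ k) (dualFrom μ ρ f (k + 1) j)

theorem measurable_dualFrom (ρ : ℕ → C(X × X, ℝ)) {f : X → ℝ} (hf : Measurable f) (k j : ℕ) :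
    Measurable (dualFrom μ ρ f k j) := by
  induction j generalizing k with
  | zero => exact hf
  | succ j ih => exact measurable_dualOp μ (ρ k) (ih (k + 1))

theorem exists_abs_dualFrom_le (ρ : ℕ → C(X × X, ℝ)) {f : X → ℝ} {C : ℝ} (hC : ∀ x, |f x| ≤ C)
    (k j : ℕ) : ∃ D, ∀ x, |dualFrom μ ρ f k j x| ≤ D := by
  induction j generalizing k with
  | zero => exact ⟨C, hC⟩
  | succ j ih =>
    obtain ⟨D, hD⟩ := ih (k + 1)
    exact ⟨_, abs_dualOp_le μ (ρ k) hD⟩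

theorem sInt_compFrom_kerOp (ρ : ℕ → C(X × X, ℝ)) {f : X → ℝ} (hf : Measurable f) {C : ℝ}
    (hC : ∀ x, |f x| ≤ C) (k j : ℕ) (l : SignedMeasure X) :
    sInt (compFrom (fun n => kerOp μ (ρ n)) k j l) f = sInt l (dualFrom μ ρ f k j) := by
  induction j generalizing k l with
  | zero => rfl
  | succ j ih =>
    obtain ⟨D, hD⟩ := exists_abs_dualFrom_le (μ := μ) ρ hC (k + 1) j
    rw [compFrom_succ', LinearMap.comp_apply, ih,
      sInt_kerOp μ (ρ k) l (measurable_dualFrom ρ hf (k + 1) j) hD]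
    rfl

theorem dualFrom_pos [NeZero μ] {ρ : ℕ → C(X × X, ℝ)} (hρ : ∀ n z, 0 < ρ n z) (k j : ℕ) (x : X) :
    0 < dualFrom μ ρ (fun _ => 1) k j x := by
  induction j generalizing k x with
  | zero => exact one_pos
  | succ j ih =>
    obtain ⟨D, hD⟩ := exists_abs_dualFrom_le (μ := μ) ρ (f := fun _ => 1) (C := 1) (by simp)
      (k + 1) j
    exact dualOp_pos (hρ k) (measurable_dualFrom ρ measurable_const _ _) hD (ih (k + 1)) x

/-- The ratio of two backward functions has geometrically decreasing oscillation. -/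
theorem exists_ratio_bounds [NeZero μ] {ρ : ℕ → C(X × X, ℝ)} {κ : ℝ} (hκ0 : 0 < κ) (hκ1 : κ ≤ 1)
    (hmix : ∀ n, IsMixing μ (ρ n) κ) (hρ : ∀ n z, 0 < ρ n z)
    {f : X → ℝ} (hf : Measurable f) (hf0 : ∀ x, 0 ≤ f x) (hf1 : ∀ x, f x ≤ 1) (x₀ : X) (k j : ℕ) :
    ∃ a b : ℝ, b - a ≤ (1 - κ ^ 2) ^ j ∧ ∀ x,
      a * dualFrom μ ρ (fun _ => 1) k j x ≤ dualFrom μ ρ f k j x ∧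
      dualFrom μ ρ f k j x ≤ b * dualFrom μ ρ (fun _ => 1) k j x := by
  have hfb : ∀ x, |f x| ≤ 1 := fun x => by rw [abs_of_nonneg (hf0 x)]; exact hf1 x
  induction j generalizing k with
  | zero => exact ⟨0, 1, by simp, fun x => by simpa [dualFrom] using ⟨hf0 x, hf1 x⟩⟩
  | succ j ih =>
    obtain ⟨a, b, hab, hr⟩ := ih (k + 1)
    have hUpos := dualFrom_pos (μ := μ) hρ k (j + 1)
    rw [dualFrom] at hUpos
    rw [dualFrom, dualFrom]
    set u := dualFrom μ ρ (fun _ => 1) (k + 1) j with hu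
    set v := dualFrom μ ρ f (k + 1) j with hv
    have hum : Measurable u := measurable_dualFrom ρ measurable_const _ _
    have hvm : Measurable v := measurable_dualFrom ρ hf _ _
    obtain ⟨D, hD⟩ := exists_abs_dualFrom_le (μ := μ) ρ (f := fun _ => 1) (C := 1) (by simp)
      (k + 1) j
    obtain ⟨D', hD'⟩ := exists_abs_dualFrom_le (μ := μ) ρ hfb (k + 1) j
    have hbd : ∀ s t : ℝ, ∃ C, ∀ x, |s * v x - t * u x| ≤ C := fun s t =>
      ⟨|s| * D' + |t| * D, fun x => (abs_sub _ _).trans (by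
        rw [abs_mul, abs_mul]
        exact add_le_add (mul_le_mul_of_nonneg_left (hD' x) (abs_nonneg _))
          (mul_le_mul_of_nonneg_left (hD x) (abs_nonneg _)))⟩
    have hm1 : ∀ s t : ℝ, Measurable fun x => s * v x - t * u x := fun s t => by fun_prop
    have hn1 : ∀ x, 0 ≤ 1 * v x - a * u x := fun x => by have := (hr x).1; linarith
    have hn2 : ∀ x, 0 ≤ -1 * v x - -b * u x := fun x => by have := (hr x).2; linarith
    have hlow := hmix k _ (hm1 _ _) hn1 (hbd _ _)
    have hupp := hmix k _ (hm1 _ _) hn2 (hbd _ _)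
    have hu0 := hmix k u hum (fun x => (dualFrom_pos hρ _ _ x).le) ⟨D, hD⟩
    have hs1 := dualOp_nonneg (μ := μ) (fun z => (hρ k z).le) hn1 x₀
    have hs2 := dualOp_nonneg (μ := μ) (fun z => (hρ k z).le) hn2 x₀
    simp only [dualOp_sub_mul (ρ k) hvm hum hD' hD] at hlow hupp hs1 hs2
    set U := dualOp μ (ρ k) u with hU
    set W := dualOp μ (ρ k) v with hW
    -- `q` is the excess of the new ratio over `a` at the reference point. At any other point mixing
    -- is used once for the numerator and once for the denominator, so at least `κ ^ 2 * q` survives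
    -- above `a`, and likewise below `b`. The interval shrinks by `κ ^ 2 * (b - a)` in total.
    set q := (W x₀ - a * U x₀) / U x₀ with hq
    have hqU : q * U x₀ = W x₀ - a * U x₀ := by rw [hq, div_mul_cancel₀ _ (hUpos x₀).ne']
    have hq0 : 0 ≤ q := div_nonneg (by linarith) (hUpos x₀).le
    have hq1 : 0 ≤ b - a - q := by
      have : 0 ≤ (b - a - q) * U x₀ := by linarith
      exact nonneg_of_mul_nonneg_left this (hUpos x₀)
    refine ⟨a + κ ^ 2 * q, b - κ ^ 2 * (b - a - q), ?_, fun x => ⟨?_, ?_⟩⟩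
    · calc _ = (1 - κ ^ 2) * (b - a) := by ring
        _ ≤ (1 - κ ^ 2) * (1 - κ ^ 2) ^ j := by
          gcongr
          nlinarith
        _ = _ := by ring
    · have h1 := hlow x x₀
      have h2 := mul_le_mul_of_nonneg_left (hu0 x₀ x) (mul_nonneg hκ0.le hq0)
      have h3 : κ * q * U x₀ = κ * (1 * W x₀ - a * U x₀) := by rw [mul_assoc, hqU]; ring
      linarith
    · have h1 := hupp x x₀
      have h2 := mul_le_mul_of_nonneg_left (hu0 x₀ x) (mul_nonneg hκ0.le hq1)
      have h3 : κ * (b - a - q) * U x₀ = κ * (-1 * W x₀ - -b * U x₀) := by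
        have : κ * (b - a - q) * U x₀ = κ * (b * U x₀ - a * U x₀ - q * U x₀) := by ring
        rw [this, hqU]; ring
      linarith

/-- The mass is a `P`-average of column integrals of the kernel, and mixing makes these comparable
with each other up to the factor `κ`. -/
theorem IsProb.mass_kerOp_pos [NeZero μ] {P : SignedMeasure X} (hP : IsProb P) {ρ : C(X × X, ℝ)}
    {κ : ℝ} (hκ0 : 0 < κ) (hmix : IsMixing μ ρ κ) (hρ : ∀ z, 0 < ρ z) :
    0 < mass (kerOp μ ρ P) ∧ ∀ x, κ * dualOp μ ρ (fun _ => 1) x ≤ mass (kerOp μ ρ P) ∧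
      mass (kerOp μ ρ P) ≤ κ⁻¹ * dualOp μ ρ (fun _ => 1) x := by
  have hm := measurable_dualOp μ ρ (f := fun _ => 1) measurable_const
  have hb := abs_dualOp_le μ ρ (f := fun _ => 1) (C := 1) (by simp)
  have h := hmix (fun _ => 1) measurable_const (by simp) ⟨1, by simp⟩
  rw [mass_apply, kerOp_univ]
  have h1 : ∀ x, κ * dualOp μ ρ (fun _ => 1) x ≤ sInt P (dualOp μ ρ fun _ => 1) := fun x => by
    rw [← hP.sInt_const (κ * dualOp μ ρ (fun _ => 1) x)]
    exact hP.sInt_mono measurable_const hm (fun _ => le_rfl) hb fun y => h y x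
  have h2 : ∀ x, sInt P (dualOp μ ρ fun _ => 1) ≤ κ⁻¹ * dualOp μ ρ (fun _ => 1) x := fun x => by
    rw [← hP.sInt_const (κ⁻¹ * dualOp μ ρ (fun _ => 1) x)]
    refine hP.sInt_mono hm measurable_const hb (fun _ => le_rfl) fun y => ?_
    rw [le_inv_mul_iff₀ hκ0]
    exact h x y
  refine ⟨?_, fun x => ⟨h1 x, h2 x⟩⟩
  obtain ⟨a, ha, rfl⟩ := hP
  have : Nonempty X := nonempty_of_isProbabilityMeasure a
  obtain ⟨x⟩ := this
  refine lt_of_lt_of_le (mul_pos hκ0 ?_) (h1 x)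
  exact dualOp_pos hρ measurable_const (C := 1) (by simp) (fun _ => one_pos) x

theorem IsProb.kerOp [NeZero μ] {P : SignedMeasure X} (hP : IsProb P) {ρ : C(X × X, ℝ)}
    {κ : ℝ} (hκ0 : 0 < κ) (hmix : IsMixing μ ρ κ) (hρ : ∀ z, 0 < ρ z) :
    IsProb ((mass (kerOp μ ρ P))⁻¹ • kerOp μ ρ P) := by
  have hpos := (hP.mass_kerOp_pos hκ0 hmix hρ).1
  refine isProb_of_nonneg (fun A hA => ?_) ?_
  · have hi : ∀ x, |A.indicator (fun _ => (1 : ℝ)) x| ≤ 1 := fun x => by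
      by_cases hx : x ∈ A <;> simp [hx]
    rw [smul_apply, smul_eq_mul, ← sInt_indicator _ hA,
      sInt_kerOp μ ρ P (measurable_const.indicator hA) hi]
    refine mul_nonneg (inv_nonneg.2 hpos.le) ?_
    rw [← hP.sInt_const 0]
    refine hP.sInt_mono measurable_const (measurable_dualOp μ ρ (measurable_const.indicator hA))
      (fun _ => le_rfl) (abs_dualOp_le μ ρ hi) fun x => dualOp_nonneg (fun z => (hρ z).le)
      (fun y => Set.indicator_nonneg (fun _ _ => zero_le_one) y) x
  · rw [smul_apply, smul_eq_mul, ← mass_apply, inv_mul_cancel₀ hpos.ne']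

/-- The normalized composition of mixing kernels contracts geometrically, uniformly in the
direction of the linearization. -/
theorem norm_tanMap_compFrom_le [NeZero μ] {ρ : ℕ → C(X × X, ℝ)} {κ : ℝ} (hκ0 : 0 < κ)
    (hκ1 : κ ≤ 1) (hmix : ∀ n, IsMixing μ (ρ n) κ) (hρ : ∀ n z, 0 < ρ n z)
    {P P' : SignedMeasure X} (hP : IsProb P) (k j : ℕ)
    (hP' : compFrom (fun n => kerOp μ (ρ n)) k (j + 1) P =
      mass (compFrom (fun n => kerOp μ (ρ n)) k (j + 1) P) • P') :
    0 < mass (compFrom (fun n => kerOp μ (ρ n)) k (j + 1) P) ∧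
    (∀ v, |mass (compFrom (fun n => kerOp μ (ρ n)) k (j + 1) v)| ≤
      κ⁻¹ * mass (compFrom (fun n => kerOp μ (ρ n)) k (j + 1) P) * ‖v‖) ∧
    ∀ v, ‖tanMap mass (compFrom (fun n => kerOp μ (ρ n)) k (j + 1)) P P' v‖ ≤
      2 * (κ⁻¹ * (1 - κ ^ 2) ^ (j + 1) * ‖v‖) := by
  set a := compFrom (fun n => kerOp μ (ρ n)) k (j + 1) with ha
  set u := dualFrom μ ρ (fun _ => 1) k (j + 1) with hu
  have hum : Measurable u := measurable_dualFrom ρ measurable_const _ _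
  obtain ⟨D, hD⟩ := exists_abs_dualFrom_le (μ := μ) ρ (f := fun _ => 1) (C := 1) (by simp)
    k (j + 1)
  have hmass : ∀ v, mass (a v) = sInt v u := fun v => by
    rw [mass_apply, ← sInt_one, ha, sInt_compFrom_kerOp ρ measurable_const (C := 1) (by simp)]
  have hupos : ∀ x, 0 < u x := dualFrom_pos hρ k (j + 1)
  -- Mixing of the kernel with index `k`, which acts first on measures and last on functions,
  -- already makes the backward function `u` nearly constant; the later kernels do not enter.
  have hκu : ∀ x, κ * u x ≤ mass (a P) := fun x => by
    rw [hmass, ← hP.sInt_const (κ * u x)]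
    refine hP.sInt_mono measurable_const hum (fun _ => le_rfl) hD fun y => ?_
    obtain ⟨D, hD⟩ := exists_abs_dualFrom_le (μ := μ) ρ (f := fun _ => 1) (C := 1) (by simp)
      (k + 1) j
    exact hmix k _ (measurable_dualFrom ρ measurable_const _ _)
      (fun x => (dualFrom_pos hρ _ _ x).le) ⟨D, hD⟩ y x
  obtain ⟨x₀⟩ : Nonempty X := by
    obtain ⟨b, hb, -⟩ := hP
    exact nonempty_of_isProbabilityMeasure b
  have hcpos : 0 < mass (a P) := (mul_pos hκ0 (hupos x₀)).trans_le (hκu x₀)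
  have hule : ∀ x, u x ≤ κ⁻¹ * mass (a P) := fun x => by
    rw [le_inv_mul_iff₀ hκ0]; exact hκu x
  refine ⟨hcpos, fun v => ?_, fun v => norm_le_of_forall_abs_apply_le fun A hA => ?_⟩
  · rw [hmass v]
    exact abs_sInt_le v fun x => by rw [abs_of_pos (hupos x)]; exact hule x
  have hind : Measurable (A.indicator fun _ => (1 : ℝ)) := measurable_const.indicator hA
  have hi0 : ∀ x, 0 ≤ A.indicator (fun _ => (1 : ℝ)) x := fun x =>
    Set.indicator_nonneg (fun _ _ => zero_le_one) x
  have hi1 : ∀ x, A.indicator (fun _ => (1 : ℝ)) x ≤ 1 := fun x => by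
    by_cases hx : x ∈ A <;> simp [hx]
  have hib : ∀ x, |A.indicator (fun _ => (1 : ℝ)) x| ≤ 1 := fun x => by
    rw [abs_of_nonneg (hi0 x)]; exact hi1 x
  obtain ⟨lo, hi, hlh, hr⟩ := exists_ratio_bounds (μ := μ) hκ0 hκ1 hmix hρ hind hi0 hi1 x₀ k (j + 1)
  set f := dualFrom μ ρ (A.indicator fun _ => 1) k (j + 1) with hf
  have hfm : Measurable f := measurable_dualFrom ρ hind _ _
  obtain ⟨D', hD'⟩ := exists_abs_dualFrom_le (μ := μ) ρ hib k (j + 1)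
  have happ : ∀ v, a v A = sInt v f := fun v => by
    rw [← sInt_indicator _ hA, ha, sInt_compFrom_kerOp ρ hind hib]
  have hPA : mass (a P) * P' A = sInt P f := by
    rw [← happ P]
    have h1 := congrArg (fun s : SignedMeasure X => s A) hP'
    simpa using h1.symm
  -- `P' A` is the quotient of the `P`-integrals of `f` and `u`, so it lies between the same bounds
  -- as the pointwise ratio `f / u`.
  have hlo : lo ≤ P' A := by
    have h1 : sInt P (fun x => lo * u x) ≤ sInt P f := hP.sInt_mono (by fun_prop) hfm
      (C := |lo| * D) (fun x => by rw [abs_mul]; gcongr; exact hD x) hD' fun x => (hr x).1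
    rw [sInt_const_mul, ← hmass, ← hPA, mul_comm] at h1
    exact le_of_mul_le_mul_left h1 hcpos
  have hhi : P' A ≤ hi := by
    have h1 : sInt P f ≤ sInt P (fun x => hi * u x) := hP.sInt_mono hfm (by fun_prop) hD'
      (D := |hi| * D) (fun x => by rw [abs_mul]; gcongr; exact hD x) fun x => (hr x).2
    rw [sInt_const_mul, ← hmass, ← hPA, mul_comm hi] at h1
    exact le_of_mul_le_mul_left h1 hcpos
  -- Duality rewrites the tangent map, tested on `A`, as a pairing of `v` with a function. Both `f`
  -- and `P' A * u` lie between `lo * u` and `hi * u`, so that function is at most `(hi - lo) * u`.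
  have hval : tanMap mass a P P' v A = (mass (a P))⁻¹ * sInt v fun x => f x - P' A * u x := by
    rw [sInt_fun_sub v hfm (by fun_prop) hD' (D := |P' A| * D)
      (fun x => by rw [abs_mul]; gcongr; exact hD x), sInt_const_mul, ← happ, ← hmass,
      tanMap_apply]
    simp only [sub_apply, smul_apply, map_smul, smul_eq_mul]
    ring
  rw [hval, abs_mul, abs_of_pos (inv_pos.2 hcpos), inv_mul_le_iff₀ hcpos]
  refine (abs_sInt_le v (C := κ⁻¹ * mass (a P) * (1 - κ ^ 2) ^ (j + 1)) fun x => ?_).trans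
    (le_of_eq (by ring))
  have h1 : |f x - P' A * u x| ≤ u x * (hi - lo) := by
    have hux := hupos x
    rw [abs_le]
    constructor
    · nlinarith [(hr x).1]
    · nlinarith [(hr x).2]
  refine h1.trans ?_
  have h2 : 0 ≤ hi - lo := by linarith
  exact mul_le_mul (hule x) hlh h2 (by have := inv_pos.2 hκ0; positivity)

end Mixing

/-! ### Kernels with bounded scores generate trajectories -/

section KernelTrajectory

variable {X : Type} [MeasurableSpace X] [MetricSpace X] [CompactSpace X] [BorelSpace X]
  {μ : Measure X} [IsFiniteMeasure μ]

/-- The linearization is exact up to a scalar: the difference of two normalized images is the ratio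
of their masses times the tangent map at `P` applied to `Q - P`. Mixing bounds that ratio by `κ⁻¹`.
-/
theorem norm_sub_le_of_compFrom [NeZero μ] {ρ : ℕ → C(X × X, ℝ)} {κ : ℝ} (hκ0 : 0 < κ)
    (hκ1 : κ ≤ 1) (hmix : ∀ n, IsMixing μ (ρ n) κ) (hρ : ∀ n z, 0 < ρ n z)
    {P P' Q Q' : SignedMeasure X} (hP : IsProb P) (hQ : IsProb Q) (k j : ℕ)
    (hP' : compFrom (fun n => kerOp μ (ρ n)) k (j + 1) P =
      mass (compFrom (fun n => kerOp μ (ρ n)) k (j + 1) P) • P')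
    (hQ' : compFrom (fun n => kerOp μ (ρ n)) k (j + 1) Q =
      mass (compFrom (fun n => kerOp μ (ρ n)) k (j + 1) Q) • Q') :
    ‖Q' - P'‖ ≤ 2 * κ⁻¹ ^ 2 * (1 - κ ^ 2) ^ (j + 1) * ‖Q - P‖ := by
  obtain ⟨hp1, hp2, hp3⟩ := norm_tanMap_compFrom_le hκ0 hκ1 hmix hρ hP k j hP'
  obtain ⟨hq1, hq2, -⟩ := norm_tanMap_compFrom_le hκ0 hκ1 hmix hρ hQ k j hQ'
  set a := compFrom (fun n => kerOp μ (ρ n)) k (j + 1)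
  have key : Q' - P' = (mass (a P) * (mass (a Q))⁻¹) • tanMap mass a P P' (Q - P) := by
    have h1 : tanMap mass a P P' (Q - P) = (mass (a P))⁻¹ • mass (a Q) • (Q' - P') := by
      rw [tanMap_apply, map_smul, map_sub, map_sub, smul_sub (mass (a Q)), ← hQ', smul_eq_mul,
        mul_smul, ← smul_sub, sub_smul, ← hP']
      congr 1; abel
    rw [h1, smul_smul, smul_smul]
    rw [show mass (a P) * (mass (a Q))⁻¹ * (mass (a P))⁻¹ * mass (a Q) = 1 by
      field_simp, one_smul]
  have hr : mass (a P) * (mass (a Q))⁻¹ ≤ κ⁻¹ := by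
    have := hq2 P
    rw [abs_of_pos hp1, hP.norm_eq, mul_one] at this
    rwa [mul_inv_le_iff₀ hq1]
  have h0 : 0 ≤ mass (a P) * (mass (a Q))⁻¹ := by positivity
  rw [key, norm_smul, Real.norm_of_nonneg h0]
  calc _ ≤ κ⁻¹ * (2 * (κ⁻¹ * (1 - κ ^ 2) ^ (j + 1) * ‖Q - P‖)) :=
        mul_le_mul hr (hp3 _) (norm_nonneg _) (by positivity)
    _ = _ := by ring

variable {d p : ℕ} {ρ : ℕ → MultiIndex d → C(X × X, ℝ)} {L L' : ℕ → MultiIndex d → SignedMeasure X}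

theorem IsStep.zero {m : SignedMeasure X →ₗ[ℝ] ℝ} {A : MultiIndex d → SignedMeasure X →ₗ[ℝ] SignedMeasure X}
    {l l' : MultiIndex d → SignedMeasure X} (h : IsStep m p A l l') :
    l' 0 = (m (A 0 (l 0)))⁻¹ • A 0 (l 0) := by
  rw [h 0 (by simp), sVec]
  have h1 : Finset.Iic (0 : MultiIndex d) = {0} := by
    ext β; simp
  have h2 : Finset.Iio (0 : MultiIndex d) = ∅ := by
    ext β; simp
  rw [h1, h2]
  simp [mchoose_self]

theorem isProb_of_isStep [NeZero μ] {κ : ℝ} (hκ0 : 0 < κ) (hmix : ∀ n, IsMixing μ (ρ n 0) κ)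
    (hρ : ∀ n z, 0 < ρ n 0 z)
    (hstep : ∀ n, IsStep mass p (fun γ => kerOp μ (ρ n γ)) (L n) (L (n + 1)))
    (h0 : IsProb (L 0 0)) (n : ℕ) : IsProb (L n 0) := by
  induction n with
  | zero => exact h0
  | succ n ih => rw [(hstep n).zero]; exact ih.kerOp hκ0 (hmix n) (hρ n)

theorem kerOp_isStep_zero [NeZero μ] {κ : ℝ} (hκ0 : 0 < κ) (hmix : ∀ n, IsMixing μ (ρ n 0) κ)
    (hρ : ∀ n z, 0 < ρ n 0 z)
    (hstep : ∀ n, IsStep mass p (fun γ => kerOp μ (ρ n γ)) (L n) (L (n + 1)))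
    (h0 : IsProb (L 0 0)) (n : ℕ) :
    kerOp μ (ρ n 0) (L n 0) = mass (kerOp μ (ρ n 0) (L n 0)) • L (n + 1) 0 := by
  have h := ((isProb_of_isStep hκ0 hmix hρ hstep h0 n).mass_kerOp_pos hκ0 (hmix n) (hρ n)).1
  rw [(hstep n).zero, smul_smul, mul_inv_cancel₀ h.ne', one_smul]

/-- Mixing kernels with bounded scores generate trajectories of the abstract recursion. -/
theorem isTrajectory_kerOp [NeZero μ] {κ : ℝ} (hκ0 : 0 < κ) (hκ1 : κ ≤ 1)
    (hmix : ∀ n, IsMixing μ (ρ n 0) κ) (hρ : ∀ n z, 0 < ρ n 0 z)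
    (hstep : ∀ n, IsStep mass p (fun γ => kerOp μ (ρ n γ)) (L n) (L (n + 1)))
    (h0 : IsProb (L 0 0)) {N : ℕ} {w : ℝ} (hw : 1 ≤ w)
    (hscore : ∀ n < N, ∀ γ, deg γ ≤ p → ∀ z, |ρ n γ z| ≤ w ^ deg γ * ρ n 0 z)
    (hinit : ∀ α, deg α ≤ p → ‖L 0 α‖ ≤ w ^ deg α) :
    IsTrajectory mass p (2 * κ⁻¹ ^ 2) (1 - κ ^ 2) N w (fun n γ => kerOp μ (ρ n γ)) L := by
  have hprob := isProb_of_isStep hκ0 hmix hρ hstep h0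
  have hmass := fun n => (hprob n).mass_kerOp_pos hκ0 (hmix n) (hρ n)
  have hκi : 1 ≤ κ⁻¹ := (one_le_inv₀ hκ0).2 hκ1
  refine ⟨abs_mass_le, hw, fun n _ => hstep n, fun n _ => (hmass n).1, fun n hn γ hγ v => ?_,
    fun n _ => (hprob n).norm_eq.le, hinit, fun k j _ v => ?_⟩
  -- The operator bound is stated relative to the current normalizer, since column integrals of `ρ n
  -- 0` exceed that normalizer by at most the factor `κ⁻¹`.
  · have hc := (hmass n).1
    have hb : ∀ x', ∫ x, |ρ n γ (x, x')| ∂μ ≤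
        w ^ deg γ * (κ⁻¹ * mass (kerOp μ (ρ n 0) (L n 0))) := fun x' => by
      calc ∫ x, |ρ n γ (x, x')| ∂μ ≤ ∫ x, w ^ deg γ * (1 * ρ n 0 (x, x')) ∂μ := by
            refine integral_mono (integrable_of_continuous μ (by fun_prop))
              (integrable_of_continuous μ (by fun_prop)) fun x => ?_
            simpa using hscore n hn γ hγ (x, x')
        _ = w ^ deg γ * dualOp μ (ρ n 0) (fun _ => 1) x' := by rw [integral_const_mul]; rfl
        _ ≤ _ := by
            gcongr
            rw [le_inv_mul_iff₀ hκ0]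
            exact ((hmass n).2 x').1
    refine (norm_kerOp_le μ (ρ n γ) v hb).trans ?_
    have : 0 ≤ w ^ deg γ * mass (kerOp μ (ρ n 0) (L n 0)) * ‖v‖ := by positivity
    calc _ = 2 * κ⁻¹ * (w ^ deg γ * mass (kerOp μ (ρ n 0) (L n 0)) * ‖v‖) := by ring
      _ ≤ 2 * κ⁻¹ ^ 2 * (w ^ deg γ * mass (kerOp μ (ρ n 0) (L n 0)) * ‖v‖) := by
          gcongr; nlinarith
      _ = _ := by ring
  · rcases j with _ | j
    · have : (1 : ℝ) ≤ 2 * κ⁻¹ ^ 2 := by nlinarith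
      simpa [compFrom] using le_mul_of_one_le_left (norm_nonneg v) this
    · have hP := fun n => kerOp_isStep_zero hκ0 hmix hρ hstep h0 n
      rw [compFrom_tanMap (N := k + (j + 1)) (P := fun n => L n 0) (fun n _ => hP n)
        (fun n _ => (hprob n).mass_eq) (fun n _ => (hmass n).1.ne') le_rfl]
      refine ((norm_tanMap_compFrom_le hκ0 hκ1 hmix hρ (hprob k) k j
        (compFrom_apply_eq (N := k + (j + 1)) (P := fun n => L n 0) (fun n _ => hP n)
        (fun n _ => (hprob n).mass_eq) le_rfl)).2.2 v).trans ?_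
      have hτ : 0 ≤ 1 - κ ^ 2 := by nlinarith
      calc _ = 2 * κ⁻¹ * ((1 - κ ^ 2) ^ (j + 1) * ‖v‖) := by ring
        _ ≤ 2 * κ⁻¹ ^ 2 * ((1 - κ ^ 2) ^ (j + 1) * ‖v‖) := by gcongr; nlinarith
        _ = _ := by ring

theorem norm_sub_zero_le [NeZero μ] {κ : ℝ} (hκ0 : 0 < κ) (hκ1 : κ ≤ 1)
    (hmix : ∀ n, IsMixing μ (ρ n 0) κ) (hρ : ∀ n z, 0 < ρ n 0 z)
    (hstep : ∀ n, IsStep mass p (fun γ => kerOp μ (ρ n γ)) (L n) (L (n + 1)))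
    (hstep' : ∀ n, IsStep mass p (fun γ => kerOp μ (ρ n γ)) (L' n) (L' (n + 1)))
    (h0 : IsProb (L 0 0)) (h0' : IsProb (L' 0 0)) (n : ℕ) :
    ‖L n 0 - L' n 0‖ ≤ 2 * κ⁻¹ ^ 2 * (1 - κ ^ 2) ^ n * ‖L 0 0 - L' 0 0‖ := by
  have hκi : 1 ≤ κ⁻¹ := (one_le_inv₀ hκ0).2 hκ1
  rcases n with _ | n
  · have : (1 : ℝ) ≤ 2 * κ⁻¹ ^ 2 := by nlinarith
    simpa using le_mul_of_one_le_left (norm_nonneg (L 0 0 - L' 0 0)) this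
  have h := fun {L : ℕ → MultiIndex d → SignedMeasure X}
    (hstep : ∀ n, IsStep mass p (fun γ => kerOp μ (ρ n γ)) (L n) (L (n + 1)))
    (h0 : IsProb (L 0 0)) => compFrom_apply_eq (N := 0 + (n + 1)) (P := fun n => L n 0)
      (fun n _ => kerOp_isStep_zero hκ0 hmix hρ hstep h0 n)
      (fun n _ => (isProb_of_isStep hκ0 hmix hρ hstep h0 n).mass_eq) le_rfl
  have := norm_sub_le_of_compFrom hκ0 hκ1 hmix hρ h0' h0 0 n (h hstep' h0') (h hstep h0)
  simpa using this

end KernelTrajectory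

/-! ### The norm on vector measures -/

section LVecNorm

variable {d p : ℕ} {X : Type*} [MeasurableSpace X]

instance : Finite {α : MultiIndex d // deg α ≤ p} := by
  refine Set.Finite.to_subtype ((Set.finite_Iic (fun _ => p : MultiIndex d)).subset fun α hα i => ?_)
  exact (Finset.single_le_sum (f := α) (fun _ _ => Nat.zero_le _) (Finset.mem_univ i)).trans hα

instance : Nonempty {α : MultiIndex d // deg α ≤ p} := ⟨⟨0, by simp⟩⟩

namespace LVec

theorem comp_of_le (Λ : LVec d p X) {α : MultiIndex d} (h : deg α ≤ p) :
    Λ.comp α = Λ ⟨α, h⟩ := dif_pos h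

theorem comp_of_lt (Λ : LVec d p X) {α : MultiIndex d} (h : p < deg α) : Λ.comp α = 0 :=
  dif_neg (by omega)

theorem comp_sub (Λ Λ' : LVec d p X) (α : MultiIndex d) :
    (Λ - Λ').comp α = Λ.comp α - Λ'.comp α := by
  by_cases h : deg α ≤ p
  · simp only [comp_of_le _ h]; rfl
  · simp [comp_of_lt _ (not_le.1 h)]

theorem norm_comp_le (Λ : LVec d p X) (α : MultiIndex d) : ‖Λ.comp α‖ ≤ Λ.norm := by
  have hb : BddAbove (Set.range fun α : {α : MultiIndex d // deg α ≤ p} => tvNorm (Λ.comp α.1)) :=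
    (Set.finite_range _).bddAbove
  by_cases h : deg α ≤ p
  · exact le_ciSup hb ⟨α, h⟩
  · rw [comp_of_lt _ (not_le.1 h), norm_zero]
    exact (norm_nonneg (Λ.comp 0)).trans (le_ciSup hb ⟨0, by simp⟩)

theorem norm_le {Λ : LVec d p X} {C : ℝ} (h : ∀ α, deg α ≤ p → ‖Λ.comp α‖ ≤ C) : Λ.norm ≤ C :=
  ciSup_le fun α => h α.1 α.2

theorem norm_nonneg (Λ : LVec d p X) : 0 ≤ Λ.norm := (_root_.norm_nonneg _).trans (Λ.norm_comp_le 0)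

theorem norm_sub_le_add_sub (Λ Λ' Λ'' : LVec d p X) :
    (Λ - Λ'').norm ≤ (Λ - Λ').norm + (Λ' - Λ'').norm :=
  norm_le fun α _ => by
    rw [comp_sub, ← sub_add_sub_cancel _ (Λ'.comp α), ← comp_sub, ← comp_sub]
    exact (norm_add_le _ _).trans (add_le_add (norm_comp_le _ α) (norm_comp_le _ α))

theorem comp_initVec (l : Measure X) [IsFiniteMeasure l] (α : MultiIndex d) :
    (initVec d p l).comp α = if α = 0 then l.toSignedMeasure else 0 := by
  by_cases h : deg α ≤ p
  · rw [comp_of_le _ h]; rfl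
  · rw [comp_of_lt _ (not_le.1 h), if_neg]
    rintro rfl
    simp at h

theorem isL0_iff [MetricSpace X] [CompactSpace X] [BorelSpace X] (Λ : LVec d p X) :
    Λ.IsL0 ↔ IsProb (Λ.comp 0) := Iff.rfl

theorem isL0_initVec (l : Measure X) [IsProbabilityMeasure l] : (initVec d p l).IsL0 :=
  ⟨l, inferInstance, by rw [comp_initVec, if_pos rfl]⟩

theorem IsL0.one_le_norm [MetricSpace X] [CompactSpace X] [BorelSpace X] {Λ : LVec d p X}
    (h : Λ.IsL0) : 1 ≤ Λ.norm := by
  rw [← ((isL0_iff Λ).1 h).norm_eq]; exact Λ.norm_comp_le 0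

theorem norm_initVec [MetricSpace X] [CompactSpace X] [BorelSpace X] (l : Measure X)
    [IsProbabilityMeasure l] : (initVec d p l).norm = 1 := by
  refine le_antisymm (norm_le fun α _ => ?_) (isL0_initVec l).one_le_norm
  rw [comp_initVec]
  split_ifs
  · rw [norm_toSignedMeasure, probReal_univ]
  · simp

end LVec

end LVecNorm

/-! ### The filter step as an instance of the abstract recursion -/

section Step

variable {d p : ℕ} {X : Type} [MeasurableSpace X] [MetricSpace X] [CompactSpace X] [BorelSpace X]
  {Y : Type} [MetricSpace Y] [CompactSpace Y]

/-- The continuous functions `ρ γ` on `Y × (X × X)` are the partial derivatives of order at most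
`p` of `R` at `θ`. -/
def IsDerivKernel (p : ℕ) (R : E d → Y → X → X → ℝ) (θ : E d)
    (ρ : MultiIndex d → C(Y × (X × X), ℝ)) : Prop :=
  ∀ γ, deg γ ≤ p → ∀ y x x', mderiv γ (fun ϑ => R ϑ y x x') θ = ρ γ (y, (x, x'))

/-- The kernel `ρ γ` for the observation `y`. -/
def slice (ρ : C(Y × (X × X), ℝ)) (y : Y) : C(X × X, ℝ) := ρ.curry y

theorem slice_apply (ρ : C(Y × (X × X), ℝ)) (y : Y) (z : X × X) : slice ρ y z = ρ (y, z) := rfl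

variable {μ : Measure X} [IsFiniteMeasure μ] {R : E d → Y → X → X → ℝ} {θ : E d}
  {ρ : MultiIndex d → C(Y × (X × X), ℝ)}

theorem IsDerivKernel.rDeriv_eq (h : IsDerivKernel p R θ ρ) {γ : MultiIndex d} (hγ : deg γ ≤ p)
    (y : Y) (l : SignedMeasure X) (x : X) :
    rDeriv R γ θ y l x = sInt l fun x' => slice (ρ γ) y (x, x') := by
  unfold rDeriv sInt
  congr 1
  ext x'
  exact h γ hγ y x x'

theorem IsDerivKernel.continuous_rDeriv (h : IsDerivKernel p R θ ρ) {γ : MultiIndex d}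
    (hγ : deg γ ≤ p) (y : Y) (l : SignedMeasure X) : Continuous (rDeriv R γ θ y l) := by
  simp_rw [funext (h.rDeriv_eq hγ y l)]
  exact continuous_sInt _ l

theorem IsDerivKernel.withDensityᵥ_rDeriv (h : IsDerivKernel p R θ ρ) {γ : MultiIndex d}
    (hγ : deg γ ≤ p) (y : Y) (l : SignedMeasure X) :
    μ.withDensityᵥ (rDeriv R γ θ y l) = kerOp μ (slice (ρ γ) y) l := by
  rw [kerOp_apply, funext (h.rDeriv_eq hγ y l)]

theorem integral_eq_mass_withDensityᵥ {f : X → ℝ} (hf : Continuous f) :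
    ∫ x, f x ∂μ = mass (μ.withDensityᵥ f) := by
  rw [mass_apply, withDensityᵥ_apply (integrable_of_continuous μ hf) MeasurableSet.univ,
    setIntegral_univ]

theorem withDensityᵥ_sum {ι : Type*} (s : Finset ι) {f : ι → X → ℝ}
    (hf : ∀ i ∈ s, Continuous (f i)) :
    μ.withDensityᵥ (fun x => ∑ i ∈ s, f i x) = ∑ i ∈ s, μ.withDensityᵥ (f i) := by
  classical
  induction s using Finset.induction_on with
  | empty => simp only [Finset.sum_empty]; exact withDensityᵥ_zero
  | insert i s hi ih =>
    have h1 : ∀ j ∈ s, Continuous (f j) := fun j hj => hf j (Finset.mem_insert_of_mem hj)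
    simp_rw [Finset.sum_insert hi]
    rw [← ih h1, ← withDensityᵥ_add' (integrable_of_continuous μ (hf i (Finset.mem_insert_self i s)))
      (integrable_of_continuous μ (continuous_finsetSum s h1))]

theorem IsDerivKernel.continuous_sDens (h : IsDerivKernel p R θ ρ) {α : MultiIndex d}
    (hα : deg α ≤ p) (y : Y) (Λ : LVec d p X) : Continuous (sDens μ R θ y Λ α) := by
  unfold sDens
  refine continuous_finsetSum _ fun β hβ => continuous_const.mul (Continuous.div_const ?_ _)
  have := deg_sub_add (Finset.mem_Iic.1 hβ)
  exact h.continuous_rDeriv (by omega) y _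

theorem IsDerivKernel.withDensityᵥ_sDens (h : IsDerivKernel p R θ ρ) {α : MultiIndex d}
    (hα : deg α ≤ p) (y : Y) (Λ : LVec d p X) :
    μ.withDensityᵥ (sDens μ R θ y Λ α) =
      sVec mass (fun γ => kerOp μ (slice (ρ γ) y)) Λ.comp α := by
  have hd : ∀ β ∈ Finset.Iic α, deg (α - β) ≤ p := fun β hβ => by
    have := deg_sub_add (Finset.mem_Iic.1 hβ)
    omega
  have hc : ∀ β ∈ Finset.Iic α, Continuous fun x => (mchoose α β : ℝ) *
      (rDeriv R (α - β) θ y (Λ.comp β) x / ∫ x', rDeriv R 0 θ y (Λ.comp 0) x' ∂μ) :=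
    fun β hβ => ((h.continuous_rDeriv (hd β hβ) y _).div_const _).const_mul _
  unfold sDens sVec
  rw [withDensityᵥ_sum _ hc]
  refine Finset.sum_congr rfl fun β hβ => ?_
  rw [integral_eq_mass_withDensityᵥ (h.continuous_rDeriv (by simp) y _),
    h.withDensityᵥ_rDeriv (by simp) y, ← h.withDensityᵥ_rDeriv (hd β hβ) y, ← withDensityᵥ_smul',
    ← withDensityᵥ_smul']
  congr 1
  ext x
  simp [div_eq_inv_mul]

theorem fDens_eq (y : Y) (Λ : LVec d p X) (α : MultiIndex d) (x : X) :
    fDens μ R θ y Λ α x = sDens μ R θ y Λ α x -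
      ∑ β ∈ Finset.Iio α, (mchoose α β : ℝ) *
        (fDens μ R θ y Λ β x * ∫ x', sDens μ R θ y Λ (α - β) x' ∂μ) := by
  rw [fDens, Finset.sum_attach (Finset.Iio α) fun β => (mchoose α β : ℝ) *
    (fDens μ R θ y Λ β x * ∫ x', sDens μ R θ y Λ (α - β) x' ∂μ)]

theorem IsDerivKernel.continuous_fDens (h : IsDerivKernel p R θ ρ) {α : MultiIndex d}
    (hα : deg α ≤ p) (y : Y) (Λ : LVec d p X) : Continuous (fDens μ R θ y Λ α) := by
  induction hn : deg α using Nat.strong_induction_on generalizing α with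
  | _ n ih =>
    rw [funext (fDens_eq y Λ α)]
    refine (h.continuous_sDens hα y Λ).sub (continuous_finsetSum _ fun β hβ => ?_)
    have := deg_lt_deg (Finset.mem_Iio.1 hβ)
    exact continuous_const.mul ((ih (deg β) (by omega) (by omega) rfl).mul_const _)

theorem comp_FStep (y : Y) (Λ : LVec d p X) {α : MultiIndex d} (hα : deg α ≤ p) :
    (FStep μ R θ y Λ).comp α = μ.withDensityᵥ (fDens μ R θ y Λ α) := by
  rw [LVec.comp_of_le _ hα]; rfl

/-- Passing from densities to measures turns integrals over the state space into masses and the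
functions `rDeriv` into the operators `kerOp`. The recursion for `fDens` then becomes the abstract
one term by term; continuity of all densities supplies the integrability. -/
theorem IsDerivKernel.isStep (h : IsDerivKernel p R θ ρ) (y : Y) (Λ : LVec d p X) :
    IsStep mass p (fun γ => kerOp μ (slice (ρ γ) y)) Λ.comp (FStep μ R θ y Λ).comp := by
  intro α hα
  have hd : ∀ β ∈ Finset.Iio α, deg β ≤ p ∧ deg (α - β) ≤ p := fun β hβ => by
    have := deg_sub_add (Finset.mem_Iio.1 hβ).le
    omega
  have hc : ∀ β ∈ Finset.Iio α, Continuous fun x => (mchoose α β : ℝ) *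
      (fDens μ R θ y Λ β x * ∫ x', sDens μ R θ y Λ (α - β) x' ∂μ) :=
    fun β hβ => ((h.continuous_fDens (hd β hβ).1 y Λ).mul_const _).const_mul _
  rw [comp_FStep y Λ hα, funext (fDens_eq y Λ α), ← h.withDensityᵥ_sDens hα]
  have h1 := withDensityᵥ_sub' (integrable_of_continuous μ (h.continuous_sDens (μ := μ) hα y Λ))
    (integrable_of_continuous μ (continuous_finsetSum _ hc))
  refine Eq.trans ?_ (h1.trans ?_)
  · rfl
  · congr 1
    rw [withDensityᵥ_sum _ hc]
    refine Finset.sum_congr rfl fun β hβ => ?_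
    rw [comp_FStep y Λ (hd β hβ).1, ← h.withDensityᵥ_sDens (hd β hβ).2,
      ← integral_eq_mass_withDensityᵥ (h.continuous_sDens (hd β hβ).2 y Λ), ← withDensityᵥ_smul',
      ← withDensityᵥ_smul']
    congr 1
    ext x
    simp only [smul_eq_mul]
    ring

end Step

/-! ### The constants of the forgetting theorem -/

section Constants

/-- The bounds on trajectories of the abstract recursion, with constants `K` and `σ`. -/
def TrajectoryBound (p : ℕ) (C τ σ K : ℝ) : Prop :=
  ∀ (V : Type) [NormedAddCommGroup V] [NormedSpace ℝ V] (d : ℕ) (m : V →ₗ[ℝ] ℝ) (N : ℕ) (w : ℝ)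
    (A : ℕ → MultiIndex d → V →ₗ[ℝ] V) (L : ℕ → MultiIndex d → V), IsTrajectory m p C τ N w A L →
    (∀ n ≤ N, ∀ α, deg α ≤ p → ‖L n α‖ ≤ K * w ^ deg α) ∧
    ∀ L' : ℕ → MultiIndex d → V, IsTrajectory m p C τ N w A L' →
      (∀ n ≤ N, ‖L n 0 - L' n 0‖ ≤ C * τ ^ n * ‖L 0 0 - L' 0 0‖) →
      ∀ D : ℝ, (∀ α, deg α ≤ p → ‖L 0 α - L' 0 α‖ ≤ D * w ^ deg α) →
      ∀ n ≤ N, ∀ α, deg α ≤ p → ‖L n α - L' n α‖ ≤ K * σ ^ n * D * w ^ deg α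

/-- The constants `C = 2 κ⁻²` and `τ = 1 - κ ^ 2` of the linearized filter with `κ = ε ^ 2` are
inserted into the two bounds for trajectories, leaving a dependence on `p` and `ε` alone. -/
theorem exists_trajectoryBound (p : ℕ) (ε : ℝ) : ∃ σ K : ℝ, 0 < σ ∧ σ < 1 ∧ 1 ≤ K ∧
    (0 < ε → ε < 1 → TrajectoryBound p (2 * (ε ^ 2)⁻¹ ^ 2) (1 - (ε ^ 2) ^ 2) σ K) := by
  by_cases hε : 0 < ε ∧ ε < 1
  swap
  · exact ⟨1 / 2, 1, by norm_num, by norm_num, le_rfl, fun h h' => absurd ⟨h, h'⟩ hε⟩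
  obtain ⟨h0, h1⟩ := hε
  have he0 : 0 < (ε ^ 2) ^ 2 := by positivity
  have he1 : ε ^ 2 < 1 := pow_lt_one₀ h0.le h1 two_ne_zero
  have he2 : (ε ^ 2) ^ 2 < 1 := pow_lt_one₀ (by positivity) he1 two_ne_zero
  have hC : 1 ≤ 2 * (ε ^ 2)⁻¹ ^ 2 := by
    have : 1 ≤ (ε ^ 2)⁻¹ ^ 2 := one_le_pow₀ ((one_le_inv₀ (by positivity)).2 he1.le)
    linarith
  have hτ0 : 0 < 1 - (ε ^ 2) ^ 2 := by linarith
  have hτ1 : 1 - (ε ^ 2) ^ 2 < 1 := by linarith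
  obtain ⟨B, hB, hB'⟩ := IsTrajectory.exists_norm_le hC hτ0 hτ1 p
  obtain ⟨K, σ, hK, hσ, hσ1, hK'⟩ := IsTrajectory.exists_norm_sub_le hC hτ0 hτ1 p
  refine ⟨σ, max B K, hτ0.trans_le hσ, hσ1, hB.trans (le_max_left _ _), fun _ _ => ?_⟩
  intro V _ _ d m N w A L h
  have hw : 0 ≤ w := zero_le_one.trans h.one_le_w
  refine ⟨fun n hn α hα => (hB' V d m p N w A L le_rfl h n hn α hα).trans ?_,
    fun L' h' hf D hD n hn α hα => (hK' V d m p N w A L L' le_rfl h h' hf D hD n hn α hα).trans ?_⟩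
  · gcongr; exact le_max_left _ _
  · have hD0 : 0 ≤ D := by
      have := (norm_nonneg _).trans (hD 0 (by simp))
      simpa using this
    have hσ0 : 0 ≤ σ := (hτ0.trans_le hσ).le
    gcongr; exact le_max_right _ _

/-- The rate of forgetting of the derivative filter. -/
def rateConst (p : ℕ) (ε : ℝ) : ℝ := (exists_trajectoryBound p ε).choose

/-- The constant in the bounds on the derivative filter. -/
def boundConst (p : ℕ) (ε : ℝ) : ℝ := (exists_trajectoryBound p ε).choose_spec.choose

theorem rateConst_pos (p : ℕ) (ε : ℝ) : 0 < rateConst p ε :=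
  (exists_trajectoryBound p ε).choose_spec.choose_spec.1

theorem rateConst_lt_one (p : ℕ) (ε : ℝ) : rateConst p ε < 1 :=
  (exists_trajectoryBound p ε).choose_spec.choose_spec.2.1

theorem one_le_boundConst (p : ℕ) (ε : ℝ) : 1 ≤ boundConst p ε :=
  (exists_trajectoryBound p ε).choose_spec.choose_spec.2.2.1

theorem trajectoryBound_const (p : ℕ) {ε : ℝ} (h0 : 0 < ε) (h1 : ε < 1) :
    TrajectoryBound p (2 * (ε ^ 2)⁻¹ ^ 2) (1 - (ε ^ 2) ^ 2) (rateConst p ε) (boundConst p ε) :=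
  (exists_trajectoryBound p ε).choose_spec.choose_spec.2.2.2 h0 h1

end Constants

/-! ### The accumulated score bound -/

section PsiSum

variable {Y : Type*} {ψ : Y → ℝ} {y : ℕ → Y}

theorem le_psiSum (hψ : ∀ y, 1 ≤ ψ y) {m n k : ℕ} (h1 : m < k) (h2 : k ≤ n) :
    ψ (y k) ≤ psiSum ψ y m n := by
  rw [psiSum, if_neg (by omega)]
  exact Finset.single_le_sum (f := fun k => ψ (y k)) (fun k _ => zero_le_one.trans (hψ _))
    (Finset.mem_Icc.2 ⟨h1, h2⟩)

theorem one_le_psiSum (hψ : ∀ y, 1 ≤ ψ y) {m n : ℕ} (h : m ≤ n) : 1 ≤ psiSum ψ y m n := by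
  rcases h.eq_or_lt with rfl | h
  · simp [psiSum]
  · exact (hψ _).trans (le_psiSum hψ (Nat.lt_succ_self m) h)

end PsiSum

/-! ### Time shifts of the iterated filter -/

section FilterIteration

variable {d p : ℕ} {X : Type} [MeasurableSpace X] {Y : Type} {μ : Measure X}
  {R : E d → Y → X → X → ℝ} {θ : E d} {y : ℕ → Y} {Λ : LVec d p X}

theorem FIter_self (m : ℕ) : FIter μ R θ y Λ m m = Λ := by
  rcases m with _ | m <;> simp [FIter]

theorem FIter_succ {m n : ℕ} (h : m ≤ n) :
    FIter μ R θ y Λ m (n + 1) = FStep μ R θ (y (n + 1)) (FIter μ R θ y Λ m n) := by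
  rw [FIter, if_pos h]

theorem FIter_shift (m k : ℕ) :
    FIter μ R θ y Λ m (m + k) = FIter μ R θ (fun i => y (m + i)) Λ 0 k := by
  induction k with
  | zero => simp [FIter_self]
  | succ k ih => rw [← add_assoc, FIter_succ (by omega), FIter_succ (by omega), ih]; rfl

theorem FIter_succ' (n : ℕ) :
    FIter μ R θ y Λ 0 (n + 1) = FIter μ R θ y (FStep μ R θ (y 1) Λ) 1 (n + 1) := by
  induction n with
  | zero => rw [FIter_self]; rfl
  | succ n ih => rw [FIter_succ (by omega), ih, ← FIter_succ (by omega)]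

theorem FIter_congr {y' : ℕ → Y} {m n : ℕ} (h : ∀ k, m < k → k ≤ n → y k = y' k) :
    FIter μ R θ y Λ m n = FIter μ R θ y' Λ m n := by
  induction n with
  | zero => rfl
  | succ n ih =>
    rw [FIter, FIter, ih fun k h1 h2 => h k h1 (by omega)]
    split_ifs with hm
    · rw [h (n + 1) (by omega) le_rfl]
    · rfl

end FilterIteration

/-! ### Stability bounds for the derivative filter -/

section Bounds

variable {d p : ℕ} {X : Type} [MeasurableSpace X] [MetricSpace X] [CompactSpace X] [BorelSpace X]
  {Y : Type} [MetricSpace Y] [CompactSpace Y]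
  {μ : Measure X} [IsFiniteMeasure μ] {R : E d → Y → X → X → ℝ} {Θ : Set (E d)} {θ : E d}
  {ρ : MultiIndex d → C(Y × (X × X), ℝ)}

theorem IsDerivKernel.R_eq (h : IsDerivKernel p R θ ρ) (y : Y) (x x' : X) :
    R θ y x x' = slice (ρ 0) y (x, x') := by
  rw [slice_apply, ← h 0 (by simp), mderiv_zero]

/-- The kernels from `x` and from `x₀` are both comparable with one reference measure, which drops
out: the measure from `x` dominates `ε ^ 2` times the measure from `x₀`, and integrating `f` gives
the claim. -/
theorem IsDerivKernel.isMixing (h : IsDerivKernel p R θ ρ) (hpos : ∀ y x x', 0 < R θ y x x')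
    {ε : ℝ} (hmix : StrongMixing μ R Θ ε) (hθ : θ ∈ Θ) (y : Y) :
    IsMixing μ (slice (ρ 0) y) (ε ^ 2) := by
  obtain ⟨hε0, hε1, m, hm⟩ := hmix
  obtain ⟨-, -, hm⟩ := hm θ hθ y
  intro f hf hf0 ⟨C, hC⟩ x x₀
  have hR : ∀ x, Continuous fun x' => R θ y x' x := fun x => by
    simp_rw [h.R_eq]; fun_prop
  have hR0 : ∀ x x', 0 ≤ f x' * slice (ρ 0) y (x', x) := fun x x' => by
    rw [← h.R_eq]; exact mul_nonneg (hf0 _) (hpos _ _ _).le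
  have hle : (ENNReal.ofReal ε * ENNReal.ofReal ε) •
      μ.withDensity (fun x' => ENNReal.ofReal (R θ y x' x₀)) ≤
      μ.withDensity (fun x' => ENNReal.ofReal (R θ y x' x)) := by
    refine Measure.le_iff.2 fun B hB => ?_
    rw [Measure.smul_apply, withDensity_apply _ hB, withDensity_apply _ hB, smul_eq_mul, mul_assoc]
    refine (mul_le_mul_right ?_ _).trans (hm x B hB).1
    have h2 := (hm x₀ B hB).2
    rw [ENNReal.le_div_iff_mul_le (Or.inl (by simpa using hε0)) (Or.inl ENNReal.ofReal_ne_top)] at h2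
    rwa [mul_comm]
  have heq : ∀ x, ENNReal.ofReal (dualOp μ (slice (ρ 0) y) f x) =
      ∫⁻ x', ENNReal.ofReal (f x') ∂(μ.withDensity fun x' => ENNReal.ofReal (R θ y x' x)) :=
    fun x => by
      rw [dualOp, ofReal_integral_eq_lintegral_ofReal (integrable_dualOp _ hf hC x)
        (Eventually.of_forall (hR0 x)),
        lintegral_withDensity_eq_lintegral_mul _ (hR x).measurable.ennreal_ofReal hf.ennreal_ofReal]
      refine lintegral_congr fun x' => ?_
      rw [Pi.mul_apply, ← ENNReal.ofReal_mul (hpos _ _ _).le, h.R_eq, mul_comm]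
  have hfin := lintegral_mono' hle (le_refl fun x' => ENNReal.ofReal (f x'))
  rw [lintegral_smul_measure, ← heq, ← heq, smul_eq_mul, ← ENNReal.ofReal_mul hε0.le,
    ← ENNReal.ofReal_mul (by positivity)] at hfin
  rw [pow_two]
  exact (ENNReal.ofReal_le_ofReal_iff (integral_nonneg (hR0 x))).1 hfin

theorem ScoreBound.abs_le {ψ : Y → ℝ} (hs : ScoreBound p R Θ ψ) (h : IsDerivKernel p R θ ρ)
    (hpos : ∀ y x x', 0 < R θ y x x') (hθ : θ ∈ Θ) {γ : MultiIndex d} (hγ : deg γ ≤ p) (y : Y)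
    (z : X × X) : |slice (ρ γ) y z| ≤ ψ y ^ deg γ * slice (ρ 0) y z := by
  rw [← h.R_eq, slice_apply, ← h γ hγ]
  by_cases h0 : γ = 0
  · subst h0
    simp [mderiv_zero, abs_of_pos (hpos _ _ _)]
  · exact hs.2 θ hθ _ _ _ γ h0 hγ

section

variable [NeZero μ] (hk : IsDerivKernel p R θ ρ) (hpos : ∀ y x x', 0 < R θ y x x')
  {ε : ℝ} (hmix : StrongMixing μ R Θ ε) (hθ : θ ∈ Θ)

include hk hpos hmix hθ

theorem isL0_FIter {Λ : LVec d p X} (hΛ : Λ.IsL0) (y : ℕ → Y) (m n : ℕ) :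
    (FIter μ R θ y Λ m n).IsL0 := by
  induction n with
  | zero => exact hΛ
  | succ n ih =>
    rw [FIter]
    split_ifs
    · rw [LVec.isL0_iff, (hk.isStep _ _).zero]
      exact IsProb.kerOp ((LVec.isL0_iff _).1 ih) (pow_pos hmix.1 2)
        (hk.isMixing hpos hmix hθ _) fun z => by rw [← hk.R_eq]; exact hpos _ _ _
    · exact hΛ

theorem isL0_FStep {Λ : LVec d p X} (hΛ : Λ.IsL0) (y : Y) : (FStep μ R θ y Λ).IsL0 := by
  have := isL0_FIter hk hpos hmix hθ hΛ (fun _ => y) 0 1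
  rwa [FIter_succ le_rfl, FIter_self] at this

/-- A single scale `w` has to dominate all scores `ψ (y k)` of the time window and the initial norm.
For `α ≠ 0` the initial component is then at most `w ≤ w ^ deg α`; for `α = 0` it is a probability
measure, of norm `1 = w ^ 0`. -/
theorem isTrajectory_FIter {ψ : Y → ℝ} (hs : ScoreBound p R Θ ψ) {Λ : LVec d p X} (hΛ : Λ.IsL0)
    (y : ℕ → Y) (m N : ℕ) {w : ℝ} (hw : psiSum ψ y m (m + N) ≤ w) (hΛw : Λ.norm ≤ w) :
    IsTrajectory mass p (2 * (ε ^ 2)⁻¹ ^ 2) (1 - (ε ^ 2) ^ 2) N w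
      (fun n γ => kerOp μ (slice (ρ γ) (y (m + n + 1))))
      fun n => (FIter μ R θ y Λ m (m + n)).comp := by
  have hψ := hs.1
  have hw1 : 1 ≤ w := (one_le_psiSum hψ (Nat.le_add_right m N)).trans hw
  refine isTrajectory_kerOp (ρ := fun n γ => slice (ρ γ) (y (m + n + 1))) (pow_pos hmix.1 2)
    (pow_le_one₀ hmix.1.le hmix.2.1.le) (fun n => hk.isMixing hpos hmix hθ _)
    (fun n z => by rw [← hk.R_eq]; exact hpos _ _ _) (fun n => ?_) ?_ hw1 (fun n hn γ hγ z => ?_)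
    fun α hα => ?_
  · rw [← add_assoc, FIter_succ (by omega)]
    exact hk.isStep _ _
  · exact (LVec.isL0_iff _).1 (isL0_FIter hk hpos hmix hθ hΛ y m (m + 0))
  · refine (hs.abs_le hk hpos hθ hγ _ z).trans ?_
    have h1 : ψ (y (m + n + 1)) ≤ w := (le_psiSum hψ (by omega) (by omega)).trans hw
    have h2 : 0 ≤ slice (ρ 0) (y (m + n + 1)) z := by rw [← hk.R_eq]; exact (hpos _ _ _).le
    have h3 := zero_le_one.trans (hψ (y (m + n + 1)))
    gcongr
  · rw [add_zero, FIter_self]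
    by_cases h0 : α = 0
    · subst h0
      simp [((LVec.isL0_iff Λ).1 hΛ).norm_eq]
    · refine (Λ.norm_comp_le α).trans (hΛw.trans (le_self_pow₀ hw1 fun h => h0 (deg_eq_zero.1 h)))

/-- Choose `w = Λ.norm * psiSum ψ y m n`; both factors are at least one, so `w ^ deg α ≤ w ^ p`. -/
theorem norm_FIter_le {ψ : Y → ℝ} (hs : ScoreBound p R Θ ψ) {Λ : LVec d p X} (hΛ : Λ.IsL0)
    {m n : ℕ} (hmn : m ≤ n) (y : ℕ → Y) :
    (FIter μ R θ y Λ m n).norm ≤ boundConst p ε * Λ.norm ^ p * psiSum ψ y m n ^ p := by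
  obtain ⟨N, rfl⟩ := Nat.exists_eq_add_of_le hmn
  have h1 := hΛ.one_le_norm
  have h2 := one_le_psiSum (y := y) hs.1 hmn
  have ht := isTrajectory_FIter hk hpos hmix hθ hs hΛ y m N (w := Λ.norm * psiSum ψ y m (m + N))
    (le_mul_of_one_le_left (by positivity) h1) (le_mul_of_one_le_right (by positivity) h2)
  refine LVec.norm_le fun α hα => ((trajectoryBound_const p hmix.1 hmix.2.1 _ _ _ _ _ _ _ ht).1 N
    le_rfl α hα).trans ?_
  rw [mul_assoc, ← mul_pow]
  have := one_le_boundConst p ε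
  gcongr
  exact ht.one_le_w

/-- The initial differences are measured by `D` relative to the powers `w ^ deg α`. Keeping `D` free
allows two choices: the norm of the initial difference for the Lipschitz bound, and the constant `2`
for the bound used in the ergodic theorem. -/
theorem norm_FIter_sub_le_aux {ψ : Y → ℝ} (hs : ScoreBound p R Θ ψ) {Λ Λ' : LVec d p X}
    (hΛ : Λ.IsL0) (hΛ' : Λ'.IsL0) {m n : ℕ} (hmn : m ≤ n) (y : ℕ → Y) {D : ℝ}
    (hD : ∀ α, deg α ≤ p → ‖Λ.comp α - Λ'.comp α‖ ≤
      D * ((Λ.norm + Λ'.norm) * psiSum ψ y m n) ^ deg α) :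
    (FIter μ R θ y Λ m n - FIter μ R θ y Λ' m n).norm ≤
      boundConst p ε * rateConst p ε ^ (n - m) * D * (Λ.norm + Λ'.norm) ^ p *
        psiSum ψ y m n ^ p := by
  obtain ⟨N, rfl⟩ := Nat.exists_eq_add_of_le hmn
  have h1 := hΛ.one_le_norm
  have h1' := hΛ'.one_le_norm
  have h2 := one_le_psiSum (y := y) hs.1 hmn
  have hw1 : 1 ≤ Λ.norm + Λ'.norm := by linarith
  set w := (Λ.norm + Λ'.norm) * psiSum ψ y m (m + N) with hw
  have hw' : psiSum ψ y m (m + N) ≤ w := le_mul_of_one_le_left (by positivity) hw1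
  have hw2 : Λ.norm + Λ'.norm ≤ w := le_mul_of_one_le_right (by positivity) h2
  have ht := isTrajectory_FIter hk hpos hmix hθ hs hΛ y m N (w := w) hw' (by linarith)
  have ht' := isTrajectory_FIter hk hpos hmix hθ hs hΛ' y m N (w := w) hw' (by linarith)
  have hD0 : 0 ≤ D := by simpa using (norm_nonneg _).trans (hD 0 (by simp))
  refine LVec.norm_le fun α hα => ?_
  rw [LVec.comp_sub]
  refine ((trajectoryBound_const p hmix.1 hmix.2.1 _ _ _ _ _ _ _ ht).2 _ ht' (fun n _ => ?_) D ?_ N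
    le_rfl α hα).trans ?_
  · refine norm_sub_zero_le (p := p) (ρ := fun n γ => slice (ρ γ) (y (m + n + 1)))
      (L := fun n => (FIter μ R θ y Λ m (m + n)).comp)
      (L' := fun n => (FIter μ R θ y Λ' m (m + n)).comp) (pow_pos hmix.1 2)
      (pow_le_one₀ hmix.1.le hmix.2.1.le) (fun n => hk.isMixing hpos hmix hθ _)
      (fun n z => by rw [← hk.R_eq]; exact hpos _ _ _) (fun n => ?_) (fun n => ?_)
      ((LVec.isL0_iff _).1 (isL0_FIter hk hpos hmix hθ hΛ y m (m + 0)))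
      ((LVec.isL0_iff _).1 (isL0_FIter hk hpos hmix hθ hΛ' y m (m + 0))) n
    · rw [← add_assoc, FIter_succ (by omega)]
      exact hk.isStep _ _
    · rw [← add_assoc, FIter_succ (by omega)]
      exact hk.isStep _ _
  · simpa only [add_zero, FIter_self] using hD
  · rw [mul_assoc _ ((Λ.norm + Λ'.norm) ^ p), ← mul_pow, ← hw, Nat.add_sub_cancel_left]
    have := one_le_boundConst p ε
    have := rateConst_pos p ε
    have := ht.one_le_w
    gcongr

theorem norm_FIter_sub_le {ψ : Y → ℝ} (hs : ScoreBound p R Θ ψ) {Λ Λ' : LVec d p X}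
    (hΛ : Λ.IsL0) (hΛ' : Λ'.IsL0) {m n : ℕ} (hmn : m ≤ n) (y : ℕ → Y) :
    (FIter μ R θ y Λ m n - FIter μ R θ y Λ' m n).norm ≤
      boundConst p ε * rateConst p ε ^ (n - m) * (Λ - Λ').norm * (Λ.norm + Λ'.norm) ^ p *
        psiSum ψ y m n ^ p := by
  refine norm_FIter_sub_le_aux hk hpos hmix hθ hs hΛ hΛ' hmn y fun α _ => ?_
  rw [← LVec.comp_sub]
  refine (LVec.norm_comp_le _ α).trans (le_mul_of_one_le_right (LVec.norm_nonneg _) ?_)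
  have h1 := hΛ.one_le_norm
  have h1' := hΛ'.one_le_norm
  exact one_le_pow₀ (one_le_mul_of_one_le_of_one_le (by linarith) (one_le_psiSum hs.1 hmn))

/-- A bound on the difference of two filters that is not proportional to the initial difference. -/
theorem norm_FIter_sub_le' {ψ : Y → ℝ} (hs : ScoreBound p R Θ ψ) {Λ Λ' : LVec d p X}
    (hΛ : Λ.IsL0) (hΛ' : Λ'.IsL0) {m n : ℕ} (hmn : m ≤ n) (y : ℕ → Y) :
    (FIter μ R θ y Λ m n - FIter μ R θ y Λ' m n).norm ≤
      boundConst p ε * rateConst p ε ^ (n - m) * 2 * (Λ.norm + Λ'.norm) ^ p *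
        psiSum ψ y m n ^ p := by
  -- `D = 2` is enough: two probability measures differ by at most `2`, and for `α ≠ 0` the
  -- difference is at most `Λ.norm + Λ'.norm`, hence at most `w ^ deg α`. Avoiding the factor `(Λ -
  -- Λ').norm` saves one power of the norms.
  refine norm_FIter_sub_le_aux hk hpos hmix hθ hs hΛ hΛ' hmn y fun α _ => ?_
  have h1 := hΛ.one_le_norm
  have h1' := hΛ'.one_le_norm
  have h2 := one_le_psiSum (y := y) hs.1 hmn
  have hw1 : 1 ≤ Λ.norm + Λ'.norm := by linarith
  have hw2 : Λ.norm + Λ'.norm ≤ (Λ.norm + Λ'.norm) * psiSum ψ y m n :=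
    le_mul_of_one_le_right (by positivity) h2
  by_cases h0 : α = 0
  · subst h0
    simp only [deg_zero, pow_zero, mul_one]
    refine (norm_sub_le _ _).trans ?_
    rw [((LVec.isL0_iff _).1 hΛ).norm_eq, ((LVec.isL0_iff _).1 hΛ').norm_eq]
    norm_num
  · have h3 : (Λ.norm + Λ'.norm) * psiSum ψ y m n ≤
        ((Λ.norm + Λ'.norm) * psiSum ψ y m n) ^ deg α :=
      le_self_pow₀ (hw1.trans hw2) fun h => h0 (deg_eq_zero.1 h)
    have h4 := norm_sub_le (Λ.comp α) (Λ'.comp α)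
    have := Λ.norm_comp_le α
    have := Λ'.norm_comp_le α
    linarith

end

end Bounds

theorem contDiffOn_clm {d : ℕ} {F G : Type*} [NormedAddCommGroup F] [NormedSpace ℝ F]
    [NormedAddCommGroup G] [NormedSpace ℝ G] (L : F →L[ℝ] G) {n : WithTop ℕ∞} {f : E d → F}
    {U : Set (E d)} (hf : ContDiffOn ℝ n f U) : ContDiffOn ℝ n (fun θ => L (f θ)) U :=
  L.contDiff.comp_contDiffOn hf

/-! ### Composition with smooth functions -/

section Superposition

variable {d : ℕ} {T : Type*} [TopologicalSpace T] [CompactSpace T]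

theorem exists_contDiffOn_comp_left {F G : Type u} [NormedAddCommGroup F] [NormedSpace ℝ F]
    [NormedAddCommGroup G] [NormedSpace ℝ G] {U : Set (E d)} (hU : IsOpen U) {O : Set F}
    (hO : IsOpen O) {n : ℕ} {h : F → G} (hh : ContDiffOn ℝ n h O) {g : E d → C(T, F)}
    (hg : ContDiffOn ℝ n g U) (hgO : ∀ θ ∈ U, ∀ t, g θ t ∈ O) :
    ∃ k : E d → C(T, G), (∀ θ ∈ U, ∀ t, k θ t = h (g θ t)) ∧ ContDiffOn ℝ n k U := by
  classical
  refine ⟨fun θ => if hc : Continuous fun t => h (g θ t) then ⟨_, hc⟩ else 0, ?_, ?_⟩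
  swap
  · refine contDiffOn_comp_left hU hO hh hg hgO ?_
    intro θ hθ t
    have hc : Continuous fun t => h (g θ t) :=
      hh.continuousOn.comp_continuous (g θ).continuous (hgO θ hθ)
    simp only [dif_pos hc]
    rfl
  · intro θ hθ t
    have hc : Continuous fun t => h (g θ t) :=
      hh.continuousOn.comp_continuous (g θ).continuous (hgO θ hθ)
    simp only [dif_pos hc]
    rfl

/-- The theorem on families over a compact space, applied to the one-point space. -/
theorem contDiff_of_diffTimes {n p : ℕ} {r : E n → ℝ} (hr : DiffTimes p r Set.univ)
    (hc : ∀ α : MultiIndex n, deg α ≤ p → Continuous (mderiv α r)) : ContDiff ℝ p r := by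
  obtain ⟨g, hg, hgc⟩ := contDiffOn_continuousMap_of_mderiv (T := Unit) isOpen_univ
    (f := fun θ _ => r θ) (fun _ => partialDiff_of_diffTimes isOpen_univ hr)
    fun α hα => ((hc α hα).comp continuous_fst).continuousOn
  rw [← contDiffOn_univ]
  have := (evalL (F := ℝ) (T := Unit) ()).contDiff.comp_contDiffOn hgc
  exact this.congr fun θ hθ => (hg θ hθ ()).symm

end Superposition

/-! ### The truncated densities as smooth maps -/

section NormalizedDensity

variable {d dx n p : ℕ}

open Matrix in
theorem ringInverse_toEuclideanCLM {B : Matrix (Fin n) (Fin n) ℝ} (hB : IsUnit B) :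
    Ring.inverse (toEuclideanCLM (n := Fin n) (𝕜 := ℝ) B) = toEuclideanCLM (n := Fin n) (𝕜 := ℝ) B⁻¹ := by
  obtain ⟨u, rfl⟩ := hB
  rw [← coe_units_inv]
  exact Ring.inverse_unit (Units.map (toEuclideanCLM (n := Fin n) (𝕜 := ℝ)).toMonoidHom u)

/-- The space of the arguments of the unnormalized density. -/
abbrev VecOp (n : ℕ) := E n × (E n →L[ℝ] E n)

/-- The unnormalized density `r(B_θ(x)⁻¹(s - A_θ(x)))` on compact sets. -/
theorem exists_contDiffOn_density {U : Set (E d)} (hU : IsOpen U) {S : Set (E n)} {K : Set (E dx)}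
    [CompactSpace S] [CompactSpace K]
    {r : E n → ℝ} {A : E d → E dx → E n} {B : E d → E dx → Matrix (Fin n) (Fin n) ℝ}
    (hB : ∀ θ ∈ U, ∀ x, IsUnit (B θ x)) (hr : DiffTimes p r Set.univ)
    (hA : ∀ x, DiffTimes p (fun θ => A θ x) U)
    (hBd : ∀ x i j, DiffTimes p (fun θ => B θ x i j) U)
    (hrc : ∀ α : MultiIndex n, deg α ≤ p → Continuous (mderiv α r))
    (hAc : ∀ α : MultiIndex d, deg α ≤ p →
      ContinuousOn (fun z : E d × E dx => mderiv α (fun θ => A θ z.2) z.1) (U ×ˢ Set.univ))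
    (hBc : ∀ α : MultiIndex d, deg α ≤ p → ∀ i j,
      ContinuousOn (fun z : E d × E dx => mderiv α (fun θ => B θ z.2 i j) z.1) (U ×ˢ Set.univ)) :
    ∃ g : E d → C(S × K, ℝ), (∀ θ ∈ U, ∀ t, g θ t =
      r (Matrix.toEuclideanLin (B θ t.2)⁻¹ (t.1 - A θ t.2))) ∧ ContDiffOn ℝ p g U := by
  have hval : Continuous fun z : E d × K => (z.1, (z.2 : E dx)) := by fun_prop
  obtain ⟨gA, hgA, hgAc⟩ := contDiffOn_continuousMap_of_mderiv (T := K) hU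
    (f := fun θ x => A θ x) (n := p) (fun x => partialDiff_of_diffTimes hU (hA x))
    fun α hα => (hAc α hα).comp hval.continuousOn fun z hz => ⟨hz.1, trivial⟩
  have hgB := fun i j => contDiffOn_continuousMap_of_mderiv (T := K) hU
    (f := fun θ x => B θ x i j) (n := p) (fun x => partialDiff_of_diffTimes hU (hBd x i j))
    fun α hα => (hBc α hα i j).comp hval.continuousOn fun z hz => ⟨hz.1, trivial⟩
  choose gB hgB hgBc using hgB
  let Φ := Matrix.toEuclideanCLM (n := Fin n) (𝕜 := ℝ)
  let snd : C(S × K, K) := ⟨Prod.snd, continuous_snd⟩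
  let c : C(S × K, VecOp n) := ⟨fun t => ((t.1 : E n), 0), by fun_prop⟩
  let L : Fin n → Fin n → ℝ →L[ℝ] VecOp n := fun i j =>
    ContinuousLinearMap.toSpanSingleton ℝ (0, Φ (Matrix.single i j 1))
  -- The pair `(s - A_θ(x), B_θ(x))` as a map into a space of continuous functions; the matrix is
  -- assembled from its entries, since regularity is assumed entry by entry.
  let f : E d → C(S × K, VecOp n) := fun θ =>
    c - postL (ContinuousLinearMap.inl ℝ (E n) (E n →L[ℝ] E n)) (pullL snd (gA θ)) +
      ∑ i, ∑ j, postL (L i j) (pullL snd (gB i j θ))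
  have hf : ContDiffOn ℝ p f U := by
    refine ContDiffOn.add (contDiffOn_const.sub ?_) (ContDiffOn.sum fun i _ => ContDiffOn.sum
      fun j _ => ?_)
    · exact contDiffOn_clm (postL (T := S × K) (ContinuousLinearMap.inl ℝ (E n) (E n →L[ℝ] E n)))
        (contDiffOn_clm (pullL snd) hgAc)
    · exact contDiffOn_clm (postL (T := S × K) (L i j)) (contDiffOn_clm (pullL snd) (hgBc i j))
  have hfe : ∀ θ ∈ U, ∀ t, f θ t = ((t.1 : E n) - A θ t.2, Φ (B θ t.2)) := by
    intro θ hθ t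
    have h1 : f θ t = ((t.1 : E n), 0) - (gA θ t.2, 0) +
        ∑ i, ∑ j, gB i j θ t.2 • ((0, Φ (Matrix.single i j 1)) : VecOp n) := by
      simp [f, c, L, snd]
    rw [h1]
    conv_rhs => rw [Matrix.matrix_eq_sum_single (B θ t.2)]
    simp only [hgA θ hθ, hgB _ _ θ hθ, map_sum]
    ext1
    · simp [Prod.fst_sum]
    · simp only [Prod.snd_add, Prod.snd_sub, Prod.snd_sum, Prod.smul_snd, sub_zero, zero_add]
      refine Finset.sum_congr rfl fun i _ => Finset.sum_congr rfl fun j _ => ?_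
      rw [← map_smul, Matrix.smul_single, smul_eq_mul, mul_one]
  let O : Set (VecOp n) := Prod.snd ⁻¹' {a | IsUnit a}
  have hO : IsOpen O := Units.isOpen.preimage continuous_snd
  -- The density is a fixed function of this pair. It is `C^p` on the open set of pairs whose second
  -- entry is invertible, because inversion is smooth there.
  let h : VecOp n → ℝ := fun z => r (Ring.inverse z.2 z.1)
  have hh : ContDiffOn ℝ p h O := by
    refine (contDiff_of_diffTimes hr hrc).comp_contDiffOn (ContDiffOn.clm_apply ?_ contDiffOn_fst)
    intro z hz
    obtain ⟨u, hu⟩ := hz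
    have := (contDiffAt_ringInverse ℝ (n := p) u)
    rw [hu] at this
    exact (this.comp z contDiffAt_snd).contDiffWithinAt
  obtain ⟨k, hk, hkc⟩ := exists_contDiffOn_comp_left hU hO hh hf (fun θ hθ t => by
    rw [hfe θ hθ]
    exact (hB θ hθ t.2).map Φ)
  refine ⟨k, fun θ hθ t => ?_, hkc⟩
  rw [hk θ hθ, hfe θ hθ]
  simp only [h]
  rw [ringInverse_toEuclideanCLM (hB θ hθ t.2)]
  rfl

theorem comap_val_neZero {S : Set (E n)} (hm : MeasurableSet S) (hi : (interior S).Nonempty) :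
    NeZero ((volume : Measure (E n)).comap (Subtype.val : S → E n)) := by
  refine ⟨fun h => ?_⟩
  have h1 := congrArg (fun m => m Set.univ) h
  simp only [Measure.coe_zero, Pi.zero_apply] at h1
  rw [(MeasurableEmbedding.subtype_coe hm).comap_apply] at h1
  rw [Set.image_univ, Subtype.range_coe] at h1
  exact (isOpen_interior.measure_pos volume hi).ne' (measure_mono_null interior_subset h1)

theorem comap_val_isFinite {S : Set (E n)} (hc : IsCompact S) :
    IsFiniteMeasure ((volume : Measure (E n)).comap (Subtype.val : S → E n)) := by
  refine ⟨?_⟩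
  rw [(MeasurableEmbedding.subtype_coe hc.measurableSet).comap_apply, Set.image_univ, Subtype.range_coe]
  exact hc.measure_lt_top

/-- The normalized density is a `C^p` map into the space of continuous functions. -/
theorem exists_contDiffOn_normalized {U : Set (E d)} (hU : IsOpen U) {S : Set (E n)}
    {K : Set (E dx)} [CompactSpace S] [CompactSpace K] (hS : IsCompact S) (hSi : (interior S).Nonempty)
    {g : E d → C(S × K, ℝ)} (hg : ContDiffOn ℝ p g U) (hpos : ∀ θ ∈ U, ∀ t, 0 < g θ t)
    {f : E d → E n → K → ℝ} (hf : ∀ θ ∈ U, ∀ t, g θ t = f θ t.1 t.2) :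
    ∃ k : E d → C(S × K, ℝ), (∀ θ ∈ U, ∀ t, k θ t = f θ t.1 t.2 / ∫ s in S, f θ s t.2) ∧
      (∀ θ ∈ U, ∀ t, 0 < k θ t) ∧ ContDiffOn ℝ p k U := by
  let ν := (volume : Measure (E n)).comap (Subtype.val : S → E n)
  have hν : NeZero ν := comap_val_neZero hS.measurableSet hSi
  have hν' : IsFiniteMeasure ν := comap_val_isFinite hS
  let swp : C(K × S, S × K) := ⟨Prod.swap, continuous_swap⟩
  let snd : C(S × K, K) := ⟨Prod.snd, continuous_snd⟩
  let D : E d → C(K, ℝ) := fun θ => integralL K ν (pullL swp (g θ))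
  have hD : ContDiffOn ℝ p D U :=
    contDiffOn_clm (integralL K ν) (contDiffOn_clm (pullL swp) hg)
  have hDe : ∀ θ ∈ U, ∀ x, D θ x = ∫ s in S, f θ s x := fun θ hθ x => by
    rw [← integral_subtype_comap hS.measurableSet fun s => f θ s x]
    change ∫ s, g θ (s, x) ∂ν = _
    exact integral_congr_ae (Eventually.of_forall fun s => hf θ hθ (s, x))
  have hDpos : ∀ θ ∈ U, ∀ x, 0 < D θ x := fun θ hθ x => by
    change 0 < ∫ s, g θ (s, x) ∂ν
    have hc : Continuous fun s => g θ (s, x) := by fun_prop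
    refine (integral_pos_iff_support_of_nonneg (fun s => (hpos θ hθ _).le)
      (hc.integrable_of_hasCompactSupport (HasCompactSupport.of_compactSpace _))).2 ?_
    rw [Set.eq_univ_of_forall (s := Function.support fun s => g θ (s, x))
      fun s => (hpos θ hθ _).ne']
    exact Measure.measure_univ_pos.2 (NeZero.ne ν)
  -- The normalizer is positive for all parameters in `U`, so inversion on `ℝ \ {0}` may be composed
  -- with it.
  obtain ⟨Di, hDi, hDic⟩ := exists_contDiffOn_comp_left hU (h := fun x : ℝ => x⁻¹)
    (isOpen_ne (x := (0 : ℝ))) (fun x hx => (contDiffAt_inv ℝ hx).contDiffWithinAt) hD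
    fun θ hθ x => (hDpos θ hθ x).ne'
  refine ⟨fun θ => g θ * pullL snd (Di θ), fun θ hθ t => ?_, fun θ hθ t => ?_,
    hg.mul (contDiffOn_clm (pullL snd) hDic)⟩
  · rw [ContinuousMap.mul_apply, pullL_apply, hDi θ hθ, hf θ hθ, hDe θ hθ]; rfl
  · rw [ContinuousMap.mul_apply, pullL_apply, hDi θ hθ]
    exact mul_pos (hpos θ hθ t) (inv_pos.2 (hDpos θ hθ _))

end NormalizedDensity

/-! ### Smoothness of the model kernel -/

namespace TruncatedModel

variable {d dx dy p : ℕ} {M : TruncatedModel d dx dy}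

/-- The function `r_θ(y, x' | x)` is a `C^p` map into the space of continuous functions. -/
theorem Regular.exists_contDiffOn (hM : M.Regular p) [CompactSpace M.𝒳] [CompactSpace M.𝒴] :
    ∃ G : E d → C(M.𝒴 × (M.𝒳 × M.𝒳), ℝ),
      (∀ θ ∈ M.Θ', ∀ y x' x, G θ (y, (x', x)) = M.R θ y x' x) ∧
      (∀ θ ∈ M.Θ', ∀ y x' x, 0 < M.R θ y x' x) ∧ ContDiffOn ℝ p G M.Θ' := by
  obtain ⟨gp, hgp, hgpc⟩ := exists_contDiffOn_density (S := M.𝒳) (K := M.𝒳) hM.isOpen_Θ'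
    hM.isUnit_B hM.diff_r hM.diff_A hM.diff_B hM.cont_r hM.cont_A hM.cont_B
  obtain ⟨gq, hgq, hgqc⟩ := exists_contDiffOn_density (S := M.𝒴) (K := M.𝒳) hM.isOpen_Θ'
    hM.isUnit_D hM.diff_s hM.diff_C hM.diff_D hM.cont_s hM.cont_C hM.cont_D
  obtain ⟨kp, hkp, hkp0, hkpc⟩ := exists_contDiffOn_normalized hM.isOpen_Θ' hM.isCompact_𝒳
    hM.interior_𝒳 hgpc (fun θ hθ t => by rw [hgp θ hθ]; exact hM.r_pos _)
    (f := fun θ s x => M.r (Matrix.toEuclideanLin (M.B θ x)⁻¹ (s - M.A θ x))) hgp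
  obtain ⟨kq, hkq, hkq0, hkqc⟩ := exists_contDiffOn_normalized hM.isOpen_Θ' hM.isCompact_𝒴
    hM.interior_𝒴 hgqc (fun θ hθ t => by rw [hgq θ hθ]; exact hM.s_pos _)
    (f := fun θ s x => M.s (Matrix.toEuclideanLin (M.D θ x)⁻¹ (s - M.C θ x))) hgq
  let a : C(M.𝒴 × (M.𝒳 × M.𝒳), M.𝒴 × M.𝒳) := ⟨fun t => (t.1, t.2.1), by fun_prop⟩
  let b : C(M.𝒴 × (M.𝒳 × M.𝒳), M.𝒳 × M.𝒳) := ⟨fun t => t.2, by fun_prop⟩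
  have hGe : ∀ θ ∈ M.Θ', ∀ y x' x, (pullL a (kq θ) * pullL b (kp θ)) (y, (x', x)) =
      M.R θ y x' x := fun θ hθ y x' x => by
    rw [ContinuousMap.mul_apply, pullL_apply, pullL_apply, hkq θ hθ, hkp θ hθ]; rfl
  refine ⟨fun θ => pullL a (kq θ) * pullL b (kp θ), hGe, fun θ hθ y x' x => ?_,
    (contDiffOn_clm (pullL a) hkqc).mul (contDiffOn_clm (pullL b) hkpc)⟩
  rw [← hGe θ hθ, ContinuousMap.mul_apply]
  exact mul_pos (hkq0 θ hθ _) (hkp0 θ hθ _)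

end TruncatedModel

/-! ### Smooth positive families of kernels; mixing and score constants -/

section SmoothFamily

variable {d p : ℕ} {X : Type} [MeasurableSpace X] [MetricSpace X] [CompactSpace X] [BorelSpace X]
  {Y : Type} [MetricSpace Y] [CompactSpace Y]

/-- `G` represents the family `R` as a `C^p` map into the space of continuous functions, which is
positive on `U`. -/
structure IsSmoothFamily (p : ℕ) (R : E d → Y → X → X → ℝ) (U : Set (E d))
    (G : E d → C(Y × (X × X), ℝ)) : Prop where
  isOpen : IsOpen U
  eq : ∀ θ ∈ U, ∀ y x' x, G θ (y, (x', x)) = R θ y x' x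
  pos : ∀ θ ∈ U, ∀ y x' x, 0 < R θ y x' x
  contDiffOn : ContDiffOn ℝ p G U

variable {R : E d → Y → X → X → ℝ} {U Θ : Set (E d)} {G : E d → C(Y × (X × X), ℝ)}

theorem IsSmoothFamily.mono (h : IsSmoothFamily p R U G) (hΘ : IsOpen Θ) (hs : Θ ⊆ U) :
    IsSmoothFamily p R Θ G :=
  ⟨hΘ, fun θ hθ => h.eq θ (hs hθ), fun θ hθ => h.pos θ (hs hθ), h.contDiffOn.mono hs⟩

/-- Point evaluation is continuous and linear on the function space, so it commutes with partial
derivatives: one Banach-valued derivative contains all the pointwise ones. -/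
theorem IsSmoothFamily.isDerivKernel (h : IsSmoothFamily p R U G) {θ : E d} (hθ : θ ∈ U) :
    IsDerivKernel p R θ fun γ => mderiv γ G θ := by
  intro γ hγ y x x'
  rw [mderiv_congr h.isOpen (g := fun ϑ => evalL (y, (x, x')) (G ϑ))
    (fun ϑ hϑ => (h.eq ϑ hϑ y x x').symm) γ hθ,
    mderiv_clm_comp h.isOpen (evalL (y, (x, x'))) (partialDiff_of_contDiffOn h.isOpen
      (h.contDiffOn.of_le (by exact_mod_cast hγ))) hθ]
  rfl

theorem IsSmoothFamily.continuousOn_mderiv (h : IsSmoothFamily p R U G) {γ : MultiIndex d}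
    (hγ : deg γ ≤ p) :
    ContinuousOn (fun z : E d × (Y × (X × X)) => mderiv γ G z.1 z.2) (U ×ˢ Set.univ) :=
  continuousOn_uncurry (contDiffOn_mderiv h.isOpen (k := 0)
    (h.contDiffOn.of_le (by rw [zero_add]; exact_mod_cast hγ))).continuousOn

/-- On sets with compact closure in `U`, the mixing and score conditions are satisfied with
constants. -/
theorem IsSmoothFamily.exists_constants (h : IsSmoothFamily p R U G) {μ : Measure X}
    [IsFiniteMeasure μ] [NeZero μ] (hc : IsCompact (closure Θ)) (hs : closure Θ ⊆ U) :
    ∃ ε c : ℝ, StrongMixing μ R Θ ε ∧ ScoreBound p R Θ (fun _ => c) := by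
  have hK : IsCompact (closure Θ ×ˢ (Set.univ : Set (Y × (X × X)))) := hc.prod isCompact_univ
  have hsub : closure Θ ×ˢ (Set.univ : Set (Y × (X × X))) ⊆ U ×ˢ Set.univ :=
    Set.prod_mono hs subset_rfl
  have hG : ContinuousOn (fun z : E d × (Y × (X × X)) => G z.1 z.2) (closure Θ ×ˢ Set.univ) := by
    have := h.continuousOn_mderiv (γ := 0) (by simp)
    simp only [mderiv_zero] at this
    exact this.mono hsub
  obtain ⟨a, ha0, ha⟩ : ∃ a > 0, ∀ θ ∈ Θ, ∀ y x' x, a ≤ R θ y x' x := by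
    rcases (closure Θ ×ˢ (Set.univ : Set (Y × (X × X)))).eq_empty_or_nonempty with he | hne
    · refine ⟨1, one_pos, fun θ hθ y x' x => ?_⟩
      have : (θ, (y, (x', x))) ∈ closure Θ ×ˢ (Set.univ : Set (Y × (X × X))) :=
        ⟨subset_closure hθ, trivial⟩
      rw [he] at this
      exact this.elim
    · obtain ⟨⟨θ₀, y₀, x₀', x₀⟩, hz, hmin⟩ := hK.exists_isMinOn hne hG
      refine ⟨R θ₀ y₀ x₀' x₀, h.pos θ₀ (hs hz.1) _ _ _, fun θ hθ y x' x => ?_⟩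
      rw [← h.eq θ₀ (hs hz.1), ← h.eq θ (hs (subset_closure hθ))]
      exact hmin (show (θ, (y, (x', x))) ∈ _ from ⟨subset_closure hθ, trivial⟩)
  have hbd : ∀ γ : {α : MultiIndex d // deg α ≤ p}, ∃ b, ∀ θ ∈ Θ, ∀ y x' x,
      |mderiv γ.1 (fun ϑ => R ϑ y x' x) θ| ≤ b := fun γ => by
    obtain ⟨b, hb⟩ := hK.exists_bound_of_continuousOn ((h.continuousOn_mderiv γ.2).mono hsub)
    refine ⟨b, fun θ hθ y x' x => ?_⟩
    rw [h.isDerivKernel (hs (subset_closure hθ)) γ.1 γ.2]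
    exact hb (θ, (y, (x', x))) ⟨subset_closure hθ, trivial⟩
  choose b hb using hbd
  obtain ⟨b', hb'⟩ := (Set.finite_range b).bddAbove
  have hb'' : ∀ γ : MultiIndex d, deg γ ≤ p → ∀ θ ∈ Θ, ∀ y x' x,
      |mderiv γ (fun ϑ => R ϑ y x' x) θ| ≤ max b' 1 := fun γ hγ θ hθ y x' x =>
    (hb ⟨γ, hγ⟩ θ hθ y x' x).trans ((hb' ⟨_, rfl⟩).trans (le_max_left _ _))
  set B := max b' 1
  have hB1 : 1 ≤ B := le_max_right _ _
  -- With the reference measure `μ` itself, mixing asks for `ε ≤ a` from below and `B ≤ ε⁻¹` from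
  -- above; `1 / 2` ensures `ε < 1`. The score bound holds with `B / a`, raised to at least one.
  set ε := min a (min B⁻¹ (1 / 2)) with hε
  have hε0 : 0 < ε := lt_min ha0 (lt_min (by positivity) (by norm_num))
  refine ⟨ε, max 1 (B / a), ⟨hε0, ?_, fun _ _ => μ, fun θ hθ y => ⟨?_, measure_lt_top _ _, ?_⟩⟩,
    fun _ => le_max_left _ _, fun θ hθ x x' y α hα0 hα => ?_⟩
  · exact ((min_le_right _ _).trans (min_le_right _ _)).trans_lt (by norm_num)
  · exact Measure.measure_univ_pos.2 (NeZero.ne μ)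
  · refine fun x s hs => ⟨?_, ?_⟩
    · rw [← setLIntegral_const]
      exact lintegral_mono fun x' => ENNReal.ofReal_le_ofReal
        ((min_le_left _ _).trans (ha θ hθ y x' x))
    · calc ∫⁻ x' in s, ENNReal.ofReal (R θ y x' x) ∂μ ≤ ∫⁻ _ in s, ENNReal.ofReal B ∂μ := by
            refine lintegral_mono fun x' => ENNReal.ofReal_le_ofReal ?_
            have := hb'' 0 (by simp) θ hθ y x' x
            rw [mderiv_zero] at this
            exact (le_abs_self _).trans this
        _ = ENNReal.ofReal B * μ s := by rw [setLIntegral_const]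
        _ ≤ (ENNReal.ofReal ε)⁻¹ * μ s := by
            gcongr
            rw [← ENNReal.ofReal_inv_of_pos hε0]
            refine ENNReal.ofReal_le_ofReal ?_
            rw [le_inv_comm₀ (by positivity) hε0]
            exact (min_le_right _ _).trans (min_le_left _ _)
        _ = _ := by rw [ENNReal.div_eq_inv_mul]
  · have h1 := ha θ hθ y x' x
    calc _ ≤ B := hb'' α hα θ hθ y x' x
      _ = B / a * a := by field_simp
      _ ≤ max 1 (B / a) * R θ y x' x := by gcongr; exact le_max_right _ _
      _ ≤ max 1 (B / a) ^ deg α * R θ y x' x := by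
          gcongr
          · exact ha0.le.trans h1
          · exact le_self_pow₀ (le_max_left _ _) fun h => hα0 (deg_eq_zero.1 h)

end SmoothFamily

/-! ### Derivatives of a normalized density -/

section NormalizeStep

variable {d p : ℕ} {X : Type} [MeasurableSpace X] [MetricSpace X] [CompactSpace X] [BorelSpace X]
  {W : Type} [TopologicalSpace W] [CompactSpace W] {μ : Measure X} [IsFiniteMeasure μ]

theorem integral_pos_of_continuous [NeZero μ] {f : X → ℝ} (hf : Continuous f) (h : ∀ x, 0 < f x) :
    0 < ∫ x, f x ∂μ := by
  refine (integral_pos_iff_support_of_nonneg (fun x => (h x).le)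
    (integrable_of_continuous μ hf)).2 ?_
  rw [Set.eq_univ_of_forall (s := Function.support f) fun x => (h x).ne']
  exact Measure.measure_univ_pos.2 (NeZero.ne μ)

/-- The derivatives of a normalized positive function satisfy the recursion that defines the
densities `f^α`. -/
theorem exists_normalize [NeZero μ] {U : Set (E d)} (hU : IsOpen U) {h : E d → C(W × X, ℝ)}
    (hh : ContDiffOn ℝ p h U) (hpos : ∀ θ ∈ U, ∀ t, 0 < h θ t) :
    ∃ (c : E d → C(W, ℝ)) (g : E d → C(W × X, ℝ)), ContDiffOn ℝ p c U ∧ ContDiffOn ℝ p g U ∧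
      ∀ θ ∈ U, (∀ y, c θ y = ∫ x, h θ (y, x) ∂μ) ∧ (∀ y, 0 < c θ y) ∧
        (∀ y x, g θ (y, x) = h θ (y, x) / c θ y) ∧
        ∀ α, deg α ≤ p → (∀ y, mderiv α c θ y = ∫ x, mderiv α h θ (y, x) ∂μ) ∧
          ∀ y x, mderiv α g θ (y, x) = mderiv α h θ (y, x) / c θ y -
            ∑ β ∈ Finset.Iio α, (mchoose α β : ℝ) * (mderiv β g θ (y, x) *
              ∫ x', mderiv (α - β) h θ (y, x') / c θ y ∂μ) := by
  let c : E d → C(W, ℝ) := fun θ => integralL W μ (h θ)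
  have hc : ContDiffOn ℝ p c U := contDiffOn_clm _ hh
  have hcpos : ∀ θ ∈ U, ∀ y, 0 < c θ y := fun θ hθ y =>
    integral_pos_of_continuous (f := fun x => h θ (y, x)) (by fun_prop) fun x => hpos θ hθ _
  obtain ⟨ci, hci, hcic⟩ := exists_contDiffOn_comp_left hU (h := fun x : ℝ => x⁻¹)
    (isOpen_ne (x := (0 : ℝ))) (fun x hx => (contDiffAt_inv ℝ hx).contDiffWithinAt) hc
    fun θ hθ x => (hcpos θ hθ x).ne'
  let fst : C(W × X, W) := ⟨Prod.fst, continuous_fst⟩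
  let g : E d → C(W × X, ℝ) := fun θ => h θ * pullL fst (ci θ)
  have hg : ContDiffOn ℝ p g U := hh.mul (contDiffOn_clm (pullL fst) hcic)
  have hge : ∀ θ ∈ U, ∀ y x, g θ (y, x) = h θ (y, x) / c θ y := fun θ hθ y x => by
    simp only [g, ContinuousMap.mul_apply, pullL_apply, hci θ hθ, div_eq_mul_inv]
    rfl
  have hcd : ∀ θ ∈ U, ∀ α, deg α ≤ p → ∀ y, mderiv α c θ y = ∫ x, mderiv α h θ (y, x) ∂μ :=
    fun θ hθ α hα y => by
      rw [mderiv_clm_comp hU (integralL W μ) (partialDiff_of_contDiffOn hU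
        (hh.of_le (by exact_mod_cast hα))) hθ, integralL_apply]
  refine ⟨c, g, hc, hg, fun θ hθ => ⟨fun y => rfl, hcpos θ hθ, hge θ hθ, fun α hα =>
    ⟨hcd θ hθ α hα, fun y x => ?_⟩⟩⟩
  -- Instead of a quotient rule, the Leibniz rule is applied to `g * c = h`, divided by `c`, and
  -- solved for the term `β = α`. Since `c` is the integral of `h`, its derivatives divided by `c`
  -- are the integrals appearing in the recursion.
  have hprod : Set.EqOn (fun θ => ContinuousLinearMap.mul ℝ C(W × X, ℝ) (g θ) (pullL fst (c θ))) h
      U := fun θ hθ => by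
    ext ⟨y, x⟩
    simp only [ContinuousLinearMap.mul_apply', ContinuousMap.mul_apply, pullL_apply, hge θ hθ]
    exact div_mul_cancel₀ _ (hcpos θ hθ y).ne'
  have h1 := mderiv_congr hU hprod α hθ
  rw [mderiv_bilin hU (ContinuousLinearMap.mul ℝ C(W × X, ℝ)) (hg.of_le (by exact_mod_cast hα))
    (contDiffOn_clm (pullL fst) (hc.of_le (by exact_mod_cast hα))) hθ] at h1
  have h2 := congrArg (fun f : C(W × X, ℝ) => f (y, x)) h1
  simp only [ContinuousMap.sum_apply, ContinuousMap.smul_apply, ContinuousLinearMap.mul_apply',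
    ContinuousMap.mul_apply, smul_eq_mul] at h2
  have h3 : ∀ β ∈ Finset.Iic α, mderiv (α - β) (fun θ => pullL fst (c θ)) θ (y, x) =
      c θ y * ∫ x', mderiv (α - β) h θ (y, x') / c θ y ∂μ := fun β hβ => by
    have hd := deg_sub_add (Finset.mem_Iic.1 hβ)
    have hle : deg (α - β) ≤ p := by omega
    rw [mderiv_clm_comp hU (pullL fst) (partialDiff_of_contDiffOn hU
      (hc.of_le (by exact_mod_cast hle))) hθ, pullL_apply]
    change mderiv (α - β) c θ y = _
    rw [hcd θ hθ _ hle, integral_div, mul_div_cancel₀ _ (hcpos θ hθ y).ne']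
  rw [← Finset.Iio_insert, Finset.sum_insert (by simp), mchoose_self, tsub_self, mderiv_zero] at h2
  rw [Finset.sum_congr rfl fun β hβ => by rw [h3 β (Finset.mem_Iic.2 (Finset.mem_Iio.1 hβ).le)]]
    at h2
  rw [pullL_apply, Nat.cast_one, one_mul] at h2
  have h4 : (c θ) (fst (y, x)) = c θ y := rfl
  rw [h4] at h2
  rw [← h2, eq_sub_iff_add_eq, add_div, mul_div_cancel_right₀ _ (hcpos θ hθ y).ne', add_right_inj,
    Finset.sum_div]
  refine Finset.sum_congr rfl fun β _ => ?_
  have := (hcpos θ hθ y).ne'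
  field_simp

end NormalizeStep

/-! ### Derivatives of the filter -/

section FilterDerivatives

variable {d p : ℕ} {X : Type} [MeasurableSpace X] [MetricSpace X] [CompactSpace X] [BorelSpace X]
  {Y : Type} [MetricSpace Y] [CompactSpace Y]
  {μ : Measure X} [IsFiniteMeasure μ] [NeZero μ] {R : E d → Y → X → X → ℝ} {U : Set (E d)}
  {G : E d → C(Y × (X × X), ℝ)}

theorem integral_swap_of_continuous {a b : Measure X} [IsFiniteMeasure a] [IsFiniteMeasure b]
    {f : X → X → ℝ} (hf : Continuous fun z : X × X => f z.1 z.2) :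
    ∫ x, ∫ x', f x x' ∂b ∂a = ∫ x', ∫ x, f x x' ∂a ∂b :=
  integral_integral_swap
    (hf.integrable_of_hasCompactSupport (HasCompactSupport.of_compactSpace _))

theorem rIter_succ (θ : E d) (y : ℕ → Y) {m n : ℕ} (h : n ≠ m) (x' x : X) :
    rIter μ R θ y m (n + 1) x' x =
      ∫ x'', R θ (y (n + 1)) x' x'' * rIter μ R θ y m n x'' x ∂μ := by
  rw [rIter]; exact if_neg h

theorem rIter_shift (θ : E d) (y : ℕ → Y) (m k : ℕ) :
    rIter μ R θ y m (m + (k + 1)) = rIter μ R θ (fun i => y (m + i)) 0 (k + 1) := by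
  induction k with
  | zero => funext x' x; simp [rIter]
  | succ k ih =>
    rw [← add_assoc, ← add_assoc]
    funext x' x
    rw [rIter_succ _ _ (by omega), rIter_succ _ _ (by omega), add_assoc m k 1, ih]
    rfl

theorem filterDens_shift (θ : E d) (y : ℕ → Y) (m k : ℕ) (l : Measure X) :
    filterDens μ R θ y m (m + (k + 1)) l =
      filterDens μ R θ (fun i => y (m + i)) 0 (k + 1) l := by
  funext x
  rw [filterDens, filterDens, rIter_shift]

theorem filterProb_shift (θ : E d) (y : ℕ → Y) (m k : ℕ) (l : Measure X) (B : Set X) :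
    filterProb μ R θ y m (m + (k + 1)) l B =
      filterProb μ R θ (fun i => y (m + i)) 0 (k + 1) l B := by
  rw [filterProb, filterProb, filterDens_shift]

theorem IsSmoothFamily.exists_rIter_eq (h : IsSmoothFamily p R U G) {θ : E d} (hθ : θ ∈ U)
    (y : ℕ → Y) (k : ℕ) : ∃ V : C(X × X, ℝ), (∀ x' x, rIter μ R θ y 0 (k + 1) x' x = V (x', x)) ∧
      ∀ z, 0 < V z := by
  induction k with
  | zero =>
    refine ⟨slice (G θ) (y 1), fun x' x => ?_, fun z => ?_⟩
    · rw [slice_apply, h.eq θ hθ]; simp [rIter]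
    · rw [slice_apply, h.eq θ hθ]; exact h.pos θ hθ _ _ _
  | succ k ih =>
    obtain ⟨V, hV, hV0⟩ := ih
    let f : C((X × X) × X, ℝ) := ⟨fun t => G θ (y (k + 2), (t.1.1, t.2)) * V (t.2, t.1.2),
      by fun_prop⟩
    refine ⟨⟨fun z => ∫ x, f (z, x) ∂μ, continuous_integral_of_compact μ f⟩, fun x' x => ?_,
      fun z => ?_⟩
    · rw [rIter_succ _ _ (by omega)]
      simp only [hV]
      exact integral_congr_ae (Eventually.of_forall fun x'' => by simp [f, h.eq θ hθ])
    · refine integral_pos_of_continuous (f := fun x => f (z, x)) (by fun_prop) fun x => ?_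
      refine mul_pos ?_ (hV0 _)
      rw [h.eq θ hθ]
      exact h.pos θ hθ _ _ _

/-- The unnormalized filter. -/
def unnormDens (μ : Measure X) (R : E d → Y → X → X → ℝ) (θ : E d) (y : ℕ → Y) (l : Measure X)
    (k : ℕ) (x : X) : ℝ := ∫ x', rIter μ R θ y 0 k x x' ∂l

variable {l : Measure X} [IsProbabilityMeasure l]

theorem IsSmoothFamily.continuous_unnormDens (h : IsSmoothFamily p R U G) {θ : E d} (hθ : θ ∈ U)
    (y : ℕ → Y) (k : ℕ) : Continuous (unnormDens μ R θ y l (k + 1)) := by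
  obtain ⟨V, hV, -⟩ := h.exists_rIter_eq (μ := μ) hθ y k
  unfold unnormDens
  simp_rw [hV]
  exact continuous_integral_of_compact l V

theorem IsSmoothFamily.unnormDens_pos (h : IsSmoothFamily p R U G) {θ : E d} (hθ : θ ∈ U)
    (y : ℕ → Y) (k : ℕ) (x : X) : 0 < unnormDens μ R θ y l (k + 1) x := by
  obtain ⟨V, hV, hV0⟩ := h.exists_rIter_eq (μ := μ) hθ y k
  unfold unnormDens
  simp_rw [hV]
  exact integral_pos_of_continuous (by fun_prop) fun _ => hV0 _

theorem unnormDens_one (θ : E d) (y : ℕ → Y) (x : X) :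
    unnormDens μ R θ y l 1 x = ∫ x', R θ (y 1) x x' ∂l := by
  simp [unnormDens, rIter]

theorem IsSmoothFamily.unnormDens_succ (h : IsSmoothFamily p R U G) {θ : E d} (hθ : θ ∈ U)
    (y : ℕ → Y) (k : ℕ) (x : X) : unnormDens μ R θ y l (k + 2) x =
      ∫ x'', R θ (y (k + 2)) x x'' * unnormDens μ R θ y l (k + 1) x'' ∂μ := by
  obtain ⟨V, hV, -⟩ := h.exists_rIter_eq (μ := μ) hθ y k
  unfold unnormDens
  simp_rw [show k + 2 = (k + 1) + 1 from rfl]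
  simp_rw [rIter_succ θ y (show k + 1 ≠ 0 by omega), hV, ← h.eq θ hθ]
  rw [integral_swap_of_continuous (f := fun x' x'' => G θ (y (k + 1 + 1), (x, x'')) * V (x'', x'))
    (by fun_prop)]
  simp_rw [integral_const_mul]

theorem IsSmoothFamily.filterDens_eq (h : IsSmoothFamily p R U G) {θ : E d} (hθ : θ ∈ U)
    (y : ℕ → Y) (k : ℕ) (x : X) : filterDens μ R θ y 0 (k + 1) l x =
      unnormDens μ R θ y l (k + 1) x / ∫ x', unnormDens μ R θ y l (k + 1) x' ∂μ := by
  obtain ⟨V, hV, -⟩ := h.exists_rIter_eq (μ := μ) hθ y k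
  unfold filterDens unnormDens
  simp_rw [hV]
  rw [integral_swap_of_continuous (f := fun x' x'' => V (x'', x')) (by fun_prop)]

/-- The bilinear map `(g, ρ) ↦ ((y, x) ↦ ∫ ρ(y_n, x, x') g(y, x') μ(dx'))`. -/
def predictL (Y : Type) [MetricSpace Y] [CompactSpace Y] (μ : Measure X) [IsFiniteMeasure μ]
    (n : ℕ) : C((ℕ → Y) × X, ℝ) →L[ℝ] C(Y × (X × X), ℝ) →L[ℝ] C((ℕ → Y) × X, ℝ) :=
  (ContinuousLinearMap.compL ℝ _ _ _ (integralL ((ℕ → Y) × X) μ)).comp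
    ((ContinuousLinearMap.mul ℝ C(((ℕ → Y) × X) × X, ℝ)).bilinearComp
      (pullL ⟨fun t => (t.1.1, t.2), by fun_prop⟩)
      (pullL ⟨fun t => (t.1.1 n, (t.1.2, t.2)), by fun_prop⟩))

theorem predictL_apply (n : ℕ) (g : C((ℕ → Y) × X, ℝ)) (ρ : C(Y × (X × X), ℝ)) (y : ℕ → Y) (x : X) :
    predictL Y μ n g ρ (y, x) = ∫ x', g (y, x') * ρ (y n, (x, x')) ∂μ := rfl

/-- The linear map `ρ ↦ ((y, x) ↦ ∫ ρ(y_1, x, x') l(dx'))`. -/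
def predictInitL (Y : Type) [MetricSpace Y] [CompactSpace Y] (l : Measure X)
    [IsProbabilityMeasure l] : C(Y × (X × X), ℝ) →L[ℝ] C((ℕ → Y) × X, ℝ) :=
  (integralL ((ℕ → Y) × X) l).comp (pullL ⟨fun t => (t.1.1 1, (t.1.2, t.2)), by fun_prop⟩)

theorem predictInitL_apply (ρ : C(Y × (X × X), ℝ)) (y : ℕ → Y) (x : X) :
    predictInitL Y l ρ (y, x) = ∫ x', ρ (y 1, (x, x')) ∂l := rfl

/-- The filter density `g` after step `k + 1` and the normalizing constant `c` of that step are
`C^p` maps, whose derivatives are given by the derivative recursion. -/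
structure IsFilterFamily (μ : Measure X) (p : ℕ) (R : E d → Y → X → X → ℝ) (U : Set (E d))
    (l : Measure X) [IsProbabilityMeasure l] (k : ℕ) (c : E d → C(ℕ → Y, ℝ))
    (g : E d → C((ℕ → Y) × X, ℝ)) : Prop where
  contDiffOn_c : ContDiffOn ℝ p c U
  contDiffOn_g : ContDiffOn ℝ p g U
  c_pos : ∀ θ ∈ U, ∀ y, 0 < c θ y
  g_pos : ∀ θ ∈ U, ∀ y x, 0 < g θ (y, x)
  g_eq : ∀ θ ∈ U, ∀ y x, g θ (y, x) = filterDens μ R θ y 0 (k + 1) l x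
  c_eq : ∀ θ ∈ U, ∀ y, c θ y = ∫ x, rDeriv R 0 θ (y (k + 1))
    ((FIter μ R θ y (initVec d p l) 0 k).comp 0) x ∂μ
  mderiv_g : ∀ θ ∈ U, ∀ α, deg α ≤ p → ∀ y x, mderiv α g θ (y, x) =
    fDens μ R θ (y (k + 1)) (FIter μ R θ y (initVec d p l) 0 k) α x
  mderiv_c : ∀ θ ∈ U, ∀ α, deg α ≤ p → ∀ y, mderiv α c θ y =
    c θ y * ∫ x, sDens μ R θ (y (k + 1)) (FIter μ R θ y (initVec d p l) 0 k) α x ∂μ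

/-- If the derivatives of the unnormalized density `h` are the numerators of `s^α`, dividing by its
integral gives `s^α` itself, and the normalization lemma reproduces the recursion that defines
`fDens`, order by order. -/
theorem IsSmoothFamily.isFilterFamily_of_step (hG : IsSmoothFamily p R U G) {k : ℕ}
    {h : E d → C((ℕ → Y) × X, ℝ)} (hh : ContDiffOn ℝ p h U) (hpos : ∀ θ ∈ U, ∀ t, 0 < h θ t)
    (hd : ∀ θ ∈ U, ∀ α, deg α ≤ p → ∀ y x, mderiv α h θ (y, x) =
      ∑ β ∈ Finset.Iic α, (mchoose α β : ℝ) * rDeriv R (α - β) θ (y (k + 1))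
        ((FIter μ R θ y (initVec d p l) 0 k).comp β) x)
    (hf : ∀ θ ∈ U, ∀ y x, h θ (y, x) / ∫ x', h θ (y, x') ∂μ =
      filterDens μ R θ y 0 (k + 1) l x) :
    ∃ c g, IsFilterFamily μ p R U l k c g := by
  obtain ⟨c, g, hc, hg, H⟩ := exists_normalize (μ := μ) hG.isOpen hh hpos
  have hh0 : ∀ θ ∈ U, ∀ y x, h θ (y, x) = rDeriv R 0 θ (y (k + 1))
      ((FIter μ R θ y (initVec d p l) 0 k).comp 0) x := fun θ hθ y x => by
    have := hd θ hθ 0 (by simp) y x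
    rw [mderiv_zero] at this
    rw [this, show Finset.Iic (0 : MultiIndex d) = {0} by ext; simp, Finset.sum_singleton]
    simp [mchoose_self]
  have hce : ∀ θ ∈ U, ∀ y, c θ y = ∫ x, rDeriv R 0 θ (y (k + 1))
      ((FIter μ R θ y (initVec d p l) 0 k).comp 0) x ∂μ := fun θ hθ y => by
    rw [(H θ hθ).1]; exact integral_congr_ae (Eventually.of_forall fun x => hh0 θ hθ y x)
  have hs : ∀ θ ∈ U, ∀ α, deg α ≤ p → ∀ y x, mderiv α h θ (y, x) / c θ y =
      sDens μ R θ (y (k + 1)) (FIter μ R θ y (initVec d p l) 0 k) α x := fun θ hθ α hα y x => by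
    rw [hd θ hθ α hα, sDens, hce θ hθ, Finset.sum_div]
    exact Finset.sum_congr rfl fun β _ => mul_div_assoc _ _ _
  refine ⟨c, g, hc, hg, fun θ hθ => (H θ hθ).2.1, fun θ hθ y x => ?_, fun θ hθ y x => ?_, hce,
    fun θ hθ α hα y x => ?_, fun θ hθ α hα y => ?_⟩
  · rw [(H θ hθ).2.2.1]; exact div_pos (hpos θ hθ _) ((H θ hθ).2.1 y)
  · rw [(H θ hθ).2.2.1, (H θ hθ).1, hf θ hθ]
  · induction hn : deg α using Nat.strong_induction_on generalizing α with
    | _ n ih =>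
      rw [((H θ hθ).2.2.2 α hα).2, fDens_eq, hs θ hθ α hα]
      congr 1
      refine Finset.sum_congr rfl fun β hβ => ?_
      have h1 := deg_lt_deg (Finset.mem_Iio.1 hβ)
      have h2 := deg_sub_add (Finset.mem_Iio.1 hβ).le
      rw [ih (deg β) (by omega) β (by omega) rfl,
        integral_congr_ae (Eventually.of_forall fun x' => hs θ hθ (α - β) (by omega) y x')]
  · rw [((H θ hθ).2.2.2 α hα).1, ← integral_const_mul]
    refine integral_congr_ae (Eventually.of_forall fun x => ?_)
    simp only
    rw [← hs θ hθ α hα, mul_div_cancel₀ _ ((H θ hθ).2.1 y).ne']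

/-- Induction over time. The next unnormalized density is bilinear in the present filter density and
the kernel, so the Leibniz rule produces the numerator of `s^α`: the derivative of order `β` of the
filter density is the density of component `β` of `FIter`. -/
theorem IsSmoothFamily.exists_isFilterFamily (hG : IsSmoothFamily p R U G) (k : ℕ) :
    ∃ c g, IsFilterFamily μ p R U l k c g := by
  induction k with
  | zero =>
    refine hG.isFilterFamily_of_step (h := fun θ => predictInitL Y l (G θ))
      (contDiffOn_clm _ hG.contDiffOn) (fun θ hθ t => ?_) (fun θ hθ α hα y x => ?_)
      fun θ hθ y x => ?_
    · exact integral_pos_of_continuous (μ := l) (f := fun x' => G θ (t.1 1, (t.2, x')))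
        (by fun_prop) fun x' => by rw [hG.eq θ hθ]; exact hG.pos θ hθ _ _ _
    · rw [mderiv_clm_comp hG.isOpen (predictInitL Y l) (partialDiff_of_contDiffOn hG.isOpen
        (hG.contDiffOn.of_le (by exact_mod_cast hα))) hθ, predictInitL_apply]
      -- The initial law does not depend on `θ`; all components of `initVec` except the zeroth
      -- vanish.
      rw [Finset.sum_eq_single 0]
      · rw [mchoose_zero_right, tsub_zero, (hG.isDerivKernel hθ).rDeriv_eq hα, FIter,
          LVec.comp_initVec, if_pos rfl, sInt_toSignedMeasure]
        simp [slice_apply]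
      · intro β hβ h0
        rw [FIter, LVec.comp_initVec, if_neg h0]
        simp [rDeriv]
      · intro h0
        exact absurd (Finset.mem_Iic.2 zero_le) h0
    · rw [hG.filterDens_eq hθ]
      simp only [predictInitL_apply, hG.eq θ hθ, zero_add, unnormDens_one]
  | succ k ih =>
    obtain ⟨c, g, H⟩ := ih
    refine hG.isFilterFamily_of_step (h := fun θ => predictL Y μ (k + 2) (g θ) (G θ))
      (contDiffOn_bilin _ H.contDiffOn_g hG.contDiffOn) (fun θ hθ t => ?_)
      (fun θ hθ α hα y x => ?_) fun θ hθ y x => ?_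
    · exact integral_pos_of_continuous
        (f := fun x' => g θ (t.1, x') * G θ (t.1 (k + 2), (t.2, x')))
        (by fun_prop) fun x' => by
          rw [hG.eq θ hθ]; exact mul_pos (H.g_pos θ hθ _ _) (hG.pos θ hθ _ _ _)
    · rw [mderiv_bilin hG.isOpen (predictL Y μ (k + 2))
        (H.contDiffOn_g.of_le (by exact_mod_cast hα))
        (hG.contDiffOn.of_le (by exact_mod_cast hα)) hθ]
      simp only [ContinuousMap.sum_apply, ContinuousMap.smul_apply, smul_eq_mul, predictL_apply]
      refine Finset.sum_congr rfl fun β hβ => ?_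
      have hd := deg_sub_add (Finset.mem_Iic.1 hβ)
      congr 1
      rw [(hG.isDerivKernel hθ).rDeriv_eq (by omega), FIter_succ (by omega),
        comp_FStep _ _ (by omega), sInt_withDensityᵥ μ
          (integrable_of_continuous μ ((hG.isDerivKernel hθ).continuous_fDens (by omega) _ _))
          (f := fun x' => slice (mderiv (α - β) G θ) (y (k + 1 + 1)) (x, x')) (C := ‖mderiv (α - β) G θ‖)
          (by fun_prop) (fun x' => (mderiv (α - β) G θ).norm_coe_le_norm _)]
      refine integral_congr_ae (Eventually.of_forall fun x' => ?_)
      simp only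
      rw [H.mderiv_g θ hθ β (by omega), slice_apply, mul_comm]
    -- Normalizing at every step or only at the end gives the same filter: the mass `D` accumulated
    -- before this step is a common factor of numerator and denominator.
    · set D := ∫ x', unnormDens μ R θ y l (k + 1) x' ∂μ with hD
      have hDpos : 0 < D := integral_pos_of_continuous (hG.continuous_unnormDens hθ y k)
        (hG.unnormDens_pos hθ y k)
      have hN : ∀ x, unnormDens μ R θ y l (k + 1 + 1) x =
          D * predictL Y μ (k + 2) (g θ) (G θ) (y, x) := fun x => by
        rw [hG.unnormDens_succ hθ, predictL_apply, ← integral_const_mul]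
        refine integral_congr_ae (Eventually.of_forall fun x' => ?_)
        simp only
        rw [H.g_eq θ hθ, hG.filterDens_eq hθ, hG.eq θ hθ]
        rw [← hD]
        field_simp
      rw [hG.filterDens_eq hθ, hN x]
      simp_rw [hN]
      rw [integral_const_mul, mul_div_mul_left _ _ hDpos.ne']

/-- The density at a point and the probability of a set are continuous linear functionals of one
`C^p` map `g`, and commute with its derivatives. A time shift reduces to `m = 0`. -/
theorem IsSmoothFamily.filter_derivatives (hG : IsSmoothFamily p R U G) {m n : ℕ} (hmn : m < n)
    (y : ℕ → Y) :
    (∀ x, DiffTimes p (fun θ => filterDens μ R θ y m n l x) U) ∧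
    (∀ B, MeasurableSet B → DiffTimes p (fun θ => filterProb μ R θ y m n l B) U) ∧
    ∀ θ ∈ U, ∀ α : MultiIndex d, deg α ≤ p →
      (∀ x, mderiv α (fun ϑ => filterDens μ R ϑ y m n l x) θ =
        fIter μ R θ y (initVec d p l) m n α x) ∧
      (∀ B, MeasurableSet B → mderiv α (fun ϑ => filterProb μ R ϑ y m n l B) θ =
          (FIter μ R θ y (initVec d p l) m n).comp α B) := by
  obtain ⟨k, rfl⟩ : ∃ k, n = m + (k + 1) := ⟨n - m - 1, by omega⟩
  obtain ⟨c, g, H⟩ := hG.exists_isFilterFamily (μ := μ) (l := l) k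
  set y' : ℕ → Y := fun i => y (m + i) with hy'
  have hU := hG.isOpen
  let La := fun x : X => evalL (F := ℝ) (y', x)
  let Lb := fun B : Set X => (intL (μ.restrict B)).comp
    (pullL (F := ℝ) (⟨fun x => (y', x), by fun_prop⟩ : C(X, (ℕ → Y) × X)))
  have hLb : ∀ B f, Lb B f = ∫ x in B, f (y', x) ∂μ := fun B f => rfl
  have ha : ∀ x, Set.EqOn (fun θ => filterDens μ R θ y m (m + (k + 1)) l x)
      (fun θ => La x (g θ)) U := fun x θ hθ => by
    simp only
    rw [filterDens_shift, ← H.g_eq θ hθ]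
    rfl
  have hb : ∀ B, Set.EqOn (fun θ => filterProb μ R θ y m (m + (k + 1)) l B)
      (fun θ => Lb B (g θ)) U := fun B θ hθ => by
    simp only [hLb]
    rw [filterProb_shift, filterProb]
    exact integral_congr_ae (Eventually.of_forall fun x => (H.g_eq θ hθ y' x).symm)
  refine ⟨fun x => diffTimes_of_contDiffOn hU ((contDiffOn_clm (La x) H.contDiffOn_g).congr (ha x)),
    fun B _ => diffTimes_of_contDiffOn hU ((contDiffOn_clm (Lb B) H.contDiffOn_g).congr (hb B)),
    fun θ hθ α hα => ⟨fun x => ?_, fun B hB => ?_⟩⟩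
  · rw [mderiv_congr hU (ha x) α hθ, mderiv_clm_comp hU (La x) (partialDiff_of_contDiffOn hU
      (H.contDiffOn_g.of_le (by exact_mod_cast hα))) hθ, fIter,
      show m + (k + 1) - 1 = m + k by omega, FIter_shift]
    exact H.mderiv_g θ hθ α hα y' x
  · rw [mderiv_congr hU (hb B) α hθ, mderiv_clm_comp hU (Lb B) (partialDiff_of_contDiffOn hU
      (H.contDiffOn_g.of_le (by exact_mod_cast hα))) hθ]
    simp only [hLb]
    rw [FIter_shift,
      FIter_succ (by omega), comp_FStep _ _ hα, withDensityᵥ_apply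
        (integrable_of_continuous μ ((hG.isDerivKernel hθ).continuous_fDens hα _ _)) hB]
    exact integral_congr_ae (Eventually.of_forall fun x => H.mderiv_g θ hθ α hα y' x)

end FilterDerivatives

/-! ### Topology and measurability of vector measures -/

section LVecTopology

variable {d p : ℕ} {X : Type*} [MeasurableSpace X]

namespace LVec

theorem norm_sub_self (Λ : LVec d p X) : (Λ - Λ).norm = 0 :=
  le_antisymm (norm_le fun α _ => by rw [comp_sub, sub_self, _root_.norm_zero]) (norm_nonneg _)

theorem isOpen_ball (Λ : LVec d p X) (ε : ℝ) : IsOpen {Λ' : LVec d p X | (Λ' - Λ).norm < ε} := by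
  intro Λ' hΛ'
  refine ⟨ε - (Λ' - Λ).norm, sub_pos.2 hΛ', fun Λ'' h => ?_⟩
  have := norm_sub_le_add_sub Λ'' Λ' Λ
  simp only [Set.mem_ofPred_eq] at hΛ' ⊢
  linarith

theorem tendsto_nhds_iff {ι : Type*} {l : Filter ι} {f : ι → LVec d p X} {Λ : LVec d p X} :
    Tendsto f l (𝓝 Λ) ↔ Tendsto (fun i => (f i - Λ).norm) l (𝓝 0) := by
  constructor
  · intro h
    rw [Metric.tendsto_nhds]
    intro ε hε
    have : {Λ' : LVec d p X | (Λ' - Λ).norm < ε} ∈ 𝓝 Λ :=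
      (isOpen_ball Λ ε).mem_nhds (show (Λ - Λ).norm < ε by rwa [norm_sub_self])
    filter_upwards [h this] with i hi
    rw [Real.dist_0_eq_abs, abs_of_nonneg (norm_nonneg _)]
    exact hi
  · intro h
    rw [tendsto_nhds]
    intro s hs hΛ
    obtain ⟨ε, hε, hsub⟩ := hs Λ hΛ
    filter_upwards [h.eventually (gt_mem_nhds hε)] with i hi
    exact hsub _ hi

theorem continuous_apply (α : MultiIndex d) (A : Set X) :
    Continuous fun Λ : LVec d p X => Λ.comp α A := by
  rw [continuous_iff_continuousAt]
  intro Λ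
  rw [ContinuousAt, tendsto_iff_norm_sub_tendsto_zero]
  have h : Tendsto (fun Λ' : LVec d p X => (Λ' - Λ).norm) (𝓝 Λ) (𝓝 0) :=
    tendsto_nhds_iff.1 tendsto_id
  refine squeeze_zero (fun _ => _root_.norm_nonneg _) (fun Λ' => ?_) h
  have := (abs_apply_le_norm ((Λ' - Λ).comp α) A).trans (norm_comp_le _ α)
  rwa [comp_sub, sub_apply] at this

/-- Being a probability measure is expressed by one closed condition for each measurable set. There
may be uncountably many of them, but the intersection is still closed, hence Borel. -/
theorem isClosed_isL0 [MetricSpace X] [CompactSpace X] [BorelSpace X] :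
    IsClosed {Λ : LVec d p X | Λ.IsL0} := by
  have : {Λ : LVec d p X | Λ.IsL0} =
      (⋂ A : {A : Set X // MeasurableSet A}, {Λ : LVec d p X | 0 ≤ Λ.comp 0 A.1}) ∩
        {Λ | Λ.comp 0 Set.univ = 1} := by
    ext Λ
    simp only [Set.mem_ofPred_eq, Set.mem_inter_iff, Set.mem_iInter, isL0_iff]
    constructor
    · intro h
      refine ⟨fun A => ?_, h.mass_eq⟩
      obtain ⟨a, _, ha⟩ := h
      rw [ha, Measure.toSignedMeasure_apply_measurable A.2]
      exact measureReal_nonneg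
    · exact fun h => isProb_of_nonneg (fun A hA => h.1 ⟨A, hA⟩) h.2
  rw [this]
  exact (isClosed_iInter fun A : {A : Set X // MeasurableSet A} => isClosed_le continuous_const (continuous_apply 0 A.1)).inter
    (isClosed_eq (continuous_apply 0 _) continuous_const)

end LVec

instance : BorelSpace (LVec d p X) := ⟨rfl⟩

theorem LVec.measurableSet_isL0 [MetricSpace X] [CompactSpace X] [BorelSpace X] :
    MeasurableSet {Λ : LVec d p X | Λ.IsL0} := isClosed_isL0.measurableSet

end LVecTopology

/-! ### Joint continuity and measurability of the filter step -/

section StepContinuity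

variable {d p : ℕ} {X : Type} [MeasurableSpace X] [MetricSpace X] [CompactSpace X] [BorelSpace X]
  {Y : Type} [MetricSpace Y] [CompactSpace Y] [MeasurableSpace Y] [BorelSpace Y]
  {μ : Measure X} [IsFiniteMeasure μ] [NeZero μ] {R : E d → Y → X → X → ℝ} {Θ : Set (E d)} {θ : E d}
  {ρ : MultiIndex d → C(Y × (X × X), ℝ)}
  (hk : IsDerivKernel p R θ ρ) (hpos : ∀ y x x', 0 < R θ y x x')
  {ε : ℝ} (hmix : StrongMixing μ R Θ ε) (hθ : θ ∈ Θ)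

include hk in
theorem continuous_rDeriv_uncurry {γ : MultiIndex d} (hγ : deg γ ≤ p) (l : SignedMeasure X) :
    Continuous fun z : Y × X => rDeriv R γ θ z.1 l z.2 := by
  simp_rw [hk.rDeriv_eq hγ]
  exact continuous_sInt (T := Y × X) ⟨fun t => ρ γ (t.1.1, (t.1.2, t.2)), by fun_prop⟩ l

include hk hpos hmix hθ

theorem integral_rDeriv_pos {Λ : LVec d p X} (hΛ : Λ.IsL0) (y : Y) :
    0 < ∫ x, rDeriv R 0 θ y (Λ.comp 0) x ∂μ := by
  rw [integral_eq_mass_withDensityᵥ (hk.continuous_rDeriv (by simp) y _),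
    hk.withDensityᵥ_rDeriv (by simp) y]
  exact (((LVec.isL0_iff Λ).1 hΛ).mass_kerOp_pos (pow_pos hmix.1 2)
    (hk.isMixing hpos hmix hθ y) fun z => by rw [← hk.R_eq]; exact hpos _ _ _).1

theorem continuous_sDens_uncurry {Λ : LVec d p X} (hΛ : Λ.IsL0) {α : MultiIndex d}
    (hα : deg α ≤ p) : Continuous fun z : Y × X => sDens μ R θ z.1 Λ α z.2 := by
  unfold sDens
  refine continuous_finsetSum _ fun β hβ => Continuous.const_mul (Continuous.div ?_ ?_ ?_) _
  · have := deg_sub_add (Finset.mem_Iic.1 hβ)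
    exact continuous_rDeriv_uncurry hk (by omega) _
  · exact (continuous_integral_of_compact μ
      ⟨_, continuous_rDeriv_uncurry hk (γ := 0) (by simp) (Λ.comp 0)⟩).comp continuous_fst
  · exact fun z => (integral_rDeriv_pos hk hpos hmix hθ hΛ z.1).ne'

theorem continuous_fDens_uncurry {Λ : LVec d p X} (hΛ : Λ.IsL0) {α : MultiIndex d}
    (hα : deg α ≤ p) : Continuous fun z : Y × X => fDens μ R θ z.1 Λ α z.2 := by
  induction hn : deg α using Nat.strong_induction_on generalizing α with
  | _ n ih =>
    simp_rw [fDens_eq _ Λ α]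
    refine (continuous_sDens_uncurry hk hpos hmix hθ hΛ hα).sub
      (continuous_finsetSum _ fun β hβ => Continuous.const_mul (Continuous.mul ?_ ?_) _)
    · have := deg_lt_deg (Finset.mem_Iio.1 hβ)
      exact ih (deg β) (by omega) (by omega) rfl
    · have := deg_sub_add (Finset.mem_Iio.1 hβ).le
      exact (continuous_integral_of_compact μ
        ⟨_, continuous_sDens_uncurry hk hpos hmix hθ hΛ (α := α - β) (by omega)⟩).comp continuous_fst

theorem continuous_FStep_left {Λ : LVec d p X} (hΛ : Λ.IsL0) :
    Continuous fun y => FStep μ R θ y Λ := by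
  rw [continuous_iff_continuousAt]
  intro y₀
  rw [ContinuousAt, LVec.tendsto_nhds_iff, Metric.tendsto_nhds]
  intro η hη
  have hα : ∀ α : {α : MultiIndex d // deg α ≤ p}, ∀ᶠ y in 𝓝 y₀,
      ‖(FStep μ R θ y Λ - FStep μ R θ y₀ Λ).comp α.1‖ ≤ η / 2 := by
    rintro ⟨α, hα⟩
    let f : C(Y × X, ℝ) := ⟨_, continuous_fDens_uncurry hk hpos hmix hθ hΛ hα⟩
    have ht : Tendsto (fun y => 2 * (‖f.curry y - f.curry y₀‖ * μ.real Set.univ)) (𝓝 y₀) (𝓝 0) := by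
      have h1 : Tendsto (fun y => ‖f.curry y - f.curry y₀‖) (𝓝 y₀) (𝓝 0) :=
        tendsto_iff_norm_sub_tendsto_zero.1 (f.curry.continuous.tendsto y₀)
      have h2 := (h1.mul_const (μ.real Set.univ)).const_mul 2
      simpa using h2
    filter_upwards [ht.eventually (ge_mem_nhds (half_pos hη))] with y hy
    refine (norm_le_of_forall_abs_apply_le fun A hA => ?_).trans hy
    have hi := fun y => integrable_of_continuous μ (hk.continuous_fDens (μ := μ) hα y Λ)
    rw [LVec.comp_sub, comp_FStep _ _ hα, comp_FStep _ _ hα, sub_apply,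
      withDensityᵥ_apply (hi y) hA, withDensityᵥ_apply (hi y₀) hA,
      ← integral_sub (hi y).integrableOn (hi y₀).integrableOn]
    calc _ ≤ ‖f.curry y - f.curry y₀‖ * μ.real A :=
          norm_setIntegral_le_of_norm_le_const (measure_lt_top _ _) fun x _ =>
            (f.curry y - f.curry y₀).norm_coe_le_norm x
      _ ≤ _ := mul_le_mul_of_nonneg_left (measureReal_mono (Set.subset_univ A)) (norm_nonneg _)
  filter_upwards [eventually_all.2 hα] with y hy
  rw [Real.dist_0_eq_abs, abs_of_nonneg (LVec.norm_nonneg _)]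
  exact (LVec.norm_le fun α hα => hy ⟨α, hα⟩).trans_lt (by linarith)

/-- The forgetting bound for a single step, with `Λ.norm` eliminated by the triangle inequality, so
that the right side tends to zero as `Λ` approaches a fixed `Λ'`, uniformly in the observation. -/
theorem norm_FStep_sub_le {c : ℝ} (hs : ScoreBound p R Θ fun _ => c) {Λ Λ' : LVec d p X}
    (hΛ : Λ.IsL0) (hΛ' : Λ'.IsL0) (y : Y) :
    (FStep μ R θ y Λ - FStep μ R θ y Λ').norm ≤ boundConst p ε * rateConst p ε *
      (Λ - Λ').norm * ((Λ - Λ').norm + 2 * Λ'.norm) ^ p * c ^ p := by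
  have hpsi : psiSum (fun _ : Y => c) (fun _ : ℕ => y) 0 1 = c := by simp [psiSum]
  have e : ∀ Λ : LVec d p X, FIter μ R θ (fun _ => y) Λ 0 1 = FStep μ R θ y Λ := fun Λ => rfl
  have := norm_FIter_sub_le hk hpos hmix hθ hs hΛ hΛ' (Nat.zero_le 1) (fun _ => y)
  rw [e, e, hpsi, Nat.sub_zero, pow_one] at this
  refine this.trans ?_
  have hc : 0 ≤ c := zero_le_one.trans (hs.1 y)
  have hn : Λ.norm ≤ (Λ - Λ').norm + Λ'.norm := by
    have hn := LVec.norm_sub_le_add_sub Λ Λ' (0 : LVec d p X)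
    rwa [sub_zero, sub_zero] at hn
  have h1 := one_le_boundConst p ε
  have h2 := rateConst_pos p ε
  have h5 := LVec.norm_nonneg (Λ - Λ')
  have h6 := LVec.norm_nonneg Λ
  have h7 := LVec.norm_nonneg Λ'
  have h8 : Λ.norm + Λ'.norm ≤ (Λ - Λ').norm + 2 * Λ'.norm := by linarith
  refine mul_le_mul_of_nonneg_right (mul_le_mul_of_nonneg_left
    (pow_le_pow_left₀ (by linarith) h8 p) ?_) (pow_nonneg hc p)
  exact mul_nonneg (mul_nonneg (by linarith) h2.le) h5

/-- Continuity in the observation at a fixed filter, combined with the local Lipschitz bound in the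
filter that is uniform in the observation. -/
theorem continuousOn_FStep {c : ℝ} (hs : ScoreBound p R Θ fun _ => c) :
    ContinuousOn (fun z : Y × LVec d p X => FStep μ R θ z.1 z.2) {z | z.2.IsL0} := by
  rintro ⟨y₀, Λ₀⟩ hΛ₀
  have hΛ₀' : Λ₀.IsL0 := hΛ₀
  set l := 𝓝[{z : Y × LVec d p X | z.2.IsL0}] (y₀, Λ₀) with hl
  have hfst : Tendsto (fun z : Y × LVec d p X => z.1) l (𝓝 y₀) :=
    (continuous_fst.tendsto (y₀, Λ₀)).mono_left nhdsWithin_le_nhds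
  have hsnd : Tendsto (fun z : Y × LVec d p X => z.2) l (𝓝 Λ₀) :=
    (continuous_snd.tendsto (y₀, Λ₀)).mono_left nhdsWithin_le_nhds
  have hF := ((continuous_FStep_left hk hpos hmix hθ hΛ₀').tendsto y₀).comp hfst
  have h1 : Tendsto (fun z : Y × LVec d p X => (FStep μ R θ z.1 Λ₀ - FStep μ R θ y₀ Λ₀).norm)
      l (𝓝 0) := LVec.tendsto_nhds_iff.1 hF
  have h2 : Tendsto (fun z : Y × LVec d p X => (z.2 - Λ₀).norm) l (𝓝 0) :=
    LVec.tendsto_nhds_iff.1 hsnd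
  have h3 : Tendsto (fun z : Y × LVec d p X => boundConst p ε * rateConst p ε *
      (z.2 - Λ₀).norm * ((z.2 - Λ₀).norm + 2 * Λ₀.norm) ^ p * c ^ p) l (𝓝 0) := by
    have := ((h2.const_mul (boundConst p ε * rateConst p ε)).mul
      ((h2.add_const (2 * Λ₀.norm)).pow p)).mul_const (c ^ p)
    simpa using this
  have h4 := h3.add h1
  rw [add_zero] at h4
  refine LVec.tendsto_nhds_iff.2 (squeeze_zero' (Eventually.of_forall fun _ => LVec.norm_nonneg _)
    ?_ h4)
  filter_upwards [self_mem_nhdsWithin] with z hz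
  exact (LVec.norm_sub_le_add_sub _ (FStep μ R θ z.1 Λ₀) _).trans
    (add_le_add (norm_FStep_sub_le hk hpos hmix hθ hs hz hΛ₀' z.1) le_rfl)

open Classical in
/-- The filter step, extended by a constant to a measurable map. -/
def stepExt (μ : Measure X) (R : E d → Y → X → X → ℝ) (θ : E d) (Λ₀ : LVec d p X)
    (z : Y × LVec d p X) : LVec d p X :=
  if z.2.IsL0 then FStep μ R θ z.1 z.2 else Λ₀

omit hk hpos hmix hθ in
theorem stepExt_of_isL0 (Λ₀ : LVec d p X) {y : Y} {Λ : LVec d p X} (h : Λ.IsL0) :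
    stepExt μ R θ Λ₀ (y, Λ) = FStep μ R θ y Λ := if_pos h

theorem isL0_stepExt {Λ₀ : LVec d p X} (h0 : Λ₀.IsL0) (z : Y × LVec d p X) :
    (stepExt μ R θ Λ₀ z).IsL0 := by
  unfold stepExt
  split_ifs with h
  · exact isL0_FStep hk hpos hmix hθ h z.1
  · exact h0

theorem measurable_stepExt {c : ℝ} (hs : ScoreBound p R Θ fun _ => c) (Λ₀ : LVec d p X) :
    Measurable (stepExt μ R θ Λ₀ (Y := Y)) := by
  classical
  have hm : MeasurableSet {z : Y × LVec d p X | z.2.IsL0} :=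
    measurable_snd LVec.measurableSet_isL0
  have := (continuousOn_FStep hk hpos hmix hθ hs).measurable_piecewise
    (continuousOn_const (c := Λ₀)) hm
  convert this using 1
  funext z
  simp only [stepExt, Set.piecewise]
  congr

end StepContinuity

/-! ### Path laws of Markov chains -/

section PathKernel

variable {V : Type*} [MeasurableSpace V]

/-- The sequence `v, ω 0, ω 1, …`. -/
def consPath (v : V) (ω : ℕ → V) : ℕ → V
  | 0 => v
  | k + 1 => ω k

@[simp] theorem consPath_zero (v : V) (ω : ℕ → V) : consPath v ω 0 = v := rfl

@[simp] theorem consPath_succ (v : V) (ω : ℕ → V) (k : ℕ) : consPath v ω (k + 1) = ω k := rfl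

theorem measurable_consPath : Measurable fun z : V × (ℕ → V) => consPath z.1 z.2 := by
  refine measurable_pi_iff.2 fun k => ?_
  rcases k with _ | k
  · exact measurable_fst
  · exact (measurable_pi_apply k).comp measurable_snd

theorem measurable_consPath_right (v : V) : Measurable (consPath v) :=
  measurable_consPath.comp measurable_prodMk_left

/-- The law of the first `n` steps of the Markov chain with transition kernel `S`, started at a
given point, extended arbitrarily to a law of sequences. -/
def pathK (S : Kernel V V) : ℕ → Kernel V (ℕ → V)
  | 0 => Kernel.deterministic (fun v _ => v) (measurable_pi_iff.2 fun _ => measurable_id)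
  | n + 1 => (Kernel.id ×ₖ (pathK S n ∘ₖ S)).map fun z => consPath z.1 z.2

variable {S : Kernel V V} [IsMarkovKernel S]

instance isMarkovKernel_pathK (n : ℕ) : IsMarkovKernel (pathK S n) := by
  induction n with
  | zero => rw [pathK]; infer_instance
  | succ n ih => rw [pathK]; exact Kernel.IsMarkovKernel.map _ measurable_consPath

theorem pathK_succ_apply (n : ℕ) (v : V) :
    pathK S (n + 1) v = ((S v).bind (pathK S n)).map (consPath v) := by
  rw [pathK, Kernel.map_apply _ measurable_consPath, Kernel.prod_apply, Kernel.id_apply,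
    Measure.dirac_prod, Measure.map_map measurable_consPath measurable_prodMk_left,
    Kernel.comp_apply]
  rfl

theorem lintegral_pathK_succ (n : ℕ) (v : V) {f : (ℕ → V) → ℝ≥0∞} (hf : Measurable f) :
    ∫⁻ ω, f ω ∂(pathK S (n + 1) v) = ∫⁻ w, ∫⁻ ω, f (consPath v ω) ∂(pathK S n w) ∂(S v) := by
  have hc := measurable_consPath_right v
  rw [pathK_succ_apply, lintegral_map hf hc]
  exact Measure.lintegral_bind (Kernel.aemeasurable _) (hf.comp hc).aemeasurable

theorem integral_pathK_succ (n : ℕ) (v : V) {f : (ℕ → V) → ℝ} (hf : Measurable f)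
    (hi : Integrable f (pathK S (n + 1) v)) :
    ∫ ω, f ω ∂(pathK S (n + 1) v) = ∫ w, ∫ ω, f (consPath v ω) ∂(pathK S n w) ∂(S v) := by
  have hc := measurable_consPath_right v
  rw [pathK_succ_apply, integrable_map_measure hf.aestronglyMeasurable hc.aemeasurable] at hi
  rw [pathK_succ_apply, integral_map hc.aemeasurable hf.aestronglyMeasurable]
  rw [← Kernel.comp_apply] at hi ⊢
  exact Kernel.integral_comp hi

theorem pathK_zero_ae [MeasurableSingletonClass V] (n : ℕ) (v : V) :
    ∀ᵐ ω ∂(pathK S n v), ω 0 = v := by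
  have hm : MeasurableSet {ω : ℕ → V | ω 0 = v} :=
    (measurable_pi_apply (X := fun _ : ℕ => V) 0) (measurableSet_singleton v)
  rcases n with _ | n
  · rw [pathK, Kernel.deterministic_apply]
    exact (ae_dirac_iff hm).2 rfl
  · rw [pathK_succ_apply]
    exact (ae_map_iff (measurable_consPath_right v).aemeasurable hm).2
      (Eventually.of_forall fun ω => rfl)

end PathKernel

/-! ### The chain of states, observations and derivative filters -/

section Chain

variable {d p : ℕ} {X : Type} [MeasurableSpace X] [MetricSpace X] [CompactSpace X] [BorelSpace X]
  {Y : Type} [MetricSpace Y] [CompactSpace Y] [MeasurableSpace Y] [BorelSpace Y]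

/-- The transition kernel of the state-space model. -/
def obsKer (P : Kernel X X) (Q : Kernel X Y) : Kernel X (X × Y) := P ⊗ₖ Kernel.prodMkLeft X Q

/-- The transition kernel of the state-space model, as a kernel on `X × Y`. -/
def stateKer (P : Kernel X X) (Q : Kernel X Y) : Kernel (X × Y) (X × Y) :=
  (obsKer P Q).comap Prod.fst measurable_fst

variable {P : Kernel X X} [IsMarkovKernel P] {Q : Kernel X Y} [IsMarkovKernel Q]

instance : IsMarkovKernel (obsKer P Q) := by unfold obsKer; infer_instance

instance : IsMarkovKernel (stateKer P Q) := by unfold stateKer; infer_instance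

theorem obsKer_apply (x : X) : obsKer P Q x = P x ⊗ₘ Q := by
  rw [obsKer, Kernel.compProd_apply_eq_compProd_sectR]
  congr 1

theorem stateKer_apply (v : X × Y) : stateKer P Q v = P v.1 ⊗ₘ Q := by
  rw [stateKer, Kernel.comap_apply, obsKer_apply]

/-- A Markov chain of states, observations and filters, where the filter is updated with the
observation `o y y'` if `y` is the current and `y'` is the next observation. -/
def genChain (μ : Measure X) (R : E d → Y → X → X → ℝ) (P : Kernel X X) (Q : Kernel X Y)
    (o : Y → Y → Y) (θ : E d) (z : X × Y × LVec d p X) : Measure (X × Y × LVec d p X) :=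
  (P z.1 ⊗ₘ Q).map fun w => (w.1, w.2, FStep μ R θ (o z.2.1 w.2) z.2.2)

/-- The sequence of the observations that are used to update the filter. -/
def obsSeq (o : Y → Y → Y) (ω : ℕ → X × Y) (k : ℕ) : Y := o (ω (k - 1)).2 (ω k).2

variable {μ : Measure X} [IsFiniteMeasure μ] [NeZero μ] {R : E d → Y → X → X → ℝ} {Θ : Set (E d)}
  {θ : E d} {ρ : MultiIndex d → C(Y × (X × X), ℝ)}

/-- The first update consumes the observation determined by `v` and `ω 0`; the remaining ones are
those of the shifted path. The value of `obsSeq` at index `0`, with its truncated `k - 1`, is never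
used. -/
theorem FIter_obsSeq_consPath (o : Y → Y → Y) (v : X × Y) (ω : ℕ → X × Y) (Λ : LVec d p X) (n : ℕ) :
    FIter μ R θ (obsSeq o (consPath v ω)) Λ 0 (n + 1) =
      FIter μ R θ (obsSeq o ω) (FStep μ R θ (o v.2 (ω 0).2) Λ) 0 n := by
  rw [FIter_succ', add_comm n 1, FIter_shift]
  refine Eq.trans (FIter_congr (y' := obsSeq o ω) fun k hk _ => ?_) ?_
  · obtain ⟨k, rfl⟩ : ∃ j, k = j + 1 := ⟨k - 1, by omega⟩
    rw [obsSeq, obsSeq, show 1 + (k + 1) - 1 = k + 1 by omega, show 1 + (k + 1) = k + 1 + 1 by omega]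
    rfl
  · rfl

/-- The chain, extended to a kernel on the whole space. -/
def extChain (μ : Measure X) (R : E d → Y → X → X → ℝ) (P : Kernel X X) (Q : Kernel X Y)
    (o : Y → Y → Y) (θ : E d) (Λ₀ : LVec d p X) :
    Kernel (X × Y × LVec d p X) (X × Y × LVec d p X) :=
  (Kernel.id ×ₖ (obsKer P Q).comap Prod.fst measurable_fst).map fun t =>
    (t.2.1, t.2.2, stepExt μ R θ Λ₀ (o t.1.2.1 t.2.2, t.1.2.2))

variable (hk : IsDerivKernel p R θ ρ) (hpos : ∀ y x x', 0 < R θ y x x')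
  {ε c : ℝ} (hmix : StrongMixing μ R Θ ε) (hs : ScoreBound p R Θ fun _ => c) (hθ : θ ∈ Θ)
  {o : Y → Y → Y} (ho : Measurable fun z : Y × Y => o z.1 z.2)

include hk hpos hmix hθ hs ho

theorem extChain_apply (Λ₀ : LVec d p X) (z : X × Y × LVec d p X) :
    extChain μ R P Q o θ Λ₀ z =
      (P z.1 ⊗ₘ Q).map fun w => (w.1, w.2, stepExt μ R θ Λ₀ (o z.2.1 w.2, z.2.2)) := by
  have hm : Measurable fun t : (X × Y × LVec d p X) × (X × Y) =>
      (t.2.1, t.2.2, stepExt μ R θ Λ₀ (o t.1.2.1 t.2.2, t.1.2.2)) := by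
    have h1 := measurable_stepExt hk hpos hmix hθ hs Λ₀
    have h2 : Measurable fun t : (X × Y × LVec d p X) × (X × Y) => o t.1.2.1 t.2.2 :=
      ho.comp (g := fun z : Y × Y => o z.1 z.2) (f := fun t : (X × Y × LVec d p X) × (X × Y) => (t.1.2.1, t.2.2)) (by fun_prop)
    have h3 : Measurable fun t : (X × Y × LVec d p X) × (X × Y) =>
      stepExt μ R θ Λ₀ (o t.1.2.1 t.2.2, t.1.2.2) := h1.comp (h2.prodMk (by fun_prop))
    fun_prop
  rw [extChain, Kernel.map_apply _ hm, Kernel.prod_apply, Kernel.id_apply, Measure.dirac_prod,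
    Measure.map_map hm measurable_prodMk_left, Kernel.comap_apply, obsKer_apply]
  rfl

theorem measurable_stepExt_obs (Λ₀ : LVec d p X) (z : X × Y × LVec d p X) :
    Measurable fun w : X × Y => (w.1, w.2, stepExt μ R θ Λ₀ (o z.2.1 w.2, z.2.2)) := by
  have h1 := measurable_stepExt hk hpos hmix hθ hs Λ₀
  have h2 : Measurable fun w : X × Y => o z.2.1 w.2 :=
    ho.comp (g := fun z : Y × Y => o z.1 z.2) (f := fun w : X × Y => (z.2.1, w.2)) (by fun_prop)
  have h3 : Measurable fun w : X × Y => stepExt μ R θ Λ₀ (o z.2.1 w.2, z.2.2) :=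
    h1.comp (h2.prodMk measurable_const)
  fun_prop

theorem genChain_eq (Λ₀ : LVec d p X) {z : X × Y × LVec d p X} (hz : z.2.2.IsL0) :
    genChain μ R P Q o θ z = extChain μ R P Q o θ Λ₀ z := by
  rw [extChain_apply hk hpos hmix hs hθ ho, genChain]
  simp_rw [stepExt_of_isL0 Λ₀ hz]

theorem ae_isL0_extChain {Λ₀ : LVec d p X} (h0 : Λ₀.IsL0) (z : X × Y × LVec d p X) :
    ∀ᵐ z' ∂(extChain μ R P Q o θ Λ₀ z), z'.2.2.IsL0 := by
  rw [extChain_apply hk hpos hmix hs hθ ho]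
  refine (ae_map_iff (measurable_stepExt_obs hk hpos hmix hs hθ ho Λ₀ z).aemeasurable
    ((measurable_snd.comp measurable_snd) LVec.measurableSet_isL0)).2
    (Eventually.of_forall fun w => isL0_stepExt hk hpos hmix hθ h0 _)

/-- `genChain` is only a family of measures, because off `IsL0` the filter step is not known to be
measurable. Started in `IsL0` the chain stays there almost surely, and there it coincides with a
genuine kernel. -/
theorem kerIter_genChain {Λ₀ : LVec d p X} (h0 : Λ₀.IsL0) {z : X × Y × LVec d p X}
    (hz : z.2.2.IsL0) (n : ℕ) :
    kerIter (genChain μ R P Q o θ) n z = (extChain μ R P Q o θ Λ₀ ^ n) z ∧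
      ∀ᵐ z' ∂((extChain μ R P Q o θ Λ₀ ^ n) z), z'.2.2.IsL0 := by
  have hm : MeasurableSet {z : X × Y × LVec d p X | z.2.2.IsL0} :=
    (measurable_snd.comp measurable_snd) LVec.measurableSet_isL0
  induction n with
  | zero =>
    refine ⟨?_, ?_⟩
    · rw [pow_zero]; exact (Kernel.id_apply z).symm
    · rw [pow_zero]
      change ∀ᵐ z' ∂(Kernel.id z), z'.2.2.IsL0
      rw [Kernel.id_apply]
      exact (ae_dirac_iff hm).2 hz
  | succ n ih =>
    have he : (extChain μ R P Q o θ Λ₀ ^ (n + 1)) z =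
        ((extChain μ R P Q o θ Λ₀ ^ n) z).bind (extChain μ R P Q o θ Λ₀) := by
      rw [pow_succ']; rfl
    refine ⟨?_, ?_⟩
    · change (kerIter (genChain μ R P Q o θ) n z).bind (genChain μ R P Q o θ) = _
      rw [ih.1, he]
      refine Measure.bind_congr_right ?_
      filter_upwards [ih.2] with z' hz'
      exact genChain_eq hk hpos hmix hs hθ ho Λ₀ hz'
    · rw [he]
      refine (Measure.ae_comp_of_ae_ae ?_ (Eventually.of_forall fun z' => ?_))
      · exact hm
      · exact ae_isL0_extChain hk hpos hmix hs hθ ho h0 z'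

theorem measurable_FIter_obsSeq {Λ : LVec d p X} (hΛ : Λ.IsL0) (n : ℕ) :
    Measurable fun ω : ℕ → X × Y => FIter μ R θ (obsSeq o ω) Λ 0 n := by
  induction n with
  | zero => exact measurable_const
  | succ n ih =>
    have h1 := measurable_stepExt hk hpos hmix hθ hs Λ
    have h2 : Measurable fun ω : ℕ → X × Y => obsSeq o ω (n + 1) :=
      ho.comp (g := fun z : Y × Y => o z.1 z.2)
        (f := fun ω : ℕ → X × Y => ((ω n).2, (ω (n + 1)).2)) (by fun_prop)
    have h3 := h1.comp (h2.prodMk ih)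
    convert h3 using 1
    funext ω
    rw [FIter_succ (Nat.zero_le n), Function.comp_apply, stepExt_of_isL0]
    exact isL0_FIter hk hpos hmix hθ hΛ _ _ _

/-- The filter is a deterministic function of the path of states and observations, so the law after
`n` steps is an image of the path law. The induction splits off the first step. -/
theorem extChain_pow_apply {Λ₀ Λ : LVec d p X} (h0 : Λ₀.IsL0) (hΛ : Λ.IsL0) (n : ℕ) (v : X × Y) :
    (extChain μ R P Q o θ Λ₀ ^ n) (v.1, v.2, Λ) = (pathK (stateKer P Q) n v).map fun ω =>
      ((ω n).1, (ω n).2, FIter μ R θ (obsSeq o ω) Λ 0 n) := by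
  have hgm : ∀ (n : ℕ) {Λ : LVec d p X}, Λ.IsL0 → Measurable fun ω : ℕ → X × Y =>
      ((ω n).1, (ω n).2, FIter μ R θ (obsSeq o ω) Λ 0 n) := fun n Λ hΛ => by
    have := measurable_FIter_obsSeq hk hpos hmix hs hθ ho hΛ n
    fun_prop
  induction n generalizing v Λ with
  | zero =>
    rw [pow_zero, pathK, Kernel.deterministic_apply, Measure.map_dirac' (hgm 0 hΛ)]
    exact Kernel.id_apply _
  | succ n ih =>
    have he : (extChain μ R P Q o θ Λ₀ ^ (n + 1)) (v.1, v.2, Λ) =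
        ((extChain μ R P Q o θ Λ₀) (v.1, v.2, Λ)).bind (extChain μ R P Q o θ Λ₀ ^ n) := by
      rw [pow_succ]; rfl
    refine Measure.ext_of_lintegral _ fun f hf => ?_
    have hl := lintegral_pathK_succ (S := stateKer P Q) n v (hf.comp (hgm (n + 1) hΛ))
    simp only [Function.comp_apply] at hl
    rw [he, Measure.lintegral_bind (Kernel.aemeasurable _) hf.aemeasurable,
      extChain_apply hk hpos hmix hs hθ ho, lintegral_map (hf.lintegral_kernel)
      (measurable_stepExt_obs hk hpos hmix hs hθ ho Λ₀ _), lintegral_map hf (hgm (n + 1) hΛ),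
      hl, stateKer_apply]
    refine lintegral_congr fun w => ?_
    have hΛ' := isL0_stepExt hk hpos hmix hθ h0 (o v.2 w.2, Λ)
    rw [ih hΛ' w, lintegral_map hf (hgm n hΛ')]
    refine lintegral_congr_ae ?_
    filter_upwards [pathK_zero_ae (S := stateKer P Q) n w] with ω hω
    rw [consPath_succ, FIter_obsSeq_consPath, hω, stepExt_of_isL0 Λ₀ hΛ]

variable {Φ : X × Y × LVec d p X → ℝ}
  (hΦ : Measurable fun z : {z : X × Y × LVec d p X // z.2.2.IsL0} => Φ z)

include hΦ

theorem measurable_comp_FIter {Λ : LVec d p X} (hΛ : Λ.IsL0) (n j : ℕ) :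
    Measurable fun ω : ℕ → X × Y =>
      Φ ((ω j).1, (ω j).2, FIter μ R θ (obsSeq o ω) Λ 0 n) := by
  have h1 := measurable_FIter_obsSeq hk hpos hmix hs hθ ho hΛ n
  have h2 : Measurable fun ω : ℕ → X × Y =>
      ((ω j).1, (ω j).2, FIter μ R θ (obsSeq o ω) Λ 0 n) := by fun_prop
  exact hΦ.comp (h2.subtype_mk (p := fun z : X × Y × LVec d p X => z.2.2.IsL0)
    (h := fun ω => isL0_FIter hk hpos hmix hθ hΛ _ _ _))

theorem aestronglyMeasurable_kerIter {Λ : LVec d p X} (hΛ : Λ.IsL0) (n : ℕ) (v : X × Y) :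
    AEStronglyMeasurable Φ (kerIter (genChain μ R P Q o θ) n (v.1, v.2, Λ)) := by
  classical
  obtain ⟨h1, h2⟩ := kerIter_genChain (P := P) (Q := Q) hk hpos hmix hs hθ ho hΛ
    (z := (v.1, v.2, Λ)) hΛ n
  have hm : MeasurableSet {z : X × Y × LVec d p X | z.2.2.IsL0} :=
    (measurable_snd.comp measurable_snd) LVec.measurableSet_isL0
  have h3 := Measurable.dite (s := {z : X × Y × LVec d p X | z.2.2.IsL0}) hΦ
    (g := fun _ => 0) measurable_const hm
  rw [h1]
  refine ⟨_, h3.stronglyMeasurable, ?_⟩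
  filter_upwards [h2] with z hz
  rw [dif_pos hz]

theorem kerInt_genChain {Λ : LVec d p X} (hΛ : Λ.IsL0) (n : ℕ) (v : X × Y) :
    kerInt (genChain μ R P Q o θ) n Φ (v.1, v.2, Λ) =
      ∫ ω, Φ ((ω n).1, (ω n).2, FIter μ R θ (obsSeq o ω) Λ 0 n) ∂(pathK (stateKer P Q) n v) := by
  have h := aestronglyMeasurable_kerIter (P := P) (Q := Q) hk hpos hmix hs hθ ho hΦ hΛ n v
  have h1 := measurable_FIter_obsSeq hk hpos hmix hs hθ ho hΛ n
  rw [kerInt]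
  rw [(kerIter_genChain (P := P) (Q := Q) hk hpos hmix hs hθ ho hΛ (z := (v.1, v.2, Λ)) hΛ n).1,
    extChain_pow_apply hk hpos hmix hs hθ ho hΛ hΛ] at h ⊢
  exact integral_map (by fun_prop) h

theorem integrable_kerIter_iff {Λ : LVec d p X} (hΛ : Λ.IsL0) (n : ℕ) (v : X × Y) :
    Integrable Φ (kerIter (genChain μ R P Q o θ) n (v.1, v.2, Λ)) ↔
      Integrable (fun ω => Φ ((ω n).1, (ω n).2, FIter μ R θ (obsSeq o ω) Λ 0 n))
        (pathK (stateKer P Q) n v) := by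
  have h := aestronglyMeasurable_kerIter (P := P) (Q := Q) hk hpos hmix hs hθ ho hΦ hΛ n v
  have h1 := measurable_FIter_obsSeq hk hpos hmix hs hθ ho hΛ n
  rw [(kerIter_genChain (P := P) (Q := Q) hk hpos hmix hs hθ ho hΛ (z := (v.1, v.2, Λ)) hΛ n).1,
    extChain_pow_apply hk hpos hmix hs hθ ho hΛ hΛ] at h ⊢
  exact integrable_map_measure h (by fun_prop)

end Chain

/-! ### Geometric convergence from an approximate Markov recursion -/

section Ergodic

/-- Working with lower integrals of `ENNReal.ofReal (g ω)` makes measurability of the dominating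
function unnecessary. -/
theorem abs_integral_le_of_lintegral_le {Ω : Type*} [MeasurableSpace Ω] {m : Measure Ω} {f g : Ω → ℝ}
    {a C : ℝ} (hf : AEStronglyMeasurable f m) (ha : 0 ≤ a) (hC : 0 ≤ C)
    (h : ∀ᵐ ω ∂m, |f ω| ≤ a * g ω) (hg : ∫⁻ ω, ENNReal.ofReal (g ω) ∂m ≤ ENNReal.ofReal C) :
    Integrable f m ∧ |∫ ω, f ω ∂m| ≤ a * C := by
  have h1 : ∫⁻ ω, ‖f ω‖ₑ ∂m ≤ ENNReal.ofReal (a * C) := by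
    rw [ENNReal.ofReal_mul ha]
    calc ∫⁻ ω, ‖f ω‖ₑ ∂m ≤ ∫⁻ ω, ENNReal.ofReal a * ENNReal.ofReal (g ω) ∂m := by
          refine lintegral_mono_ae ?_
          filter_upwards [h] with ω hω
          rw [← ENNReal.ofReal_mul ha, ← ofReal_norm, Real.norm_eq_abs]
          exact ENNReal.ofReal_le_ofReal hω
      _ = ENNReal.ofReal a * ∫⁻ ω, ENNReal.ofReal (g ω) ∂m :=
          lintegral_const_mul' _ _ ENNReal.ofReal_ne_top
      _ ≤ _ := by gcongr
  refine ⟨⟨hf, h1.trans_lt ENNReal.ofReal_lt_top⟩, ?_⟩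
  have h2 := norm_integral_le_lintegral_norm (μ := m) f
  rw [Real.norm_eq_abs] at h2
  refine h2.trans (ENNReal.toReal_le_of_le_ofReal (by positivity) ?_)
  simpa only [ofReal_norm] using h1

theorem abs_integral_le_of_abs_le {Ω : Type*} [MeasurableSpace Ω] {m : Measure Ω}
    [IsProbabilityMeasure m] {f : Ω → ℝ} {C : ℝ} (h : ∀ ω, |f ω| ≤ C) : |∫ ω, f ω ∂m| ≤ C := by
  simpa using norm_integral_le_of_norm_le_const (μ := m) (f := f) (Eventually.of_forall h)

variable {X : Type*} [MeasurableSpace X] {P : Kernel X X} [IsMarkovKernel P] {π : Measure X}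
  [IsProbabilityMeasure π] {δ K₀ : ℝ}

instance isMarkovKernel_pow (n : ℕ) : IsMarkovKernel (P ^ n) := by
  induction n with
  | zero => exact (inferInstance : IsMarkovKernel (Kernel.id : Kernel X X))
  | succ n ih =>
    rw [pow_succ]
    exact (inferInstance : IsMarkovKernel ((P ^ n) ∘ₖ P))

theorem GeomErgodic.abs_integral_sub_le (h : GeomErgodic P π δ K₀) {g : X → ℝ} (hg : Measurable g)
    {C : ℝ} (hC : ∀ x, |g x| ≤ C) (n : ℕ) (x : X) :
    |∫ x', g x' ∂((P ^ n) x) - ∫ x', g x' ∂π| ≤ 2 * (K₀ * δ ^ n) * C := by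
  have h0 : 0 ≤ C := (abs_nonneg _).trans (hC x)
  rw [← sInt_sub_toSignedMeasure _ _ hg hC]
  refine (abs_sInt_le _ hC).trans ?_
  rw [mul_comm]
  refine mul_le_mul_of_nonneg_right (norm_le_of_forall_abs_apply_le fun A hA => ?_) h0
  rw [sub_apply, Measure.toSignedMeasure_apply_measurable hA,
    Measure.toSignedMeasure_apply_measurable hA]
  exact h.2.2.2 n x A hA

/-- The functions `g n` follow `g (n + 1) ≈ P (g n)` with summable errors, so `g (n + m)` is close
to `P ^ m (g n)`, which for `m ≥ n` is close to the mean of `g n` under `π`. The functions may grow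
like `η ^ (-n)`: ergodicity gains `δ ^ m ≤ η ^ (2 n)`, which outweighs the growth. -/
theorem exists_geometric_limit (h : GeomErgodic P π δ K₀) {η E₀ : ℝ} (hη0 : 0 < η) (hη1 : η < 1)
    (hδ : δ ≤ η ^ 2) (hE : 0 ≤ E₀) {g : ℕ → X → ℝ} (hg : ∀ n, Measurable (g n))
    (hb : ∀ n x, η ^ n * |g n x| ≤ E₀)
    (hs : ∀ n x, |g (n + 1) x - ∫ x', g n x' ∂(P x)| ≤ E₀ * (η ^ 2) ^ n) :
    ∃ ϕ : ℝ, ∀ n x, |g n x - ϕ| ≤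
      3 * (E₀ / (1 - η ^ 2) + 2 * K₀ * E₀) / (1 - η) / η * √η ^ n := by
  have hη2 : η ^ 2 < 1 := pow_lt_one₀ hη0.le hη1 two_ne_zero
  have hX : Nonempty X := by
    by_contra hX
    rw [not_nonempty_iff] at hX
    exact IsProbabilityMeasure.ne_zero π (Measure.eq_zero_of_isEmpty π)
  obtain ⟨x₀⟩ := hX
  have hb' : ∀ n x, |g n x| ≤ E₀ / η ^ n := fun n x => by
    rw [le_div_iff₀' (by positivity)]; exact hb n x
  have hint : ∀ n (m : Measure X) [IsFiniteMeasure m], Integrable (g n) m := fun n m _ =>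
    integrable_of_abs_le m (hg n) (hb' n)
  have hiter : ∀ n m x, |g (n + m) x - ∫ x', g n x' ∂((P ^ m) x)| ≤
      ∑ j ∈ Finset.range m, E₀ * (η ^ 2) ^ (n + j) := by
    intro n m
    induction m with
    | zero =>
      intro x
      have : ∫ x', g n x' ∂((P ^ 0) x) = g n x := by
        rw [pow_zero]
        change ∫ x', g n x' ∂(Kernel.id x) = g n x
        rw [Kernel.id_apply, integral_dirac' _ _ (hg n).stronglyMeasurable]
      rw [this]; simp
    | succ m ih =>
      intro x
      have h1 : ∫ x', g n x' ∂((P ^ (m + 1)) x) = ∫ w, ∫ x', g n x' ∂((P ^ m) w) ∂(P x) := by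
        rw [pow_succ]
        exact Kernel.integral_comp (κ := P) (η := P ^ m) (hint n _)
      have hm : Measurable fun w => ∫ x', g n x' ∂((P ^ m) w) :=
        ((hg n).stronglyMeasurable.integral_kernel).measurable
      have h2 : |∫ w, (g (n + m) w - ∫ x', g n x' ∂((P ^ m) w)) ∂(P x)| ≤
          ∑ j ∈ Finset.range m, E₀ * (η ^ 2) ^ (n + j) :=
        abs_integral_le_of_abs_le ih
      have hi2 : Integrable (fun w => ∫ x', g n x' ∂((P ^ m) w)) (P x) := by
        refine integrable_of_abs_le _ hm (C := E₀ / η ^ n) fun w => ?_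
        exact abs_integral_le_of_abs_le (hb' n)
      rw [integral_sub (hint _ _) hi2] at h2
      rw [Finset.sum_range_succ, h1, add_comm (∑ j ∈ _, _)]
      refine (abs_sub_le _ (∫ x', g (n + m) x' ∂(P x)) _).trans (add_le_add ?_ h2)
      exact hs (n + m) x
  set C := E₀ / (1 - η ^ 2) + 2 * K₀ * E₀ with hCdef
  have hK := h.2.2.1
  have hC0 : 0 ≤ C := by
    have : 0 ≤ E₀ / (1 - η ^ 2) := div_nonneg hE (by linarith)
    positivity
  have hmain : ∀ n m, n ≤ m → ∀ x, |g (n + m) x - ∫ x', g n x' ∂π| ≤ C * η ^ n := by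
    intro n m hnm x
    refine (abs_sub_le _ (∫ x', g n x' ∂((P ^ m) x)) _).trans ?_
    rw [hCdef, add_mul]
    refine add_le_add ((hiter n m x).trans ?_) ((h.abs_integral_sub_le (hg n) (hb' n) m x).trans ?_)
    · simp_rw [pow_add, ← mul_assoc]
      rw [← Finset.mul_sum]
      have h1 : ∑ j ∈ Finset.range m, (η ^ 2) ^ j ≤ (1 - η ^ 2)⁻¹ := by
        rw [← tsum_geometric_of_lt_one (by positivity) hη2]
        exact (summable_geometric_of_lt_one (by positivity) hη2).sum_le_tsum _
          fun j _ => by positivity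
      have h2 : (η ^ 2) ^ n ≤ η ^ n :=
        pow_le_pow_left₀ (by positivity) (by nlinarith) n
      rw [div_eq_mul_inv, mul_assoc, mul_assoc, mul_comm (1 - η ^ 2)⁻¹]
      have h3 : 0 ≤ (1 - η ^ 2)⁻¹ := inv_nonneg.2 (by linarith)
      exact mul_le_mul_of_nonneg_left (mul_le_mul h2 h1
        (Finset.sum_nonneg fun j _ => by positivity) (by positivity)) hE
    · have h1 : δ ^ m ≤ η ^ n * η ^ n := by
        calc δ ^ m ≤ (η ^ 2) ^ m := pow_le_pow_left₀ h.1.le hδ m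
          _ ≤ (η ^ 2) ^ n := pow_le_pow_of_le_one (by positivity) hη2.le hnm
          _ = η ^ n * η ^ n := by rw [← pow_mul, ← pow_add]; ring_nf
      calc 2 * (K₀ * δ ^ m) * (E₀ / η ^ n) ≤ 2 * (K₀ * (η ^ n * η ^ n)) * (E₀ / η ^ n) := by
            have : 0 ≤ E₀ / η ^ n := by positivity
            gcongr
        _ = 2 * K₀ * E₀ * η ^ n := by field_simp
  -- The means of `g n` and `g (n + 1)` are both compared with the value of `g` at the common time
  -- `2 n + 3`.
  have hdist : ∀ n, dist (∫ x', g n x' ∂π) (∫ x', g (n + 1) x' ∂π) ≤ 2 * C * η ^ n := by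
    intro n
    have h1 := hmain n (n + 3) (by omega) x₀
    have h2 := hmain (n + 1) (n + 2) (by omega) x₀
    rw [show n + 1 + (n + 2) = n + (n + 3) by omega] at h2
    have h3 : η ^ (n + 1) ≤ η ^ n := pow_le_pow_of_le_one hη0.le hη1.le (Nat.le_succ n)
    have h4 := mul_le_mul_of_nonneg_left h3 hC0
    rw [Real.dist_eq]
    rw [abs_le] at h1 h2 ⊢
    constructor <;> linarith [h1.1, h1.2, h2.1, h2.2]
  obtain ⟨ϕ, hϕ⟩ := cauchySeq_tendsto_of_complete (cauchySeq_of_le_geometric η _ hη1 hdist)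
  refine ⟨ϕ, fun N x => ?_⟩
  -- Half of the time is spent on `g n` becoming accurate and half on the chain mixing, which yields
  -- the rate `√η` per step.
  obtain ⟨n, m, hN, hnm, hm⟩ : ∃ n m, N = n + m ∧ n ≤ m ∧ m ≤ n + 1 :=
    ⟨N / 2, N - N / 2, by omega, by omega, by omega⟩
  have h1 := hmain n m hnm x
  have h2 := dist_le_of_le_geometric_of_tendsto η _ hη1 hdist hϕ n
  rw [Real.dist_eq] at h2
  have h1η : 0 < 1 - η := by linarith
  have h3 : C * η ^ n ≤ C * η ^ n / (1 - η) := le_div_self (by positivity) h1η (by linarith)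
  have hsq : √η ^ 2 = η := Real.sq_sqrt hη0.le
  have hs0 : 0 < √η := Real.sqrt_pos.2 hη0
  have hs1 : √η ≤ 1 := Real.sqrt_le_one.2 hη1.le
  have h4 : η ^ n ≤ √η ^ N / η := by
    rw [le_div_iff₀ hη0, ← pow_succ]
    calc η ^ (n + 1) = √η ^ (2 * (n + 1)) := by rw [pow_mul, hsq]
      _ ≤ √η ^ N := pow_le_pow_of_le_one hs0.le hs1 (by omega)
  rw [hN] at *
  calc |g (n + m) x - ϕ| ≤ C * η ^ n + 2 * C * η ^ n / (1 - η) :=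
        (abs_sub_le _ _ _).trans (add_le_add h1 h2)
    _ ≤ 3 * C / (1 - η) * η ^ n := by
        have : 3 * C / (1 - η) * η ^ n = C * η ^ n / (1 - η) + 2 * C * η ^ n / (1 - η) := by ring
        linarith
    _ ≤ 3 * C / (1 - η) * (√η ^ (n + m) / η) := by
        refine mul_le_mul_of_nonneg_left h4 (by positivity)
    _ = _ := by ring

end Ergodic

/-! ### Moments along a path -/

section Moments

variable {V : Type*} [MeasurableSpace V] {S : Kernel V V} [IsMarkovKernel S] {f g : V → ℝ≥0∞}
  (hf : Measurable f) (hg : Measurable g) {c : ℝ≥0∞}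

theorem lintegral_pathK_zero {F : (ℕ → V) → ℝ≥0∞} (hF : Measurable F) (v : V) :
    ∫⁻ ω, F ω ∂(pathK S 0 v) = F fun _ => v := by
  rw [pathK, Kernel.deterministic_apply, lintegral_dirac' _ hF]

include hf

theorem lintegral_pathK_last_le (h : ∀ v, ∫⁻ w, f w ∂(S v) ≤ c) (n : ℕ) (v : V) :
    ∫⁻ ω, f (ω (n + 1)) ∂(pathK S (n + 1) v) ≤ c := by
  induction n generalizing v with
  | zero =>
    rw [lintegral_pathK_succ 0 v (by fun_prop)]
    simp_rw [consPath_succ]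
    refine (le_of_eq (lintegral_congr fun w => ?_)).trans (h v)
    rw [lintegral_pathK_zero (by fun_prop)]
  | succ n ih =>
    rw [lintegral_pathK_succ (n + 1) v (by fun_prop)]
    simp_rw [consPath_succ]
    refine (lintegral_mono ih).trans ?_
    simp

include hg

theorem lintegral_pathK_first_le (h : ∀ v, ∫⁻ w, f w ∂(S v) ≤ c) (n : ℕ) (v : V) :
    ∫⁻ ω, f (ω (n + 1)) * g (ω 0) ∂(pathK S (n + 1) v) ≤ c * g v := by
  have h1 : ∫⁻ ω, f (ω (n + 1)) * g (ω 0) ∂(pathK S (n + 1) v) =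
      (∫⁻ ω, f (ω (n + 1)) ∂(pathK S (n + 1) v)) * g v := by
    rw [lintegral_pathK_succ n v (by fun_prop), lintegral_pathK_succ n v (by fun_prop),
      ← lintegral_mul_const _ (Measurable.lintegral_kernel
        (f := fun ω => f (consPath v ω (n + 1))) (by simp_rw [consPath_succ]; fun_prop))]
    refine lintegral_congr fun w => ?_
    simp_rw [consPath_succ, consPath_zero]
    rw [lintegral_mul_const _ (by fun_prop)]
  rw [h1]
  gcongr
  exact lintegral_pathK_last_le hf h n v

/-- By the Markov property the factor at the later time costs at most `c`, whatever the state at the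
earlier time, and the earlier factor costs another `c`. If the times coincide, the joint moment `h3`
is used. -/
theorem lintegral_pathK_mul_le (hc : 1 ≤ c) (h1 : ∀ v, ∫⁻ w, f w ∂(S v) ≤ c)
    (h2 : ∀ v, ∫⁻ w, g w ∂(S v) ≤ c) (h3 : ∀ v, ∫⁻ w, f w * g w ∂(S v) ≤ c) {n k : ℕ}
    (hkn : k ≤ n) (v : V) :
    ∫⁻ ω, f (ω (n + 1)) * g (ω (k + 1)) ∂(pathK S (n + 1) v) ≤ c * c := by
  induction n generalizing v k with
  | zero =>
    obtain rfl : k = 0 := by omega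
    rw [lintegral_pathK_succ 0 v (by fun_prop)]
    simp_rw [consPath_succ]
    refine (le_of_eq (lintegral_congr fun w => ?_)).trans ((h3 v).trans (le_mul_of_one_le_right' hc))
    rw [lintegral_pathK_zero (by fun_prop)]
  | succ n ih =>
    rw [lintegral_pathK_succ (n + 1) v (by fun_prop)]
    simp_rw [consPath_succ]
    rcases k with _ | k
    · calc _ ≤ ∫⁻ w, c * g w ∂(S v) :=
            lintegral_mono fun w => lintegral_pathK_first_le hf hg h1 n w
        _ = c * ∫⁻ w, g w ∂(S v) := lintegral_const_mul _ hg
        _ ≤ c * c := by gcongr; exact h2 v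
    · refine (lintegral_mono fun w => ih (Nat.le_of_succ_le_succ hkn) w).trans ?_
      simp

end Moments

/-! ### Polynomial against geometric growth -/

section Constants

theorem exists_rpow_mul_pow_le {a : ℝ} (ha0 : 0 < a) (ha1 : a < 1) (r : ℝ) :
    ∃ C : ℝ, 1 ≤ C ∧ ∀ n : ℕ, 1 ≤ n → (n : ℝ) ^ r * a ^ n ≤ C := by
  have h := tendsto_pow_const_mul_const_pow_of_abs_lt_one ⌈r⌉₊ (r := a)
    (by rwa [abs_of_pos ha0])
  obtain ⟨C, hC⟩ := h.bddAbove_range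
  refine ⟨max C 1, le_max_right _ _, fun n hn => le_trans ?_ (le_max_left _ _)⟩
  refine le_trans ?_ (hC ⟨n, rfl⟩)
  refine mul_le_mul_of_nonneg_right ?_ (by positivity)
  rw [← Real.rpow_natCast]
  exact Real.rpow_le_rpow_of_exponent_le (by exact_mod_cast hn) (Nat.le_ceil r)

end Constants

/-! ### The rate and the constant of the ergodic theorem -/

section Constants

/-- The constant in the bound for the dependence on the initial condition. -/
def forgetConst (p : ℕ) (q ε : ℝ) : ℝ :=
  2 * boundConst p ε * 2 ^ p * (2 * boundConst p ε) ^ q +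
    2 * boundConst p ε * (2 * boundConst p ε) ^ p * (2 * boundConst p ε) ^ q / rateConst p ε

theorem forgetConst_nonneg (p : ℕ) (q ε : ℝ) : 0 ≤ forgetConst p q ε := by
  have h1 := one_le_boundConst p ε
  have h2 := rateConst_pos p ε
  unfold forgetConst
  positivity

/-- The relation of the rate `ρ` and the constant `L` of the ergodic theorem to the parameters. -/
def IsRate (p : ℕ) (q ε δ K₀ L₀ ρ L : ℝ) : Prop :=
  0 < ρ ∧ ρ < 1 ∧ 1 ≤ L ∧ (0 ≤ q → 0 < δ → δ < 1 → 1 ≤ K₀ → 1 ≤ L₀ → ∃ η C E₀,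
    0 < η ∧ η < 1 ∧ δ ≤ η ^ 2 ∧ 1 ≤ C ∧ ρ = √η ∧
    (∀ n : ℕ, 1 ≤ n → (n : ℝ) ^ ((p : ℝ) * (p + q + 1)) * rateConst p ε ^ n ≤ C * (η ^ 2) ^ n) ∧
    (∀ n : ℕ, 1 ≤ n → (n : ℝ) ^ ((p : ℝ) * (p + q + 1)) * η ^ n ≤ C) ∧
    E₀ = L₀ + boundConst p ε ^ q * L₀ ^ 3 * C + forgetConst p q ε * C * L₀ ^ 3 ∧
    forgetConst p q ε * C * L₀ ^ 2 +
      3 * (E₀ / (1 - η ^ 2) + 2 * K₀ * E₀) / (1 - η) / η / ρ ≤ L)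

theorem exists_isRate (p : ℕ) (q ε δ K₀ L₀ : ℝ) : ∃ ρ L, IsRate p q ε δ K₀ L₀ ρ L := by
  by_cases h : 0 < δ ∧ δ < 1
  swap
  · exact ⟨1 / 2, 1, by norm_num, by norm_num, le_rfl, fun _ h1 h2 => absurd ⟨h1, h2⟩ h⟩
  obtain ⟨hδ0, hδ1⟩ := h
  have hτ0 := rateConst_pos p ε
  have hτ1 := rateConst_lt_one p ε
  set τ := rateConst p ε
  have hs0 : 0 < √τ := Real.sqrt_pos.2 hτ0
  have hs1 : √τ < 1 := (Real.sqrt_lt' one_pos).2 (by simpa using hτ1)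
  -- Two requirements: `δ ≤ η ^ 2` for the chain and `√τ ≤ η ^ 2` for the filter. One factor `√τ ^
  -- n` of `τ ^ n` absorbs the polynomial `n ^ r`, the other supplies the rate.
  set η := max √δ √√τ with hη
  have hη0 : 0 < η := lt_max_of_lt_left (Real.sqrt_pos.2 hδ0)
  have hη1 : η < 1 := max_lt ((Real.sqrt_lt' one_pos).2 (by simpa using hδ1))
    ((Real.sqrt_lt' one_pos).2 (by simpa using hs1))
  have hηδ : δ ≤ η ^ 2 := by
    calc δ = √δ ^ 2 := (Real.sq_sqrt hδ0.le).symm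
      _ ≤ η ^ 2 := pow_le_pow_left₀ (Real.sqrt_nonneg _) (le_max_left _ _) 2
  have hητ : √τ ≤ η ^ 2 := by
    calc √τ = √√τ ^ 2 := (Real.sq_sqrt hs0.le).symm
      _ ≤ η ^ 2 := pow_le_pow_left₀ (Real.sqrt_nonneg _) (le_max_right _ _) 2
  obtain ⟨C₁, hC₁, h1⟩ := exists_rpow_mul_pow_le hs0 hs1 ((p : ℝ) * (p + q + 1))
  obtain ⟨C₂, hC₂, h2⟩ := exists_rpow_mul_pow_le hη0 hη1 ((p : ℝ) * (p + q + 1))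
  refine ⟨√η, max 1 _, Real.sqrt_pos.2 hη0, (Real.sqrt_lt' one_pos).2 (by simpa using hη1),
    le_max_left _ _, fun _ _ _ _ _ => ⟨η, max C₁ C₂, _, hη0, hη1, hηδ, hC₁.trans (le_max_left _ _),
    rfl, fun n hn => ?_, fun n hn => (h2 n hn).trans (le_max_right _ _), rfl, le_max_right _ _⟩⟩
  calc (n : ℝ) ^ ((p : ℝ) * (p + q + 1)) * τ ^ n
      = ((n : ℝ) ^ ((p : ℝ) * (p + q + 1)) * √τ ^ n) * √τ ^ n := by
        rw [mul_assoc, ← mul_pow, Real.mul_self_sqrt hτ0.le]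
    _ ≤ max C₁ C₂ * (η ^ 2) ^ n :=
        mul_le_mul ((h1 n hn).trans (le_max_left _ _)) (pow_le_pow_left₀ hs0.le hητ n)
          (by positivity) (by linarith [le_max_left C₁ C₂])

end Constants

/-! ### Pathwise bounds for functionals of the filter -/

section Pathwise

variable {d p : ℕ} {X : Type} [MeasurableSpace X] [MetricSpace X] [CompactSpace X] [BorelSpace X]
  {Y : Type} [MetricSpace Y] [CompactSpace Y] [MeasurableSpace Y] [BorelSpace Y]
  {μ : Measure X} [IsFiniteMeasure μ] [NeZero μ] {R : E d → Y → X → X → ℝ} {Θ : Set (E d)}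
  {θ : E d} {ρ : MultiIndex d → C(Y × (X × X), ℝ)}

theorem psiSum_one_le {ψ : Y → ℝ} (hψ : ∀ y, 1 ≤ ψ y) (y : ℕ → Y) {n : ℕ} (hn : 1 ≤ n) :
    psiSum ψ y 1 n ≤ psiSum ψ y 0 n := by
  rcases hn.eq_or_lt with rfl | h
  · rw [psiSum, if_pos rfl]
    exact one_le_psiSum hψ (Nat.zero_le 1)
  · rw [psiSum, if_neg (by omega), psiSum, if_neg (by omega)]
    exact Finset.sum_le_sum_of_subset_of_nonneg (Finset.Icc_subset_Icc_left (by omega))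
      fun k _ _ => zero_le_one.trans (hψ _)

variable (hk : IsDerivKernel p R θ ρ) (hpos : ∀ y x x', 0 < R θ y x x')
  {ε : ℝ} (hmix : StrongMixing μ R Θ ε) {ψ : Y → ℝ} (hs : ScoreBound p R Θ ψ) (hθ : θ ∈ Θ)
  {Φ : X × Y × LVec d p X → ℝ} {φ : X × Y → ℝ} {q : ℝ} (hq : 0 ≤ q) (hφ : ∀ w, 1 ≤ φ w)
  (hΦ : ∀ x y, ∀ Λ Λ' : LVec d p X, Λ.IsL0 → Λ'.IsL0 →
    |Φ (x, y, Λ)| ≤ φ (x, y) * Λ.norm ^ q ∧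
    |Φ (x, y, Λ) - Φ (x, y, Λ')| ≤ φ (x, y) * (Λ - Λ').norm * (Λ.norm + Λ'.norm) ^ q)

include hk hpos hmix hs hθ hq hφ hΦ

/-- Growth of `Φ` combined with growth of the filter. The exponents are larger than needed, to agree
with those of the difference bound; `m = 0` and `m = 1` cover the original and the restarted filter.
-/
theorem abs_apply_FIter_le {Λ : LVec d p X} (hΛ : Λ.IsL0) (y : ℕ → Y) {m n : ℕ} (hm : m ≤ 1)
    (hn : 1 ≤ n) (w : X × Y) :
    |Φ (w.1, w.2, FIter μ R θ y Λ m n)| ≤ boundConst p ε ^ q * Λ.norm ^ ((p : ℝ) * (q + 1)) *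
      (φ w * psiSum ψ y 0 n ^ ((p : ℝ) * (p + q + 1))) := by
  have hK := one_le_boundConst p ε
  have h0 := isL0_FIter hk hpos hmix hθ hΛ y m n
  have h1 := (hΦ w.1 w.2 _ _ h0 h0).1
  have h2 := norm_FIter_le hk hpos hmix hθ hs hΛ (hm.trans hn) y
  have hN := hΛ.one_le_norm
  have hψ : 1 ≤ psiSum ψ y 0 n := one_le_psiSum hs.1 (Nat.zero_le n)
  have hψm : psiSum ψ y m n ≤ psiSum ψ y 0 n := by
    rcases Nat.le_one_iff_eq_zero_or_eq_one.1 hm with rfl | rfl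
    · exact le_rfl
    · exact psiSum_one_le hs.1 y hn
  have hψ1 : 1 ≤ psiSum ψ y m n := one_le_psiSum hs.1 (hm.trans hn)
  have hφw := hφ w
  refine h1.trans ?_
  have h3 : (FIter μ R θ y Λ m n).norm ^ q ≤
      boundConst p ε ^ q * (Λ.norm ^ p) ^ q * (psiSum ψ y 0 n ^ p) ^ q := by
    rw [← Real.mul_rpow (by positivity) (by positivity),
      ← Real.mul_rpow (by positivity) (by positivity)]
    refine Real.rpow_le_rpow (LVec.norm_nonneg _) (h2.trans ?_) hq
    gcongr
  have h4 : (Λ.norm ^ p) ^ q ≤ Λ.norm ^ ((p : ℝ) * (q + 1)) := by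
    rw [← Real.rpow_natCast, ← Real.rpow_mul (by positivity)]
    exact Real.rpow_le_rpow_of_exponent_le hN
      (mul_le_mul_of_nonneg_left (by linarith) (Nat.cast_nonneg p))
  have h5 : (psiSum ψ y 0 n ^ p) ^ q ≤ psiSum ψ y 0 n ^ ((p : ℝ) * (p + q + 1)) := by
    rw [← Real.rpow_natCast, ← Real.rpow_mul (by positivity)]
    exact Real.rpow_le_rpow_of_exponent_le hψ
      (mul_le_mul_of_nonneg_left (by linarith [Nat.cast_nonneg (α := ℝ) p]) (Nat.cast_nonneg p))
  calc φ (w.1, w.2) * (FIter μ R θ y Λ m n).norm ^ q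
      ≤ φ w * (boundConst p ε ^ q * Λ.norm ^ ((p : ℝ) * (q + 1)) *
        psiSum ψ y 0 n ^ ((p : ℝ) * (p + q + 1))) := by
        refine mul_le_mul_of_nonneg_left (h3.trans ?_) (by linarith)
        gcongr
    _ = _ := by ring

/-- The filter `B` started from `ref` at time `0` lies between the two. Against `Λ` it has the same
observations and another initial value; against the restarted filter `D` it has the initial value
`FStep μ R θ (y 1) ref` at time `1`. Both differences are forgotten geometrically. -/
theorem abs_apply_FIter_sub_le {Λ ref : LVec d p X} (hΛ : Λ.IsL0) (hr : ref.IsL0)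
    (hr1 : ref.norm = 1) (y : ℕ → Y) {n : ℕ} (hn : 1 ≤ n) (w : X × Y) :
    |Φ (w.1, w.2, FIter μ R θ y Λ 0 n) - Φ (w.1, w.2, FIter μ R θ y ref 1 n)| ≤
      forgetConst p q ε * rateConst p ε ^ n * Λ.norm ^ ((p : ℝ) * (q + 1)) *
        (φ w * psiSum ψ y 0 n ^ ((p : ℝ) * (p + q + 1))) := by
  obtain ⟨k, rfl⟩ : ∃ k, n = k + 1 := ⟨n - 1, by omega⟩
  have hK := one_le_boundConst p ε
  have hτ := rateConst_pos p ε
  set K := boundConst p ε with hKdef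
  set τ := rateConst p ε with hτdef
  have hN := hΛ.one_le_norm
  set Ψ := psiSum ψ y 0 (k + 1) with hΨdef
  have hψ : 1 ≤ Ψ := one_le_psiSum hs.1 (Nat.zero_le _)
  have hψ1 : psiSum ψ y 1 (k + 1) ≤ Ψ := psiSum_one_le hs.1 y hn
  have hψ0 : 1 ≤ psiSum ψ y 1 (k + 1) := one_le_psiSum hs.1 hn
  have hφw := hφ w
  set G := Λ.norm ^ p with hG
  set T := Ψ ^ p with hT
  have hψ1p : psiSum ψ y 1 (k + 1) ^ p ≤ T := pow_le_pow_left₀ (by linarith) hψ1 p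
  have hG1 : 1 ≤ G := one_le_pow₀ hN
  have hT1 : 1 ≤ T := one_le_pow₀ hψ
  have hexpG : Λ.norm ^ ((p : ℝ) * (q + 1)) = G ^ q * G := by
    rw [Real.rpow_mul (by positivity), Real.rpow_natCast, Real.rpow_add (by positivity),
      Real.rpow_one]
  -- The three factors of `T = Ψ ^ p` have separate origins: `T ^ p` bounds the value after one
  -- step, raised to the power `p`; `T ^ q` is the growth of `Φ`; the last `T` is the forgetting
  -- bound.
  have hexpT : Ψ ^ ((p : ℝ) * (p + q + 1)) = T ^ p * T ^ q * T := by
    rw [Real.rpow_mul (by positivity), Real.rpow_natCast, Real.rpow_add (by positivity),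
      Real.rpow_add (by positivity), Real.rpow_one, Real.rpow_natCast]
  have hGq : 1 ≤ G ^ q := Real.one_le_rpow hG1 hq
  have hTq : 1 ≤ T ^ q := Real.one_le_rpow hT1 hq
  have hTp : 1 ≤ T ^ p := one_le_pow₀ hT1
  set A := FIter μ R θ y Λ 0 (k + 1) with hA
  set B := FIter μ R θ y ref 0 (k + 1) with hB
  set D := FIter μ R θ y ref 1 (k + 1) with hD
  have hA0 : A.IsL0 := isL0_FIter hk hpos hmix hθ hΛ _ _ _
  have hB0 : B.IsL0 := isL0_FIter hk hpos hmix hθ hr _ _ _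
  have hD0 : D.IsL0 := isL0_FIter hk hpos hmix hθ hr _ _ _
  have hAn : A.norm ≤ K * G * T := norm_FIter_le hk hpos hmix hθ hs hΛ (Nat.zero_le _) y
  have hBn : B.norm ≤ K * T := by
    have := norm_FIter_le hk hpos hmix hθ hs hr (Nat.zero_le (k + 1)) y
    rwa [hr1, one_pow, mul_one] at this
  have hDn : D.norm ≤ K * T := by
    have := norm_FIter_le hk hpos hmix hθ hs hr hn y
    rw [hr1, one_pow, mul_one] at this
    exact this.trans (mul_le_mul_of_nonneg_left hψ1p (by linarith))
  have hAB : (A - B).norm ≤ K * τ ^ (k + 1) * 2 * (2 * Λ.norm) ^ p * T := by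
    have := norm_FIter_sub_le' hk hpos hmix hθ hs hΛ hr (Nat.zero_le (k + 1)) y
    rw [hr1, Nat.sub_zero] at this
    refine this.trans ?_
    have : Λ.norm + 1 ≤ 2 * Λ.norm := by linarith
    gcongr
  -- Only `k = n - 1` steps of forgetting are available after the restart at time `1`, which
  -- accounts for the division by the rate in `forgetConst`.
  have hBD : (B - D).norm ≤ K * τ ^ k * 2 * (2 * (K * T)) ^ p * T := by
    have hF0 := isL0_FStep hk hpos hmix hθ hr (y 1)
    have hF1 : (FStep μ R θ (y 1) ref).norm ≤ K * T := by
      have h1 := norm_FIter_le hk hpos hmix hθ hs hr (Nat.zero_le 1) y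
      rw [hr1, one_pow, mul_one, FIter_succ le_rfl, FIter_self] at h1
      refine h1.trans ?_
      have h2 : psiSum ψ y 0 1 ≤ Ψ := by
        rw [psiSum, if_neg one_ne_zero]
        simp only [zero_add, Finset.Icc_self, Finset.sum_singleton]
        exact le_psiSum hs.1 (by omega) hn
      have h3 : 1 ≤ psiSum ψ y 0 1 := one_le_psiSum hs.1 (Nat.zero_le _)
      exact mul_le_mul_of_nonneg_left (pow_le_pow_left₀ (by linarith) h2 p) (by linarith)
    have := norm_FIter_sub_le' hk hpos hmix hθ hs hF0 hr hn y
    rw [← FIter_succ', hr1, Nat.add_sub_cancel] at this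
    refine this.trans ?_
    have h4 : (FStep μ R θ (y 1) ref).norm + 1 ≤ 2 * (K * T) := by
      have : 1 ≤ K * T := one_le_mul_of_one_le_of_one_le hK hT1
      linarith
    have h5 := LVec.norm_nonneg (FStep μ R θ (y 1) ref)
    gcongr
  have hKT : K * T ≤ K * G * T := by
    rw [mul_assoc]
    exact mul_le_mul_of_nonneg_left (le_mul_of_one_le_left (by linarith) hG1) (by linarith)
  have hq1 : (A.norm + B.norm) ^ q ≤ (2 * K) ^ q * (G ^ q * T ^ q) := by
    rw [← Real.mul_rpow (by positivity) (by positivity),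
      ← Real.mul_rpow (by positivity) (by positivity)]
    refine Real.rpow_le_rpow (add_nonneg (LVec.norm_nonneg _) (LVec.norm_nonneg _)) ?_ hq
    calc A.norm + B.norm ≤ K * G * T + K * G * T := add_le_add hAn (hBn.trans hKT)
      _ = 2 * K * (G * T) := by ring
  have hq2 : (B.norm + D.norm) ^ q ≤ (2 * K) ^ q * T ^ q := by
    rw [← Real.mul_rpow (by positivity) (by positivity)]
    refine Real.rpow_le_rpow (add_nonneg (LVec.norm_nonneg _) (LVec.norm_nonneg _)) ?_ hq
    linarith
  have e1 : |Φ (w.1, w.2, A) - Φ (w.1, w.2, B)| ≤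
      2 * K * 2 ^ p * (2 * K) ^ q * (τ ^ (k + 1) * (G ^ q * G) * (φ w * (T ^ p * T ^ q * T))) := by
    refine (hΦ w.1 w.2 A B hA0 hB0).2.trans ?_
    calc φ (w.1, w.2) * (A - B).norm * (A.norm + B.norm) ^ q
        ≤ φ w * (K * τ ^ (k + 1) * 2 * (2 * Λ.norm) ^ p * T) * ((2 * K) ^ q * (G ^ q * T ^ q)) := by
          refine mul_le_mul (mul_le_mul_of_nonneg_left hAB (by linarith)) hq1
            (Real.rpow_nonneg (add_nonneg (LVec.norm_nonneg _) (LVec.norm_nonneg _)) q)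
            (by positivity)
      _ = 2 * K * 2 ^ p * (2 * K) ^ q *
          (τ ^ (k + 1) * (G ^ q * G) * (φ w * (1 * T ^ q * T))) := by
          rw [mul_pow, ← hG]; ring
      _ ≤ _ := by gcongr
  have e2 : |Φ (w.1, w.2, B) - Φ (w.1, w.2, D)| ≤ 2 * K * (2 * K) ^ p * (2 * K) ^ q / τ *
      (τ ^ (k + 1) * (G ^ q * G) * (φ w * (T ^ p * T ^ q * T))) := by
    refine (hΦ w.1 w.2 B D hB0 hD0).2.trans ?_
    calc φ (w.1, w.2) * (B - D).norm * (B.norm + D.norm) ^ q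
        ≤ φ w * (K * τ ^ k * 2 * (2 * (K * T)) ^ p * T) * ((2 * K) ^ q * T ^ q) := by
          refine mul_le_mul (mul_le_mul_of_nonneg_left hBD (by linarith)) hq2
            (Real.rpow_nonneg (add_nonneg (LVec.norm_nonneg _) (LVec.norm_nonneg _)) q)
            (by positivity)
      _ = 2 * K * (2 * K) ^ p * (2 * K) ^ q / τ *
          (τ ^ (k + 1) * (1 * 1) * (φ w * (T ^ p * T ^ q * T))) := by
          rw [← mul_assoc 2 K T, mul_pow (2 * K) T p, pow_succ]; field_simp
      _ ≤ _ := by gcongr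
  refine (abs_sub_le _ (Φ (w.1, w.2, B)) _).trans ((add_le_add e1 e2).trans (le_of_eq ?_))
  rw [hexpG, hexpT, forgetConst, ← hKdef, ← hτdef]
  ring

end Pathwise

/-! ### Moment bounds and existence of the limits -/

section Limit

variable {d p : ℕ} {X : Type} [MeasurableSpace X] [MetricSpace X] [CompactSpace X] [BorelSpace X]
  {Y : Type} [MetricSpace Y] [CompactSpace Y] [MeasurableSpace Y] [BorelSpace Y]
  {P : Kernel X X} [IsMarkovKernel P] {Q : Kernel X Y} [IsMarkovKernel Q]

theorem lintegral_compProd_le {F : X × Y → ℝ≥0∞} (hF : Measurable F) {c : ℝ≥0∞}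
    (h : ∀ x, ∫⁻ y, F (x, y) ∂(Q x) ≤ c) (m : Measure X) [IsProbabilityMeasure m] :
    ∫⁻ w, F w ∂(m ⊗ₘ Q) ≤ c := by
  rw [Measure.lintegral_compProd hF]
  exact (lintegral_mono h).trans (by simp)

/-- The power mean inequality bounds the power of the sum by `(n + 1) ^ (r - 1)` times the sum of
the powers, and that sum has `n + 1` terms. -/
theorem lintegral_mul_psiSum_rpow_le {r : ℝ} (hr : 1 ≤ r) {φ : X × Y → ℝ} (hφm : Measurable φ)
    (hφ : ∀ w, 1 ≤ φ w) {ψ : Y → ℝ} (hψm : Measurable ψ) (hψ : ∀ y, 1 ≤ ψ y) {o : Y → Y → Y}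
    (ho : Measurable fun z : Y × Y => o z.1 z.2) {m : Measure (ℕ → X × Y)} (n : ℕ) {B : ℝ≥0∞}
    (hB : ∀ k, k ≤ n → ∫⁻ ω, ENNReal.ofReal (φ (ω (n + 1))) *
      ENNReal.ofReal (ψ (obsSeq o ω (k + 1)) ^ r) ∂m ≤ B) :
    ∫⁻ ω, ENNReal.ofReal (φ (ω (n + 1)) * psiSum ψ (obsSeq o ω) 0 (n + 1) ^ r) ∂m ≤
      ENNReal.ofReal (((n + 1 : ℕ) : ℝ) ^ r) * B := by
  have hom : ∀ k, Measurable fun ω : ℕ → X × Y => obsSeq o ω k := fun k =>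
    ho.comp (g := fun z : Y × Y => o z.1 z.2)
      (f := fun ω : ℕ → X × Y => ((ω (k - 1)).2, (ω k).2)) (by fun_prop)
  have hψ0 : ∀ y, 0 ≤ ψ y := fun y => zero_le_one.trans (hψ y)
  have h1 : ∀ ω : ℕ → X × Y,
      ENNReal.ofReal (φ (ω (n + 1)) * psiSum ψ (obsSeq o ω) 0 (n + 1) ^ r) ≤
        ENNReal.ofReal (((n + 1 : ℕ) : ℝ) ^ (r - 1)) * ∑ k ∈ Finset.Icc 1 (n + 1),
          ENNReal.ofReal (φ (ω (n + 1))) * ENNReal.ofReal (ψ (obsSeq o ω k) ^ r) := by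
    intro ω
    have h2 := Real.rpow_sum_le_const_mul_sum_rpow_of_nonneg (Finset.Icc 1 (n + 1))
      (f := fun k => ψ (obsSeq o ω k)) hr fun k _ => hψ0 _
    rw [Nat.card_Icc, Nat.add_sub_cancel] at h2
    rw [psiSum, if_neg (Nat.succ_ne_zero n), ← Finset.mul_sum,
      ← ENNReal.ofReal_sum_of_nonneg fun k _ => Real.rpow_nonneg (hψ0 _) r,
      ← ENNReal.ofReal_mul (by linarith [hφ (ω (n + 1))]), ← ENNReal.ofReal_mul (by positivity)]
    refine ENNReal.ofReal_le_ofReal ?_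
    have := mul_le_mul_of_nonneg_left h2 (zero_le_one.trans (hφ (ω (n + 1))))
    refine this.trans (le_of_eq ?_)
    ring
  refine (lintegral_mono h1).trans ?_
  rw [lintegral_const_mul' _ _ ENNReal.ofReal_ne_top, lintegral_finsetSum _ fun k _ => by
    have := hom k
    fun_prop]
  calc _ ≤ ENNReal.ofReal (((n + 1 : ℕ) : ℝ) ^ (r - 1)) * ∑ k ∈ Finset.Icc 1 (n + 1), B := by
        refine mul_le_mul_right (Finset.sum_le_sum fun k hk => ?_) _
        obtain ⟨j, rfl⟩ : ∃ j, k = j + 1 := ⟨k - 1, by have := (Finset.mem_Icc.1 hk).1; omega⟩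
        exact hB j (by have := (Finset.mem_Icc.1 hk).2; omega)
    _ = _ := by
        rw [Finset.sum_const, Nat.card_Icc, Nat.add_sub_cancel, nsmul_eq_mul, ← mul_assoc,
          ← ENNReal.ofReal_natCast, ← ENNReal.ofReal_mul (by positivity),
          Real.rpow_sub_one (by positivity), div_mul_cancel₀ _ (by positivity)]

/-- The moment bounds that make the chain with observations `o y y'` ergodic. -/
structure MomentBound (P : Kernel X X) (Q : Kernel X Y) (r L₀ : ℝ) (φ : X × Y → ℝ) (ψ : Y → ℝ)
    (o : Y → Y → Y) (W : Y → ℝ) : Prop where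
  one_le : ∀ y, 1 ≤ W y
  weight : ∀ x, ∫⁻ w, ENNReal.ofReal (W w.2) ∂(obsKer P Q x) ≤ ENNReal.ofReal L₀
  phi : ∀ x, ∫⁻ w, ENNReal.ofReal (φ w) ∂(obsKer P Q x) ≤ ENNReal.ofReal L₀
  moment : ∀ n v, ∫⁻ ω, ENNReal.ofReal (φ (ω (n + 1)) * psiSum ψ (obsSeq o ω) 0 (n + 1) ^ r)
    ∂(pathK (stateKer P Q) (n + 1) v) ≤
      ENNReal.ofReal (((n + 1 : ℕ) : ℝ) ^ r * (L₀ ^ 2 * W v.2))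

section

variable {r : ℝ} {φ : X × Y → ℝ} {ψ : Y → ℝ} {L₀ : ℝ} (hr : 1 ≤ r) (hφm : Measurable φ)
  (hφ : ∀ w, 1 ≤ φ w) (hψm : Measurable ψ) (hψ : ∀ y, 1 ≤ ψ y) (hL : 1 ≤ L₀)
  (h : ∀ x, ∫⁻ y, ENNReal.ofReal (φ (x, y) * ψ y ^ r) ∂(Q x) ≤ ENNReal.ofReal L₀)

include hr hφm hφ hψm hψ hL h

theorem lintegral_obs_bounds (m : Measure X) [IsProbabilityMeasure m] :
    ∫⁻ w, ENNReal.ofReal (φ w) ∂(m ⊗ₘ Q) ≤ ENNReal.ofReal L₀ ∧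
    ∫⁻ w, ENNReal.ofReal (ψ w.2 ^ r) ∂(m ⊗ₘ Q) ≤ ENNReal.ofReal L₀ ∧
    ∫⁻ w, ENNReal.ofReal (φ w) * ENNReal.ofReal (ψ w.2 ^ r) ∂(m ⊗ₘ Q) ≤ ENNReal.ofReal L₀ := by
  have hψr : ∀ y, 1 ≤ ψ y ^ r := fun y => Real.one_le_rpow (hψ y) (by linarith)
  have h1 : ∫⁻ w, ENNReal.ofReal (φ w * ψ w.2 ^ r) ∂(m ⊗ₘ Q) ≤ ENNReal.ofReal L₀ :=
    lintegral_compProd_le (by fun_prop) h m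
  refine ⟨le_trans (lintegral_mono fun w => ENNReal.ofReal_le_ofReal ?_) h1,
    le_trans (lintegral_mono fun w => ENNReal.ofReal_le_ofReal ?_) h1,
    le_trans (le_of_eq (lintegral_congr fun w => ?_)) h1⟩
  · exact le_mul_of_one_le_right (zero_le_one.trans (hφ w)) (hψr _)
  · exact le_mul_of_one_le_left (zero_le_one.trans (hψr _)) (hφ w)
  · rw [ENNReal.ofReal_mul (zero_le_one.trans (hφ w))]

/-- Every observation used by the filter lies in the future of the starting point, so its moments
are bounded uniformly and the weight is `1`. -/
theorem momentBound_next :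
    MomentBound P Q r L₀ φ ψ (fun _ b => b) fun _ => 1 where
  one_le _ := le_rfl
  weight x := by simpa using hL
  phi x := by rw [obsKer_apply]; exact (lintegral_obs_bounds hr hφm hφ hψm hψ hL h _).1
  moment n v := by
    have hb := fun v : X × Y => lintegral_obs_bounds hr hφm hφ hψm hψ hL h (P v.1)
    simp_rw [← stateKer_apply (P := P) (Q := Q)] at hb
    rw [ENNReal.ofReal_mul (by positivity), mul_one, sq, ENNReal.ofReal_mul (by linarith)]
    refine lintegral_mul_psiSum_rpow_le hr hφm hφ hψm hψ measurable_snd n fun k hk => ?_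
    exact lintegral_pathK_mul_le (f := fun w => ENNReal.ofReal (φ w))
      (g := fun w : X × Y => ENNReal.ofReal (ψ w.2 ^ r)) (by fun_prop) (by fun_prop)
      (by simpa using hL) (fun v => (hb v).1) (fun v => (hb v).2.1) (fun v => (hb v).2.2) hk v

/-- The first update uses the current observation, which is not averaged. Its contribution `ψ y ^ r`
remains as the weight. -/
theorem momentBound_current :
    MomentBound P Q r L₀ φ ψ (fun a _ => a) fun y => ψ y ^ r where
  one_le y := Real.one_le_rpow (hψ y) (by linarith)
  weight x := by rw [obsKer_apply]; exact (lintegral_obs_bounds hr hφm hφ hψm hψ hL h _).2.1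
  phi x := by rw [obsKer_apply]; exact (lintegral_obs_bounds hr hφm hφ hψm hψ hL h _).1
  moment n v := by
    have hb := fun v : X × Y => lintegral_obs_bounds hr hφm hφ hψm hψ hL h (P v.1)
    simp_rw [← stateKer_apply (P := P) (Q := Q)] at hb
    have hψr : 1 ≤ ψ v.2 ^ r := Real.one_le_rpow (hψ _) (by linarith)
    have hL1 : 1 ≤ ENNReal.ofReal L₀ := by simpa using hL
    have hψr' : 1 ≤ ENNReal.ofReal (ψ v.2 ^ r) := by simpa using hψr
    have hf : Measurable fun w : X × Y => ENNReal.ofReal (φ w) := by fun_prop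
    have hg : Measurable fun w : X × Y => ENNReal.ofReal (ψ w.2 ^ r) := by fun_prop
    rw [ENNReal.ofReal_mul (by positivity), ENNReal.ofReal_mul (by positivity), sq,
      ENNReal.ofReal_mul (by linarith)]
    refine lintegral_mul_psiSum_rpow_le hr hφm hφ hψm hψ measurable_fst n fun k hk => ?_
    rcases k with _ | k
    · refine (lintegral_pathK_first_le hf hg (fun v => (hb v).1) n v).trans ?_
      exact mul_le_mul_left (le_mul_of_one_le_right' hL1) _
    · refine le_trans ?_ (le_mul_of_one_le_right' hψr')
      exact lintegral_pathK_mul_le hf hg hL1 (fun v => (hb v).1) (fun v => (hb v).2.1)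
        (fun v => (hb v).2.2) (Nat.le_of_succ_le hk) v

end

variable {μ : Measure X} [IsFiniteMeasure μ] [NeZero μ] {R : E d → Y → X → X → ℝ} {Θ : Set (E d)}
  {θ : E d} {ρ : MultiIndex d → C(Y × (X × X), ℝ)}

set_option maxHeartbeats 400000 in
-- Forgetting replaces the filter by one restarted from `ref` at time `1`. Its expected functional
-- depends on the starting point only through the state, which leaves the approximate recursion for
-- `g n` required by `exists_geometric_limit`. The limit is common to all starting points and all
-- `Λ`.
theorem exists_limit_pathK (hp : 1 ≤ p) (hk : IsDerivKernel p R θ ρ)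
    (hpos : ∀ y x x', 0 < R θ y x x') {ε c : ℝ} (hmix : StrongMixing μ R Θ ε)
    (hsc : ScoreBound p R Θ fun _ => c) {ψ : Y → ℝ} (hs : ScoreBound p R Θ ψ) (hθ : θ ∈ Θ)
    {o : Y → Y → Y} (ho : Measurable fun z : Y × Y => o z.1 z.2) {Φ : X × Y × LVec d p X → ℝ}
    (hΦm : Measurable fun z : {z : X × Y × LVec d p X // z.2.2.IsL0} => Φ z)
    {φ : X × Y → ℝ} {q : ℝ} (hq : 0 ≤ q) (hφ : ∀ w, 1 ≤ φ w)
    (hΦ : ∀ x y, ∀ Λ Λ' : LVec d p X, Λ.IsL0 → Λ'.IsL0 →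
      |Φ (x, y, Λ)| ≤ φ (x, y) * Λ.norm ^ q ∧
      |Φ (x, y, Λ) - Φ (x, y, Λ')| ≤ φ (x, y) * (Λ - Λ').norm * (Λ.norm + Λ'.norm) ^ q)
    {π : Measure X} [IsProbabilityMeasure π] {δ K₀ L₀ : ℝ} (hP : GeomErgodic P π δ K₀) (hL : 1 ≤ L₀)
    {W : Y → ℝ} (hM : MomentBound P Q ((p : ℝ) * (p + q + 1)) L₀ φ ψ o W) {rt L : ℝ}
    (hrt : IsRate p q ε δ K₀ L₀ rt L) :
    (∀ v, ∀ Λ : LVec d p X, Λ.IsL0 → ∀ n, 1 ≤ n → Integrable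
      (fun ω => Φ ((ω n).1, (ω n).2, FIter μ R θ (obsSeq o ω) Λ 0 n)) (pathK (stateKer P Q) n v)) ∧
    ∃ ϕ : ℝ, ∀ v, ∀ Λ : LVec d p X, Λ.IsL0 → ∀ n, 1 ≤ n →
      |∫ ω, Φ ((ω n).1, (ω n).2, FIter μ R θ (obsSeq o ω) Λ 0 n) ∂(pathK (stateKer P Q) n v) - ϕ| ≤
        L * rt ^ n * W v.2 * Λ.norm ^ ((p : ℝ) * (q + 1)) := by
  obtain ⟨hrt0, hrt1, hL1, hrt'⟩ := hrt
  obtain ⟨η, C, E₀, hη0, hη1, hηδ, hC, hrη, hC1, hC2, hE₀, hLE⟩ := hrt' hq hP.1 hP.2.1 hP.2.2.1 hL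
  set r : ℝ := (p : ℝ) * (p + q + 1) with hr
  set s : ℝ := (p : ℝ) * (q + 1) with hs'
  set Kq : ℝ := boundConst p ε ^ q with hKq
  set Fc : ℝ := forgetConst p q ε with hFc
  have hKq0 : 0 ≤ Kq := Real.rpow_nonneg (zero_le_one.trans (one_le_boundConst p ε)) q
  have hFc0 : 0 ≤ Fc := forgetConst_nonneg p q ε
  have hτ0 := rateConst_pos p ε
  obtain ⟨x₀⟩ : Nonempty X := by
    by_contra hX
    rw [not_nonempty_iff] at hX
    exact IsProbabilityMeasure.ne_zero π (Measure.eq_zero_of_isEmpty π)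
  set ref : LVec d p X := initVec d p (Measure.dirac x₀)
  have hr0 : ref.IsL0 := LVec.isL0_initVec _
  have hr1 : ref.norm = 1 := LVec.norm_initVec _
  have hmeas : ∀ {Λ : LVec d p X}, Λ.IsL0 → ∀ n, Measurable fun ω : ℕ → X × Y =>
      Φ ((ω n).1, (ω n).2, FIter μ R θ (obsSeq o ω) Λ 0 n) := fun hΛ n =>
    measurable_comp_FIter hk hpos hmix hsc hθ ho hΦm hΛ n n
  -- bounds for one initial value
  have hA : ∀ v, ∀ Λ : LVec d p X, Λ.IsL0 → ∀ n, _ := fun v Λ hΛ n =>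
    abs_integral_le_of_lintegral_le (m := pathK (stateKer P Q) (n + 1) v)
      (hmeas hΛ (n + 1)).aestronglyMeasurable
      (a := Kq * Λ.norm ^ s) (mul_nonneg hKq0 (Real.rpow_nonneg (LVec.norm_nonneg _) _))
      (by have := hM.one_le v.2; positivity)
      (Eventually.of_forall fun ω => abs_apply_FIter_le hk hpos hmix hs hθ hq hφ hΦ hΛ
        (obsSeq o ω) (Nat.zero_le 1) (Nat.succ_pos n) (ω (n + 1))) (hM.moment n v)
  refine ⟨fun v Λ hΛ n hn => ?_, ?_⟩
  · obtain ⟨k, rfl⟩ : ∃ k, n = k + 1 := ⟨n - 1, by omega⟩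
    exact (hA v Λ hΛ k).1
  set A : ℕ → X × Y → LVec d p X → ℝ := fun n v Λ =>
    ∫ ω, Φ ((ω n).1, (ω n).2, FIter μ R θ (obsSeq o ω) Λ 0 n) ∂(pathK (stateKer P Q) n v)
    with hAdef
  have hAm : ∀ n, Measurable fun v => A n v ref := fun n =>
    ((hmeas hr0 n).stronglyMeasurable.integral_kernel).measurable
  set g : ℕ → X → ℝ := fun n x => ∫ w, A n w ref ∂(obsKer P Q x) with hg
  have hgm : ∀ n, Measurable (g n) := fun n =>
    ((hAm n).stronglyMeasurable.integral_kernel).measurable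
  -- the first step forgets the initial value
  have hstep : ∀ n v, ∀ Λ : LVec d p X, Λ.IsL0 → |A (n + 1) v Λ - g n v.1| ≤
      Fc * rateConst p ε ^ (n + 1) * Λ.norm ^ s * (((n + 1 : ℕ) : ℝ) ^ r * (L₀ ^ 2 * W v.2)) := by
    intro n v Λ hΛ
    -- The restarted filter on a path is the filter of the shifted path, so its expectation is the
    -- average of `A n · ref` over the first transition, which is `g n`.
    have hD : ∀ ω : ℕ → X × Y, ∀ v, FIter μ R θ (obsSeq o (consPath v ω)) ref 1 (n + 1) =
        FIter μ R θ (obsSeq o ω) ref 0 n := by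
      intro ω v
      rw [add_comm n 1, FIter_shift]
      refine FIter_congr fun k hk _ => ?_
      obtain ⟨k, rfl⟩ : ∃ j, k = j + 1 := ⟨k - 1, by omega⟩
      rw [obsSeq, obsSeq, show 1 + (k + 1) - 1 = k + 1 by omega,
        show 1 + (k + 1) = k + 1 + 1 by omega]
      rfl
    have hDm : Measurable fun ω : ℕ → X × Y =>
        Φ ((ω (n + 1)).1, (ω (n + 1)).2, FIter μ R θ (obsSeq o ω) ref 1 (n + 1)) := by
      have h1 : Measurable fun ω : ℕ → X × Y => fun k => ω (k + 1) := by fun_prop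
      have h2 := (hmeas hr0 n).comp h1
      convert h2 using 1
      funext ω
      have h3 := hD (fun k => ω (k + 1)) (ω 0)
      have h4 : consPath (ω 0) (fun k => ω (k + 1)) = ω := by
        funext k
        rcases k with _ | k <;> rfl
      rw [h4] at h3
      rw [h3]
      rfl
    have hDi := (abs_integral_le_of_lintegral_le (m := pathK (stateKer P Q) (n + 1) v)
      hDm.aestronglyMeasurable
      (a := Kq * ref.norm ^ s) (mul_nonneg hKq0 (Real.rpow_nonneg (LVec.norm_nonneg _) _))
      (by have := hM.one_le v.2; positivity)
      (Eventually.of_forall fun ω => abs_apply_FIter_le hk hpos hmix hs hθ hq hφ hΦ hr0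
        (obsSeq o ω) le_rfl (Nat.succ_pos n) (ω (n + 1))) (hM.moment n v)).1
    have hgv : g n v.1 = ∫ ω, Φ ((ω (n + 1)).1, (ω (n + 1)).2,
        FIter μ R θ (obsSeq o ω) ref 1 (n + 1)) ∂(pathK (stateKer P Q) (n + 1) v) := by
      rw [integral_pathK_succ n v hDm hDi]
      simp_rw [hD, consPath_succ]
      rfl
    rw [hgv, hAdef, ← integral_sub (hA v Λ hΛ n).1 hDi]
    exact (abs_integral_le_of_lintegral_le
      ((hmeas hΛ (n + 1)).sub hDm).aestronglyMeasurable
      (mul_nonneg (by positivity) (Real.rpow_nonneg (LVec.norm_nonneg _) _))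
      (by have := hM.one_le v.2; positivity)
      (Eventually.of_forall fun ω => abs_apply_FIter_sub_le hk hpos hmix hs hθ hq hφ hΦ hΛ hr0 hr1
        (obsSeq o ω) (Nat.succ_pos n) (ω (n + 1))) (hM.moment n v)).2
  -- The moments let `g n` grow like `n ^ r`; the factor `η ^ n` compensates this, as
  -- `exists_geometric_limit` permits.
  have hgb : ∀ n x, Integrable (fun w => A n w ref) (obsKer P Q x) ∧
      η ^ n * |g n x| ≤ L₀ + Kq * L₀ ^ 3 * C := by
    intro n x
    rcases n with _ | n
    · have h0 : ∀ w : X × Y, |A 0 w ref| ≤ 1 * φ w := by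
        intro w
        have h1 : A 0 w ref = Φ (w.1, w.2, ref) := by
          simp only [hAdef]
          rw [pathK, Kernel.deterministic_apply,
            integral_dirac' _ _ (hmeas hr0 0).stronglyMeasurable]
          rfl
        have h2 := (hΦ w.1 w.2 ref ref hr0 hr0).1
        rwa [← h1, hr1, Real.one_rpow, mul_one, ← one_mul (φ _)] at h2
      obtain ⟨h1, h2⟩ := abs_integral_le_of_lintegral_le (hAm 0).aestronglyMeasurable zero_le_one
        (zero_le_one.trans hL) (Eventually.of_forall h0) (hM.phi x)
      refine ⟨h1, ?_⟩
      rw [pow_zero, one_mul]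
      rw [one_mul] at h2
      have : 0 ≤ Kq * L₀ ^ 3 * C := by positivity
      linarith
    · have h0 : ∀ w : X × Y, |A (n + 1) w ref| ≤
          Kq * (((n + 1 : ℕ) : ℝ) ^ r * L₀ ^ 2) * W w.2 := by
        intro w
        refine ((hA w ref hr0 n).2).trans (le_of_eq ?_)
        rw [hr1, Real.one_rpow]
        ring
      obtain ⟨h1, h2⟩ := abs_integral_le_of_lintegral_le (hAm (n + 1)).aestronglyMeasurable
        (by positivity) (zero_le_one.trans hL) (Eventually.of_forall h0) (hM.weight x)
      refine ⟨h1, ?_⟩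
      calc η ^ (n + 1) * |g (n + 1) x|
          ≤ η ^ (n + 1) * (Kq * (((n + 1 : ℕ) : ℝ) ^ r * L₀ ^ 2) * L₀) := by gcongr
        _ = Kq * L₀ ^ 3 * (((n + 1 : ℕ) : ℝ) ^ r * η ^ (n + 1)) := by ring
        _ ≤ Kq * L₀ ^ 3 * C := by gcongr; exact hC2 (n + 1) (Nat.succ_pos n)
        _ ≤ _ := by linarith
  have hE0 : 0 ≤ Fc * C * L₀ ^ 3 := by positivity
  have hE1 : 0 ≤ Kq * L₀ ^ 3 * C := by positivity
  have hgs : ∀ n x, |g (n + 1) x - ∫ x', g n x' ∂(P x)| ≤ E₀ * (η ^ 2) ^ n := by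
    intro n x
    have h1 : ∫ x', g n x' ∂(P x) = ∫ w, g n w.1 ∂(obsKer P Q x) := by
      rw [obsKer_apply, ← integral_map (f := g n) measurable_fst.aemeasurable
        (hgm n).aestronglyMeasurable]
      change _ = ∫ y, g n y ∂(P x ⊗ₘ Q).fst
      rw [Measure.fst_compProd]
    have h2 : Integrable (fun w : X × Y => g n w.1) (obsKer P Q x) := by
      refine integrable_of_abs_le _ ((hgm n).comp measurable_fst)
        (C := (L₀ + Kq * L₀ ^ 3 * C) / η ^ n) fun w => ?_
      rw [le_div_iff₀' (by positivity)]
      exact (hgb n w.1).2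
    have h0 : ∀ w : X × Y, |A (n + 1) w ref - g n w.1| ≤
        Fc * rateConst p ε ^ (n + 1) * (((n + 1 : ℕ) : ℝ) ^ r * L₀ ^ 2) * W w.2 := by
      intro w
      refine (hstep n w ref hr0).trans (le_of_eq ?_)
      rw [hr1, Real.one_rpow]
      ring
    rw [h1, hg]
    simp only
    rw [← integral_sub (hgb (n + 1) x).1 h2]
    refine (abs_integral_le_of_lintegral_le
      ((hAm (n + 1)).sub ((hgm n).comp measurable_fst)).aestronglyMeasurable
      (by positivity) (zero_le_one.trans hL) (Eventually.of_forall h0) (hM.weight x)).2.trans ?_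
    calc Fc * rateConst p ε ^ (n + 1) * (((n + 1 : ℕ) : ℝ) ^ r * L₀ ^ 2) * L₀
        = Fc * L₀ ^ 3 * (((n + 1 : ℕ) : ℝ) ^ r * rateConst p ε ^ (n + 1)) := by ring
      _ ≤ Fc * L₀ ^ 3 * (C * (η ^ 2) ^ (n + 1)) := by
          exact mul_le_mul_of_nonneg_left (hC1 (n + 1) (Nat.succ_pos n)) (by positivity)
      _ ≤ Fc * L₀ ^ 3 * (C * (η ^ 2) ^ n) := by
          have : (η ^ 2) ^ (n + 1) ≤ (η ^ 2) ^ n :=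
            pow_le_pow_of_le_one (by positivity) (pow_le_one₀ hη0.le hη1.le) (Nat.le_succ n)
          gcongr
      _ = Fc * C * L₀ ^ 3 * (η ^ 2) ^ n := by ring
      _ ≤ E₀ * (η ^ 2) ^ n := by
          refine mul_le_mul_of_nonneg_right ?_ (by positivity)
          linarith
  obtain ⟨ϕ, hϕ⟩ := exists_geometric_limit hP hη0 hη1 hηδ (by linarith) hgm
    (fun n x => (hgb n x).2.trans (by linarith)) hgs
  refine ⟨ϕ, fun v Λ hΛ n hn => ?_⟩
  obtain ⟨k, rfl⟩ : ∃ k, n = k + 1 := ⟨n - 1, by omega⟩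
  have h1 := hstep k v Λ hΛ
  have h2 := hϕ k v.1
  rw [← hrη] at h2
  set Cg := 3 * (E₀ / (1 - η ^ 2) + 2 * K₀ * E₀) / (1 - η) / η with hCg
  have hCg0 : 0 ≤ Cg := by
    have h3 : 0 ≤ E₀ := by linarith
    have h4 : 0 < 1 - η ^ 2 := by nlinarith
    have h5 : 0 < 1 - η := by linarith
    have h6 := hP.2.2.1
    positivity
  have hN : 1 ≤ Λ.norm ^ s := Real.one_le_rpow hΛ.one_le_norm (by positivity)
  have hW := hM.one_le v.2
  -- Since `rt = √η`, one has `η ^ 2 = rt ^ 4 ≤ rt`, so the forgetting of the first step is not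
  -- slower than the final rate.
  have hηr : η ^ 2 ≤ rt := by
    have : rt ^ 2 = η := by rw [hrη, Real.sq_sqrt hη0.le]
    rw [← this]
    calc (rt ^ 2) ^ 2 = rt * rt ^ 3 := by ring
      _ ≤ rt * 1 := by gcongr; exact pow_le_one₀ hrt0.le hrt1.le
      _ = rt := mul_one _
  have hWN : 1 ≤ W v.2 * Λ.norm ^ s := one_le_mul_of_one_le_of_one_le hW hN
  calc |A (k + 1) v Λ - ϕ|
      ≤ Fc * rateConst p ε ^ (k + 1) * Λ.norm ^ s * (((k + 1 : ℕ) : ℝ) ^ r * (L₀ ^ 2 * W v.2)) +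
        Cg * rt ^ k := (abs_sub_le _ _ _).trans (add_le_add h1 h2)
    _ = Fc * L₀ ^ 2 * (((k + 1 : ℕ) : ℝ) ^ r * rateConst p ε ^ (k + 1)) *
        (W v.2 * Λ.norm ^ s) + Cg / rt * rt ^ (k + 1) * 1 := by
        rw [pow_succ rt]; field_simp
    _ ≤ Fc * L₀ ^ 2 * (C * rt ^ (k + 1)) * (W v.2 * Λ.norm ^ s) +
        Cg / rt * rt ^ (k + 1) * (W v.2 * Λ.norm ^ s) := by
        refine add_le_add (mul_le_mul_of_nonneg_right (mul_le_mul_of_nonneg_left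
          ((hC1 (k + 1) (Nat.succ_pos k)).trans ?_) (by positivity)) (by linarith))
          (mul_le_mul_of_nonneg_left hWN (by positivity))
        gcongr
    _ = (Fc * C * L₀ ^ 2 + Cg / rt) * rt ^ (k + 1) * (W v.2 * Λ.norm ^ s) := by ring
    _ ≤ L * rt ^ (k + 1) * (W v.2 * Λ.norm ^ s) :=
        mul_le_mul_of_nonneg_right (mul_le_mul_of_nonneg_right hLE (by positivity)) (by linarith)
    _ = _ := by ring

end Limit

/-! ### The ergodic theorem -/

section Ergodicity

/-- The rate of convergence in the ergodic theorem. -/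
def ergodicRate (p : ℕ) (q ε δ K₀ L₀ : ℝ) : ℝ := (exists_isRate p q ε δ K₀ L₀).choose

/-- The constant in the ergodic theorem. -/
def ergodicConst (p : ℕ) (q ε δ K₀ L₀ : ℝ) : ℝ := (exists_isRate p q ε δ K₀ L₀).choose_spec.choose

theorem isRate_ergodic (p : ℕ) (q ε δ K₀ L₀ : ℝ) :
    IsRate p q ε δ K₀ L₀ (ergodicRate p q ε δ K₀ L₀) (ergodicConst p q ε δ K₀ L₀) :=
  (exists_isRate p q ε δ K₀ L₀).choose_spec.choose_spec

variable {d p : ℕ} {X : Type} [MeasurableSpace X] [MetricSpace X] [CompactSpace X] [BorelSpace X]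
  {Y : Type} [MetricSpace Y] [CompactSpace Y] [MeasurableSpace Y] [BorelSpace Y]
  {P : Kernel X X} [IsMarkovKernel P] {Q : Kernel X Y} [IsMarkovKernel Q]
  {μ : Measure X} [IsFiniteMeasure μ] [NeZero μ] {R : E d → Y → X → X → ℝ} {U Θ : Set (E d)}
  {G : E d → C(Y × (X × X), ℝ)}

theorem exists_moment_bound {φ : X × Y → ℝ} (hφ : ∀ w, 1 ≤ φ w)
    (h : (⨆ x, ∫⁻ y, ENNReal.ofReal (φ (x, y)) ∂(Q x)) < ∞) (a : ℝ) :
    ∃ L₀ : ℝ, 1 ≤ L₀ ∧ ∀ x, ∫⁻ y, ENNReal.ofReal (φ (x, y) * a) ∂(Q x) ≤ ENNReal.ofReal L₀ := by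
  set S := ⨆ x, ∫⁻ y, ENNReal.ofReal (φ (x, y)) ∂(Q x)
  have hS : S * ENNReal.ofReal a ≠ ∞ := ENNReal.mul_ne_top h.ne ENNReal.ofReal_ne_top
  refine ⟨max 1 (S * ENNReal.ofReal a).toReal, le_max_left _ _, fun x => ?_⟩
  calc ∫⁻ y, ENNReal.ofReal (φ (x, y) * a) ∂(Q x)
      = ∫⁻ y, ENNReal.ofReal (φ (x, y)) * ENNReal.ofReal a ∂(Q x) :=
        lintegral_congr fun y => ENNReal.ofReal_mul (zero_le_one.trans (hφ _))
    _ = (∫⁻ y, ENNReal.ofReal (φ (x, y)) ∂(Q x)) * ENNReal.ofReal a :=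
        lintegral_mul_const' _ _ ENNReal.ofReal_ne_top
    _ ≤ S * ENNReal.ofReal a := by
        gcongr
        exact le_iSup (fun x => ∫⁻ y, ENNReal.ofReal (φ (x, y)) ∂(Q x)) x
    _ = ENNReal.ofReal (S * ENNReal.ofReal a).toReal := (ENNReal.ofReal_toReal hS).symm
    _ ≤ _ := ENNReal.ofReal_le_ofReal (le_max_right _ _)

theorem tendsto_of_abs_sub_le_mul_pow {a : ℕ → ℝ} {b C t : ℝ} (ht0 : 0 ≤ t) (ht1 : t < 1)
    (h : ∀ n, 1 ≤ n → |a n - b| ≤ C * t ^ n) : Tendsto a atTop (𝓝 b) := by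
  rw [tendsto_iff_dist_tendsto_zero]
  refine squeeze_zero' (Eventually.of_forall fun _ => dist_nonneg)
    (g := fun n => C * t ^ n) ?_ ?_
  · filter_upwards [eventually_ge_atTop 1] with n hn using h n hn
  · simpa using (tendsto_pow_atTop_nhds_zero_of_lt_one ht0 ht1).const_mul C

theorem chainKer_eq : chainKer (d := d) (p := p) μ R P Q = genChain μ R P Q fun _ b => b := rfl

theorem chainKer'_eq : chainKer' (d := d) (p := p) μ R P Q = genChain μ R P Q fun a _ => a := rfl

/-- The limits are constructed once, from the constants provided by compactness. For any other
admissible `ε`, `ψ` and `L₀` the same argument gives limits with the corresponding rates, and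
uniqueness of limits identifies them with the first ones. -/
theorem exists_ergodic_limits (hp : 1 ≤ p) (hG : IsSmoothFamily p R U G)
    (hc : IsCompact (closure Θ)) (hΘ : closure Θ ⊆ U) {π : Measure X} [IsProbabilityMeasure π]
    {δ K₀ : ℝ} (hP : GeomErgodic P π δ K₀) {Φ : E d → X × Y × LVec d p X → ℝ} {φ : X × Y → ℝ}
    {q : ℝ} (hΦm : ∀ θ ∈ Θ, Measurable fun z : {z : X × Y × LVec d p X // z.2.2.IsL0} => Φ θ z)
    (hφm : Measurable φ) (hΦ : GrowthCondition Θ Φ φ q)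
    (hφQ : (⨆ x, ∫⁻ y, ENNReal.ofReal (φ (x, y)) ∂(Q x)) < ∞) :
    (∃ ε c L₀ : ℝ, StrongMixing μ R Θ ε ∧ ScoreBound p R Θ (fun _ => c) ∧ 1 ≤ L₀ ∧
      ∀ x, ∫⁻ y, ENNReal.ofReal (φ (x, y) * c ^ ((p : ℝ) * (p + q + 1))) ∂(Q x) ≤
        ENNReal.ofReal L₀) ∧
    ∃ ϕ ϕ' : E d → ℝ,
      (∀ θ ∈ Θ, ∀ z : X × Y × LVec d p X, z.2.2.IsL0 →
        (∀ n, 1 ≤ n → Integrable (Φ θ) (kerIter (chainKer μ R P Q θ) n z) ∧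
          Integrable (Φ θ) (kerIter (chainKer' μ R P Q θ) n z)) ∧
        Tendsto (fun n => kerInt (chainKer μ R P Q θ) n (Φ θ) z) atTop (𝓝 (ϕ θ)) ∧
        Tendsto (fun n => kerInt (chainKer' μ R P Q θ) n (Φ θ) z) atTop (𝓝 (ϕ' θ))) ∧
      ∀ (ε L₀ : ℝ) (ψ : Y → ℝ), Measurable ψ → StrongMixing μ R Θ ε → ScoreBound p R Θ ψ →
        1 ≤ L₀ →
        (∀ x, ∫⁻ y, ENNReal.ofReal (φ (x, y) * ψ y ^ ((p : ℝ) * (p + q + 1))) ∂(Q x) ≤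
          ENNReal.ofReal L₀) →
        ∀ θ ∈ Θ, ∀ x y, ∀ Λ : LVec d p X, Λ.IsL0 → ∀ n : ℕ, 1 ≤ n →
          |kerInt (chainKer μ R P Q θ) n (Φ θ) (x, y, Λ) - ϕ θ| ≤
            ergodicConst p q ε δ K₀ L₀ * ergodicRate p q ε δ K₀ L₀ ^ n *
              Λ.norm ^ ((p : ℝ) * (q + 1)) ∧
          |kerInt (chainKer' μ R P Q θ) n (Φ θ) (x, y, Λ) - ϕ' θ| ≤
            ergodicConst p q ε δ K₀ L₀ * ergodicRate p q ε δ K₀ L₀ ^ n *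
              ψ y ^ ((p : ℝ) * (p + q + 1)) * Λ.norm ^ ((p : ℝ) * (q + 1)) := by
  obtain ⟨hq, hφ, hΦ⟩ := hΦ
  obtain ⟨ε₁, c, hmix₁, hs₁⟩ := hG.exists_constants (μ := μ) hc hΘ
  obtain ⟨L₁, hL₁, hb₁⟩ := exists_moment_bound hφ hφQ (c ^ ((p : ℝ) * (p + q + 1)))
  refine ⟨⟨ε₁, c, L₁, hmix₁, hs₁, hL₁, hb₁⟩, ?_⟩
  have hr : 1 ≤ (p : ℝ) * (p + q + 1) := by
    have : (1 : ℝ) ≤ p := by exact_mod_cast hp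
    nlinarith
  have key : ∀ (ε L₀ : ℝ) (ψ : Y → ℝ), Measurable ψ → StrongMixing μ R Θ ε →
      ScoreBound p R Θ ψ → 1 ≤ L₀ →
      (∀ x, ∫⁻ y, ENNReal.ofReal (φ (x, y) * ψ y ^ ((p : ℝ) * (p + q + 1))) ∂(Q x) ≤
        ENNReal.ofReal L₀) → ∀ θ ∈ Θ,
      (∀ z : X × Y × LVec d p X, z.2.2.IsL0 → ∀ n, 1 ≤ n →
        Integrable (Φ θ) (kerIter (chainKer μ R P Q θ) n z) ∧
        Integrable (Φ θ) (kerIter (chainKer' μ R P Q θ) n z)) ∧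
      ∃ ϕ ϕ' : ℝ, ∀ z : X × Y × LVec d p X, z.2.2.IsL0 → ∀ n : ℕ, 1 ≤ n →
        |kerInt (chainKer μ R P Q θ) n (Φ θ) z - ϕ| ≤
          ergodicConst p q ε δ K₀ L₀ * ergodicRate p q ε δ K₀ L₀ ^ n *
            z.2.2.norm ^ ((p : ℝ) * (q + 1)) ∧
        |kerInt (chainKer' μ R P Q θ) n (Φ θ) z - ϕ'| ≤
          ergodicConst p q ε δ K₀ L₀ * ergodicRate p q ε δ K₀ L₀ ^ n *
            ψ z.2.1 ^ ((p : ℝ) * (p + q + 1)) * z.2.2.norm ^ ((p : ℝ) * (q + 1)) := by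
    intro ε L₀ ψ hψm hmix hs hL hb θ hθ
    have hk := hG.isDerivKernel (hΘ (subset_closure hθ))
    have hpos := hG.pos θ (hΘ (subset_closure hθ))
    obtain ⟨hi, ϕ, hϕ⟩ := exists_limit_pathK hp hk hpos hmix hs₁ hs hθ measurable_snd (hΦm θ hθ) hq
      hφ (hΦ θ hθ) hP hL (momentBound_next hr hφm hφ hψm hs.1 hL hb) (isRate_ergodic p q ε δ K₀ L₀)
    obtain ⟨hi', ϕ', hϕ'⟩ := exists_limit_pathK hp hk hpos hmix hs₁ hs hθ measurable_fst (hΦm θ hθ)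
      hq hφ (hΦ θ hθ) hP hL (momentBound_current hr hφm hφ hψm hs.1 hL hb)
      (isRate_ergodic p q ε δ K₀ L₀)
    rw [chainKer_eq, chainKer'_eq]
    refine ⟨fun ⟨x, y, Λ⟩ hz n hn => ⟨?_, ?_⟩, ϕ, ϕ', fun ⟨x, y, Λ⟩ hz n hn => ⟨?_, ?_⟩⟩
    · exact (integrable_kerIter_iff hk hpos hmix hs₁ hθ measurable_snd (hΦm θ hθ) hz n (x, y)).2
        (hi (x, y) Λ hz n hn)
    · exact (integrable_kerIter_iff hk hpos hmix hs₁ hθ measurable_fst (hΦm θ hθ) hz n (x, y)).2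
        (hi' (x, y) Λ hz n hn)
    · have := hϕ (x, y) Λ hz n hn
      rw [mul_one] at this
      rwa [kerInt_genChain hk hpos hmix hs₁ hθ measurable_snd (hΦm θ hθ) hz n (x, y)]
    · have := hϕ' (x, y) Λ hz n hn
      rwa [kerInt_genChain hk hpos hmix hs₁ hθ measurable_fst (hΦm θ hθ) hz n (x, y)]
  have hlim : ∀ {ε L₀ a : ℝ} {f : ℕ → ℝ} {N : ℝ},
      (∀ n, 1 ≤ n → |f n - a| ≤ ergodicConst p q ε δ K₀ L₀ * ergodicRate p q ε δ K₀ L₀ ^ n * N) →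
      Tendsto f atTop (𝓝 a) := fun {ε L₀ a f N} h => by
    have h1 := isRate_ergodic p q ε δ K₀ L₀
    refine tendsto_of_abs_sub_le_mul_pow h1.1.le h1.2.1
      (C := ergodicConst p q ε δ K₀ L₀ * N) fun n hn => (h n hn).trans (le_of_eq (by ring))
  -- A constant score bound is always available; it fixes the limit functions before `ε`, `ψ` and
  -- `L₀` are given.
  have key₁ := key ε₁ L₁ (fun _ => c) measurable_const hmix₁ hs₁ hL₁ hb₁
  classical
  choose! hint ϕ ϕ' hϕ using key₁
  have ht : ∀ θ ∈ Θ, ∀ z : X × Y × LVec d p X, z.2.2.IsL0 →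
      Tendsto (fun n => kerInt (chainKer μ R P Q θ) n (Φ θ) z) atTop (𝓝 (ϕ θ)) :=
    fun θ hθ z hz => hlim fun n hn => (hϕ θ hθ z hz n hn).1
  have ht' : ∀ θ ∈ Θ, ∀ z : X × Y × LVec d p X, z.2.2.IsL0 →
      Tendsto (fun n => kerInt (chainKer' μ R P Q θ) n (Φ θ) z) atTop (𝓝 (ϕ' θ)) :=
    fun θ hθ z hz => hlim fun n hn =>
      ((hϕ θ hθ z hz n hn).2).trans (le_of_eq (mul_assoc _ _ _))
  refine ⟨ϕ, ϕ', fun θ hθ z hz => ⟨hint θ hθ z hz, ht θ hθ z hz, ht' θ hθ z hz⟩, ?_⟩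
  intro ε L₀ ψ hψm hmix hs hL hb θ hθ x y Λ hΛ n hn
  obtain ⟨-, a, a', ha⟩ := key ε L₀ ψ hψm hmix hs hL hb θ hθ
  have h1 := tendsto_nhds_unique (ht θ hθ (x, y, Λ) hΛ) (hlim fun n hn =>
    (ha (x, y, Λ) hΛ n hn).1)
  have h2 := tendsto_nhds_unique (ht' θ hθ (x, y, Λ) hΛ)
    (hlim fun n hn =>
      ((ha (x, y, Λ) hΛ n hn).2).trans (le_of_eq (mul_assoc _ _ _)))
  rw [h1, h2]
  exact ha (x, y, Λ) hΛ n hn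

theorem TruncatedModel.Regular.exists_isSmoothFamily {d dx dy p : ℕ} {M : TruncatedModel d dx dy}
    (hM : M.Regular p) [CompactSpace M.𝒳] [CompactSpace M.𝒴] :
    ∃ G, IsSmoothFamily p M.R M.Θ' G := by
  obtain ⟨G, h1, h2, h3⟩ := hM.exists_contDiffOn
  exact ⟨G, hM.isOpen_Θ', h1, h2, h3⟩

end Ergodicity

/-! ### A class of functionals of the observation and the filter -/

section Tame

variable {d p : ℕ} {X : Type} [MeasurableSpace X] [MetricSpace X] [CompactSpace X] [BorelSpace X]
  {Y : Type} [MetricSpace Y] [CompactSpace Y] [MeasurableSpace Y] [BorelSpace Y]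

/-- Functions of the observation and the filter, continuous in the observation and of polynomial
growth and locally Lipschitz in the filter, uniformly in the parameter. -/
structure IsTame (Θ : Set (E d)) (Φ : E d → Y → LVec d p X → ℝ) : Prop where
  continuous : ∀ θ ∈ Θ, ∀ Λ : LVec d p X, Λ.IsL0 → Continuous fun y => Φ θ y Λ
  bound : ∃ (C : ℝ) (q : ℕ), 0 ≤ C ∧ ∀ θ ∈ Θ, ∀ y, ∀ Λ Λ' : LVec d p X, Λ.IsL0 → Λ'.IsL0 →
    |Φ θ y Λ| ≤ C * Λ.norm ^ q ∧
    |Φ θ y Λ - Φ θ y Λ'| ≤ C * (Λ - Λ').norm * (Λ.norm + Λ'.norm) ^ q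

variable {Θ : Set (E d)} {Φ Ψ : E d → Y → LVec d p X → ℝ}

theorem IsTame.add (hΦ : IsTame Θ Φ) (hΨ : IsTame Θ Ψ) :
    IsTame Θ fun θ y Λ => Φ θ y Λ + Ψ θ y Λ := by
  obtain ⟨C₁, q₁, h₁, H₁⟩ := hΦ.bound
  obtain ⟨C₂, q₂, h₂, H₂⟩ := hΨ.bound
  refine ⟨fun θ hθ Λ hΛ => (hΦ.continuous θ hθ Λ hΛ).add (hΨ.continuous θ hθ Λ hΛ), C₁ + C₂,
    max q₁ q₂, add_nonneg h₁ h₂, fun θ hθ y Λ Λ' hΛ hΛ' => ?_⟩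
  obtain ⟨a1, a2⟩ := H₁ θ hθ y Λ Λ' hΛ hΛ'
  obtain ⟨b1, b2⟩ := H₂ θ hθ y Λ Λ' hΛ hΛ'
  have n1 := hΛ.one_le_norm
  have n2 := hΛ'.one_le_norm
  have n3 := LVec.norm_nonneg (Λ - Λ')
  have e1 : Λ.norm ^ q₁ ≤ Λ.norm ^ max q₁ q₂ := pow_le_pow_right₀ n1 (le_max_left _ _)
  have e2 : Λ.norm ^ q₂ ≤ Λ.norm ^ max q₁ q₂ := pow_le_pow_right₀ n1 (le_max_right _ _)
  have e3 : (Λ.norm + Λ'.norm) ^ q₁ ≤ (Λ.norm + Λ'.norm) ^ max q₁ q₂ :=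
    pow_le_pow_right₀ (by linarith) (le_max_left _ _)
  have e4 : (Λ.norm + Λ'.norm) ^ q₂ ≤ (Λ.norm + Λ'.norm) ^ max q₁ q₂ :=
    pow_le_pow_right₀ (by linarith) (le_max_right _ _)
  constructor
  · rw [add_mul]
    exact (abs_add_le _ _).trans (add_le_add (a1.trans (mul_le_mul_of_nonneg_left e1 h₁))
      (b1.trans (mul_le_mul_of_nonneg_left e2 h₂)))
  · rw [add_sub_add_comm, add_mul, add_mul]
    exact (abs_add_le _ _).trans (add_le_add
      (a2.trans (mul_le_mul_of_nonneg_left e3 (mul_nonneg h₁ n3)))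
      (b2.trans (mul_le_mul_of_nonneg_left e4 (mul_nonneg h₂ n3))))

theorem abs_mul_sub_mul_le {a a' b b' C₁ C₂ D S₁ S₂ : ℝ} (hC₁ : 0 ≤ C₁) (hD : 0 ≤ D) (hS₁ : 0 ≤ S₁)
    (ha' : |a'| ≤ C₁ * S₁) (hb : |b| ≤ C₂ * S₂) (ha : |a - a'| ≤ C₁ * D * S₁)
    (hb' : |b - b'| ≤ C₂ * D * S₂) : |a * b - a' * b'| ≤ 2 * (C₁ * C₂) * D * (S₁ * S₂) := by
  calc |a * b - a' * b'| = |(a - a') * b + a' * (b - b')| := by ring_nf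
    _ ≤ |a - a'| * |b| + |a'| * |b - b'| := by rw [← abs_mul, ← abs_mul]; exact abs_add_le _ _
    _ ≤ (C₁ * D * S₁) * (C₂ * S₂) + (C₁ * S₁) * (C₂ * D * S₂) :=
        add_le_add (mul_le_mul ha hb (abs_nonneg _) (by positivity))
          (mul_le_mul ha' hb' (abs_nonneg _) (by positivity))
    _ = _ := by ring

theorem IsTame.mul (hΦ : IsTame Θ Φ) (hΨ : IsTame Θ Ψ) :
    IsTame Θ fun θ y Λ => Φ θ y Λ * Ψ θ y Λ := by
  obtain ⟨C₁, q₁, h₁, H₁⟩ := hΦ.bound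
  obtain ⟨C₂, q₂, h₂, H₂⟩ := hΨ.bound
  refine ⟨fun θ hθ Λ hΛ => (hΦ.continuous θ hθ Λ hΛ).mul (hΨ.continuous θ hθ Λ hΛ), 2 * (C₁ * C₂),
    q₁ + q₂, by positivity, fun θ hθ y Λ Λ' hΛ hΛ' => ?_⟩
  obtain ⟨a1, a2⟩ := H₁ θ hθ y Λ Λ' hΛ hΛ'
  obtain ⟨b1, b2⟩ := H₂ θ hθ y Λ Λ' hΛ hΛ'
  obtain ⟨a3, -⟩ := H₁ θ hθ y Λ' Λ hΛ' hΛ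
  have n1 := zero_le_one.trans hΛ.one_le_norm
  have n2 := zero_le_one.trans hΛ'.one_le_norm
  have e1 : Λ.norm ≤ Λ.norm + Λ'.norm := le_add_of_nonneg_right n2
  have e2 : Λ'.norm ≤ Λ.norm + Λ'.norm := le_add_of_nonneg_left n1
  rw [pow_add, pow_add]
  refine ⟨?_, abs_mul_sub_mul_le h₁ (LVec.norm_nonneg _) (pow_nonneg (add_nonneg n1 n2) _)
    (a3.trans (mul_le_mul_of_nonneg_left (pow_le_pow_left₀ n2 e2 q₁) h₁))
    (b1.trans (mul_le_mul_of_nonneg_left (pow_le_pow_left₀ n1 e1 q₂) h₂)) a2 b2⟩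
  have h3 := mul_le_mul a1 b1 (abs_nonneg _) (mul_nonneg h₁ (pow_nonneg n1 _))
  rw [abs_mul]
  have h4 : 0 ≤ C₁ * Λ.norm ^ q₁ * (C₂ * Λ.norm ^ q₂) :=
    mul_nonneg (mul_nonneg h₁ (pow_nonneg n1 _)) (mul_nonneg h₂ (pow_nonneg n1 _))
  linarith

theorem IsTame.const (a : ℝ) : IsTame Θ fun _ (_ : Y) (_ : LVec d p X) => a := by
  refine ⟨fun _ _ _ _ => continuous_const, |a|, 0, abs_nonneg a, fun θ _ y Λ Λ' _ _ => ?_⟩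
  simp only [pow_zero, mul_one, sub_self, abs_zero, le_refl, true_and]
  exact mul_nonneg (abs_nonneg a) (LVec.norm_nonneg _)

theorem IsTame.sum {ι : Type*} (s : Finset ι) {F : ι → E d → Y → LVec d p X → ℝ}
    (h : ∀ i ∈ s, IsTame Θ (F i)) : IsTame Θ fun θ y Λ => ∑ i ∈ s, F i θ y Λ := by
  classical
  induction s using Finset.induction_on with
  | empty => simpa using IsTame.const 0
  | insert i s hi ih =>
    simp_rw [Finset.sum_insert hi]
    exact (h i (Finset.mem_insert_self i s)).add (ih fun j hj => h j (Finset.mem_insert_of_mem hj))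

theorem IsTame.congr (hΦ : IsTame Θ Φ)
    (h : ∀ θ ∈ Θ, ∀ y, ∀ Λ : LVec d p X, Λ.IsL0 → Ψ θ y Λ = Φ θ y Λ) : IsTame Θ Ψ := by
  obtain ⟨C, q, h0, H⟩ := hΦ.bound
  refine ⟨fun θ hθ Λ hΛ => ?_, C, q, h0, fun θ hθ y Λ Λ' hΛ hΛ' => ?_⟩
  · simp_rw [h θ hθ _ Λ hΛ]
    exact hΦ.continuous θ hθ Λ hΛ
  · rw [h θ hθ y Λ hΛ, h θ hθ y Λ' hΛ']
    exact H θ hθ y Λ Λ' hΛ hΛ'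

/-- A function that is bounded and Lipschitz on the range preserves the class: boundedness is
dominated by any power of the norm, which is at least one, and the Lipschitz constant multiplies the
old bound. -/
theorem IsTame.comp (hΦ : IsTame Θ Φ) {S : Set ℝ} {f : ℝ → ℝ} {M K : ℝ} (hK : 0 ≤ K)
    (hS : ∀ θ ∈ Θ, ∀ y, ∀ Λ : LVec d p X, Λ.IsL0 → Φ θ y Λ ∈ S) (hf : ContinuousOn f S)
    (hM : ∀ t ∈ S, |f t| ≤ M) (hfK : ∀ t ∈ S, ∀ u ∈ S, |f t - f u| ≤ K * |t - u|) :
    IsTame Θ fun θ y Λ => f (Φ θ y Λ) := by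
  obtain ⟨C, q, h0, H⟩ := hΦ.bound
  refine ⟨fun θ hθ Λ hΛ => hf.comp_continuous (hΦ.continuous θ hθ Λ hΛ) fun y => hS θ hθ y Λ hΛ,
    |M| + K * C, q, by positivity, fun θ hθ y Λ Λ' hΛ hΛ' => ⟨?_, ?_⟩⟩
  · have n1 : 1 ≤ Λ.norm ^ q := one_le_pow₀ hΛ.one_le_norm
    calc |f (Φ θ y Λ)| ≤ |M| := (hM _ (hS θ hθ y Λ hΛ)).trans (le_abs_self M)
      _ ≤ (|M| + K * C) * 1 := by have := mul_nonneg hK h0; linarith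
      _ ≤ _ := mul_le_mul_of_nonneg_left n1 (by positivity)
  · refine (hfK _ (hS θ hθ y Λ hΛ) _ (hS θ hθ y Λ' hΛ')).trans ?_
    refine (mul_le_mul_of_nonneg_left (H θ hθ y Λ Λ' hΛ hΛ').2 hK).trans ?_
    have n4 : 0 ≤ (Λ.norm + Λ'.norm) ^ q :=
      pow_nonneg (add_nonneg (LVec.norm_nonneg _) (LVec.norm_nonneg _)) q
    have h5 : 0 ≤ |M| * (Λ - Λ').norm * (Λ.norm + Λ'.norm) ^ q :=
      mul_nonneg (mul_nonneg (abs_nonneg M) (LVec.norm_nonneg _)) n4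
    rw [add_mul, add_mul, mul_assoc K, mul_assoc K]
    exact le_add_of_nonneg_left h5

theorem IsTame.continuousOn (hΦ : IsTame Θ Φ) {θ : E d} (hθ : θ ∈ Θ) :
    ContinuousOn (fun z : Y × LVec d p X => Φ θ z.1 z.2) {z | z.2.IsL0} := by
  obtain ⟨C, q, h0, H⟩ := hΦ.bound
  rintro ⟨y₀, Λ₀⟩ hΛ₀
  have hΛ₀' : Λ₀.IsL0 := hΛ₀
  set l := 𝓝[{z : Y × LVec d p X | z.2.IsL0}] (y₀, Λ₀) with hl
  have hfst : Tendsto (fun z : Y × LVec d p X => z.1) l (𝓝 y₀) :=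
    (continuous_fst.tendsto (y₀, Λ₀)).mono_left nhdsWithin_le_nhds
  have hsnd : Tendsto (fun z : Y × LVec d p X => z.2) l (𝓝 Λ₀) :=
    (continuous_snd.tendsto (y₀, Λ₀)).mono_left nhdsWithin_le_nhds
  have h1 : Tendsto (fun z : Y × LVec d p X => Φ θ z.1 Λ₀) l (𝓝 (Φ θ y₀ Λ₀)) :=
    ((hΦ.continuous θ hθ Λ₀ hΛ₀').tendsto y₀).comp hfst
  have h2 : Tendsto (fun z : Y × LVec d p X => (z.2 - Λ₀).norm) l (𝓝 0) :=
    LVec.tendsto_nhds_iff.1 hsnd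
  have h3 : Tendsto (fun z : Y × LVec d p X =>
      C * (z.2 - Λ₀).norm * ((z.2 - Λ₀).norm + 2 * Λ₀.norm) ^ q) l (𝓝 0) := by
    have := (h2.const_mul C).mul ((h2.add_const (2 * Λ₀.norm)).pow q)
    simpa using this
  have h4 : Tendsto (fun z : Y × LVec d p X => Φ θ z.1 z.2 - Φ θ z.1 Λ₀) l (𝓝 0) := by
    refine squeeze_zero_norm' ?_ h3
    filter_upwards [self_mem_nhdsWithin] with z hz
    refine (H θ hθ z.1 z.2 Λ₀ hz hΛ₀').2.trans ?_
    have hn := LVec.norm_sub_le_add_sub z.2 Λ₀ (0 : LVec d p X)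
    rw [sub_zero, sub_zero] at hn
    have h5 := LVec.norm_nonneg (z.2 - Λ₀)
    have h6 := LVec.norm_nonneg z.2
    have h7 := LVec.norm_nonneg Λ₀
    exact mul_le_mul_of_nonneg_left (pow_le_pow_left₀ (by linarith) (by linarith) q)
      (mul_nonneg h0 h5)
  have h5 := h4.add h1
  simp only [sub_add_cancel, zero_add] at h5
  exact h5

theorem IsTame.measurable (hΦ : IsTame Θ Φ) {θ : E d} (hθ : θ ∈ Θ) :
    Measurable fun z : {z : X × Y × LVec d p X // z.2.2.IsL0} => Φ θ z.1.2.1 z.1.2.2 := by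
  classical
  have hm : MeasurableSet {z : Y × LVec d p X | z.2.IsL0} :=
    measurable_snd LVec.measurableSet_isL0
  have h1 := (hΦ.continuousOn hθ).measurable_piecewise (continuousOn_const (c := (0 : ℝ))) hm
  have h2 : Measurable fun z : {z : X × Y × LVec d p X // z.2.2.IsL0} => z.1.2 := by fun_prop
  convert h1.comp h2 using 1
  funext z
  have hz : z.1.2 ∈ {z : Y × LVec d p X | z.2.IsL0} := z.2
  rw [Function.comp_apply, Set.piecewise_eq_of_mem _ _ _ hz]

theorem IsTame.exists_growthCondition (hΦ : IsTame Θ Φ) :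
    ∃ C q : ℝ, 1 ≤ C ∧ GrowthCondition Θ (fun θ (z : X × Y × LVec d p X) => Φ θ z.2.1 z.2.2)
      (fun _ => C) q := by
  obtain ⟨C, q, h0, H⟩ := hΦ.bound
  refine ⟨max C 1, q, le_max_right _ _, Nat.cast_nonneg q, fun _ => le_max_right _ _,
    fun θ hθ x y Λ Λ' hΛ hΛ' => ?_⟩
  obtain ⟨a1, a2⟩ := H θ hθ y Λ Λ' hΛ hΛ'
  simp_rw [Real.rpow_natCast]
  have n3 := LVec.norm_nonneg (Λ - Λ')
  have n4 : 0 ≤ (Λ.norm + Λ'.norm) ^ q :=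
    pow_nonneg (add_nonneg (LVec.norm_nonneg _) (LVec.norm_nonneg _)) q
  have n5 : 0 ≤ Λ.norm ^ q := pow_nonneg (LVec.norm_nonneg _) q
  exact ⟨a1.trans (mul_le_mul_of_nonneg_right (le_max_left _ _) n5),
    a2.trans (mul_le_mul_of_nonneg_right (mul_le_mul_of_nonneg_right (le_max_left _ _) n3) n4)⟩

end Tame

/-! ### Derivatives of the logarithm of the normalizing constant -/

section LogDerivatives

variable {d p : ℕ} {X : Type} [MeasurableSpace X] [MetricSpace X] [CompactSpace X] [BorelSpace X]
  {Y : Type} [MetricSpace Y] [CompactSpace Y] [MeasurableSpace Y] [BorelSpace Y]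
  {μ : Measure X} [IsFiniteMeasure μ] [NeZero μ] {R : E d → Y → X → X → ℝ} {U Θ : Set (E d)}
  {G : E d → C(Y × (X × X), ℝ)}

theorem IsSmoothFamily.exists_norm_mderiv_le (hG : IsSmoothFamily p R U G)
    (hc : IsCompact (closure Θ)) (hΘ : closure Θ ⊆ U) {γ : MultiIndex d} (hγ : deg γ ≤ p) :
    ∃ C : ℝ, 0 ≤ C ∧ ∀ θ ∈ Θ, ‖mderiv γ G θ‖ ≤ C := by
  have h := (contDiffOn_mderiv hG.isOpen (k := 0)
    (hG.contDiffOn.of_le (by rw [zero_add]; exact_mod_cast hγ))).continuousOn.mono hΘ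
  obtain ⟨C, hC⟩ := hc.exists_bound_of_continuousOn h
  exact ⟨max C 0, le_max_right _ _, fun θ hθ => (hC θ (subset_closure hθ)).trans (le_max_left _ _)⟩

theorem IsSmoothFamily.exists_le (hG : IsSmoothFamily p R U G) (hc : IsCompact (closure Θ))
    (hΘ : closure Θ ⊆ U) : ∃ a : ℝ, 0 < a ∧ ∀ θ ∈ Θ, ∀ y x' x, a ≤ R θ y x' x := by
  rcases (closure Θ ×ˢ (Set.univ : Set (Y × (X × X)))).eq_empty_or_nonempty with he | hne
  · refine ⟨1, one_pos, fun θ hθ y x' x => ?_⟩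
    have : (θ, (y, (x', x))) ∈ closure Θ ×ˢ (Set.univ : Set (Y × (X × X))) :=
      ⟨subset_closure hθ, trivial⟩
    rw [he] at this
    exact this.elim
  · have hcont := hG.continuousOn_mderiv (γ := 0) (by simp)
    simp only [mderiv_zero] at hcont
    obtain ⟨z, hz, hmin⟩ := (hc.prod isCompact_univ).exists_isMinOn hne
      (hcont.mono (Set.prod_mono hΘ subset_rfl))
    refine ⟨G z.1 z.2, ?_, fun θ hθ y x' x => ?_⟩
    · have := hG.pos z.1 (hΘ hz.1) z.2.1 z.2.2.1 z.2.2.2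
      rwa [← hG.eq z.1 (hΘ hz.1)] at this
    · rw [← hG.eq θ (hΘ (subset_closure hθ))]
      exact hmin (show (θ, (y, (x', x))) ∈ _ from ⟨subset_closure hθ, trivial⟩)

variable (hG : IsSmoothFamily p R U G) (hc : IsCompact (closure Θ)) (hΘ : closure Θ ⊆ U)

include hG hc hΘ

/-- Linear in the component `β` of `Λ`, with an operator norm bounded uniformly over `Θ` by
compactness of its closure; the growth exponent is therefore `1`. -/
theorem isTame_integral_rDeriv {γ β : MultiIndex d} (hγ : deg γ ≤ p) :
    IsTame Θ fun θ y (Λ : LVec d p X) => ∫ x, rDeriv R γ θ y (Λ.comp β) x ∂μ := by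
  obtain ⟨C, hC0, hC⟩ := hG.exists_norm_mderiv_le hc hΘ hγ
  have hΘ' : Θ ⊆ U := subset_closure.trans hΘ
  have hlin : ∀ θ ∈ Θ, ∀ y, ∀ l : SignedMeasure X, ∫ x, rDeriv R γ θ y l x ∂μ =
      mass (kerOp μ (slice (mderiv γ G θ) y) l) := fun θ hθ y l => by
    have hk := hG.isDerivKernel (hΘ' hθ)
    rw [integral_eq_mass_withDensityᵥ (hk.continuous_rDeriv hγ y _), hk.withDensityᵥ_rDeriv hγ y]
  have hb : ∀ θ ∈ Θ, ∀ y, ∀ l : SignedMeasure X,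
      |mass (kerOp μ (slice (mderiv γ G θ) y) l)| ≤ 2 * (C * μ.real Set.univ) * ‖l‖ :=
    fun θ hθ y l => by
    rw [mul_assoc]
    refine (abs_mass_le _).trans (norm_kerOp_le μ _ l fun x' => ?_)
    have h1 : ∀ x, |slice (mderiv γ G θ) y (x, x')| ≤ C := fun x =>
      ((mderiv γ G θ).norm_coe_le_norm _).trans (hC θ hθ)
    have h2 := norm_integral_le_of_norm_le_const (μ := μ)
      (f := fun x => |slice (mderiv γ G θ) y (x, x')|) (C := C)
      (Eventually.of_forall fun x => by rw [Real.norm_eq_abs, abs_abs]; exact h1 x)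
    exact (le_abs_self _).trans h2
  refine ⟨fun θ hθ Λ hΛ => ?_, 2 * (C * μ.real Set.univ), 1, by positivity,
    fun θ hθ y Λ Λ' hΛ hΛ' => ?_⟩
  · exact continuous_integral_of_compact μ
      ⟨_, continuous_rDeriv_uncurry (hG.isDerivKernel (hΘ' hθ)) hγ (Λ.comp β)⟩
  · rw [hlin θ hθ, hlin θ hθ, pow_one, pow_one, ← map_sub, ← map_sub, ← LVec.comp_sub]
    have hK : 0 ≤ 2 * (C * μ.real Set.univ) := by positivity
    refine ⟨(hb θ hθ y _).trans (mul_le_mul_of_nonneg_left (LVec.norm_comp_le _ _) hK),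
      (hb θ hθ y _).trans ?_⟩
    have n1 := hΛ.one_le_norm
    have n2 := hΛ'.one_le_norm
    exact (mul_le_mul_of_nonneg_left (LVec.norm_comp_le _ _) hK).trans
      (le_mul_of_one_le_right (mul_nonneg hK (LVec.norm_nonneg _)) (by linarith))

/-- The kernel lies between positive constants uniformly over `Θ`, and averaging over a probability
measure preserves the bounds. On the resulting interval `t⁻¹` and `Real.log` are bounded and
Lipschitz. -/
theorem exists_integral_rDeriv_mem : ∃ a b : ℝ, 0 < a ∧ ∀ θ ∈ Θ, ∀ y, ∀ Λ : LVec d p X, Λ.IsL0 →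
    ∫ x, rDeriv R 0 θ y (Λ.comp 0) x ∂μ ∈ Set.Icc a b := by
  have hΘ' : Θ ⊆ U := subset_closure.trans hΘ
  obtain ⟨a, ha0, ha⟩ := hG.exists_le hc hΘ
  obtain ⟨C, hC0, hC⟩ := hG.exists_norm_mderiv_le hc hΘ (γ := 0) (by simp)
  simp only [mderiv_zero] at hC
  have hμ : 0 < μ.real Set.univ := by
    rw [measureReal_def]
    exact ENNReal.toReal_pos (NeZero.ne (μ Set.univ)) (measure_ne_top μ _)
  refine ⟨a * μ.real Set.univ, C * μ.real Set.univ, mul_pos ha0 hμ, fun θ hθ y Λ hΛ => ?_⟩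
  have hk := hG.isDerivKernel (hΘ' hθ)
  have hP := (LVec.isL0_iff Λ).1 hΛ
  have hcont := hk.continuous_rDeriv (γ := 0) (by simp) y (Λ.comp 0)
  have h1 : ∀ x, rDeriv R 0 θ y (Λ.comp 0) x ∈ Set.Icc a C := fun x => by
    have hle : ∀ x', slice (mderiv 0 G θ) y (x, x') ∈ Set.Icc a C := fun x' => by
      rw [slice_apply, mderiv_zero]
      refine ⟨?_, (le_abs_self _).trans (((G θ).norm_coe_le_norm _).trans (hC θ hθ))⟩
      rw [hG.eq θ (hΘ' hθ)]
      exact ha θ hθ y x x'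
    have habs : ∀ x', |slice (mderiv 0 G θ) y (x, x')| ≤ C := fun x' => by
      rw [abs_of_nonneg (ha0.le.trans (hle x').1)]; exact (hle x').2
    have hm : Measurable fun x' => slice (mderiv 0 G θ) y (x, x') := by fun_prop
    rw [hk.rDeriv_eq (by simp)]
    constructor
    · rw [← hP.sInt_const a]
      exact hP.sInt_mono measurable_const hm (fun _ => le_rfl) habs fun x' => (hle x').1
    · calc _ ≤ sInt (Λ.comp 0) fun _ => C :=
          hP.sInt_mono hm measurable_const habs (fun _ => le_rfl) fun x' => (hle x').2
        _ = C := hP.sInt_const C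
  have hi := integrable_of_continuous μ hcont
  constructor
  · calc a * μ.real Set.univ = ∫ _, a ∂μ := by simp [mul_comm]
      _ ≤ _ := integral_mono (integrable_const a) hi fun x => (h1 x).1
  · calc _ ≤ ∫ _, C ∂μ := integral_mono hi (integrable_const C) fun x => (h1 x).2
      _ = _ := by simp [mul_comm]

theorem isTame_inv_integral_rDeriv :
    IsTame Θ fun θ y (Λ : LVec d p X) => (∫ x, rDeriv R 0 θ y (Λ.comp 0) x ∂μ)⁻¹ := by
  obtain ⟨a, b, ha, hab⟩ := exists_integral_rDeriv_mem (μ := μ) hG hc hΘ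
  refine (isTame_integral_rDeriv (μ := μ) hG hc hΘ (γ := 0) (β := 0) (by simp)).comp
    (f := fun t => t⁻¹) (S := Set.Icc a b) (M := a⁻¹) (K := (a * a)⁻¹) (by positivity) hab
    (continuousOn_inv₀.mono fun t ht => (ha.trans_le ht.1).ne') (fun t ht => ?_)
    fun t ht u hu => ?_
  · have ht0 := ha.trans_le ht.1
    rw [abs_of_pos (inv_pos.2 ht0)]
    exact inv_anti₀ ha ht.1
  · have ht0 := ha.trans_le ht.1
    have hu0 := ha.trans_le hu.1
    rw [inv_sub_inv ht0.ne' hu0.ne', abs_div, abs_sub_comm u t, div_eq_inv_mul,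
      abs_of_pos (mul_pos ht0 hu0)]
    exact mul_le_mul_of_nonneg_right (inv_anti₀ (by positivity)
      (mul_le_mul ht.1 hu.1 ha.le ht0.le)) (abs_nonneg _)

theorem isTame_log_integral_rDeriv :
    IsTame Θ fun θ y (Λ : LVec d p X) => Real.log (∫ x, rDeriv R 0 θ y (Λ.comp 0) x ∂μ) := by
  obtain ⟨a, b, ha, hab⟩ := exists_integral_rDeriv_mem (μ := μ) hG hc hΘ
  have key : ∀ t ∈ Set.Icc a b, ∀ u ∈ Set.Icc a b, Real.log t - Real.log u ≤ a⁻¹ * |t - u| := by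
    intro t ht u hu
    have ht0 := ha.trans_le ht.1
    have hu0 := ha.trans_le hu.1
    rw [← Real.log_div ht0.ne' hu0.ne']
    calc Real.log (t / u) ≤ t / u - 1 := Real.log_le_sub_one_of_pos (div_pos ht0 hu0)
      _ = u⁻¹ * (t - u) := by field_simp
      _ ≤ u⁻¹ * |t - u| := mul_le_mul_of_nonneg_left (le_abs_self _) (inv_nonneg.2 hu0.le)
      _ ≤ a⁻¹ * |t - u| := mul_le_mul_of_nonneg_right (inv_anti₀ ha hu.1) (abs_nonneg _)
  refine (isTame_integral_rDeriv (μ := μ) hG hc hΘ (γ := 0) (β := 0) (by simp)).comp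
    (f := Real.log) (S := Set.Icc a b) (M := |Real.log a| + |Real.log b|) (K := a⁻¹)
    (by positivity) hab
    (Real.continuousOn_log.mono fun t ht => (ha.trans_le ht.1).ne') (fun t ht => ?_)
    fun t ht u hu => ?_
  · have h1 := Real.log_le_log ha ht.1
    have h2 := Real.log_le_log (ha.trans_le ht.1) ht.2
    rw [abs_le]
    constructor
    · linarith [neg_abs_le (Real.log a), abs_nonneg (Real.log b)]
    · linarith [le_abs_self (Real.log b), abs_nonneg (Real.log a)]
  · rw [abs_le]
    have h1 := key t ht u hu
    have h2 := key u hu t ht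
    rw [abs_sub_comm u t] at h2
    constructor <;> linarith

theorem isTame_integral_sDens {γ : MultiIndex d} (hγ : deg γ ≤ p) :
    IsTame Θ fun θ y (Λ : LVec d p X) => ∫ x, sDens μ R θ y Λ γ x ∂μ := by
  have hΘ' : Θ ⊆ U := subset_closure.trans hΘ
  have hd : ∀ β ∈ Finset.Iic γ, deg (γ - β) ≤ p := fun β hβ => by
    have := deg_sub_add (Finset.mem_Iic.1 hβ)
    omega
  refine IsTame.congr (Φ := fun θ y Λ => ∑ β ∈ Finset.Iic γ, (mchoose γ β : ℝ) *
    ((∫ x, rDeriv R (γ - β) θ y (Λ.comp β) x ∂μ) * (∫ x, rDeriv R 0 θ y (Λ.comp 0) x ∂μ)⁻¹))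
    (IsTame.sum _ fun β hβ => (IsTame.const _).mul
      ((isTame_integral_rDeriv hG hc hΘ (hd β hβ)).mul (isTame_inv_integral_rDeriv hG hc hΘ)))
    fun θ hθ y Λ hΛ => ?_
  have hk := hG.isDerivKernel (hΘ' hθ)
  unfold sDens
  rw [integral_finsetSum _ fun β hβ => integrable_of_continuous μ
    (((hk.continuous_rDeriv (hd β hβ) y _).div_const _).const_mul _)]
  refine Finset.sum_congr rfl fun β _ => ?_
  rw [integral_const_mul, integral_div, div_eq_mul_inv]

/-- Apply the Leibniz rule of order `α'` to `c * ∂ᵢ log c = ∂ᵢ c` and divide by `c`. The derivative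
of order `α' + eᵢ` of the logarithm is expressed through integrals of `s^γ` and derivatives of lower
order. The formula does not involve the time or the initial law, so one `Ψ` serves all of them. -/
theorem exists_isTame_logDeriv {α : MultiIndex d} (hα : deg α ≤ p) :
    ∃ Ψ : E d → Y → LVec d p X → ℝ, IsTame Θ Ψ ∧
      ∀ (l : Measure X) [IsProbabilityMeasure l] (k : ℕ) (c : E d → C(ℕ → Y, ℝ))
        (g : E d → C((ℕ → Y) × X, ℝ)), IsFilterFamily μ p R U l k c g → ∀ θ ∈ Θ, ∀ y : ℕ → Y,
        mderiv α (fun ϑ => Real.log (c ϑ y)) θ =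
          Ψ θ (y (k + 1)) (FIter μ R θ y (initVec d p l) 0 k) := by
  have hΘ' : Θ ⊆ U := subset_closure.trans hΘ
  induction hn : deg α using Nat.strong_induction_on generalizing α with
  | _ n ih =>
    by_cases h0 : α = 0
    · subst h0
      refine ⟨_, isTame_log_integral_rDeriv hG hc hΘ (μ := μ), fun l _ k c g H θ hθ y => ?_⟩
      rw [mderiv_zero, H.c_eq θ (hΘ' hθ)]
    obtain ⟨i, hi⟩ := Function.ne_iff.1 h0
    obtain ⟨α', rfl⟩ : ∃ α' : MultiIndex d, α = α' + (Pi.single i 1 : MultiIndex d) :=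
      ⟨α - Pi.single i 1, (tsub_add_cancel_of_le (single_le_iff.2 hi)).symm⟩
    have hdα : deg α' + 1 ≤ p := by rwa [deg_add, deg_single] at hα
    rw [deg_add, deg_single] at hn
    have hdeg : ∀ β ∈ Finset.Iio α', deg β + 1 < n ∧ deg (α' - β) ≤ p := fun β hβ => by
      have h1 := deg_lt_deg (Finset.mem_Iio.1 hβ)
      have h2 := deg_sub_add (Finset.mem_Iio.1 hβ).le
      omega
    -- A total choice function is needed; outside the summation range it is given the value `0`.
    have hex : ∀ β : MultiIndex d, ∃ Ψ : E d → Y → LVec d p X → ℝ, β ∈ Finset.Iio α' →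
        IsTame Θ Ψ ∧ ∀ (l : Measure X) [IsProbabilityMeasure l] (k : ℕ) (c : E d → C(ℕ → Y, ℝ))
        (g : E d → C((ℕ → Y) × X, ℝ)), IsFilterFamily μ p R U l k c g → ∀ θ ∈ Θ, ∀ y : ℕ → Y,
        mderiv (β + Pi.single i 1) (fun ϑ => Real.log (c ϑ y)) θ =
          Ψ θ (y (k + 1)) (FIter μ R θ y (initVec d p l) 0 k) := fun β => by
      by_cases hβ : β ∈ Finset.Iio α'
      · have h1 := (hdeg β hβ).1
        have h2 : deg (β + Pi.single i 1) = deg β + 1 := by rw [deg_add, deg_single]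
        obtain ⟨Ψ, hΨ⟩ := ih (deg β + 1) h1 (α := β + Pi.single i 1) (by omega) h2
        exact ⟨Ψ, fun _ => hΨ⟩
      · exact ⟨0, fun h => absurd h hβ⟩
    choose Ψ hΨ using hex
    refine ⟨fun θ y Λ => (∫ x, sDens μ R θ y Λ (α' + Pi.single i 1) x ∂μ) +
      (-1) * ∑ β ∈ Finset.Iio α', (mchoose α' β : ℝ) *
        (Ψ β θ y Λ * ∫ x, sDens μ R θ y Λ (α' - β) x ∂μ),
      (isTame_integral_sDens hG hc hΘ hα).add ((IsTame.const _).mul (IsTame.sum _ fun β hβ =>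
        (IsTame.const _).mul ((hΨ β hβ).1.mul (isTame_integral_sDens hG hc hΘ (hdeg β hβ).2)))),
      fun l _ k c g H θ hθ y => ?_⟩
    have hU := hG.isOpen
    have hθU := hΘ' hθ
    have hcy : ContDiffOn ℝ p (fun ϑ => c ϑ y) U :=
      contDiffOn_clm (evalL y) H.contDiffOn_c
    have hly : ContDiffOn ℝ p (fun ϑ => Real.log (c ϑ y)) U :=
      hcy.log fun ϑ hϑ => (H.c_pos ϑ hϑ y).ne'
    have hcle : ContDiffOn ℝ (deg α' + 1 : ℕ) (fun ϑ => c ϑ y) U :=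
      hcy.of_le (by exact_mod_cast hdα)
    have hlle : ContDiffOn ℝ (deg α' + 1 : ℕ) (fun ϑ => Real.log (c ϑ y)) U :=
      hly.of_le (by exact_mod_cast hdα)
    have hpl := ((contDiffOn_succ_iff_partialDeriv hU).1 hlle).2 i
    have hmc : ∀ γ, deg γ ≤ p → mderiv γ (fun ϑ => c ϑ y) θ =
        c θ y * ∫ x, sDens μ R θ (y (k + 1)) (FIter μ R θ y (initVec d p l) 0 k) γ x ∂μ :=
      fun γ hγ => by
      rw [← H.mderiv_c θ hθU γ hγ y]
      exact mderiv_clm_comp hU (evalL y) (partialDiff_of_contDiffOn hU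
        (H.contDiffOn_c.of_le (by exact_mod_cast hγ))) hθU
    have hprod : Set.EqOn (partialDeriv i fun ϑ => c ϑ y) (fun ϑ =>
        ContinuousLinearMap.mul ℝ ℝ (partialDeriv i (fun ϑ => Real.log (c ϑ y)) ϑ) (c ϑ y)) U := by
      intro ϑ hϑ
      have h1 : DifferentiableAt ℝ (fun ϑ => c ϑ y) ϑ :=
        ((contDiffOn_succ_iff_partialDeriv hU).1 hcle).1.differentiableAt (hU.mem_nhds hϑ)
      have h2 := h1.hasFDerivAt.log (H.c_pos ϑ hϑ y).ne'
      have h3 := (H.c_pos ϑ hϑ y).ne'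
      beta_reduce
      rw [partialDeriv_eq_fderiv h1, partialDeriv_eq_fderiv h2.differentiableAt, h2.fderiv]
      simp only [ContinuousLinearMap.mul_apply', smul_apply, smul_eq_mul]
      field_simp
    have h1 := hmc (α' + Pi.single i 1) hα
    rw [mderiv_add_single hU (partialDiff_of_contDiffOn hU hcle) i hθU,
      mderiv_congr hU hprod α' hθU, mderiv_bilin hU (ContinuousLinearMap.mul ℝ ℝ) hpl
        (hcle.of_le (by exact_mod_cast Nat.le_succ _)) hθU] at h1
    beta_reduce at h1
    rw [← Finset.Iio_insert, Finset.sum_insert (by simp)] at h1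
    simp only [mchoose_self, Nat.cast_one, tsub_self, mderiv_zero, smul_eq_mul,
      ContinuousLinearMap.mul_apply'] at h1
    have h2 : ∀ β ∈ Finset.Iio α', (mchoose α' β : ℝ) *
        (mderiv β (partialDeriv i fun ϑ => Real.log (c ϑ y)) θ *
          mderiv (α' - β) (fun ϑ => c ϑ y) θ) = c θ y * ((mchoose α' β : ℝ) *
        (Ψ β θ (y (k + 1)) (FIter μ R θ y (initVec d p l) 0 k) *
        ∫ x, sDens μ R θ (y (k + 1)) (FIter μ R θ y (initVec d p l) 0 k) (α' - β) x ∂μ)) := by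
      intro β hβ
      have h3 := deg_lt_deg (Finset.mem_Iio.1 hβ)
      rw [hmc _ (hdeg β hβ).2, ← mderiv_add_single hU (partialDiff_of_contDiffOn hU
        (hlle.of_le (by exact_mod_cast (by omega : deg β + 1 ≤ deg α' + 1)))) i hθU,
        (hΨ β hβ).2 l k c g H θ hθ y]
      ring
    rw [Finset.sum_congr rfl h2, ← Finset.mul_sum] at h1
    rw [mderiv_add_single hU (partialDiff_of_contDiffOn hU hlle) i hθU]
    have h3 := (H.c_pos θ hθU y).ne'
    apply mul_left_cancel₀ h3
    linear_combination h1

end LogDerivatives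

/-! ### Factorization of the likelihood -/

section Likelihood

variable {d p : ℕ} {X : Type} [MeasurableSpace X] [MetricSpace X] [CompactSpace X] [BorelSpace X]
  {Y : Type} [MetricSpace Y] [CompactSpace Y] [MeasurableSpace Y] [BorelSpace Y]
  {μ : Measure X} [IsFiniteMeasure μ] {R : E d → Y → X → X → ℝ} {U Θ : Set (E d)}
  {G : E d → C(Y × (X × X), ℝ)} {θ : E d}

/-- The likelihood of `y₁, …, yₙ` for the initial state `x₀`. -/
def pathLik (μ : Measure X) (R : E d → Y → X → X → ℝ) (θ : E d) (n : ℕ) (y : ℕ → Y) (x₀ : X) : ℝ :=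
  ∫ x : Fin n → X,
    ∏ k : Fin n, R θ (y (k + 1)) (x k) ((Fin.cons x₀ x : Fin (n + 1) → X) k.castSucc)
      ∂(Measure.pi fun _ => μ)

theorem pathLik_zero (y : ℕ → Y) (x₀ : X) : pathLik μ R θ 0 y x₀ = 1 := by
  simp [pathLik, measureReal_def]

theorem IsSmoothFamily.pathLik_succ (hG : IsSmoothFamily p R U G) (hθ : θ ∈ U) (n : ℕ) (y : ℕ → Y)
    (x₀ : X) : pathLik μ R θ (n + 1) y x₀ =
      ∫ x₁, R θ (y 1) x₁ x₀ * pathLik μ R θ n (fun k => y (k + 1)) x₁ ∂μ := by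
  -- The state `x₁` is split off from the product measure; it becomes the initial state of the
  -- remaining path.
  have he := (measurePreserving_piFinSuccAbove (fun _ : Fin (n + 1) => μ) 0).symm
  rw [pathLik, ← he.integral_comp']
  have hF : ∀ z : X × (Fin n → X), ∏ k : Fin (n + 1), R θ (y (k + 1))
      ((MeasurableEquiv.piFinSuccAbove (fun _ : Fin (n + 1) => X) 0).symm z k)
      ((Fin.cons x₀ ((MeasurableEquiv.piFinSuccAbove (fun _ : Fin (n + 1) => X) 0).symm z) :
        Fin (n + 2) → X) k.castSucc) = R θ (y 1) z.1 x₀ *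
      ∏ k : Fin n, R θ (y (k + 1 + 1)) (z.2 k) ((Fin.cons z.1 z.2 : Fin (n + 1) → X) k.castSucc) := by
    intro z
    have hz : (MeasurableEquiv.piFinSuccAbove (fun _ : Fin (n + 1) => X) 0).symm z =
        Fin.cons z.1 z.2 := by
      rw [← Fin.insertNth_zero']; rfl
    rw [hz, Fin.prod_univ_succ]
    congr 1
  simp_rw [hF]
  have hcont : Continuous fun z : X × (Fin n → X) => R θ (y 1) z.1 x₀ *
      ∏ k : Fin n, R θ (y (k + 1 + 1)) (z.2 k)
        ((Fin.cons z.1 z.2 : Fin (n + 1) → X) k.castSucc) := by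
    simp_rw [← hG.eq θ hθ]
    have h1 : ∀ j : Fin (n + 1), Continuous fun z : X × (Fin n → X) =>
        (Fin.cons z.1 z.2 : Fin (n + 1) → X) j := fun j => by
      refine Fin.cases ?_ (fun i => ?_) j
      · simpa using continuous_fst
      · simp only [Fin.cons_succ]; fun_prop
    fun_prop
  change ∫ z, _ ∂(μ.prod (Measure.pi fun _ : Fin n => μ)) = _
  rw [integral_prod _ (integrable_of_continuous _ hcont)]
  simp_rw [integral_const_mul]
  rfl

theorem IsSmoothFamily.continuous_pathLik (hG : IsSmoothFamily p R U G) (hθ : θ ∈ U) (n : ℕ)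
    (y : ℕ → Y) : Continuous (pathLik μ R θ n y) := by
  induction n generalizing y with
  | zero => simp_rw [funext (pathLik_zero (μ := μ) (R := R) (θ := θ) y)]; exact continuous_const
  | succ n ih =>
    have h1 := ih fun k => y (k + 1)
    simp_rw [funext (hG.pathLik_succ (μ := μ) hθ n y), ← hG.eq θ hθ]
    exact continuous_integral_of_compact μ ⟨fun z : X × X => G θ (y 1, (z.2, z.1)) *
      pathLik μ R θ n (fun k => y (k + 1)) z.2, by fun_prop⟩

/-- Integrating out the first transition maps the initial law to the one-step normalizing constant
times the updated filter. Repeating this extracts one normalizing constant per observation. -/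
theorem IsSmoothFamily.sInt_pathLik [NeZero μ] (hG : IsSmoothFamily p R U G) {ε : ℝ}
    (hmix : StrongMixing μ R Θ ε) (hθ : θ ∈ Θ) (hθU : θ ∈ U) (n : ℕ) (y : ℕ → Y) {Λ : LVec d p X}
    (hΛ : Λ.IsL0) : sInt (Λ.comp 0) (pathLik μ R θ n y) = ∏ k ∈ Finset.range n,
      ∫ x, rDeriv R 0 θ (y (k + 1)) ((FIter μ R θ y Λ 0 k).comp 0) x ∂μ := by
  have hk := hG.isDerivKernel hθU
  have hpos := hG.pos θ hθU
  induction n generalizing y Λ with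
  | zero =>
    simp_rw [funext (pathLik_zero (μ := μ) (R := R) (θ := θ) y)]
    simpa using ((LVec.isL0_iff Λ).1 hΛ).sInt_const 1
  | succ n ih =>
    have hu := integral_rDeriv_pos hk hpos hmix hθ hΛ (y 1)
    have h0 : ∫ x, rDeriv R 0 θ (y 1) (Λ.comp 0) x ∂μ =
        mass (kerOp μ (slice (mderiv 0 G θ) (y 1)) (Λ.comp 0)) := by
      rw [integral_eq_mass_withDensityᵥ (hk.continuous_rDeriv (by simp) _ _),
        hk.withDensityᵥ_rDeriv (by simp)]
    have h1 : kerOp μ (slice (mderiv 0 G θ) (y 1)) (Λ.comp 0) =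
        (∫ x, rDeriv R 0 θ (y 1) (Λ.comp 0) x ∂μ) • (FStep μ R θ (y 1) Λ).comp 0 := by
      rw [(hk.isStep (y 1) Λ).zero, ← h0, smul_inv_smul₀ hu.ne']
    have hc := hG.continuous_pathLik (μ := μ) hθU n fun k => y (k + 1)
    have h2 : pathLik μ R θ (n + 1) y = dualOp μ (slice (mderiv 0 G θ) (y 1))
        (pathLik μ R θ n fun k => y (k + 1)) := by
      funext x₀
      rw [hG.pathLik_succ hθU, dualOp]
      refine integral_congr_ae (Eventually.of_forall fun x => ?_)
      simp only
      rw [slice_apply, mderiv_zero, hG.eq θ hθU, mul_comm]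
    let f : C(X, ℝ) := ⟨_, hc⟩
    have h3 := sInt_kerOp μ (slice (mderiv 0 G θ) (y 1)) (Λ.comp 0) (f := f) f.continuous.measurable
      (C := ‖f‖) f.norm_coe_le_norm
    have h4 := ih (fun k => y (k + 1)) (isL0_FStep hk hpos hmix hθ hΛ (y 1))
    rw [h2]
    refine h3.symm.trans ?_
    rw [h1, sInt_smul]
    refine (congrArg _ h4).trans ?_
    rw [Finset.prod_range_succ', mul_comm, FIter_self]
    refine congrArg (· * _) (Finset.prod_congr rfl fun k _ => ?_)
    have h5 : FIter μ R θ y Λ 0 (k + 1) =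
        FIter μ R θ (fun i => y (i + 1)) (FStep μ R θ (y 1) Λ) 0 k := by
      rw [FIter_succ', add_comm k 1, FIter_shift]
      simp_rw [add_comm 1]
    rw [h5]

theorem IsSmoothFamily.log_likelihood [NeZero μ] (hG : IsSmoothFamily p R U G) {ε : ℝ}
    (hmix : StrongMixing μ R Θ ε) (hθ : θ ∈ Θ) (hθU : θ ∈ U) (n : ℕ) (y : ℕ → Y) (l : Measure X)
    [IsProbabilityMeasure l] : Real.log (likelihood μ R θ n y l) = ∑ k ∈ Finset.range n, Real.log
      (∫ x, rDeriv R 0 θ (y (k + 1)) ((FIter μ R θ y (initVec d p l) 0 k).comp 0) x ∂μ) := by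
  have h0 := LVec.isL0_initVec (d := d) (p := p) l
  have h1 : likelihood μ R θ n y l = sInt ((initVec d p l).comp 0) (pathLik μ R θ n y) := by
    rw [LVec.comp_initVec, if_pos rfl, sInt_toSignedMeasure]
    rfl
  rw [h1, hG.sInt_pathLik hmix hθ hθU n y h0, Real.log_prod fun k _ => ?_]
  exact (integral_rDeriv_pos (hG.isDerivKernel hθU) (hG.pos θ hθU) hmix hθ
    (isL0_FIter (hG.isDerivKernel hθU) (hG.pos θ hθU) hmix hθ h0 _ _ _) _).ne'

end Likelihood

/-! ### Path laws of a process with Markovian transitions -/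

section PathLaw

variable {V : Type*} [MeasurableSpace V]

/-- The sequence that agrees with `ω` up to time `n` and is equal to `w` afterwards. -/
def extPath (n : ℕ) (ω : ℕ → V) (w : V) (k : ℕ) : V := if k ≤ n then ω k else w

theorem measurable_extPath (n : ℕ) : Measurable fun z : (ℕ → V) × V => extPath n z.1 z.2 := by
  refine measurable_pi_iff.2 fun k => ?_
  by_cases hk : k ≤ n
  · simp only [extPath, if_pos hk]
    exact (measurable_pi_apply k).comp measurable_fst
  · simpa only [extPath, if_neg hk] using measurable_snd

theorem extPath_zero (v w : V) : extPath 0 (fun _ => v) w = consPath v fun _ => w := by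
  funext k
  rcases k with _ | k
  · simp [extPath]
  · simp [extPath]

theorem extPath_consPath (n : ℕ) (v : V) (ω : ℕ → V) (w : V) :
    extPath (n + 1) (consPath v ω) w = consPath v (extPath n ω w) := by
  funext k
  rcases k with _ | k
  · simp [extPath]
  · simp [extPath]

variable {S : Kernel V V} [IsMarkovKernel S]

theorem measurable_lintegral_extPath (n : ℕ) {f : (ℕ → V) → ℝ≥0∞} (hf : Measurable f) :
    Measurable fun ω : ℕ → V => ∫⁻ w, f (extPath n ω w) ∂(S (ω n)) :=
  (hf.comp (measurable_extPath n)).lintegral_kernel_prod_right'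
    (κ := S.comap (fun ω : ℕ → V => ω n) (measurable_pi_apply n))

/-- `pathK` is built by prepending states, whereas the law of a process is described by conditioning
the next state on the past; this reconciles the two. -/
theorem lintegral_pathK_succ_right (n : ℕ) (v : V) {f : (ℕ → V) → ℝ≥0∞} (hf : Measurable f) :
    ∫⁻ ω, f ω ∂(pathK S (n + 1) v) =
      ∫⁻ ω, ∫⁻ w, f (extPath n ω w) ∂(S (ω n)) ∂(pathK S n v) := by
  induction n generalizing v f with
  | zero =>
    rw [lintegral_pathK_succ 0 v hf, lintegral_pathK_zero (measurable_lintegral_extPath 0 hf)]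
    refine lintegral_congr fun w => ?_
    have h1 : Measurable fun ω => f (consPath v ω) := hf.comp (measurable_consPath_right v)
    rw [lintegral_pathK_zero h1, extPath_zero]
  | succ n ih =>
    rw [lintegral_pathK_succ _ v hf, lintegral_pathK_succ _ v (measurable_lintegral_extPath _ hf)]
    refine lintegral_congr fun w => ?_
    have h1 : Measurable fun ω => f (consPath v ω) := hf.comp (measurable_consPath_right v)
    rw [ih w h1]
    simp_rw [extPath_consPath, consPath_succ]

/-- The path `Z 0, …, Z n` of a process, extended constantly. -/
def stopPath {Ω : Type*} (Z : ℕ → Ω → V) (n : ℕ) (ω : Ω) (k : ℕ) : V := Z (min k n) ω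

theorem measurable_stopPath {Ω : Type*} [MeasurableSpace Ω] {Z : ℕ → Ω → V}
    (hZ : ∀ n, Measurable (Z n)) (n : ℕ) : Measurable (stopPath Z n) :=
  measurable_pi_iff.2 fun _ => hZ _

theorem stopPath_succ {Ω : Type*} (Z : ℕ → Ω → V) (n : ℕ) (ω : Ω) :
    stopPath Z (n + 1) ω = extPath n (stopPath Z n ω) (Z (n + 1) ω) := by
  funext k
  by_cases hk : k ≤ n
  · simp [stopPath, extPath, hk, Nat.le_succ_of_le hk]
  · simp [stopPath, extPath, hk, show n + 1 ≤ k by omega]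

/-- The joint law of the first states of a process with Markovian transitions. -/
theorem map_stopPath {Ω : Type*} [MeasurableSpace Ω] {Pr : Measure Ω} [IsProbabilityMeasure Pr]
    {Z : ℕ → Ω → V} (hZ : ∀ n, Measurable (Z n))
    (hS : ∀ n (A : Set (ℕ → V)) (B : Set V), MeasurableSet A → MeasurableSet B →
      Pr (stopPath Z n ⁻¹' A ∩ Z (n + 1) ⁻¹' B) = ∫⁻ ω in stopPath Z n ⁻¹' A, S (Z n ω) B ∂Pr)
    (n : ℕ) : Pr.map (stopPath Z n) = (Pr.map (Z 0)).bind (pathK S n) := by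
  have : IsProbabilityMeasure (Pr.map (Z 0)) :=
    Measure.isProbabilityMeasure_map (hZ 0).aemeasurable
  induction n with
  | zero =>
    refine Measure.ext_of_lintegral _ fun f hf => ?_
    rw [Measure.lintegral_bind (Kernel.aemeasurable _) hf.aemeasurable,
      lintegral_map hf (measurable_stopPath hZ 0)]
    simp_rw [lintegral_pathK_zero hf]
    have h1 : Measurable fun v : V => f fun _ => v :=
      hf.comp (measurable_pi_iff.2 fun _ => measurable_id)
    rw [lintegral_map h1 (hZ 0)]
    exact lintegral_congr fun ω => congrArg f (funext fun k => by simp [stopPath])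
  | succ n ih =>
    have hm := measurable_stopPath hZ n
    have : IsProbabilityMeasure (Pr.map (stopPath Z n)) :=
      Measure.isProbabilityMeasure_map hm.aemeasurable
    have key : Pr.map (fun ω => (stopPath Z n ω, Z (n + 1) ω)) =
        (Pr.map (stopPath Z n)) ⊗ₘ S.comap (fun ω : ℕ → V => ω n) (measurable_pi_apply n) := by
      have : IsProbabilityMeasure (Pr.map (fun ω => (stopPath Z n ω, Z (n + 1) ω))) :=
        Measure.isProbabilityMeasure_map (hm.prodMk (hZ _)).aemeasurable
      refine Measure.ext_prod fun {A B} hA hB => ?_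
      rw [Measure.map_apply (hm.prodMk (hZ _)) (hA.prod hB), Measure.compProd_apply_prod hA hB,
        setLIntegral_map hA (Kernel.measurable_coe _ hB) hm]
      refine Eq.trans ?_ ((hS n A B hA hB).trans (lintegral_congr fun ω => ?_))
      · rfl
      · simp [stopPath]
    refine Measure.ext_of_lintegral _ fun f hf => ?_
    have h2 : Measurable fun z : (ℕ → V) × V => f (extPath n z.1 z.2) :=
      hf.comp (measurable_extPath n)
    calc ∫⁻ ω, f ω ∂(Pr.map (stopPath Z (n + 1)))
        = ∫⁻ z, f (extPath n z.1 z.2) ∂(Pr.map (fun ω => (stopPath Z n ω, Z (n + 1) ω))) := by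
          rw [lintegral_map hf (measurable_stopPath hZ _), lintegral_map h2 (hm.prodMk (hZ _))]
          simp_rw [stopPath_succ]
      _ = ∫⁻ ω, ∫⁻ w, f (extPath n ω w) ∂(S (ω n)) ∂(Pr.map (stopPath Z n)) := by
          rw [key, Measure.lintegral_compProd h2]
          rfl
      _ = ∫⁻ ω, f ω ∂((Pr.map (Z 0)).bind (pathK S (n + 1))) := by
          rw [ih, Measure.lintegral_bind (Kernel.aemeasurable _)
            (measurable_lintegral_extPath n hf).aemeasurable,
            Measure.lintegral_bind (Kernel.aemeasurable _) hf.aemeasurable]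
          exact lintegral_congr fun v => (lintegral_pathK_succ_right n v hf).symm

end PathLaw

/-! ### The law of the state-space model -/

section StateSpace

variable {X : Type} [MeasurableSpace X] [MetricSpace X] [CompactSpace X] [BorelSpace X]
  {Y : Type} [MetricSpace Y] [CompactSpace Y] [MeasurableSpace Y] [BorelSpace Y]
  {P : Kernel X X} [IsMarkovKernel P] {Q : Kernel X Y} [IsMarkovKernel Q]
  {Ω : Type*} [MeasurableSpace Ω] {Pr : Measure Ω} [IsProbabilityMeasure Pr]
  {Xs : ℕ → Ω → X} {Ys : ℕ → Ω → Y}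

/-- The process is taken from time `1` on: the filter that uses the current observation then starts
with `Y₁`, as in the likelihood. The defining conditional expectation is integrated over an event of
the past to obtain the transition identity of `map_stopPath`. -/
theorem IsStateSpaceModel.map_stopPath (h : IsStateSpaceModel Pr P Q Xs Ys) (n : ℕ) :
    Pr.map (stopPath (fun k ω => (Xs (k + 1) ω, Ys (k + 1) ω)) n) =
      (Pr.map fun ω => (Xs 1 ω, Ys 1 ω)).bind (pathK (stateKer P Q) n) := by
  obtain ⟨hX, hY, h⟩ := h
  have hZ : ∀ k, Measurable fun ω => (Xs (k + 1) ω, Ys (k + 1) ω) := fun k =>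
    (hX _).prodMk (hY _)
  refine OptFilter.map_stopPath hZ (fun n A B hA hB => ?_) n
  set Z : ℕ → Ω → X × Y := fun k ω => (Xs (k + 1) ω, Ys (k + 1) ω) with hZ'
  have hm : MeasurableSpace.comap (fun ω (k : Fin (n + 1 + 1)) => (Xs k ω, Ys k ω)) inferInstance ≤
      (inferInstance : MeasurableSpace Ω) :=
    (measurable_pi_iff.2 fun k : Fin (n + 1 + 1) => (hX k).prodMk (hY k)).comap_le
  have hA' : MeasurableSet[MeasurableSpace.comap
      (fun ω (k : Fin (n + 1 + 1)) => (Xs k ω, Ys k ω)) inferInstance] (stopPath Z n ⁻¹' A) := by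
    -- The path shifted by one and stopped at `n` is a function of the times `1, …, n + 1`, all
    -- contained in the past up to `n + 1`.
    refine ⟨(fun (v : Fin (n + 1 + 1) → X × Y) (k : ℕ) =>
      v ⟨min k n + 1, by have := min_le_right k n; omega⟩) ⁻¹' A, ?_, rfl⟩
    exact (measurable_pi_iff.2 fun k => measurable_pi_apply _) hA
  have hB' : MeasurableSet (Z (n + 1) ⁻¹' B) := hZ (n + 1) hB
  have h1 := setIntegral_condExp hm ((integrable_const (1 : ℝ)).indicator hB' (μ := Pr)) hA'
  rw [setIntegral_congr_ae (g := fun ω => (P (Xs (n + 1) ω) ⊗ₘ Q).real B) (hm _ hA')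
    ((h (n + 1) B hB).mono fun ω hω _ => hω), setIntegral_indicator hB'] at h1
  have h2 : Measurable fun ω => stateKer P Q (Z n ω) B :=
    (Kernel.measurable_coe _ hB).comp (hZ n)
  simp only [integral_const, smul_eq_mul, mul_one, measureReal_restrict_apply_univ] at h1
  have h3 : ∫ ω in stopPath Z n ⁻¹' A, (P (Xs (n + 1) ω) ⊗ₘ Q).real B ∂Pr =
      (∫⁻ ω in stopPath Z n ⁻¹' A, stateKer P Q (Z n ω) B ∂Pr).toReal := by
    rw [← integral_toReal h2.aemeasurable (Eventually.of_forall fun ω => measure_lt_top _ _)]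
    simp_rw [stateKer_apply]
    rfl
  rw [h3, measureReal_def] at h1
  refine ((ENNReal.toReal_eq_toReal_iff' ?_ (measure_ne_top _ _)).1 h1).symm
  refine ((lintegral_mono fun ω => prob_le_one).trans_lt ?_).ne (b := ∞)
  simp

end StateSpace

theorem abs_integral_bind_sub_le {V W : Type*} [MeasurableSpace V] [MeasurableSpace W]
    {ν : Measure V} [IsProbabilityMeasure ν] {κ : Kernel V W} [IsMarkovKernel κ] {f : W → ℝ}
    (hf : Integrable f (ν.bind κ)) {a b : ℝ} (h : ∀ v, |∫ w, f w ∂(κ v) - a| ≤ b) :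
    |∫ w, f w ∂(ν.bind κ) - a| ≤ b := by
  have he : ν.bind κ = (κ ∘ₖ Kernel.const Unit ν) () := by
    rw [Kernel.comp_apply, Kernel.const_apply]
  rw [he] at hf ⊢
  have hi := hf.integral_comp
  rw [Kernel.const_apply] at hi
  rw [Kernel.integral_comp hf, Kernel.const_apply]
  have h1 : ∫ v, (∫ w, f w ∂(κ v) - a) ∂ν = ∫ v, ∫ w, f w ∂(κ v) ∂ν - a := by
    rw [integral_sub hi (integrable_const a)]
    simp
  rw [← h1]
  simpa using norm_integral_le_of_norm_le_const (μ := ν) (Eventually.of_forall fun v => (Real.norm_eq_abs _).trans_le (h v))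

/-! ### The log-likelihood rate -/

section Rate

variable {d p : ℕ} {X : Type} [MeasurableSpace X] [MetricSpace X] [CompactSpace X] [BorelSpace X]
  {Y : Type} [MetricSpace Y] [CompactSpace Y] [MeasurableSpace Y] [BorelSpace Y]
  {μ : Measure X} [IsFiniteMeasure μ] [NeZero μ] {R : E d → Y → X → X → ℝ} {U Θ : Set (E d)}
  {G : E d → C(Y × (X × X), ℝ)}

theorem IsFilterFamily.exists_log {l : Measure X} [IsProbabilityMeasure l] {k : ℕ}
    {c : E d → C(ℕ → Y, ℝ)} {g : E d → C((ℕ → Y) × X, ℝ)} (hU : IsOpen U)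
    (H : IsFilterFamily μ p R U l k c g) :
    ∃ h : E d → C(ℕ → Y, ℝ), ContDiffOn ℝ p h U ∧ (∀ θ ∈ U, ∀ y, h θ y = Real.log (c θ y)) ∧
      ∀ α, deg α ≤ p → ∀ θ ∈ U, ∀ y,
        mderiv α (fun ϑ => Real.log (c ϑ y)) θ = mderiv α h θ y := by
  obtain ⟨h, hh, hd⟩ := exists_contDiffOn_comp_left hU (isOpen_Ioi (a := (0 : ℝ)))
    (n := p) (h := Real.log) (fun t ht => (Real.contDiffAt_log.2 (ne_of_gt ht)).contDiffWithinAt)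
    H.contDiffOn_c fun θ hθ y => H.c_pos θ hθ y
  refine ⟨h, hd, hh, fun α hα θ hθ y => ?_⟩
  rw [← mderiv_congr hU (f := fun ϑ => evalL y (h ϑ)) (fun ϑ hϑ => hh ϑ hϑ y) α hθ]
  exact mderiv_clm_comp hU (evalL y)
    (partialDiff_of_contDiffOn hU (hd.of_le (by exact_mod_cast hα))) hθ

variable {P : Kernel X X} [IsMarkovKernel P] {Q : Kernel X Y} [IsMarkovKernel Q]
  {π : Measure X} [IsProbabilityMeasure π] {δ K₀ : ℝ}
  {Ω : Type*} [MeasurableSpace Ω] {Pr : Measure Ω} [IsProbabilityMeasure Pr]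
  {Xs : ℕ → Ω → X} {Ys : ℕ → Ω → Y}

/-- Expectations of tame functionals of the optimal filter converge geometrically fast, to a limit
that does not depend on the initial law of the filter. -/
theorem exists_limit_isTame (hp : 1 ≤ p) (hG : IsSmoothFamily p R U G)
    (hc : IsCompact (closure Θ)) (hΘ : closure Θ ⊆ U) (hP : GeomErgodic P π δ K₀)
    (hZ : IsStateSpaceModel Pr P Q Xs Ys) {Ψ : E d → Y → LVec d p X → ℝ} (hΨ : IsTame Θ Ψ) :
    ∃ (ϕ : E d → ℝ) (C ρ : ℝ), 0 ≤ ρ ∧ ρ < 1 ∧ ∀ θ ∈ Θ, ∀ (l : Measure X) [IsProbabilityMeasure l],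
      ∀ k, 1 ≤ k → Integrable (fun ω =>
        Ψ θ (Ys (k + 1) ω) (FIter μ R θ (fun j => Ys j ω) (initVec d p l) 0 k)) Pr →
      |∫ ω, Ψ θ (Ys (k + 1) ω) (FIter μ R θ (fun j => Ys j ω) (initVec d p l) 0 k) ∂Pr - ϕ θ| ≤
        C * ρ ^ k := by
  obtain ⟨ε, c, hmix, hs⟩ := hG.exists_constants (μ := μ) hc hΘ
  obtain ⟨A, q, hA, hq, hφ, hgr⟩ := hΨ.exists_growthCondition (X := X)
  set r : ℝ := (p : ℝ) * (p + q + 1) with hr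
  obtain ⟨L₀, hL1, hL⟩ := exists_moment_bound (Q := Q) (φ := fun _ : X × Y => A) (fun _ => hA)
    ((iSup_le fun x => by simp).trans_lt (ENNReal.ofReal_lt_top (r := A))) (c ^ r)
  have hp' : (1 : ℝ) ≤ p := by exact_mod_cast hp
  have hr1 : 1 ≤ r := by nlinarith
  have hrate := isRate_ergodic p q ε δ K₀ L₀
  set ρ := ergodicRate p q ε δ K₀ L₀
  set L := ergodicConst p q ε δ K₀ L₀
  -- The variant with the current observation fits: with paths starting at time `1`, the filter
  -- after `k` steps has used `Y₁, …, Y_k`, and the observation component is `Y_{k+1}`, the argument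
  -- of the next normalizing constant.
  have ho : Measurable fun z : Y × Y => (fun a _ => a : Y → Y → Y) z.1 z.2 := measurable_fst
  have key : ∀ θ ∈ Θ, ∃ ϕ : ℝ, ∀ v : X × Y, ∀ Λ : LVec d p X, Λ.IsL0 → ∀ n, 1 ≤ n →
      |∫ ω, Ψ θ (ω n).2 (FIter μ R θ (obsSeq (fun a _ => a) ω) Λ 0 n)
        ∂(pathK (stateKer P Q) n v) - ϕ| ≤
        L * ρ ^ n * c ^ r * Λ.norm ^ ((p : ℝ) * (q + 1)) := fun θ hθ => by
    have hθU := hΘ (subset_closure hθ)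
    exact (exists_limit_pathK hp (hG.isDerivKernel hθU) (hG.pos θ hθU) hmix hs hs hθ ho
        (Φ := fun z => Ψ θ z.2.1 z.2.2) (hΨ.measurable hθ) hq hφ (hgr θ hθ) hP hL1
        (momentBound_current hr1 measurable_const hφ measurable_const hs.1 hL1 hL) hrate).2
  choose! ϕ hϕ using key
  refine ⟨ϕ, L * c ^ r, ρ, hrate.1.le, hrate.2.1, fun θ hθ l _ k hk hi => ?_⟩
  have hθU := hΘ (subset_closure hθ)
  have hΛ := LVec.isL0_initVec (d := d) (p := p) l
  set Z : ℕ → Ω → X × Y := fun k ω => (Xs (k + 1) ω, Ys (k + 1) ω) with hZd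
  have hZm : Measurable (stopPath Z k) :=
    measurable_stopPath (fun j => (hZ.1 _).prodMk (hZ.2.1 _)) k
  have hfm : Measurable fun ω : ℕ → X × Y =>
      Ψ θ (ω k).2 (FIter μ R θ (obsSeq (fun a _ => a) ω) (initVec d p l) 0 k) :=
    measurable_comp_FIter (hG.isDerivKernel hθU) (hG.pos θ hθU) hmix hs hθ ho
      (Φ := fun z => Ψ θ z.2.1 z.2.2) (hΨ.measurable hθ) hΛ k k
  -- Rewriting through the stopped path is legitimate because the filter at step `k` only uses
  -- indices `1, …, k`, where the stopped and the full observation sequence agree.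
  have he : (fun ω => Ψ θ (Ys (k + 1) ω)
      (FIter μ R θ (fun j => Ys j ω) (initVec d p l) 0 k)) = fun ω' =>
      (fun ω : ℕ → X × Y => Ψ θ (ω k).2
        (FIter μ R θ (obsSeq (fun a _ => a) ω) (initVec d p l) 0 k)) (stopPath Z k ω') := by
    funext ω'
    have h1 : (stopPath Z k ω' k).2 = Ys (k + 1) ω' := by simp [stopPath, hZd]
    refine Eq.trans ?_ (congrArg (fun y => Ψ θ y _) h1.symm)
    refine congrArg (Ψ θ _) (FIter_congr fun j hj hjk => ?_)
    obtain ⟨i, rfl⟩ : ∃ i, j = i + 1 := ⟨j - 1, by omega⟩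
    simp [obsSeq, stopPath, hZd, show min i k = i by omega]
  have hν : IsProbabilityMeasure (Pr.map fun ω => (Xs 1 ω, Ys 1 ω)) :=
    Measure.isProbabilityMeasure_map ((hZ.1 _).prodMk (hZ.2.1 _)).aemeasurable
  rw [he] at hi ⊢
  rw [← integral_map hZm.aemeasurable hfm.aestronglyMeasurable, hZ.map_stopPath]
  have hi' := (integrable_map_measure hfm.aestronglyMeasurable hZm.aemeasurable).2 hi
  rw [hZ.map_stopPath] at hi'
  refine abs_integral_bind_sub_le hi' fun v => ?_
  have h2 := hϕ θ hθ v _ hΛ k hk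
  rw [LVec.norm_initVec, Real.one_rpow, mul_one] at h2
  linarith

/-- Existence and higher-order differentiability of the log-likelihood rate. -/
theorem exists_likelihood_rate (hp : 1 ≤ p) (hG : IsSmoothFamily p R U G)
    (hc : IsCompact (closure Θ)) (hΘ : closure Θ ⊆ U) (hΘo : IsOpen Θ) (hP : GeomErgodic P π δ K₀)
    (hZ : IsStateSpaceModel Pr P Q Xs Ys) :
    ∃ ell : E d → ℝ, DiffTimes p ell Θ ∧ ∀ θ ∈ Θ, ∀ (l : Measure X) [IsProbabilityMeasure l],
      (∀ n : ℕ, 1 ≤ n → Integrable (fun ω =>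
        1 / (n : ℝ) * Real.log (likelihood μ R θ n (fun k => Ys k ω) l)) Pr) ∧
      Tendsto (fun n : ℕ => ∫ ω,
        1 / (n : ℝ) * Real.log (likelihood μ R θ n (fun k => Ys k ω) l) ∂Pr) atTop
        (𝓝 (ell θ)) := by
  have hΘU : Θ ⊆ U := subset_closure.trans hΘ
  have hYm : Measurable fun ω (k : ℕ) => Ys k ω := measurable_pi_iff.2 hZ.2.1
  have hν : IsProbabilityMeasure (Pr.map fun ω (k : ℕ) => Ys k ω) :=
    Measure.isProbabilityMeasure_map hYm.aemeasurable
  set ν := Pr.map fun ω (k : ℕ) => Ys k ω with hνd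
  -- The space of observation sequences is compact, so a continuous function of the observations is
  -- bounded. Its expectation is a continuous linear functional and hence commutes with derivatives
  -- in `θ`.
  have hcont : ∀ f : C(ℕ → Y, ℝ), Integrable (fun ω => f fun k => Ys k ω) Pr ∧
      ∫ ω, f (fun k => Ys k ω) ∂Pr = intL ν f := fun f => by
    have h1 : AEStronglyMeasurable f (Pr.map fun ω (k : ℕ) => Ys k ω) :=
      f.continuous.measurable.aestronglyMeasurable
    refine ⟨?_, ?_⟩
    · refine Integrable.of_bound (f.continuous.measurable.comp hYm).aestronglyMeasurable ‖f‖
        (Eventually.of_forall fun ω => f.norm_coe_le_norm _)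
    · rw [intL_apply, hνd, integral_map hYm.aemeasurable h1]
  have hfam : ∀ (l : Measure X) [IsProbabilityMeasure l] (k : ℕ),
      ∃ h : E d → C(ℕ → Y, ℝ), ContDiffOn ℝ p h U ∧
      (∀ θ ∈ U, ∀ y, h θ y = Real.log (∫ x, rDeriv R 0 θ (y (k + 1))
        ((FIter μ R θ y (initVec d p l) 0 k).comp 0) x ∂μ)) ∧
      ∃ c g, IsFilterFamily μ p R U l k c g ∧ ∀ α, deg α ≤ p → ∀ θ ∈ U, ∀ y,
        mderiv α (fun ϑ => Real.log (c ϑ y)) θ = mderiv α h θ y := fun l _ k => by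
    obtain ⟨c, g, H⟩ := hG.exists_isFilterFamily (μ := μ) (l := l) k
    obtain ⟨h, h1, h2, h3⟩ := H.exists_log hG.isOpen
    exact ⟨h, h1, fun θ hθ y => by rw [h2 θ hθ, H.c_eq θ hθ], c, g, H, h3⟩
  -- For every order the expected derivatives converge at a geometric rate with constants
  -- independent of `θ` and of the initial law; this uniformity makes the limit differentiable.
  have hlim : ∀ α : MultiIndex d, deg α ≤ p → ∃ (ϕ : E d → ℝ) (C ρ : ℝ), 0 ≤ ρ ∧ ρ < 1 ∧
      ∀ (l : Measure X) [IsProbabilityMeasure l] (k : ℕ) (h : E d → C(ℕ → Y, ℝ)), 1 ≤ k →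
      (∃ c g, IsFilterFamily μ p R U l k c g ∧ ∀ α, deg α ≤ p → ∀ θ ∈ U, ∀ y,
        mderiv α (fun ϑ => Real.log (c ϑ y)) θ = mderiv α h θ y) →
      ∀ θ ∈ Θ, |intL ν (mderiv α h θ) - ϕ θ| ≤ C * ρ ^ k := fun α hα => by
    obtain ⟨Ψ, hΨ, hΨd⟩ := exists_isTame_logDeriv (μ := μ) hG hc hΘ hα
    obtain ⟨ϕ, C, ρ, hρ0, hρ1, H⟩ := exists_limit_isTame (μ := μ) hp hG hc hΘ hP hZ hΨ
    refine ⟨ϕ, C, ρ, hρ0, hρ1, fun l _ k h hk ⟨c, g, hcg, hh⟩ θ hθ => ?_⟩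
    have he : (fun ω => Ψ θ (Ys (k + 1) ω)
        (FIter μ R θ (fun j => Ys j ω) (initVec d p l) 0 k)) =
        fun ω => mderiv α h θ fun k => Ys k ω := by
      funext ω
      rw [← hh α hα θ (hΘU hθ), hΨd l k c g hcg θ hθ]
    have h1 := H θ hθ l k hk
    rw [he] at h1
    have h2 := h1 (hcont _).1
    rwa [(hcont _).2] at h2
  have hlim0 : ∀ {ϕ : E d → ℝ} {C ρ : ℝ}, 0 ≤ ρ → ρ < 1 → ∀ {f : ℕ → E d → ℝ} {θ : E d},
      (∀ k, 1 ≤ k → |f k θ - ϕ θ| ≤ C * ρ ^ k) → Tendsto (fun k => f k θ) atTop (𝓝 (ϕ θ)) :=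
    fun {ϕ C ρ} hρ0 hρ1 {f θ} h => by
    have h1 : Tendsto (fun k : ℕ => C * ρ ^ k) atTop (𝓝 0) := by
      simpa using (tendsto_pow_atTop_nhds_zero_of_lt_one hρ0 hρ1).const_mul C
    refine tendsto_iff_dist_tendsto_zero.2 (squeeze_zero' (Eventually.of_forall fun k =>
      dist_nonneg) ((eventually_ge_atTop 1).mono fun k hk => ?_) h1)
    exact h k hk
  obtain ⟨ell, C, ρ, hρ0, hρ1, hell⟩ := hlim 0 (by simp)
  simp only [mderiv_zero] at hell
  refine ⟨ell, ?_, fun θ hθ l _ => ?_⟩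
  -- The limit does not depend on the initial law of the filter, so differentiability may be proved
  -- with any of them, here `π`.
  · choose h h1 h2 h3 using hfam π
    have hdiff : ∀ k, ContDiffOn ℝ p (fun θ => intL ν (h k θ)) Θ := fun k =>
      contDiffOn_clm (intL ν) ((h1 k).mono hΘU)
    refine diffTimes_of_contDiffOn hΘo (contDiffOn_of_uniformCauchy_mderiv hΘo hdiff
      (fun α hα => ?_) fun θ hθ => hlim0 hρ0 hρ1 (f := fun k θ => intL ν (h k θ))
        fun k hk => hell π k (h k) hk (h3 k) θ hθ)
    obtain ⟨ϕ, C', ρ', hρ0', hρ1', H⟩ := hlim α hα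
    refine TendstoUniformlyOn.uniformCauchySeqOn (f := ϕ) (Metric.tendstoUniformlyOn_iff.2
      fun e he => ?_)
    have h4 : Tendsto (fun k : ℕ => C' * ρ' ^ k) atTop (𝓝 0) := by
      simpa using (tendsto_pow_atTop_nhds_zero_of_lt_one hρ0' hρ1').const_mul C'
    filter_upwards [eventually_ge_atTop 1, h4.eventually_lt_const he] with k hk hk' θ hθ
    have h5 : mderiv α (fun θ => intL ν (h k θ)) θ = intL ν (mderiv α (h k) θ) :=
      mderiv_clm_comp hΘo (intL ν) (partialDiff_of_contDiffOn hΘo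
        (((h1 k).mono hΘU).of_le (by exact_mod_cast hα))) hθ
    rw [dist_comm, h5]
    exact (H π k (h k) hk (h3 k) θ hθ).trans_lt hk'
  · choose h h1 h2 h3 using hfam l
    obtain ⟨ε, c, hmix, hs⟩ := hG.exists_constants (μ := μ) hc hΘ
    have hlog : ∀ n : ℕ, (fun ω => 1 / (n : ℝ) *
        Real.log (likelihood μ R θ n (fun k => Ys k ω) l)) =
        fun ω => ((n : ℝ)⁻¹ • ∑ k ∈ Finset.range n, h k θ) fun k => Ys k ω := fun n => by
      funext ω
      rw [hG.log_likelihood hmix hθ (hΘU hθ), ContinuousMap.smul_apply, ContinuousMap.sum_apply,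
        one_div, smul_eq_mul]
      exact congrArg _ (Finset.sum_congr rfl fun k _ => (h2 k θ (hΘU hθ) _).symm)
    refine ⟨fun n _ => ?_, ?_⟩
    · rw [hlog n]
      exact (hcont _).1
    · simp_rw [hlog, (hcont _).2, map_smul, map_sum, smul_eq_mul]
      -- The normalized log-likelihood is the Cesàro mean of the expected logarithms of the
      -- normalizing constants, which converge themselves.
      exact (hlim0 hρ0 hρ1 (f := fun k θ => intL ν (h k θ))
        fun k hk => hell l k (h k) hk (h3 k) θ hθ).cesaro

end Rate

end OptFilter

end

/-! ### The three claims for the truncated model -/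

theorem corollary3p1 :
    -- (i) higher-order differentiability and forgetting
    (∃ τ K : ℕ → ℝ → ℝ, (∀ p ε, 0 < τ p ε ∧ τ p ε < 1 ∧ 1 ≤ K p ε) ∧
      ∀ (d dx dy p : ℕ), 1 ≤ d → 1 ≤ dx → 1 ≤ dy → 1 ≤ p →
      ∀ M : OptFilter.TruncatedModel d dx dy, M.Regular p →
        (∀ (m n : ℕ), m < n → ∀ (y : ℕ → M.𝒴) (l : Measure M.𝒳) [IsProbabilityMeasure l],
          (∀ x, OptFilter.DiffTimes p
            (fun θ => OptFilter.filterDens M.mu M.R θ y m n l x) M.Θ) ∧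
          (∀ B, MeasurableSet B → OptFilter.DiffTimes p
            (fun θ => OptFilter.filterProb M.mu M.R θ y m n l B) M.Θ) ∧
          ∀ θ ∈ M.Θ, ∀ α : OptFilter.MultiIndex d, OptFilter.deg α ≤ p →
            (∀ x, OptFilter.mderiv α (fun ϑ => OptFilter.filterDens M.mu M.R ϑ y m n l x) θ =
              OptFilter.fIter M.mu M.R θ y (OptFilter.initVec d p l) m n α x) ∧
            (∀ B, MeasurableSet B →
              OptFilter.mderiv α (fun ϑ => OptFilter.filterProb M.mu M.R ϑ y m n l B) θ =
                (OptFilter.FIter M.mu M.R θ y (OptFilter.initVec d p l) m n).comp α B)) ∧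
        (∃ ε c : ℝ, OptFilter.StrongMixing M.mu M.R M.Θ ε ∧
          OptFilter.ScoreBound p M.R M.Θ (fun _ => c)) ∧
        ∀ (ε : ℝ) (ψ : M.𝒴 → ℝ), OptFilter.StrongMixing M.mu M.R M.Θ ε →
          OptFilter.ScoreBound p M.R M.Θ ψ →
          ∀ θ ∈ M.Θ, ∀ Λ Λ' : OptFilter.LVec d p M.𝒳, Λ.IsL0 → Λ'.IsL0 →
          ∀ (m n : ℕ), m ≤ n → ∀ y : ℕ → M.𝒴,
            (OptFilter.FIter M.mu M.R θ y Λ m n).norm ≤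
              K p ε * Λ.norm ^ p * OptFilter.psiSum ψ y m n ^ p ∧
            (OptFilter.FIter M.mu M.R θ y Λ m n - OptFilter.FIter M.mu M.R θ y Λ' m n).norm ≤
              K p ε * τ p ε ^ (n - m) * (Λ - Λ').norm * (Λ.norm + Λ'.norm) ^ p *
                OptFilter.psiSum ψ y m n ^ p) ∧
    -- (ii) ergodicity
    (∃ ρ L : ℕ → ℝ → ℝ → ℝ → ℝ → ℝ → ℝ,
      (∀ p q ε δ K₀ L₀, 0 < ρ p q ε δ K₀ L₀ ∧ ρ p q ε δ K₀ L₀ < 1 ∧ 1 ≤ L p q ε δ K₀ L₀) ∧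
      ∀ (d dx dy p : ℕ), 1 ≤ d → 1 ≤ dx → 1 ≤ dy → 1 ≤ p →
      ∀ M : OptFilter.TruncatedModel d dx dy, M.Regular p →
      ∀ (P : Kernel M.𝒳 M.𝒳) [IsMarkovKernel P] (Q : Kernel M.𝒳 M.𝒴) [IsMarkovKernel Q]
        (π : Measure M.𝒳) [IsProbabilityMeasure π] (δ K₀ : ℝ), OptFilter.GeomErgodic P π δ K₀ →
      ∀ (Φ : OptFilter.E d → M.𝒳 × M.𝒴 × OptFilter.LVec d p M.𝒳 → ℝ) (φ : M.𝒳 × M.𝒴 → ℝ) (q : ℝ),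
        (∀ θ ∈ M.Θ, Measurable fun z : {z : M.𝒳 × M.𝒴 × OptFilter.LVec d p M.𝒳 // z.2.2.IsL0} =>
          Φ θ z) →
        Measurable φ → OptFilter.GrowthCondition M.Θ Φ φ q →
        (⨆ x, ∫⁻ y, ENNReal.ofReal (φ (x, y)) ∂(Q x)) < ∞ →
        (∃ ε c L₀ : ℝ, OptFilter.StrongMixing M.mu M.R M.Θ ε ∧
          OptFilter.ScoreBound p M.R M.Θ (fun _ => c) ∧ 1 ≤ L₀ ∧
          ∀ x, ∫⁻ y, ENNReal.ofReal (φ (x, y) * c ^ ((p : ℝ) * (p + q + 1))) ∂(Q x) ≤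
            ENNReal.ofReal L₀) ∧
        ∃ ϕ ϕ' : OptFilter.E d → ℝ,
          (∀ θ ∈ M.Θ, ∀ z : M.𝒳 × M.𝒴 × OptFilter.LVec d p M.𝒳, z.2.2.IsL0 →
            (∀ n, 1 ≤ n →
              Integrable (Φ θ) (OptFilter.kerIter (OptFilter.chainKer M.mu M.R P Q θ) n z) ∧
              Integrable (Φ θ) (OptFilter.kerIter (OptFilter.chainKer' M.mu M.R P Q θ) n z)) ∧
            Tendsto (fun n => OptFilter.kerInt (OptFilter.chainKer M.mu M.R P Q θ) n (Φ θ) z) atTop (𝓝 (ϕ θ)) ∧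
            Tendsto (fun n => OptFilter.kerInt (OptFilter.chainKer' M.mu M.R P Q θ) n (Φ θ) z) atTop (𝓝 (ϕ' θ))) ∧
          ∀ (ε L₀ : ℝ) (ψ : M.𝒴 → ℝ), Measurable ψ → OptFilter.StrongMixing M.mu M.R M.Θ ε →
            OptFilter.ScoreBound p M.R M.Θ ψ → 1 ≤ L₀ →
            (∀ x, ∫⁻ y, ENNReal.ofReal (φ (x, y) * ψ y ^ ((p : ℝ) * (p + q + 1))) ∂(Q x) ≤
              ENNReal.ofReal L₀) →
            ∀ θ ∈ M.Θ, ∀ x y, ∀ Λ : OptFilter.LVec d p M.𝒳, Λ.IsL0 → ∀ n : ℕ, 1 ≤ n →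
              |OptFilter.kerInt (OptFilter.chainKer M.mu M.R P Q θ) n (Φ θ) (x, y, Λ) - ϕ θ| ≤
                L p q ε δ K₀ L₀ * ρ p q ε δ K₀ L₀ ^ n * Λ.norm ^ ((p : ℝ) * (q + 1)) ∧
              |OptFilter.kerInt (OptFilter.chainKer' M.mu M.R P Q θ) n (Φ θ) (x, y, Λ) - ϕ' θ| ≤
                L p q ε δ K₀ L₀ * ρ p q ε δ K₀ L₀ ^ n * ψ y ^ ((p : ℝ) * (p + q + 1)) *
                  Λ.norm ^ ((p : ℝ) * (q + 1))) ∧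
    -- (iii) higher-order differentiability of the log-likelihood rate
    (∀ (d dx dy p : ℕ), 1 ≤ d → 1 ≤ dx → 1 ≤ dy → 1 ≤ p →
      ∀ M : OptFilter.TruncatedModel d dx dy, M.Regular p →
      ∀ (P : Kernel M.𝒳 M.𝒳) [IsMarkovKernel P] (Q : Kernel M.𝒳 M.𝒴) [IsMarkovKernel Q]
        (π : Measure M.𝒳) [IsProbabilityMeasure π] (δ K₀ : ℝ), OptFilter.GeomErgodic P π δ K₀ →
      ∀ (Ω : Type*) [MeasurableSpace Ω] (Pr : Measure Ω) [IsProbabilityMeasure Pr]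
        (Xs : ℕ → Ω → M.𝒳) (Ys : ℕ → Ω → M.𝒴), OptFilter.IsStateSpaceModel Pr P Q Xs Ys →
        ∃ ell : OptFilter.E d → ℝ, OptFilter.DiffTimes p ell M.Θ ∧
          ∀ θ ∈ M.Θ, ∀ (l : Measure M.𝒳) [IsProbabilityMeasure l],
            (∀ n : ℕ, 1 ≤ n → Integrable (fun ω =>
              1 / (n : ℝ) * Real.log (OptFilter.likelihood M.mu M.R θ n (fun k => Ys k ω) l)) Pr) ∧
            Tendsto (fun n : ℕ => ∫ ω,
              1 / (n : ℝ) * Real.log (OptFilter.likelihood M.mu M.R θ n (fun k => Ys k ω) l) ∂Pr)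
              atTop (𝓝 (ell θ))) := by
  refine ⟨⟨OptFilter.rateConst, OptFilter.boundConst, fun p ε => ⟨OptFilter.rateConst_pos p ε,
    OptFilter.rateConst_lt_one p ε, OptFilter.one_le_boundConst p ε⟩, ?_⟩,
    ⟨OptFilter.ergodicRate, OptFilter.ergodicConst, fun p q ε δ K₀ L₀ =>
      ⟨(OptFilter.isRate_ergodic p q ε δ K₀ L₀).1, (OptFilter.isRate_ergodic p q ε δ K₀ L₀).2.1,
        (OptFilter.isRate_ergodic p q ε δ K₀ L₀).2.2.1⟩, ?_⟩, ?_⟩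
  · intro d dx dy p _ _ _ _ M hM
    have := isCompact_iff_compactSpace.1 hM.isCompact_𝒳
    have := isCompact_iff_compactSpace.1 hM.isCompact_𝒴
    have : NeZero M.mu :=
      OptFilter.comap_val_neZero hM.isCompact_𝒳.measurableSet hM.interior_𝒳
    have : IsFiniteMeasure M.mu := OptFilter.comap_val_isFinite hM.isCompact_𝒳
    obtain ⟨G, hG⟩ := hM.exists_isSmoothFamily
    have hG' := hG.mono hM.isOpen_Θ (subset_closure.trans hM.closure_subset)
    refine ⟨fun m n hmn y l _ => hG'.filter_derivatives hmn y,
      hG.exists_constants hM.isBounded_Θ.isCompact_closure hM.closure_subset, ?_⟩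
    intro ε ψ hmix hs θ hθ Λ Λ' hΛ hΛ' m n hmn y
    exact ⟨OptFilter.norm_FIter_le (hG'.isDerivKernel hθ) (hG'.pos θ hθ) hmix hθ hs hΛ hmn y,
      OptFilter.norm_FIter_sub_le (hG'.isDerivKernel hθ) (hG'.pos θ hθ) hmix hθ hs hΛ hΛ' hmn y⟩
  · intro d dx dy p _ _ _ hp M hM P _ Q _ π _ δ K₀ hP Φ φ q hΦm hφm hΦ hφ
    have := isCompact_iff_compactSpace.1 hM.isCompact_𝒳
    have := isCompact_iff_compactSpace.1 hM.isCompact_𝒴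
    have : NeZero M.mu :=
      OptFilter.comap_val_neZero hM.isCompact_𝒳.measurableSet hM.interior_𝒳
    have : IsFiniteMeasure M.mu := OptFilter.comap_val_isFinite hM.isCompact_𝒳
    obtain ⟨G, hG⟩ := hM.exists_isSmoothFamily
    exact OptFilter.exists_ergodic_limits hp hG hM.isBounded_Θ.isCompact_closure hM.closure_subset
      hP hΦm hφm hΦ hφ
  · intro d dx dy p _ _ _ hp M hM P _ Q _ π _ δ K₀ hP Ω _ Pr _ Xs Ys hZ
    have := isCompact_iff_compactSpace.1 hM.isCompact_𝒳
    have := isCompact_iff_compactSpace.1 hM.isCompact_𝒴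
    have : NeZero M.mu :=
      OptFilter.comap_val_neZero hM.isCompact_𝒳.measurableSet hM.interior_𝒳
    have : IsFiniteMeasure M.mu := OptFilter.comap_val_isFinite hM.isCompact_𝒳
    obtain ⟨G, hG⟩ := hM.exists_isSmoothFamily
    exact OptFilter.exists_likelihood_rate hp hG hM.isBounded_Θ.isCompact_closure hM.closure_subset
      hM.isOpen_Θ hP hZ
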